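/- Conventions. All manifolds are smooth, finite-dimensional and without boundary. A Poisson structure on $M$ is a smooth bivector field $w$, with bundle map $w^\sharp:T^*M\to TM$, $\alpha(w^\sharp\beta)=w(\alpha,\beta)$, whose bracket $\{f,g\}=w(df,dg)$ satisfies the Jacobi identity. It is exact if $w=-[w,\mathcal T]$ for a smooth vector field $\mathcal T$, where $[w,\mathcal T]=L_{\mathcal T}w$. A symplectic leaf is a maximal connected (injectively immersed) integral manifold of $\operatorname{im}w^\sharp$; its symplectic form is $\omega(u,v)=\alpha(v)$ for any $\alpha$ with $w^\sharp\alpha=u$, and $\omega^\flat(u)=\omega(u,\cdot)$. The bracket of 1-forms is $\{\alpha,\beta\}=L_{w^\sharp\beta}\alpha-L_{w^\sharp\alpha}\beta-d\,w(\alpha,\beta)$. Let $(Z,\varpi)$ be a (Hausdorff, second countable) Poisson manifold, $S\subset Z$ a symplectic leaf with symplectic form $\omega_S$, and $X\subset S$ an embedded Lagrangian submanifold. Put $E_X=(TX)^0\subset T^*Z|_X$, $L_X=(TS)^0|_X\subset E_X$, with dual bundles $Z'=E_X^*=TZ|_X/TX$ and $L_X^*=TZ|_X/TS|_X$, and let $\tau:Z'\to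 X$ be the projection. For $\sigma\in\Gamma(E_X)$ let $\bar\sigma\in C^\infty(Z')$ be the corresponding fibrewise linear function. 1. There is a well-defined bracket on $\Gamma(E_X)$: for $\sigma_1,\sigma_2\in\Gamma(E_X)$ there is a unique $[\sigma_1,\sigma_2]\in\Gamma(E_X)$ whose value at each $x\in X$ is $\{\alpha,\beta\}_x$ for all 1-forms $\alpha,\beta$ on $Z$ which restrict to $\sigma_1,\sigma_2$ on a neighbourhood of $x$ in $X$. There is a unique Poisson structure $\varpi'$ on $Z'$, with bracket $\{\cdot,\cdot\}'$, such that $\{\bar\sigma_1,\bar\sigma_2\}'=\overline{[\sigma_1,\sigma_2]}$ for all $\sigma_1,\sigma_2\in\Gamma(E_X)$. It is exact, $\varpi'=-[\varpi',\mathcal I]$ with $\mathcal I$ the Euler vector field of the vector bundle $Z'$. The pair $(Z',\varpi')$ is called the Sternberg–Weinstein approximation of $Z$ at $X$. 2. Let $(x^\mu,p_\mu,r_a)$ be Darboux coordinates on $Z$ centered at $x_0\in X$, i.e. coordinates vanishing at $x_0$ with $\{x^\mu,x^\nu\}=\{p_\mu,p_\nu\}=\{x^\mu,r_a\}=\{p_\mu,r_a\}=0$,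 $\{x^\mu,p_\nu\}=\delta^\mu_\nu$ and $\{r_a,r_b\}=\sum_c w^c_{ab}(r)\,r_c$ with smooth $w^c_{ab}$, and assume that they are adapted to $X$, i.e. $p_\mu=0$ and $r_a=0$ on an open neighbourhood $V$ of $x_0$ in $X$ contained in the coordinate domain. Put $c^c_{ab}=w^c_{ab}(0)$, and let $[\dot p_\mu]=\overline{dp_\mu|_X}$, $[\dot r_a]=\overline{dr_a|_X}$. Then $(x^\mu\circ\tau,[\dot p_\mu],[\dot r_a])$ are coordinates on $\tau^{-1}(V)\subset Z'$ in which $$\varpi'=\sum_\mu\frac{\partial}{\partial x^\mu}\wedge\frac{\partial}{\partial[\dot p_\mu]}+\frac12\sum_{a,b,c}c^c_{ab}[\dot r_c]\frac{\partial}{\partial[\dot r_a]}\wedge\frac{\partial}{\partial[\dot r_b]};$$ in particular they are Darboux coordinates for $\varpi'$ centered at the zero vector over $x_0$. 3. The subbundle $S'=TS|_X/TX\subset Z'$ is an integral manifold of the characteristic distribution of $\varpi'$ which contains every connected integral manifold (of the same dimension) that it meets; thus it is a symplectic leaf if $X$ is connected. The zero section is an embedded Lagrangian submanifold of $S'$.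 The bundle map $(-\omega_X^\flat)^*:S'\to T^*X$, $[v]\mapsto\bigl(u\mapsto-\omega_S(u,v)\bigr)$ for $v\in T_xS$, $u\in T_xX$, is a symplectomorphism from $S'$ onto $T^*X$ with its canonical symplectic form $d\theta$, $\theta=p\,dq$ being the tautological 1-form. 4. If $f,g\in C^\infty(Z')$ and $f|_{S'}=0$, then $\{f,g\}'|_{S'}=0$. The functions $\bar\lambda$, $\lambda\in\Gamma(L_X)$, form an ideal in the Lie algebra of the functions $\bar\sigma$, $\sigma\in\Gamma(E_X)$. 5. $L_X^*$ carries a Poisson structure which is, on each fibre $(L_X^*)_x$, the Lie–Poisson structure $\{f,g\}(n)=\langle n,[d_nf,d_ng]\rangle$ of the dual of the transverse Lie algebra $(L_X)_x=(T_xS)^0$, $[dF_x,dG_x]=d\{F,G\}_x$; and the projection $l:Z'\to L_X^*$ is a Poisson map. 6. The Sternberg–Weinstein approximation $(Z'',\varpi'')$ of $(Z',\varpi')$ at the zero section $X\subset S'\subset Z'$ (given by the unique Poisson structure $\varpi''$ on $Z''=TZ'|_X/TX$ extending the bracket of the sections of $(TX)^0\subset T^*Z'|_X$, as in 1.) is canonically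 isomorphic to $(Z',\varpi')$: the map $Z'\to Z''$ sending $v\in Z'_x$ to the class of the vertical vector $\frac{d}{ds}\big|_{s=0}(sv)$ is a diffeomorphism and a Poisson map. -/

import Mathlib

open Set Filter Bundle Module Topology
open scoped Manifold ContDiff Topology Bundle

noncomputable section

/-! ### Quotients of pulled back tangent bundles -/

lemma coordChangeL_eq {X : Type*} [TopologicalSpace X] {F : Type*} {V : X → Type*} [NormedAddCommGroup F] [NormedSpace ℝ F]
    [∀ x, AddCommGroup (V x)] [∀ x, Module ℝ (V x)] [∀ x, TopologicalSpace (V x)]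
    [TopologicalSpace (TotalSpace F V)] [FiberBundle F V] [VectorBundle ℝ F V]
    (e e' : Trivialization F (π F V)) [MemTrivializationAtlas e] [MemTrivializationAtlas e']
    {b : X} (hb : b ∈ e.baseSet ∩ e'.baseSet) (v : F) :
    e.coordChangeL ℝ e' b v = e'.continuousLinearMapAt ℝ b (e.symmL ℝ b v) := by
  rw [Trivialization.coordChangeL_apply _ _ hb,
    Trivialization.continuousLinearMapAt_apply_of_mem _ _ hb.2, Trivialization.symmL_apply _ hb.1]

section Coker

variable {EX HX X : Type*} [NormedAddCommGroup EX] [NormedSpace ℝ EX] [TopologicalSpace HX]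
  [TopologicalSpace X] [ChartedSpace HX X]
  {EA HA A : Type*} [NormedAddCommGroup EA] [NormedSpace ℝ EA] [TopologicalSpace HA]
  [TopologicalSpace A] [ChartedSpace HA A]
  {EZ HZ Z : Type*} [NormedAddCommGroup EZ] [NormedSpace ℝ EZ] [TopologicalSpace HZ]
  [TopologicalSpace Z] [ChartedSpace HZ Z]

/-- A smooth, fibrewise injective morphism `g^*TA → f^*TZ` of vector bundles over `X`. -/
structure TangentMono (IX : ModelWithCorners ℝ EX HX) (IA : ModelWithCorners ℝ EA HA)
    (IZ : ModelWithCorners ℝ EZ HZ) [IsManifold IA ∞ A] [IsManifold IZ ∞ Z]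
    (g : X → A) (f : X → Z) where
  map : ∀ x, TangentSpace IA (g x) →L[ℝ] TangentSpace IZ (f x)
  contMDiff_dom : ContMDiff IX IA ∞ g
  contMDiff_cod : ContMDiff IX IZ ∞ f
  injective : ∀ x, Function.Injective (map x)
  contMDiff_map : ∀ x₀, ContMDiffAt IX 𝓘(ℝ, EA →L[ℝ] EZ) ∞
    (inTangentCoordinates IA IZ g f map x₀) x₀

/-- The typical fibre of the quotient of a bundle with fibre `EZ` by a subbundle with
fibre `EA`. -/
abbrev CokerModel (EA EZ : Type*) [NormedAddCommGroup EA] [NormedSpace ℝ EA]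
    [NormedAddCommGroup EZ] [NormedSpace ℝ EZ] : Type :=
  Fin (finrank ℝ EZ - finrank ℝ EA) → ℝ

namespace TangentMono

variable {IX : ModelWithCorners ℝ EX HX} {IA : ModelWithCorners ℝ EA HA}
    {IZ : ModelWithCorners ℝ EZ HZ} [IsManifold IA ∞ A] [IsManifold IZ ∞ Z]
    {g : X → A} {f : X → Z} (φ : TangentMono IX IA IZ g f)

/-- The fibre `T_{f x} Z / φ (T_{g x} A)` of the quotient bundle. -/
def Coker (x : X) : Type _ := TangentSpace IZ (f x) ⧸ LinearMap.range (φ.map x).toLinearMap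

instance (x : X) : AddCommGroup (φ.Coker x) :=
  inferInstanceAs (AddCommGroup (TangentSpace IZ (f x) ⧸ LinearMap.range (φ.map x).toLinearMap))
instance (x : X) : Module ℝ (φ.Coker x) :=
  inferInstanceAs (Module ℝ (TangentSpace IZ (f x) ⧸ LinearMap.range (φ.map x).toLinearMap))
instance (x : X) : TopologicalSpace (φ.Coker x) :=
  inferInstanceAs (TopologicalSpace
    (TangentSpace IZ (f x) ⧸ LinearMap.range (φ.map x).toLinearMap))
instance (x : X) : IsTopologicalAddGroup (φ.Coker x) :=
  inferInstanceAs (IsTopologicalAddGroup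
    (TangentSpace IZ (f x) ⧸ LinearMap.range (φ.map x).toLinearMap))
instance (x : X) : ContinuousSMul ℝ (φ.Coker x) :=
  inferInstanceAs (ContinuousSMul ℝ
    (TangentSpace IZ (f x) ⧸ LinearMap.range (φ.map x).toLinearMap))

/-- The class of a vector in the quotient. -/
def cls (x : X) : TangentSpace IZ (f x) →ₗ[ℝ] φ.Coker x :=
  Submodule.mkQ (LinearMap.range (φ.map x).toLinearMap)

lemma cls_surjective (x : X) : Function.Surjective (φ.cls x) :=
  Submodule.mkQ_surjective _

lemma cls_eq_zero {x : X} {v : TangentSpace IZ (f x)} :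
    φ.cls x v = 0 ↔ ∃ u, φ.map x u = v :=
  (Submodule.Quotient.mk_eq_zero _).trans Iff.rfl

/-- A linear map on `T_{f x} Z` which vanishes on the subbundle descends to the quotient. -/
def desc {x : X} {V : Type*} [AddCommGroup V] [Module ℝ V] (h : TangentSpace IZ (f x) →ₗ[ℝ] V)
    (hh : ∀ u, h (φ.map x u) = 0) : φ.Coker x →ₗ[ℝ] V :=
  Submodule.liftQ _ h (by rintro _ ⟨u, rfl⟩; exact hh u)

@[simp] lemma desc_cls {x : X} {V : Type*} [AddCommGroup V] [Module ℝ V]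
    (h : TangentSpace IZ (f x) →ₗ[ℝ] V) (hh : ∀ u, h (φ.map x u) = 0)
    (v : TangentSpace IZ (f x)) : φ.desc h hh (φ.cls x v) = h v :=
  Submodule.liftQ_apply _ _ _

/-- The total space of the quotient bundle. -/
abbrev Total : Type _ := TotalSpace (CokerModel EA EZ) φ.Coker

/-- The morphism in the tangent bundle coordinates at `x₀`. -/
def coord (x₀ x : X) : EA →L[ℝ] EZ := inTangentCoordinates IA IZ g f φ.map x₀ x

abbrev trivA (_φ : TangentMono IX IA IZ g f) (x₀ : X) :=
  trivializationAt EA (TangentSpace IA) (g x₀)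
abbrev trivZ (_φ : TangentMono IX IA IZ g f) (x₀ : X) :=
  trivializationAt EZ (TangentSpace IZ) (f x₀)

/-- The domain on which `coord x₀` represents the morphism. -/
def coordSet (x₀ : X) : Set X := g ⁻¹' (φ.trivA x₀).baseSet ∩ f ⁻¹' (φ.trivZ x₀).baseSet

lemma isOpen_coordSet (x₀ : X) : IsOpen (φ.coordSet x₀) :=
  ((φ.trivA x₀).open_baseSet.preimage φ.contMDiff_dom.continuous).inter
    ((φ.trivZ x₀).open_baseSet.preimage φ.contMDiff_cod.continuous)

lemma mem_coordSet (x₀ : X) : x₀ ∈ φ.coordSet x₀ :=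
  ⟨mem_baseSet_trivializationAt EA (TangentSpace IA) (g x₀),
    mem_baseSet_trivializationAt EZ (TangentSpace IZ) (f x₀)⟩

lemma coord_apply (x₀ x : X) (u : EA) :
    φ.coord x₀ x u = (φ.trivZ x₀).continuousLinearMapAt ℝ (f x)
      (φ.map x ((φ.trivA x₀).symmL ℝ (g x) u)) := rfl

lemma coord_symm {x₀ x : X} (hx : x ∈ φ.coordSet x₀) (u : EA) :
    (φ.trivZ x₀).symmL ℝ (f x) (φ.coord x₀ x u) =
      φ.map x ((φ.trivA x₀).symmL ℝ (g x) u) := by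
  rw [coord_apply, Trivialization.symmL_continuousLinearMapAt _ hx.2]

lemma coord_map {x₀ x : X} (hx : x ∈ φ.coordSet x₀) (u : TangentSpace IA (g x)) :
    φ.coord x₀ x ((φ.trivA x₀).continuousLinearMapAt ℝ (g x) u) =
      (φ.trivZ x₀).continuousLinearMapAt ℝ (f x) (φ.map x u) := by
  rw [coord_apply, Trivialization.symmL_continuousLinearMapAt _ hx.1]

lemma coord_injective (x₀ : X) : Function.Injective (φ.coord x₀ x₀) := by
  have hx := φ.mem_coordSet x₀
  refine (injective_iff_map_eq_zero _).2 fun u hu ↦ ?_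
  have h := φ.coord_symm hx u
  rw [hu, map_zero] at h
  have h2 := φ.injective x₀ (h.symm.trans (map_zero _).symm)
  rw [← Trivialization.continuousLinearMapAt_symmL (R := ℝ) (φ.trivA x₀) hx.1 u, h2, map_zero]

lemma contMDiffOn_coord (x₀ : X) :
    ContMDiffOn IX 𝓘(ℝ, EA →L[ℝ] EZ) ∞ (φ.coord x₀) (φ.coordSet x₀) := by
  intro x hx
  apply ContMDiffAt.contMDiffWithinAt
  have hS : φ.coordSet x₀ ∩ φ.coordSet x ∈ 𝓝 x :=
    ((φ.isOpen_coordSet x₀).inter (φ.isOpen_coordSet x)).mem_nhds ⟨hx, φ.mem_coordSet x⟩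
  have h1 : ContMDiffAt IX 𝓘(ℝ, EZ →L[ℝ] EZ) ∞
      (fun y ↦ ((φ.trivZ x).coordChangeL ℝ (φ.trivZ x₀) (f y) : EZ →L[ℝ] EZ)) x := by
    have := (contMDiffOn_coordChangeL (IB := IZ) (n := ∞) (φ.trivZ x) (φ.trivZ x₀)).contMDiffAt
      (x := f x) (((φ.trivZ x).open_baseSet.inter (φ.trivZ x₀).open_baseSet).mem_nhds
        ⟨(φ.mem_coordSet x).2, hx.2⟩)
    exact this.comp x φ.contMDiff_cod.contMDiffAt
  have h2 : ContMDiffAt IX 𝓘(ℝ, EA →L[ℝ] EA) ∞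
      (fun y ↦ ((φ.trivA x₀).coordChangeL ℝ (φ.trivA x) (g y) : EA →L[ℝ] EA)) x := by
    have := (contMDiffOn_coordChangeL (IB := IA) (n := ∞) (φ.trivA x₀) (φ.trivA x)).contMDiffAt
      (x := g x) (((φ.trivA x₀).open_baseSet.inter (φ.trivA x).open_baseSet).mem_nhds
        ⟨hx.1, (φ.mem_coordSet x).1⟩)
    exact this.comp x φ.contMDiff_dom.contMDiffAt
  refine ((h1.clm_comp (φ.contMDiff_map x)).clm_comp h2).congr_of_eventuallyEq ?_
  filter_upwards [hS] with y hy
  ext u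
  rw [ContinuousLinearMap.comp_apply, ContinuousLinearMap.comp_apply]
  change _ = ((φ.trivZ x).coordChangeL ℝ (φ.trivZ x₀) (f y)) (φ.coord x y
    (((φ.trivA x₀).coordChangeL ℝ (φ.trivA x) (g y)) u))
  rw [coordChangeL_eq _ _ ⟨hy.2.2, hy.1.2⟩, coordChangeL_eq _ _ ⟨hy.1.1, hy.2.1⟩,
    φ.coord_map hy.2, Trivialization.symmL_continuousLinearMapAt _ hy.2.2, coord_apply]

lemma exists_section {L : EA →L[ℝ] EZ} [FiniteDimensional ℝ EA] [FiniteDimensional ℝ EZ]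
    (hL : Function.Injective L) :
    ∃ s : CokerModel EA EZ →L[ℝ] EZ, Function.Bijective (L.coprod s) := by
  obtain ⟨C, hC⟩ := Submodule.exists_isCompl (LinearMap.range L.toLinearMap)
  have h1 : finrank ℝ (LinearMap.range L.toLinearMap) = finrank ℝ EA :=
    LinearMap.finrank_range_of_inj hL
  have h2 := Submodule.finrank_add_eq_of_isCompl hC
  have h3 : finrank ℝ (CokerModel EA EZ) = finrank ℝ C := by
    rw [Module.finrank_fin_fun]; omega
  let e : CokerModel EA EZ ≃ₗ[ℝ] C := LinearEquiv.ofFinrankEq _ _ h3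
  refine ⟨LinearMap.toContinuousLinearMap (C.subtype ∘ₗ e.toLinearMap), ?_⟩
  have hinj : Function.Injective
      (L.coprod (LinearMap.toContinuousLinearMap (C.subtype ∘ₗ e.toLinearMap))) := by
    refine (injective_iff_map_eq_zero _).2 ?_
    rintro ⟨u, v⟩ huv
    have huv' : L u + (e v : EZ) = 0 := huv
    have h4 : (e v : EZ) ∈ LinearMap.range L.toLinearMap :=
      ⟨-u, by rw [map_neg]; exact (eq_neg_of_add_eq_zero_right huv').symm⟩
    have h5 : (e v : EZ) = 0 := by
      have : (e v : EZ) ∈ LinearMap.range L.toLinearMap ⊓ C := ⟨h4, (e v).2⟩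
      rwa [hC.inf_eq_bot] at this
    rw [h5, add_zero] at huv'
    have hv : v = 0 := e.injective ((Subtype.ext h5).trans (map_zero e).symm)
    have hu : u = 0 := hL (huv'.trans (map_zero L).symm)
    rw [hu, hv]; rfl
  refine ⟨hinj, ?_⟩
  have h6 : finrank ℝ (EA × CokerModel EA EZ) = finrank ℝ EZ := by
    rw [Module.finrank_prod, h3]; omega
  exact (LinearMap.injective_iff_surjective_of_finrank_eq_finrank h6
    (f := (L.coprod (LinearMap.toContinuousLinearMap
      (C.subtype ∘ₗ e.toLinearMap))).toLinearMap)).1 hinj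

variable [FiniteDimensional ℝ EA] [FiniteDimensional ℝ EZ]

/-- A linear map onto a complement of the image of the morphism at `x₀`. -/
def sec (x₀ : X) : CokerModel EA EZ →L[ℝ] EZ :=
  Classical.choose (exists_section (φ.coord_injective x₀))

/-- The frame obtained from the subbundle and the chosen complement. -/
def frame (x₀ x : X) : (EA × CokerModel EA EZ) →L[ℝ] EZ := (φ.coord x₀ x).coprod (φ.sec x₀)

/-- The domain of the trivialization of the quotient bundle around `x₀`. -/
def dom (x₀ : X) : Set X :=
  φ.coordSet x₀ ∩ φ.frame x₀ ⁻¹'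
    range (ContinuousLinearEquiv.toContinuousLinearMap (σ₁₂ := RingHom.id ℝ)
      (M₁ := EA × CokerModel EA EZ) (M₂ := EZ))

lemma contMDiffOn_frame (x₀ : X) :
    ContMDiffOn IX 𝓘(ℝ, (EA × CokerModel EA EZ) →L[ℝ] EZ) ∞ (φ.frame x₀) (φ.coordSet x₀) := by
  have h1 : ContMDiffOn IX 𝓘(ℝ, (EA × CokerModel EA EZ) →L[ℝ] EZ) ∞
      (fun x ↦ (φ.coord x₀ x).comp (ContinuousLinearMap.fst ℝ EA (CokerModel EA EZ)) +
        (φ.sec x₀).comp (ContinuousLinearMap.snd ℝ EA (CokerModel EA EZ))) (φ.coordSet x₀) :=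
    ((φ.contMDiffOn_coord x₀).clm_comp contMDiffOn_const).add contMDiffOn_const
  refine h1.congr fun x _ ↦ ?_
  ext <;> simp [frame]

lemma isOpen_dom (x₀ : X) : IsOpen (φ.dom x₀) := by
  have : FiniteDimensional ℝ (EA × CokerModel EA EZ) := inferInstance
  have : CompleteSpace (EA × CokerModel EA EZ) := FiniteDimensional.complete ℝ _
  exact (φ.contMDiffOn_frame x₀).continuousOn.isOpen_inter_preimage (φ.isOpen_coordSet x₀)
    ContinuousLinearEquiv.isOpen

lemma mem_dom (x₀ : X) : x₀ ∈ φ.dom x₀ := by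
  refine ⟨φ.mem_coordSet x₀, ?_⟩
  have h := Classical.choose_spec (exists_section (φ.coord_injective x₀))
  exact ⟨(LinearEquiv.ofBijective (φ.frame x₀ x₀).toLinearMap h).toContinuousLinearEquiv,
    by ext <;> rfl⟩

/-- The component of a vector along the chosen complement. -/
def cproj (x₀ x : X) : EZ →L[ℝ] CokerModel EA EZ :=
  (ContinuousLinearMap.snd ℝ EA (CokerModel EA EZ)).comp (φ.frame x₀ x).inverse

lemma contMDiffOn_cproj (x₀ : X) :
    ContMDiffOn IX 𝓘(ℝ, EZ →L[ℝ] CokerModel EA EZ) ∞ (φ.cproj x₀) (φ.dom x₀) := by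
  refine ContMDiffOn.clm_comp contMDiffOn_const ?_
  intro x hx
  have : FiniteDimensional ℝ (EA × CokerModel EA EZ) := inferInstance
  have : CompleteSpace (EA × CokerModel EA EZ) := FiniteDimensional.complete ℝ _
  obtain ⟨e, he⟩ := hx.2
  have h1 : ContDiffAt ℝ ∞ ContinuousLinearMap.inverse (φ.frame x₀ x) := by
    rw [← he]; exact contDiffAt_map_inverse e
  exact h1.contMDiffAt.comp_contMDiffWithinAt x ((φ.contMDiffOn_frame x₀ x hx.1).mono
    inter_subset_left)

variable {x₀ x : X}

lemma cproj_coord (hx : x ∈ φ.dom x₀) (u : EA) : φ.cproj x₀ x (φ.coord x₀ x u) = 0 := by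
  obtain ⟨e, he⟩ := hx.2
  have h1 : φ.coord x₀ x u = e (u, 0) := by
    change _ = (e : (EA × CokerModel EA EZ) →L[ℝ] EZ) (u, 0)
    rw [he]; simp [frame]
  rw [h1, cproj, ← he, ContinuousLinearMap.inverse_equiv]
  simp

lemma cproj_sec (hx : x ∈ φ.dom x₀) (v : CokerModel EA EZ) :
    φ.cproj x₀ x (φ.sec x₀ v) = v := by
  obtain ⟨e, he⟩ := hx.2
  have h1 : φ.sec x₀ v = e (0, v) := by
    change _ = (e : (EA × CokerModel EA EZ) →L[ℝ] EZ) (0, v)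
    rw [he]; simp [frame]
  rw [h1, cproj, ← he, ContinuousLinearMap.inverse_equiv]
  simp

lemma exists_sub_sec_cproj (hx : x ∈ φ.dom x₀) (y : EZ) :
    ∃ u, φ.coord x₀ x u = φ.sec x₀ (φ.cproj x₀ x y) - y := by
  obtain ⟨e, he⟩ := hx.2
  refine ⟨-(e.symm y).1, ?_⟩
  have h1 : φ.coord x₀ x (e.symm y).1 + φ.sec x₀ (e.symm y).2 = y := by
    have : (e : (EA × CokerModel EA EZ) →L[ℝ] EZ) (e.symm y) = y := e.apply_symm_apply y
    rw [he] at this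
    simpa [frame] using this
  have h2 : φ.cproj x₀ x y = (e.symm y).2 := by
    rw [cproj, ← he, ContinuousLinearMap.inverse_equiv]; rfl
  rw [h2, map_neg]
  nth_rewrite 3 [← h1]
  abel

open Classical in
/-- The local trivialization of the quotient bundle on a fibre. -/
def fibTriv (x₀ x : X) : φ.Coker x →ₗ[ℝ] CokerModel EA EZ :=
  if hx : x ∈ φ.dom x₀ then
    φ.desc (((φ.cproj x₀ x).comp ((φ.trivZ x₀).continuousLinearMapAt ℝ (f x))).toLinearMap)
      (fun u ↦ by
        change φ.cproj x₀ x ((φ.trivZ x₀).continuousLinearMapAt ℝ (f x) (φ.map x u)) = 0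
        rw [← φ.coord_map hx.1, φ.cproj_coord hx])
  else 0

/-- The inverse of the local trivialization on a fibre. -/
def fibSymm (x₀ x : X) : CokerModel EA EZ →ₗ[ℝ] φ.Coker x :=
  φ.cls x ∘ₗ (((φ.trivZ x₀).symmL ℝ (f x)).comp (φ.sec x₀)).toLinearMap

lemma fibTriv_cls (hx : x ∈ φ.dom x₀) (v : TangentSpace IZ (f x)) :
    φ.fibTriv x₀ x (φ.cls x v) =
      φ.cproj x₀ x ((φ.trivZ x₀).continuousLinearMapAt ℝ (f x) v) := by
  rw [fibTriv, dif_pos hx, desc_cls]; rfl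

lemma fibTriv_fibSymm (hx : x ∈ φ.dom x₀) (v : CokerModel EA EZ) :
    φ.fibTriv x₀ x (φ.fibSymm x₀ x v) = v := by
  change φ.fibTriv x₀ x (φ.cls x ((φ.trivZ x₀).symmL ℝ (f x) (φ.sec x₀ v))) = v
  rw [φ.fibTriv_cls hx, Trivialization.continuousLinearMapAt_symmL _ hx.1.2, φ.cproj_sec hx]

lemma fibSymm_fibTriv (hx : x ∈ φ.dom x₀) (q : φ.Coker x) :
    φ.fibSymm x₀ x (φ.fibTriv x₀ x q) = q := by
  obtain ⟨v, rfl⟩ := φ.cls_surjective x q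
  rw [φ.fibTriv_cls hx, ← sub_eq_zero]
  change φ.cls x ((φ.trivZ x₀).symmL ℝ (f x) (φ.sec x₀ _)) - φ.cls x v = 0
  rw [← map_sub, cls_eq_zero]
  obtain ⟨u, hu⟩ := φ.exists_sub_sec_cproj hx ((φ.trivZ x₀).continuousLinearMapAt ℝ (f x) v)
  refine ⟨(φ.trivA x₀).symmL ℝ (g x) u, ?_⟩
  rw [← φ.coord_symm hx.1, hu, map_sub, Trivialization.symmL_continuousLinearMapAt _ hx.1.2]

/-- The local trivialization of the quotient bundle around `x₀`. -/
def pretriv (x₀ : X) : Pretrivialization (CokerModel EA EZ) (π (CokerModel EA EZ) φ.Coker) where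
  toFun p := (p.1, φ.fibTriv x₀ p.1 p.2)
  invFun p := ⟨p.1, φ.fibSymm x₀ p.1 p.2⟩
  source := π (CokerModel EA EZ) φ.Coker ⁻¹' φ.dom x₀
  target := φ.dom x₀ ×ˢ univ
  map_source' _ hp := ⟨hp, mem_univ _⟩
  map_target' _ hp := hp.1
  left_inv' := by
    rintro ⟨x, q⟩ hp
    exact congrArg (TotalSpace.mk x) (φ.fibSymm_fibTriv hp q)
  right_inv' := by
    rintro ⟨x, v⟩ hp
    exact congrArg (Prod.mk x) (φ.fibTriv_fibSymm hp.1 v)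
  open_target := (φ.isOpen_dom x₀).prod isOpen_univ
  baseSet := φ.dom x₀
  open_baseSet := φ.isOpen_dom x₀
  source_eq := rfl
  target_eq := rfl
  proj_toFun _ _ := rfl

instance (x₀ : X) : (φ.pretriv x₀).IsLinear ℝ where
  linear x _ := (φ.fibTriv x₀ x).isLinear

lemma pretriv_symm (hx : x ∈ φ.dom x₀) (v : CokerModel EA EZ) :
    (φ.pretriv x₀).symm x v = φ.fibSymm x₀ x v :=
  Pretrivialization.symm_apply _ hx v

lemma exists_change (x₀ x₁ : X) : ∃ F : X → CokerModel EA EZ →L[ℝ] CokerModel EA EZ,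
    ContMDiffOn IX 𝓘(ℝ, CokerModel EA EZ →L[ℝ] CokerModel EA EZ) ∞ F
      ((φ.pretriv x₀).baseSet ∩ (φ.pretriv x₁).baseSet) ∧
    ∀ x ∈ (φ.pretriv x₀).baseSet ∩ (φ.pretriv x₁).baseSet, ∀ v,
      F x v = (φ.pretriv x₁ ⟨x, (φ.pretriv x₀).symm x v⟩).2 := by
  refine ⟨fun x ↦ (φ.cproj x₁ x).comp
    (((φ.trivZ x₀).coordChangeL ℝ (φ.trivZ x₁) (f x) : EZ →L[ℝ] EZ).comp (φ.sec x₀)), ?_, ?_⟩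
  · refine ((φ.contMDiffOn_cproj x₁).mono inter_subset_right).clm_comp
      (ContMDiffOn.clm_comp ?_ contMDiffOn_const)
    exact (contMDiffOn_coordChangeL (IB := IZ) (n := ∞) (φ.trivZ x₀) (φ.trivZ x₁)).comp
      φ.contMDiff_cod.contMDiffOn fun x hx ↦ ⟨hx.1.1.2, hx.2.1.2⟩
  · intro x hx v
    change φ.cproj x₁ x ((φ.trivZ x₀).coordChangeL ℝ (φ.trivZ x₁) (f x) (φ.sec x₀ v)) =
      φ.fibTriv x₁ x ((φ.pretriv x₀).symm x v)
    rw [φ.pretriv_symm hx.1, coordChangeL_eq _ _ ⟨hx.1.1.2, hx.2.1.2⟩]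
    exact (φ.fibTriv_cls hx.2 _).symm

lemma isInducing_fibTriv (x : X) : IsInducing (φ.fibTriv x x) := by
  have : FiniteDimensional ℝ (TangentSpace IZ (f x)) := inferInstanceAs (FiniteDimensional ℝ EZ)
  have : T2Space (TangentSpace IZ (f x)) := inferInstanceAs (T2Space EZ)
  have : IsClosed (LinearMap.range (φ.map x).toLinearMap : Set (TangentSpace IZ (f x))) :=
    Submodule.closed_of_finiteDimensional _
  have : T2Space (φ.Coker x) := inferInstanceAs (T2Space
    (TangentSpace IZ (f x) ⧸ LinearMap.range (φ.map x).toLinearMap))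
  have : FiniteDimensional ℝ (φ.Coker x) := inferInstanceAs (FiniteDimensional ℝ
    (TangentSpace IZ (f x) ⧸ LinearMap.range (φ.map x).toLinearMap))
  exact (LinearEquiv.ofLinearMap (φ.fibTriv x x) (φ.fibSymm x x)
    (LinearMap.ext fun v ↦ φ.fibTriv_fibSymm (φ.mem_dom x) v)
    (LinearMap.ext fun v ↦ φ.fibSymm_fibTriv (φ.mem_dom x)
      v)).toContinuousLinearEquiv.toHomeomorph.isInducing

/-- The quotient bundle, through its local trivializations. -/
def prebundle : VectorPrebundle ℝ (CokerModel EA EZ) φ.Coker where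
  pretrivializationAtlas := range φ.pretriv
  pretrivialization_linear' := by rintro _ ⟨x₀, rfl⟩; infer_instance
  pretrivializationAt := φ.pretriv
  mem_base_pretrivializationAt := φ.mem_dom
  pretrivialization_mem_atlas := mem_range_self
  exists_coordChange := by
    rintro _ ⟨x₀, rfl⟩ _ ⟨x₁, rfl⟩
    obtain ⟨F, hF, hF'⟩ := φ.exists_change x₀ x₁
    exact ⟨F, hF.continuousOn, hF'⟩
  totalSpaceMk_isInducing x :=
    (Topology.isInducing_const_prod (x := x) (f := φ.fibTriv x x)).2 (φ.isInducing_fibTriv x)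

instance : φ.prebundle.IsContMDiff IX ∞ where
  exists_contMDiffCoordChange := by
    rintro _ ⟨x₀, rfl⟩ _ ⟨x₁, rfl⟩
    exact φ.exists_change x₀ x₁

instance : TopologicalSpace φ.Total := φ.prebundle.totalSpaceTopology
instance : FiberBundle (CokerModel EA EZ) φ.Coker := φ.prebundle.toFiberBundle
instance : VectorBundle ℝ (CokerModel EA EZ) φ.Coker := φ.prebundle.toVectorBundle
instance : ContMDiffVectorBundle ∞ (CokerModel EA EZ) φ.Coker IX :=
  φ.prebundle.contMDiffVectorBundle IX

end TangentMono
/-- The zero section is injective on tangent vectors, being a section of the projection. -/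
lemma TangentMono.injective_mfderiv_zero
    {IX : ModelWithCorners ℝ EX HX} {IA : ModelWithCorners ℝ EA HA}
    {IZ : ModelWithCorners ℝ EZ HZ} [IsManifold IX ∞ X] [IsManifold IA ∞ A] [IsManifold IZ ∞ Z]
    {g : X → A} {f : X → Z} (φ : TangentMono IX IA IZ g f)
    [FiniteDimensional ℝ EA] [FiniteDimensional ℝ EZ] (x : X) :
    Function.Injective (mfderiv IX (IX.prod 𝓘(ℝ, CokerModel EA EZ))
      (zeroSection (CokerModel EA EZ) φ.Coker) x) := by
  have h1 : MDifferentiableAt IX (IX.prod 𝓘(ℝ, CokerModel EA EZ))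
      (zeroSection (CokerModel EA EZ) φ.Coker) x :=
    (contMDiff_zeroSection (n := ∞) ℝ φ.Coker).contMDiffAt.mdifferentiableAt (by simp)
  have h2 : MDifferentiableAt (IX.prod 𝓘(ℝ, CokerModel EA EZ)) IX
      (π (CokerModel EA EZ) φ.Coker) (zeroSection (CokerModel EA EZ) φ.Coker x) :=
    (contMDiff_proj (n := ∞) φ.Coker).contMDiffAt.mdifferentiableAt (by simp)
  have h3 := mfderiv_comp x h2 h1
  have h4 : π (CokerModel EA EZ) φ.Coker ∘ zeroSection (CokerModel EA EZ) φ.Coker = id := rfl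
  rw [h4, mfderiv_id] at h3
  intro u v huv
  have h5 := congrArg (fun T : TangentSpace IX x →L[ℝ] TangentSpace IX x ↦ T u) h3
  have h6 := congrArg (fun T : TangentSpace IX x →L[ℝ] TangentSpace IX x ↦ T v) h3
  exact (h5.trans (congrArg (mfderiv (IX.prod 𝓘(ℝ, CokerModel EA EZ)) IX
    (π (CokerModel EA EZ) φ.Coker) (zeroSection (CokerModel EA EZ) φ.Coker x)) huv)).trans h6.symm

end Coker

/-! ### Immersions and their normal bundles -/

section Immersions

variable {EX HX X : Type*} [NormedAddCommGroup EX] [NormedSpace ℝ EX] [TopologicalSpace HX]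
  [TopologicalSpace X] [ChartedSpace HX X]
  {ES HS S : Type*} [NormedAddCommGroup ES] [NormedSpace ℝ ES] [TopologicalSpace HS]
  [TopologicalSpace S] [ChartedSpace HS S]
  {EZ HZ Z : Type*} [NormedAddCommGroup EZ] [NormedSpace ℝ EZ] [TopologicalSpace HZ]
  [TopologicalSpace Z] [ChartedSpace HZ Z]

/-- A smooth immersion (of finite dimensional manifolds). -/
structure SmoothImmersion (IX : ModelWithCorners ℝ EX HX) (IZ : ModelWithCorners ℝ EZ HZ)
    (X Z : Type*) [TopologicalSpace X] [ChartedSpace HX X] [TopologicalSpace Z]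
    [ChartedSpace HZ Z] where
  toFun : X → Z
  contMDiff : ContMDiff IX IZ ∞ toFun
  injective_mfderiv : ∀ x, Function.Injective (mfderiv IX IZ toFun x)

instance (IX : ModelWithCorners ℝ EX HX) (IZ : ModelWithCorners ℝ EZ HZ) :
    CoeFun (SmoothImmersion IX IZ X Z) fun _ ↦ X → Z := ⟨SmoothImmersion.toFun⟩

variable {IX : ModelWithCorners ℝ EX HX} {IS : ModelWithCorners ℝ ES HS}
  {IZ : ModelWithCorners ℝ EZ HZ}

namespace SmoothImmersion

lemma mfderiv_comp_apply (j : SmoothImmersion IS IZ S Z) (i : SmoothImmersion IX IS X S) (x : X)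
    (u : TangentSpace IX x) : mfderiv IX IZ (fun y ↦ j (i y)) x u =
      mfderiv IS IZ j (i x) (mfderiv IX IS i x u) := by
  have h := mfderiv_comp x (j.contMDiff.mdifferentiableAt (x := i x) (by simp))
    (i.contMDiff.mdifferentiableAt (x := x) (by simp))
  exact congrArg (fun T : TangentSpace IX x →L[ℝ] TangentSpace IZ (j (i x)) ↦ T u) h

/-- Composition of immersions. -/
def comp (j : SmoothImmersion IS IZ S Z) (i : SmoothImmersion IX IS X S) :
    SmoothImmersion IX IZ X Z where
  toFun x := j (i x)
  contMDiff := j.contMDiff.comp i.contMDiff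
  injective_mfderiv x u v h := by
    rw [mfderiv_comp_apply, mfderiv_comp_apply] at h
    exact i.injective_mfderiv x (j.injective_mfderiv (i x) h)

variable [IsManifold IX ∞ X] [IsManifold IS ∞ S] [IsManifold IZ ∞ Z]

/-- The inclusion `TX → k^*TZ`; its quotient is the normal bundle `TZ|_X / TX`. -/
def normal (k : SmoothImmersion IX IZ X Z) : TangentMono IX IX IZ id k where
  map x := mfderiv IX IZ k x
  contMDiff_dom := contMDiff_id
  contMDiff_cod := k.contMDiff
  injective := k.injective_mfderiv
  contMDiff_map x₀ := by
    have h1 : IsManifold IX 1 X := .of_le (n := ∞) (by simp)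
    have h2 : IsManifold IZ 1 Z := .of_le (n := ∞) (by simp)
    exact ContMDiffAt.mfderiv_const k.contMDiff.contMDiffAt (by simp)

/-- The inclusion `i^*TS → (j ∘ i)^*TZ`; its quotient is the bundle `TZ|_X / TS|_X`. -/
def along (j : SmoothImmersion IS IZ S Z) (i : SmoothImmersion IX IS X S) :
    TangentMono IX IS IZ i (j.comp i) where
  map x := mfderiv IS IZ j (i x)
  contMDiff_dom := i.contMDiff
  contMDiff_cod := (j.comp i).contMDiff
  injective x := j.injective_mfderiv (i x)
  contMDiff_map x₀ := by
    have h1 : IsManifold IX 1 X := .of_le (n := ∞) (by simp)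
    have h2 : IsManifold IZ 1 Z := .of_le (n := ∞) (by simp)
    have h3 : IsManifold IS 1 S := .of_le (n := ∞) (by simp)
    exact ContMDiffAt.mfderiv (fun _ ↦ j) i (j.contMDiff.contMDiffAt.comp _ contMDiffAt_snd)
      i.contMDiff.contMDiffAt (by simp)

/-- The total space of the normal bundle `TZ|_X / TX` of an immersion `X → Z`. -/
abbrev NormalBundle (k : SmoothImmersion IX IZ X Z) : Type _ := k.normal.Total

/-- The model with corners of the total space of the normal bundle. -/
abbrev normalModel (IX : ModelWithCorners ℝ EX HX) (EA EZ : Type*) [NormedAddCommGroup EA]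
    [NormedSpace ℝ EA] [NormedAddCommGroup EZ] [NormedSpace ℝ EZ] :
    ModelWithCorners ℝ (EX × CokerModel EA EZ) (ModelProd HX (CokerModel EA EZ)) :=
  IX.prod 𝓘(ℝ, CokerModel EA EZ)

/-- The map `TS|_X / TX → TZ|_X / TX` induced by an immersion `S → Z`. -/
def inclNormal (j : SmoothImmersion IS IZ S Z) (i : SmoothImmersion IX IS X S)
    (t : i.NormalBundle) : (j.comp i).NormalBundle :=
  ⟨t.1, i.normal.desc ((j.comp i).normal.cls t.1 ∘ₗ (mfderiv IS IZ j (i t.1)).toLinearMap)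
    (fun u ↦ ((j.comp i).normal.cls_eq_zero).2 ⟨u, mfderiv_comp_apply j i t.1 u⟩) t.2⟩

/-- The projection `TZ|_X / TX → TZ|_X / TS|_X`. -/
def projAlong (j : SmoothImmersion IS IZ S Z) (i : SmoothImmersion IX IS X S)
    (t : (j.comp i).NormalBundle) : (j.along i).Total :=
  ⟨t.1, (j.comp i).normal.desc ((j.along i).cls t.1)
    (fun u ↦ ((j.along i).cls_eq_zero).2 ⟨mfderiv IX IS i t.1 u,
      (mfderiv_comp_apply j i t.1 u).symm⟩) t.2⟩

variable [FiniteDimensional ℝ EX] [FiniteDimensional ℝ EZ]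

/-- The zero section of the normal bundle. -/
def zero (k : SmoothImmersion IX IZ X Z) :
    SmoothImmersion IX (normalModel IX EX EZ) X k.NormalBundle where
  toFun := zeroSection (CokerModel EX EZ) k.normal.Coker
  contMDiff := contMDiff_zeroSection ℝ k.normal.Coker
  injective_mfderiv := k.normal.injective_mfderiv_zero

/-- The Euler vector field of the normal bundle: its value at `t` is the velocity of
`s ↦ s • t` at `s = 1`. -/
def euler (k : SmoothImmersion IX IZ X Z) (t : k.NormalBundle) :
    TangentSpace (normalModel IX EX EZ) t :=
  (mfderiv 𝓘(ℝ, ℝ) (normalModel IX EX EZ) (fun s : ℝ ↦ (⟨t.1, s • t.2⟩ : k.NormalBundle)) 1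
    (1 : ℝ) : EX × CokerModel EX EZ)

/-- The vertical tangent vector at the point `x` of the zero section given by an element of the
fibre over `x`: the velocity of `s ↦ s • v` at `s = 0`. -/
def vert (k : SmoothImmersion IX IZ X Z) (x : X) (v : k.normal.Coker x) :
    TangentSpace (normalModel IX EX EZ) (k.zero x) :=
  (mfderiv 𝓘(ℝ, ℝ) (normalModel IX EX EZ) (fun s : ℝ ↦ (⟨x, s • v⟩ : k.NormalBundle)) 0
    (1 : ℝ) : EX × CokerModel EX EZ)

/-- The canonical map from the normal bundle to the normal bundle of its zero section. -/
def toZeroNormal (k : SmoothImmersion IX IZ X Z) (t : k.NormalBundle) : k.zero.NormalBundle :=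
  ⟨t.1, k.zero.normal.cls t.1 (k.vert t.1 t.2)⟩

end SmoothImmersion
end Immersions
/-! ### Poisson manifolds -/

section Poisson

variable {EM HM M : Type*} [NormedAddCommGroup EM] [NormedSpace ℝ EM] [TopologicalSpace HM]
  [TopologicalSpace M] [ChartedSpace HM M]
  {EN HN N : Type*} [NormedAddCommGroup EN] [NormedSpace ℝ EN] [TopologicalSpace HN]
  [TopologicalSpace N] [ChartedSpace HN N]

/-- The differential of a real function. -/
def diff (I : ModelWithCorners ℝ EM HM) (f : M → ℝ) (z : M) : TangentSpace I z →L[ℝ] ℝ :=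
  mfderiv I 𝓘(ℝ, ℝ) f z

/-- Smoothness of real functions. -/
abbrev IsSmoothFun (I : ModelWithCorners ℝ EM HM) (f : M → ℝ) : Prop :=
  ContMDiff I 𝓘(ℝ, ℝ) ∞ f

/-- A Poisson structure `w` on `M`, given by the bundle map `w♯ : T^*M → TM` of the bivector field
`w (α, β) = α (w♯ β)`, with bracket `{f, g} = w (df, dg)`. -/
@[ext]
structure PoissonStructure (I : ModelWithCorners ℝ EM HM) (M : Type*) [TopologicalSpace M]
    [ChartedSpace HM M] where
  sharp : ∀ z : M, (TangentSpace I z →L[ℝ] ℝ) →ₗ[ℝ] TangentSpace I z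
  skew : ∀ z (α β : TangentSpace I z →L[ℝ] ℝ), α (sharp z β) = -β (sharp z α)
  smooth : ∀ f g : M → ℝ, IsSmoothFun I f → IsSmoothFun I g →
    IsSmoothFun I fun z ↦ diff I f z (sharp z (diff I g z))
  jacobi : let br : (M → ℝ) → (M → ℝ) → M → ℝ := fun f g z ↦ diff I f z (sharp z (diff I g z))
    ∀ f g h : M → ℝ, IsSmoothFun I f → IsSmoothFun I g → IsSmoothFun I h →
      ∀ z, br f (br g h) z + br g (br h f) z + br h (br f g) z = 0

namespace PoissonStructure

variable {I : ModelWithCorners ℝ EM HM} {J : ModelWithCorners ℝ EN HN}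

/-- The Poisson bracket. -/
def bracket (P : PoissonStructure I M) (f g : M → ℝ) (z : M) : ℝ :=
  diff I f z (P.sharp z (diff I g z))

end PoissonStructure

/-- Smooth vector fields. -/
def IsSmoothField (I : ModelWithCorners ℝ EM HM) [IsManifold I ∞ M]
    (U : ∀ z : M, TangentSpace I z) : Prop :=
  ContMDiff I I.tangent ∞ fun z ↦ (⟨z, U z⟩ : TangentBundle I M)

/-- The total space of the cotangent bundle. -/
abbrev CotangentBundle (I : ModelWithCorners ℝ EM HM) (M : Type*) [TopologicalSpace M]
    [ChartedSpace HM M] [IsManifold I ∞ M] : Type _ :=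
  TotalSpace (EM →L[ℝ] ℝ) (fun z : M ↦ TangentSpace I z →L[ℝ] ℝ)

/-- The model with corners of the cotangent bundle. -/
abbrev cotangentModel (I : ModelWithCorners ℝ EM HM) :
    ModelWithCorners ℝ (EM × (EM →L[ℝ] ℝ)) (ModelProd HM (EM →L[ℝ] ℝ)) :=
  I.prod 𝓘(ℝ, EM →L[ℝ] ℝ)

/-- Smooth 1-forms. -/
def IsSmoothForm (I : ModelWithCorners ℝ EM HM) [IsManifold I ∞ M]
    (α : ∀ z : M, TangentSpace I z →L[ℝ] ℝ) : Prop :=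
  ContMDiff I (cotangentModel I) ∞ fun z ↦ (⟨z, α z⟩ : CotangentBundle I M)

/-- `(L_V α) (U)`, the Lie derivative of a 1-form evaluated on a vector field. -/
def lieDerivForm (I : ModelWithCorners ℝ EM HM) (V : ∀ z : M, TangentSpace I z)
    (α : ∀ z : M, TangentSpace I z →L[ℝ] ℝ) (U : ∀ z : M, TangentSpace I z) (z : M) : ℝ :=
  diff I (fun y ↦ α y (U y)) z (V z) - α z (VectorField.mlieBracket I V U z)

/-- `(dθ) (U, V)`, the exterior derivative of a 1-form evaluated on vector fields. -/
def extDerivForm (I : ModelWithCorners ℝ EM HM) (θ : ∀ z : M, TangentSpace I z →L[ℝ] ℝ)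
    (U V : ∀ z : M, TangentSpace I z) (z : M) : ℝ :=
  diff I (fun y ↦ θ y (V y)) z (U z) - diff I (fun y ↦ θ y (U y)) z (V z) -
    θ z (VectorField.mlieBracket I U V z)

/-- `η = dθ`, tested on smooth vector fields. -/
def IsExtDeriv (I : ModelWithCorners ℝ EM HM) [IsManifold I ∞ M]
    (θ : ∀ z : M, TangentSpace I z →L[ℝ] ℝ)
    (η : ∀ z : M, TangentSpace I z → TangentSpace I z → ℝ) : Prop :=
  ∀ U V : ∀ z : M, TangentSpace I z, IsSmoothField I U → IsSmoothField I V →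
    ∀ z, η z (U z) (V z) = extDerivForm I θ U V z

/-- The tautological 1-form `p dq` of the cotangent bundle. -/
def tautologicalForm (I : ModelWithCorners ℝ EM HM) [IsManifold I ∞ M]
    (ξ : CotangentBundle I M) : TangentSpace (cotangentModel I) ξ →L[ℝ] ℝ :=
  ξ.2.comp (mfderiv (cotangentModel I) I (TotalSpace.proj : CotangentBundle I M → M) ξ)

namespace PoissonStructure

variable {I : ModelWithCorners ℝ EM HM} {J : ModelWithCorners ℝ EN HN}

/-- `γ = {α, β} = L_{w♯ β} α - L_{w♯ α} β - d (w (α, β))`, the bracket of 1-forms, tested on smooth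
vector fields. -/
def IsFormBracket [IsManifold I ∞ M] (P : PoissonStructure I M)
    (α β γ : ∀ z : M, TangentSpace I z →L[ℝ] ℝ) : Prop :=
  ∀ U : ∀ z : M, TangentSpace I z, IsSmoothField I U → ∀ z,
    γ z (U z) = lieDerivForm I (fun y ↦ P.sharp y (β y)) α U z -
      lieDerivForm I (fun y ↦ P.sharp y (α y)) β U z -
      diff I (fun y ↦ α y (P.sharp y (β y))) z (U z)

/-- `[w, T] (df, dg) = (L_T w) (df, dg)`. -/
def lieDeriv (P : PoissonStructure I M) (T : ∀ z : M, TangentSpace I z) (f g : M → ℝ) (z : M) : ℝ :=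
  diff I (P.bracket f g) z (T z) - P.bracket (fun y ↦ diff I f y (T y)) g z -
    P.bracket f (fun y ↦ diff I g y (T y)) z

/-- `w = -[w, T]`: the Poisson structure is exact, with primitive the smooth vector field `T`. -/
def IsExactVia [IsManifold I ∞ M] (P : PoissonStructure I M) (T : ∀ z : M, TangentSpace I z) :
    Prop :=
  IsSmoothField I T ∧ ∀ f g : M → ℝ, IsSmoothFun I f → IsSmoothFun I g →
    ∀ z, P.bracket f g z = -P.lieDeriv T f g z

/-- Poisson maps. -/
def IsPoissonMap (P : PoissonStructure I M) (Q : PoissonStructure J N) (φ : M → N) : Prop :=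
  ContMDiff I J ∞ φ ∧ ∀ f g : N → ℝ, IsSmoothFun J f → IsSmoothFun J g →
    ∀ z, P.bracket (f ∘ φ) (g ∘ φ) z = Q.bracket f g (φ z)

variable {ES HS : Type*} [NormedAddCommGroup ES] [NormedSpace ℝ ES] [TopologicalSpace HS]
  {IS : ModelWithCorners ℝ ES HS} {S : Type*} [TopologicalSpace S] [ChartedSpace HS S]
  {EX HX : Type*} [NormedAddCommGroup EX] [NormedSpace ℝ EX] [TopologicalSpace HX]
  {IX : ModelWithCorners ℝ EX HX} {X : Type*} [TopologicalSpace X] [ChartedSpace HX X]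

/-- `j : S → M` is an injectively immersed integral manifold of the characteristic
distribution `im w♯`. -/
structure IsIntegral (P : PoissonStructure I M) (j : SmoothImmersion IS I S M) : Prop where
  injective : Function.Injective j
  range_eq : ∀ s, range (mfderiv IS I j s) = range (P.sharp (j s))

/-- `j : S → M` is an integral manifold of the characteristic distribution which contains every
connected integral manifold that it meets. -/
structure IsMaximalIntegral.{u} {S : Type u} [TopologicalSpace S] [ChartedSpace HS S]
    [IsManifold IS ∞ S] (P : PoissonStructure I M) (j : SmoothImmersion IS I S M) : Prop
    extends P.IsIntegral j where
  maximal : ∀ (S₁ : Type u) [TopologicalSpace S₁] [ChartedSpace HS S₁] [IsManifold IS ∞ S₁]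
    [ConnectedSpace S₁] (j₁ : SmoothImmersion IS I S₁ M), P.IsIntegral j₁ →
    (range j₁ ∩ range j).Nonempty → range j₁ ⊆ range j

/-- `j : S → M` is a symplectic leaf: a maximal connected integral manifold of the
characteristic distribution. -/
structure IsSymplecticLeaf.{u} {S : Type u} [TopologicalSpace S] [ChartedSpace HS S]
    [IsManifold IS ∞ S] (P : PoissonStructure I M) (j : SmoothImmersion IS I S M) : Prop
    extends P.IsMaximalIntegral j where
  connected : ConnectedSpace S

open Classical in
/-- The symplectic form of an integral manifold `j : S → M`, determined by
`ω (u, v) = α (dj v)` for any covector `α` with `w♯ α = dj u`. -/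
def leafForm (P : PoissonStructure I M) (j : SmoothImmersion IS I S M) (s : S)
    (u v : TangentSpace IS s) : ℝ :=
  if h : ∃ α, P.sharp (j s) α = mfderiv IS I j s u then h.choose (mfderiv IS I j s v) else 0

/-- `i : X → S` is an embedded Lagrangian submanifold of the integral manifold `j : S → M`. -/
structure IsLagrangian (P : PoissonStructure I M) (j : SmoothImmersion IS I S M)
    (i : SmoothImmersion IX IS X S) : Prop where
  isEmbedding : IsEmbedding i
  finrank_eq : finrank ℝ ES = 2 * finrank ℝ EX
  isotropic : ∀ x (u v : TangentSpace IX x),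
    P.leafForm j (i x) (mfderiv IX IS i x u) (mfderiv IX IS i x v) = 0

/-- Darboux coordinates `(x, p, r)` centered at `z₀`, with
`{r_a, r_b} = ∑ c, w^c_{ab} (r) r_c`. -/
structure DarbouxChart (P : PoissonStructure I M) (z₀ : M) (m n : ℕ) where
  chart : OpenPartialHomeomorph M ((Fin m → ℝ) × (Fin m → ℝ) × (Fin n → ℝ))
  contMDiffOn_chart : ContMDiffOn I 𝓘(ℝ, (Fin m → ℝ) × (Fin m → ℝ) × (Fin n → ℝ)) ∞
    chart chart.source
  contMDiffOn_symm : ContMDiffOn 𝓘(ℝ, (Fin m → ℝ) × (Fin m → ℝ) × (Fin n → ℝ)) I ∞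
    chart.symm chart.target
  mem_source : z₀ ∈ chart.source
  centered : chart z₀ = 0
  w : Fin n → Fin n → Fin n → (Fin n → ℝ) → ℝ
  contDiffOn_w : ∀ c a b, ContDiffOn ℝ ∞ (w c a b) ((fun z ↦ (chart z).2.2) '' chart.source)
  bracket_x_x : ∀ z ∈ chart.source, ∀ μ ν,
    P.bracket (fun y ↦ (chart y).1 μ) (fun y ↦ (chart y).1 ν) z = 0
  bracket_p_p : ∀ z ∈ chart.source, ∀ μ ν,
    P.bracket (fun y ↦ (chart y).2.1 μ) (fun y ↦ (chart y).2.1 ν) z = 0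
  bracket_x_p : ∀ z ∈ chart.source, ∀ μ ν,
    P.bracket (fun y ↦ (chart y).1 μ) (fun y ↦ (chart y).2.1 ν) z = if μ = ν then 1 else 0
  bracket_x_r : ∀ z ∈ chart.source, ∀ μ a,
    P.bracket (fun y ↦ (chart y).1 μ) (fun y ↦ (chart y).2.2 a) z = 0
  bracket_p_r : ∀ z ∈ chart.source, ∀ μ a,
    P.bracket (fun y ↦ (chart y).2.1 μ) (fun y ↦ (chart y).2.2 a) z = 0
  bracket_r_r : ∀ z ∈ chart.source, ∀ a b,
    P.bracket (fun y ↦ (chart y).2.2 a) (fun y ↦ (chart y).2.2 b) z =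
      ∑ c, w c a b (chart z).2.2 * (chart z).2.2 c

namespace DarbouxChart

variable {P : PoissonStructure I M} {z₀ : M} {m n : ℕ} (D : P.DarbouxChart z₀ m n)

/-- The coordinate function `x^μ`. -/
def x (μ : Fin m) (z : M) : ℝ := (D.chart z).1 μ

/-- The coordinate function `p_μ`. -/
def p (μ : Fin m) (z : M) : ℝ := (D.chart z).2.1 μ

/-- The coordinate function `r_a`. -/
def r (a : Fin n) (z : M) : ℝ := (D.chart z).2.2 a

end DarbouxChart

end PoissonStructure
end Poisson

/-! ### The linear approximation at a Lagrangian submanifold of a leaf -/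

section Approximation

variable {EX HX X : Type*} [NormedAddCommGroup EX] [NormedSpace ℝ EX] [TopologicalSpace HX]
  [TopologicalSpace X] [ChartedSpace HX X]
  {ES HS S : Type*} [NormedAddCommGroup ES] [NormedSpace ℝ ES] [TopologicalSpace HS]
  [TopologicalSpace S] [ChartedSpace HS S]
  {EZ HZ Z : Type*} [NormedAddCommGroup EZ] [NormedSpace ℝ EZ] [TopologicalSpace HZ]
  [TopologicalSpace Z] [ChartedSpace HZ Z]
  {IX : ModelWithCorners ℝ EX HX} {IS : ModelWithCorners ℝ ES HS}
  {IZ : ModelWithCorners ℝ EZ HZ}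
  [IsManifold IX ∞ X] [IsManifold IS ∞ S] [IsManifold IZ ∞ Z]

/-- The smooth sections of the bundle `E_X = (TX)^0 ⊆ T^*Z|_X`. -/
@[ext]
structure ConormalSection (k : SmoothImmersion IX IZ X Z) where
  toFun : ∀ x, TangentSpace IZ (k x) →L[ℝ] ℝ
  map_tangent : ∀ x (u : TangentSpace IX x), toFun x (mfderiv IX IZ k x u) = 0
  smooth : ContMDiff IX (cotangentModel IZ) ∞ fun x ↦ (⟨k x, toFun x⟩ : CotangentBundle IZ Z)

/-- The fibrewise linear function on `TZ|_X / TX = E_X^*` defined by a section of `E_X`. -/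
def ConormalSection.bar {k : SmoothImmersion IX IZ X Z} (σ : ConormalSection k)
    (t : k.NormalBundle) : ℝ :=
  k.normal.desc (σ.toFun t.1).toLinearMap (σ.map_tangent t.1) t.2

namespace PoissonStructure

/-- `κ` is the bracket of the sections `σ`, `τ` of `E_X`: it is the restriction to `X` of the
bracket of any 1-forms on `Z` which restrict to `σ` and `τ` near the given point of `X`. -/
def IsConormalBracket (P : PoissonStructure IZ Z) {k : SmoothImmersion IX IZ X Z}
    (σ τ κ : ConormalSection k) : Prop :=
  ∀ (x : X) (α β γ : ∀ z : Z, TangentSpace IZ z →L[ℝ] ℝ), IsSmoothForm IZ α → IsSmoothForm IZ β →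
    (∀ᶠ y in 𝓝 x, α (k y) = σ.toFun y) → (∀ᶠ y in 𝓝 x, β (k y) = τ.toFun y) →
    P.IsFormBracket α β γ → γ (k x) = κ.toFun x

variable [FiniteDimensional ℝ EX] [FiniteDimensional ℝ EZ]

/-- `Q` is a Poisson structure on `TZ|_X / TX` extending the bracket of the sections of `E_X`. -/
def Extends (P : PoissonStructure IZ Z) (k : SmoothImmersion IX IZ X Z)
    (Q : PoissonStructure (SmoothImmersion.normalModel IX EX EZ) k.NormalBundle) : Prop :=
  ∀ σ τ : ConormalSection k, ∃ κ : ConormalSection k, P.IsConormalBracket σ τ κ ∧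
    ∀ t, Q.bracket σ.bar τ.bar t = κ.bar t

/-- `Q` is the Poisson structure on `TZ|_X / TS|_X` given on each fibre by the Lie-Poisson
structure `{f, g} (n) = ⟨n, [d_n f, d_n g]⟩` of the dual of the transverse Lie algebra
`(T_x S)^0 ⊆ T_x^*Z`, whose bracket is `[dF, dG] = d {F, G}`. -/
def IsFibrewiseLiePoisson [FiniteDimensional ℝ ES] (P : PoissonStructure IZ Z)
    (j : SmoothImmersion IS IZ S Z) (i : SmoothImmersion IX IS X S)
    (Q : PoissonStructure (SmoothImmersion.normalModel IX ES EZ) (j.along i).Total) : Prop :=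
  ∀ f g : (j.along i).Total → ℝ, IsSmoothFun (SmoothImmersion.normalModel IX ES EZ) f →
      IsSmoothFun (SmoothImmersion.normalModel IX ES EZ) g →
    ∀ (x : X) (v : TangentSpace IZ (j (i x))) (F G : Z → ℝ),
      IsSmoothFun IZ F → IsSmoothFun IZ G →
      (∀ u, diff IZ F (j (i x)) u = deriv (fun s : ℝ ↦
        f ⟨x, (j.along i).cls x v + s • (j.along i).cls x u⟩) 0) →
      (∀ u, diff IZ G (j (i x)) u = deriv (fun s : ℝ ↦
        g ⟨x, (j.along i).cls x v + s • (j.along i).cls x u⟩) 0) →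
      Q.bracket f g ⟨x, (j.along i).cls x v⟩ = diff IZ (P.bracket F G) (j (i x)) v

end PoissonStructure
end Approximation
end

/-! A covector that kills `TX` is sent by `w♯` to a vector of the leaf which is symplectically
orthogonal to `TX`, hence tangent to `X`, because `X` is Lagrangian. So `X` is coisotropic in `Z`
(`IsLagrangian.isCoisotropic`), and the construction of the linear Poisson structure, its Darboux
coordinates and its idempotence rest on this alone. Write `ρ(σ)` for the vector field `w♯ σ` on `X`.

A conormal section is locally the restriction of `dF` for a function `F` that vanishes on `X`
(`exists_potential`), and `[σ, τ]` is `d{F, G}` along `X`. This does not depend on the potentials: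
if `dD = 0` along `X`, then `V{D, G} = X_G(V D) + [V, X_G] D` vanishes on `X`, as `X_G` is tangent
to `X` (`diff_bracket_eq_zero`). For extensions `α`, `β` that are not exact, the error is the
differential of `(α - dF)(w♯(β - dG))`, a pairing of two factors that vanish at the point.

On `Z'` the differentials of the functions `σ̄ + h ∘ π` fill the cotangent spaces, and the bracket
must be `{σ̄ + h, τ̄ + g}' = [σ, τ]‾ + ρ(τ)h - ρ(σ)g`. In terms of local functions on `Z` this is
the bracket of `F + ε f` and `G + ε g` modulo `ε²`, whence skewness and the Jacobi identity. That
such a rule on generators is a Poisson structure is `exists_poissonStructure_of_generators`; its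
essential hypothesis, a tangent vector that realizes each bracket, is supplied by
`exists_hamiltonian`. The structure is unique although only brackets of functions `σ̄` are
prescribed: off the zero section their differentials already fill the cotangent spaces, and
continuity does the rest (`eq_of_extends`).

Sections `l` of `L_X` have zero anchor and form an ideal. Hence the functions `l̄`, which cut out
`S'`, have zero Hamiltonian vectors at the points of `S'`, and there `ker w'♯` is exactly the
annihilator of `TS'` (`sharp_eq_zero_iff`); so `S'` is an integral manifold. For its maximality,
note that on any integral manifold the derivatives of the `l̄` in Hamiltonian directions are again
functions of this type, hence bounded by a multiple of the `l̄` themselves; Gronwall's inequality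
makes their common zero set open, and it is closed (`eventually_mem_range_inclNormal`). The same
ideal property lets the structure descend to `L_X^*`.

Under `S' → T^*X` the fibrewise linear function of the vector field `ρ(σ)` pulls back to `-σ̄`, and
every tangent vector of `X` is a value of some `ρ(σ)`. This gives smoothness and injectivity, and,
together with `ρ` being a homomorphism, the equality of the two symplectic forms in a local frame
(`leafForm_eq_sum`). Finally `σ ↦ dσ̄` identifies the conormal sections of `X` with those of the
zero section compatibly with brackets and anchors, so linearizing twice changes nothing. -/

set_option linter.unusedSectionVars false

noncomputable section

/-! ### Differentials of functions, extension by cut-offs, smoothness tests for fields along maps -/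

section Calculus

variable {E H M : Type*} [NormedAddCommGroup E] [NormedSpace ℝ E] [TopologicalSpace H]
  {I : ModelWithCorners ℝ E H} [TopologicalSpace M] [ChartedSpace H M]
  {E' H' N : Type*} [NormedAddCommGroup E'] [NormedSpace ℝ E'] [TopologicalSpace H']
  {I' : ModelWithCorners ℝ E' H'} [TopologicalSpace N] [ChartedSpace H' N]

/-- A function which is smooth near a point agrees near that point with a smooth function. -/
lemma exists_contMDiff_eventuallyEq [FiniteDimensional ℝ E] [T2Space M] [IsManifold I ∞ M]
    {G : Type*} [NormedAddCommGroup G] [NormedSpace ℝ G] {f : M → G} {z : M}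
    (hf : ∀ᶠ y in 𝓝 z, ContMDiffAt I 𝓘(ℝ, G) ∞ f y) :
    ∃ g : M → G, ContMDiff I 𝓘(ℝ, G) ∞ g ∧ g =ᶠ[𝓝 z] f := by
  -- The support of the cut-off lies where `f` is smooth, so the product is smooth everywhere; near
  -- `z` the cut-off is 1.
  obtain ⟨χ, -, hχ⟩ := (SmoothBumpFunction.nhds_basis_tsupport (I := I) z).mem_iff.1 hf
  refine ⟨fun y ↦ χ y • f y, contMDiff_of_tsupport fun y hy ↦ ?_, ?_⟩
  · exact χ.contMDiffAt.smul (hχ (closure_mono (Function.support_smul_subset_left _ _) hy))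
  · filter_upwards [χ.eventuallyEq_one] with y hy
    simp [hy]

/-- A smooth function with values in the model space, equal to the chart at `z` near `z`. -/
lemma exists_contMDiff_eq_extChartAt [FiniteDimensional ℝ E] [T2Space M] [IsManifold I ∞ M]
    (z : M) : ∃ g : M → E, ContMDiff I 𝓘(ℝ, E) ∞ g ∧ g =ᶠ[𝓝 z] extChartAt I z := by
  apply exists_contMDiff_eventuallyEq
  filter_upwards [chart_source_mem_nhds H z] with y hy using contMDiffAt_extChartAt' hy

lemma diff_comp {f : N → ℝ} {g : M → N} {z : M} (hf : MDifferentiableAt I' 𝓘(ℝ, ℝ) f (g z))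
    (hg : MDifferentiableAt I I' g z) (v : TangentSpace I z) :
    diff I (fun y ↦ f (g y)) z v = diff I' f (g z) (mfderiv I I' g z v) := by
  have h := mfderiv_comp z hf hg
  exact congrArg (fun T : TangentSpace I z →L[ℝ] ℝ ↦ T v) h

lemma diff_congr {f g : M → ℝ} {z : M} (h : f =ᶠ[𝓝 z] g) : diff I f z = diff I g z :=
  h.mfderiv_eq

lemma diff_const (c : ℝ) (z : M) : diff I (fun _ ↦ c) z = 0 := mfderiv_const

lemma diff_add {f g : M → ℝ} {z : M} (hf : MDifferentiableAt I 𝓘(ℝ, ℝ) f z)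
    (hg : MDifferentiableAt I 𝓘(ℝ, ℝ) g z) :
    diff I (fun y ↦ f y + g y) z = diff I f z + diff I g z :=
  (hf.hasMFDerivAt.add hg.hasMFDerivAt).mfderiv

lemma diff_sub {f g : M → ℝ} {z : M} (hf : MDifferentiableAt I 𝓘(ℝ, ℝ) f z)
    (hg : MDifferentiableAt I 𝓘(ℝ, ℝ) g z) :
    diff I (fun y ↦ f y - g y) z = diff I f z - diff I g z :=
  (hf.hasMFDerivAt.sub hg.hasMFDerivAt).mfderiv

lemma diff_neg {f : M → ℝ} {z : M} : diff I (fun y ↦ - f y) z = - diff I f z :=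
  mfderiv_neg (f := f)

lemma diff_mul {f g : M → ℝ} {z : M} (hf : MDifferentiableAt I 𝓘(ℝ, ℝ) f z)
    (hg : MDifferentiableAt I 𝓘(ℝ, ℝ) g z) :
    diff I (fun y ↦ f y * g y) z = f z • diff I g z + g z • diff I f z :=
  (hf.hasMFDerivAt.mul hg.hasMFDerivAt).mfderiv

lemma IsSmoothFun.mdiff {f : M → ℝ} (hf : IsSmoothFun I f) (z : M) :
    MDifferentiableAt I 𝓘(ℝ, ℝ) f z := hf.mdifferentiableAt (by simp)

lemma diff_clm_comp {F : Type*} [NormedAddCommGroup F] [NormedSpace ℝ F] (L : F →L[ℝ] ℝ)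
    {U : M → F} {z : M} (hU : MDifferentiableAt I 𝓘(ℝ, F) U z) (v : TangentSpace I z) :
    diff I (fun y ↦ L (U y)) z v = L (mfderiv I 𝓘(ℝ, F) U z v) := by
  have h2 : mfderiv 𝓘(ℝ, F) 𝓘(ℝ, ℝ) L (U z) = L := L.mfderiv_eq
  refine (diff_comp (I' := 𝓘(ℝ, F)) (L.contMDiff (n := ∞) |>.mdifferentiableAt (by simp))
    hU v).trans ?_
  exact congrArg (fun T : F →L[ℝ] ℝ ↦ T (mfderiv I 𝓘(ℝ, F) U z v)) h2

/-- Every covector is the differential of a smooth function. -/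
lemma exists_diff_eq [FiniteDimensional ℝ E] [T2Space M] [IsManifold I ∞ M]
    (z : M) (α : TangentSpace I z →L[ℝ] ℝ) :
    ∃ f : M → ℝ, IsSmoothFun I f ∧ diff I f z = α := by
  obtain ⟨g, hg, hgz⟩ := exists_contMDiff_eq_extChartAt (I := I) z
  let a : E →L[ℝ] ℝ := α
  refine ⟨fun y ↦ a (g y), a.contMDiff.comp hg, ?_⟩
  -- The tangent space at `z` is modelled through the chart at `z`, whose differential there is
  -- therefore the identity.
  have h1 : mfderiv I 𝓘(ℝ, E) g z = ContinuousLinearMap.id ℝ E := by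
    rw [hgz.mfderiv_eq]; exact mfderiv_extChartAt_self
  ext v
  refine (diff_clm_comp a (hg.mdifferentiableAt (x := z) (by simp)) v).trans ?_
  rw [h1]
  rfl

/-- Every vector of a smooth vector bundle extends to a smooth section, which is constant near the
base point in the preferred trivialization. -/
lemma exists_contMDiff_section_eventuallyEq [FiniteDimensional ℝ E] [T2Space M] [IsManifold I ∞ M]
    {F : Type*} [NormedAddCommGroup F] [NormedSpace ℝ F] {V : M → Type*}
    [TopologicalSpace (TotalSpace F V)] [∀ x, TopologicalSpace (V x)]
    [∀ x, AddCommGroup (V x)] [∀ x, Module ℝ (V x)]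
    [FiberBundle F V] [VectorBundle ℝ F V] [ContMDiffVectorBundle ∞ F V I] (z : M) (v : F) :
    ∃ s : ∀ y, V y, ContMDiff I (I.prod 𝓘(ℝ, F)) ∞ (fun y ↦ (⟨y, s y⟩ : TotalSpace F V)) ∧
      ∀ᶠ y in 𝓝 z, s y = (trivializationAt F V z).symmL ℝ y v := by
  let e := trivializationAt F V z
  have hz : z ∈ e.baseSet := mem_baseSet_trivializationAt F V z
  have hs : ContMDiffOn I (I.prod 𝓘(ℝ, F)) ∞ (fun y ↦ (⟨y, e.symmL ℝ y v⟩ : TotalSpace F V))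
      e.baseSet := by
    rw [e.contMDiffOn_section_baseSet_iff]
    refine (contMDiffOn_const (c := v)).congr fun y hy ↦ ?_
    rw [← e.continuousLinearMapAt_apply_of_mem ℝ hy, e.continuousLinearMapAt_symmL hy]
  obtain ⟨χ, -, hχ⟩ :=
    (SmoothBumpFunction.nhds_basis_tsupport (I := I) z).mem_iff.1 (e.open_baseSet.mem_nhds hz)
  refine ⟨(χ : M → ℝ) • fun y ↦ e.symmL ℝ y v, ContMDiffOn.smul_section_of_tsupport
    χ.contMDiff.contMDiffOn e.open_baseSet hχ hs, ?_⟩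
  filter_upwards [χ.eventuallyEq_one] with y hy
  simp [hy, e]

/-- Every tangent vector is the value of a smooth vector field. -/
lemma exists_field_eq [FiniteDimensional ℝ E] [T2Space M] [IsManifold I ∞ M]
    (z : M) (v : TangentSpace I z) :
    ∃ V : ∀ y : M, TangentSpace I y, IsSmoothField I V ∧ V z = v := by
  let e := trivializationAt E (TangentSpace I) z
  obtain ⟨V, hV, hVz⟩ := exists_contMDiff_section_eventuallyEq (I := I) (V := TangentSpace I) z
    (e.continuousLinearMapAt ℝ z v)
  refine ⟨V, hV, hVz.self_of_nhds.trans ?_⟩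
  exact e.symmL_continuousLinearMapAt (mem_baseSet_trivializationAt E (TangentSpace I) z) v

/-- The derivative of a smooth function along a smooth vector field along a map is smooth. -/
lemma ContMDiffAt.diff_apply [IsManifold I ∞ M] {g : N → M} {V : ∀ t, TangentSpace I (g t)} {t : N}
    {f : M → ℝ} (hf : IsSmoothFun I f)
    (hV : ContMDiffAt I' I.tangent ∞ (fun t ↦ (⟨g t, V t⟩ : TangentBundle I M)) t) :
    ContMDiffAt I' 𝓘(ℝ, ℝ) ∞ (fun t ↦ diff I f (g t) (V t)) t := by
  have h1 : ContMDiff I.tangent 𝓘(ℝ, ℝ).tangent ∞ (tangentMap I 𝓘(ℝ, ℝ) f) :=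
    hf.contMDiff_tangentMap (by simp)
  have h2 := (h1.contMDiffAt (x := ⟨g t, V t⟩)).comp t hV
  exact (contMDiff_snd_tangentBundle_modelSpace ℝ 𝓘(ℝ, ℝ)).contMDiffAt.comp t h2

lemma IsSmoothField.diff_apply [IsManifold I ∞ M] {V : ∀ z : M, TangentSpace I z}
    (hV : IsSmoothField I V) {f : M → ℝ} (hf : IsSmoothFun I f) :
    IsSmoothFun I fun z ↦ diff I f z (V z) :=
  fun z ↦ ContMDiffAt.diff_apply (g := id) hf (hV z)

/-- The pairing of a covector field along a map with a vector field along the same map. -/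
lemma ContMDiffAt.covector_apply [IsManifold I ∞ M] {g : N → M}
    {α : ∀ t, TangentSpace I (g t) →L[ℝ] ℝ} {V : ∀ t, TangentSpace I (g t)} {t : N}
    (hα : ContMDiffAt I' (cotangentModel I) ∞ (fun t ↦ (⟨g t, α t⟩ : CotangentBundle I M)) t)
    (hV : ContMDiffAt I' I.tangent ∞ (fun t ↦ (⟨g t, V t⟩ : TangentBundle I M)) t) :
    ContMDiffAt I' 𝓘(ℝ, ℝ) ∞ (fun t ↦ α t (V t)) t := by
  have h := ContMDiffAt.clm_bundle_apply (F₁ := E) (F₂ := ℝ) (E₁ := (TangentSpace I : M → Type _))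
    (E₂ := Bundle.Trivial M ℝ) (b := g) (v := V) (ϕ := α) hα hV
  rw [contMDiffAt_totalSpace] at h
  exact h.2

/-- A vector field along a map is smooth if it is so when tested on functions whose differentials
exhaust the cotangent space. -/
lemma contMDiffAt_field_of_diff [FiniteDimensional ℝ E] [IsManifold I ∞ M] {g : N → M}
    {V : ∀ t, TangentSpace I (g t)} {t₀ : N} (hg : ContMDiffAt I' I ∞ g t₀) (G : Set (M → ℝ))
    (hG : ∀ u ∈ G, IsSmoothFun I u) (hspan : ∀ α, ∃ u ∈ G, diff I u (g t₀) = α)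
    (hV : ∀ u ∈ G, ContMDiffAt I' 𝓘(ℝ, ℝ) ∞ (fun t ↦ diff I u (g t) (V t)) t₀) :
    ContMDiffAt I' I.tangent ∞ (fun t ↦ (⟨g t, V t⟩ : TangentBundle I M)) t₀ := by
  have : CompleteSpace E := FiniteDimensional.complete ℝ E
  set e := trivializationAt E (TangentSpace I) (g t₀) with he
  have hmem : g t₀ ∈ e.baseSet := mem_baseSet_trivializationAt E (TangentSpace I) (g t₀)
  let b := finBasis ℝ E
  let B : E ≃L[ℝ] (Fin (finrank ℝ E) → ℝ) := b.equivFunL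
  -- These finitely many test functions have at `g t₀` the coordinate coframe of the trivialization
  -- as differentials. Their joint differential `A` stays invertible nearby, and `V` is recovered
  -- from the tested values by the inverse of `A`.
  choose u huG hu using fun i ↦ hspan (((ContinuousLinearMap.proj i).comp
    (B : E →L[ℝ] (Fin (finrank ℝ E) → ℝ))).comp (e.continuousLinearMapAt ℝ (g t₀)))
  let U : M → (Fin (finrank ℝ E) → ℝ) := fun z i ↦ u i z
  have hU : ContMDiff I 𝓘(ℝ, Fin (finrank ℝ E) → ℝ) ∞ U :=
    contMDiff_pi_space.2 fun i ↦ hG _ (huG i)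
  have hUi : ∀ z (v : TangentSpace I z) i, mfderiv I 𝓘(ℝ, Fin (finrank ℝ E) → ℝ) U z v i =
      diff I (u i) z v := by
    intro z v i
    exact (diff_clm_comp (ContinuousLinearMap.proj (R := ℝ)
      (φ := fun _ : Fin (finrank ℝ E) ↦ ℝ) i) (hU.mdifferentiableAt (by simp)) v).symm
  let A : M → E →L[ℝ] (Fin (finrank ℝ E) → ℝ) := fun z ↦
    (mfderiv I 𝓘(ℝ, Fin (finrank ℝ E) → ℝ) U z).comp (e.symmL ℝ z)
  have hA : ContMDiffAt I 𝓘(ℝ, E →L[ℝ] (Fin (finrank ℝ E) → ℝ)) ∞ A (g t₀) := by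
    refine (ContMDiffAt.mfderiv_const (hU.contMDiffAt (x := g t₀)) (m := ∞)
      (by simp)).congr_of_eventuallyEq (.of_forall fun z ↦ ?_)
    ext v i
    simp only [inTangentCoordinates, ContinuousLinearMap.inCoordinates, A, he,
      TangentBundle.continuousLinearMapAt_model_space]
    rfl
  have hA0 : A (g t₀) = B := by
    ext v i
    refine (hUi _ _ _).trans ?_
    rw [hu]
    change B (e.continuousLinearMapAt ℝ (g t₀) (e.symmL ℝ (g t₀) v)) i = _
    rw [e.continuousLinearMapAt_symmL hmem]; rfl
  have hAg := hA.comp t₀ hg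
  have hinv : ContMDiffAt I' 𝓘(ℝ, (Fin (finrank ℝ E) → ℝ) →L[ℝ] E) ∞
      (fun t ↦ (A (g t)).inverse) t₀ := by
    have h1 : ContDiffAt ℝ ∞ ContinuousLinearMap.inverse (A (g t₀)) := by
      rw [hA0]; exact contDiffAt_map_inverse B
    exact h1.contMDiffAt.comp t₀ hAg
  have hw : ContMDiffAt I' 𝓘(ℝ, Fin (finrank ℝ E) → ℝ) ∞
      (fun t i ↦ diff I (u i) (g t) (V t)) t₀ := contMDiffAt_pi_space.2 fun i ↦ hV _ (huG i)
  rw [contMDiffAt_totalSpace]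
  refine ⟨hg, (hinv.clm_apply hw).congr_of_eventuallyEq ?_⟩
  have h2 : ∀ᶠ t in 𝓝 t₀, g t ∈ e.baseSet :=
    hg.continuousAt.eventually (e.open_baseSet.mem_nhds hmem)
  have h3 : ∀ᶠ t in 𝓝 t₀, A (g t) ∈ range (ContinuousLinearEquiv.toContinuousLinearMap
      (σ₁₂ := RingHom.id ℝ) (M₁ := E) (M₂ := Fin (finrank ℝ E) → ℝ)) :=
    hAg.continuousAt.eventually (ContinuousLinearEquiv.isOpen.mem_nhds ⟨B, hA0.symm⟩)
  filter_upwards [h2, h3] with t ht ⟨C, hC⟩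
  have h4 : (fun i ↦ diff I (u i) (g t) (V t)) = A (g t) (e.continuousLinearMapAt ℝ (g t) (V t)) := by
    ext i
    refine (hUi _ _ _).symm.trans ?_
    change _ = mfderiv I 𝓘(ℝ, Fin (finrank ℝ E) → ℝ) U (g t)
      (e.symmL ℝ (g t) (e.continuousLinearMapAt ℝ (g t) (V t))) i
    rw [e.symmL_continuousLinearMapAt ht]
  rw [h4, ← hC, ContinuousLinearMap.inverse_equiv]
  change _ = C.symm (C _)
  rw [C.symm_apply_apply, e.continuousLinearMapAt_apply_of_mem ℝ ht]

/-- A covector field along a map is smooth if it is so when tested on smooth vector fields. -/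
lemma contMDiffAt_covector_of_apply [FiniteDimensional ℝ E] [T2Space M] [IsManifold I ∞ M]
    {g : N → M} {α : ∀ t, TangentSpace I (g t) →L[ℝ] ℝ} {t₀ : N}
    (hg : ContMDiffAt I' I ∞ g t₀)
    (hα : ∀ V : ∀ z : M, TangentSpace I z, IsSmoothField I V →
      ContMDiffAt I' 𝓘(ℝ, ℝ) ∞ (fun t ↦ α t (V (g t))) t₀) :
    ContMDiffAt I' (cotangentModel I) ∞ (fun t ↦ (⟨g t, α t⟩ : CotangentBundle I M)) t₀ := by
  set e := trivializationAt E (TangentSpace I) (g t₀) with he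
  have hmem : g t₀ ∈ e.baseSet := mem_baseSet_trivializationAt E (TangentSpace I) (g t₀)
  let b := finBasis ℝ E
  choose V hV hVb using fun i ↦
    exists_contMDiff_section_eventuallyEq (I := I) (V := TangentSpace I) (g t₀) (b i)
  rw [contMDiffAt_hom_bundle]
  refine ⟨hg, ?_⟩
  have h1 : ContMDiffAt I' 𝓘(ℝ, E →L[ℝ] ℝ) ∞ (fun t ↦ ∑ i, α t (V i (g t)) •
      LinearMap.toContinuousLinearMap (b.coord i)) t₀ :=
    ContMDiffAt.sum fun i _ ↦ (hα _ (hV i)).smul contMDiffAt_const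
  refine h1.congr_of_eventuallyEq ?_
  have h2 : ∀ᶠ t in 𝓝 t₀, ∀ i, V i (g t) = e.symmL ℝ (g t) (b i) :=
    hg.continuousAt.eventually (eventually_all.2 hVb)
  filter_upwards [h2] with t ht
  refine ContinuousLinearMap.coe_injective (b.ext fun k ↦ ?_)
  have h3 : (∑ i, α t (V i (g t)) • LinearMap.toContinuousLinearMap (b.coord i)) (b k) =
      α t (e.symmL ℝ (g t) (b k)) := by
    rw [_root_.sum_apply, Finset.sum_eq_single k]
    · simp [ht]
    · intro i _ hi
      simp [hi.symm]
    · simp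
  refine .trans ?_ h3.symm
  simp [ContinuousLinearMap.inCoordinates, he]
end Calculus

/-! ### The Lie bracket as a commutator of derivations -/

section Commutator

variable {E H M : Type*} [NormedAddCommGroup E] [NormedSpace ℝ E] [TopologicalSpace H]
  {I : ModelWithCorners ℝ E H} [TopologicalSpace M] [ChartedSpace H M]

/-- This transports derivations to the model space, where the commutator formula is available.
Without boundary `range I` is everything, so derivatives within it are ordinary ones. -/
lemma fderiv_comp_extChartAt_symm [IsManifold I ∞ M] [I.Boundaryless] {f : M → ℝ} {x : M} {y : E}
    (hy : y ∈ (extChartAt I x).target)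
    (hf : MDifferentiableAt I 𝓘(ℝ, ℝ) f ((extChartAt I x).symm y))
    (V : ∀ z : M, TangentSpace I z) :
    fderiv ℝ (f ∘ (extChartAt I x).symm) y
      (VectorField.mpullbackWithin 𝓘(ℝ, E) I (extChartAt I x).symm V (range I) y) =
      diff I f ((extChartAt I x).symm y) (V ((extChartAt I x).symm y)) := by
  have h1 : MDifferentiableAt 𝓘(ℝ, E) I (extChartAt I x).symm y :=
    (mdifferentiableWithinAt_extChartAt_symm hy).mdifferentiableAt (by simp [I.range_eq_univ])
  have h2 := isInvertible_mfderivWithin_extChartAt_symm (I := I) hy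
  have h3 := diff_comp (z := y) hf h1
    (VectorField.mpullbackWithin 𝓘(ℝ, E) I (extChartAt I x).symm V (range I) y)
  rw [← mfderiv_eq_fderiv]
  refine h3.trans (congrArg _ ?_)
  rw [VectorField.mpullbackWithin_apply, ← mfderivWithin_univ, ← I.range_eq_univ]
  exact h2.self_apply_inverse _

/-- The Lie bracket of vector fields acts on functions as the commutator. -/
lemma diff_mlieBracket [FiniteDimensional ℝ E] [IsManifold I ∞ M] [I.Boundaryless]
    {f : M → ℝ} {V W : ∀ z : M, TangentSpace I z} {z : M} (hf : IsSmoothFun I f)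
    (hV : IsSmoothField I V) (hW : IsSmoothField I W) :
    diff I f z (VectorField.mlieBracket I V W z) =
      diff I (fun y ↦ diff I f y (W y)) z (V z) - diff I (fun y ↦ diff I f y (V y)) z (W z) := by
  have : CompleteSpace E := FiniteDimensional.complete ℝ E
  set φ := extChartAt I z with hφ
  have hz : φ z ∈ φ.target := mem_extChartAt_target z
  have hzz : φ.symm (φ z) = z := extChartAt_to_inv z
  set V' := VectorField.mpullbackWithin 𝓘(ℝ, E) I φ.symm V (range I) with hV'
  set W' := VectorField.mpullbackWithin 𝓘(ℝ, E) I φ.symm W (range I) with hW'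
  have dV : DifferentiableAt ℝ V' (φ z) := by
    have := (hV.mdifferentiableAt (x := z) (by simp)).mdifferentiableWithinAt
      (s := univ) |>.differentiableWithinAt_mpullbackWithin_vectorField
    rw [preimage_univ, univ_inter] at this
    exact this.differentiableAt (by simp [I.range_eq_univ])
  have dW : DifferentiableAt ℝ W' (φ z) := by
    have := (hW.mdifferentiableAt (x := z) (by simp)).mdifferentiableWithinAt
      (s := univ) |>.differentiableWithinAt_mpullbackWithin_vectorField
    rw [preimage_univ, univ_inter] at this
    exact this.differentiableAt (by simp [I.range_eq_univ])
  have hfs : ContDiffAt ℝ ∞ (f ∘ φ.symm) (φ z) := by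
    have h1 : ContMDiffAt 𝓘(ℝ, E) I ∞ φ.symm (φ z) :=
      (contMDiffOn_extChartAt_symm z).contMDiffAt ((isOpen_extChartAt_target z).mem_nhds hz)
    exact (hf.contMDiffAt.comp _ h1).contDiffAt
  -- The formula in the model space; it needs two derivatives of `f`. What remains is to pull each
  -- of its terms back through the chart.
  have key := VectorField.fderiv_apply_lieBracket hfs
    (by rw [minSmoothness_of_isRCLikeNormedField]; exact WithTop.coe_le_coe.2 (le_top : (2 : ℕ∞) ≤ ⊤)) dW dV
  have ht : ∀ᶠ y in 𝓝 (φ z), y ∈ φ.target := (isOpen_extChartAt_target z).mem_nhds hz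
  have e1 : (fun y ↦ fderiv ℝ (f ∘ φ.symm) y (W' y)) =ᶠ[𝓝 (φ z)]
      (fun y ↦ diff I f y (W y)) ∘ φ.symm := by
    filter_upwards [ht] with y hy using fderiv_comp_extChartAt_symm hy (hf.mdiff _) W
  have e2 : (fun y ↦ fderiv ℝ (f ∘ φ.symm) y (V' y)) =ᶠ[𝓝 (φ z)]
      (fun y ↦ diff I f y (V y)) ∘ φ.symm := by
    filter_upwards [ht] with y hy using fderiv_comp_extChartAt_symm hy (hf.mdiff _) V
  rw [e1.fderiv_eq, e2.fderiv_eq, fderiv_comp_extChartAt_symm hz ((hW.diff_apply hf).mdiff _) V,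
    fderiv_comp_extChartAt_symm hz ((hV.diff_apply hf).mdiff _) W, hzz] at key
  rw [← key]
  have h5 := fderiv_comp_extChartAt_symm (I := I) hz (hf.mdiff _) (VectorField.mlieBracket I V W)
  rw [hzz] at h5
  rw [← h5]
  have h6 := VectorField.mfderiv_extChartAt_inverse_comp_mfderivWithin_extChartAT_symm (I := I)
    (x := z) (VectorField.mlieBracket I V W z)
  have h7 : VectorField.mlieBracket I V W z =
      (mfderiv I 𝓘(ℝ, E) φ z).inverse (VectorField.lieBracket ℝ (E := E) V' W' (φ z)) := by
    rw [VectorField.mlieBracket, VectorField.mlieBracketWithin_apply, preimage_univ, univ_inter]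
    refine congrArg (mfderiv I 𝓘(ℝ, E) φ z).inverse ?_
    change VectorField.lieBracketWithin ℝ (E := E) V' W' (range I) (φ z) = _
    rw [I.range_eq_univ]
    exact congrFun (VectorField.lieBracketWithin_univ (V := V') (W := W')) _
  have h8 := isInvertible_mfderiv_extChartAt (I := I) (mem_extChartAt_source (I := I) z)
  have h9 : Function.Injective (mfderiv I 𝓘(ℝ, E) φ z).inverse := by
    obtain ⟨e, he⟩ := h8
    rw [hφ, ← he, ContinuousLinearMap.inverse_equiv]
    exact e.symm.injective
  congr 1
  rw [VectorField.mpullbackWithin_apply]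
  apply h9
  rw [← h7]
  refine .trans ?_ h6
  exact congrArg (fun w ↦ (mfderiv I 𝓘(ℝ, E) φ z).inverse
    ((mfderivWithin 𝓘(ℝ, E) I φ.symm (range I) (φ z)).inverse
      (show E from VectorField.mlieBracket I V W w))) hzz

/-- If a covector field and a vector field both vanish at a point, then so does the differential
of their pairing. -/
lemma diff_covector_apply_eq_zero [FiniteDimensional ℝ E] [T2Space M] [IsManifold I ∞ M]
    {α : ∀ z : M, TangentSpace I z →L[ℝ] ℝ} {V : ∀ z : M, TangentSpace I z} {z : M}
    (hα : IsSmoothForm I α) (hV : IsSmoothField I V) (hα0 : α z = 0) (hV0 : V z = 0) :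
    diff I (fun y ↦ α y (V y)) z = 0 := by
  set e := trivializationAt E (TangentSpace I) z with he
  have hmem : z ∈ e.baseSet := mem_baseSet_trivializationAt E (TangentSpace I) z
  have h1 := (contMDiffAt_hom_bundle _).1 (hα z) |>.2
  have h2 := contMDiffAt_totalSpace.1 (hV z) |>.2
  have h3 := h1.mdifferentiableAt (by simp) |>.prodMk_space (h2.mdifferentiableAt (by simp))
  -- The evaluation pairing is bilinear, so its derivative at the origin is zero, and in coordinates
  -- both arguments are zero at `z`.
  have h4 : HasFDerivAt (fun p : (E →L[ℝ] ℝ) × E ↦ p.1 p.2)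
      (0 : (E →L[ℝ] ℝ) × E →L[ℝ] ℝ) (0, 0) := by
    refine ((hasFDerivAt_fst (𝕜 := ℝ)).clm_apply (hasFDerivAt_snd (𝕜 := ℝ))).congr_fderiv ?_
    ext <;> simp
  set G : M → (E →L[ℝ] ℝ) × E := fun y ↦ (ContinuousLinearMap.inCoordinates E (TangentSpace I) ℝ
    (Bundle.Trivial M ℝ) z y z y (α y), (e ⟨y, V y⟩).2) with hGdef
  have hG0 : G z = (0, 0) := by
    refine Prod.ext ?_ ?_
    · ext u
      simp only [hGdef, hα0]
      simp [ContinuousLinearMap.inCoordinates]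
    · simp only [hGdef]
      rw [hV0, ← e.continuousLinearMapAt_apply_of_mem ℝ hmem, map_zero]
  have hG : MDifferentiableAt I 𝓘(ℝ, (E →L[ℝ] ℝ) × E) G z := h3
  rw [← hG0] at h4
  have h6 : (fun y ↦ α y (V y)) =ᶠ[𝓝 z] fun y ↦ (fun p : (E →L[ℝ] ℝ) × E ↦ p.1 p.2) (G y) := by
    filter_upwards [e.open_baseSet.mem_nhds hmem] with y hy
    simp only [hGdef, ContinuousLinearMap.inCoordinates]
    rw [← e.continuousLinearMapAt_apply_of_mem ℝ hy]
    refine (congrArg (α y) (e.symmL_continuousLinearMapAt (R := ℝ) hy (V y)).symm).trans ?_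
    simp [← he]
  rw [diff_congr h6]
  ext v
  have h5 := diff_comp (I' := 𝓘(ℝ, (E →L[ℝ] ℝ) × E)) (f := fun p : (E →L[ℝ] ℝ) × E ↦ p.1 p.2)
    (z := z) h4.differentiableAt.mdifferentiableAt hG v
  refine h5.trans ?_
  have h7 : diff 𝓘(ℝ, (E →L[ℝ] ℝ) × E) (fun p : (E →L[ℝ] ℝ) × E ↦ p.1 p.2) (G z) = 0 :=
    (mfderiv_eq_fderiv).trans h4.fderiv
  rw [h7]
  rfl
end Commutator

/-! ### Inverse function theorem on manifolds -/

section Inverse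

variable {E H M : Type*} [NormedAddCommGroup E] [NormedSpace ℝ E] [TopologicalSpace H]
  {I : ModelWithCorners ℝ E H} [TopologicalSpace M] [ChartedSpace H M]
  {E' H' N : Type*} [NormedAddCommGroup E'] [NormedSpace ℝ E'] [TopologicalSpace H']
  {I' : ModelWithCorners ℝ E' H'} [TopologicalSpace N] [ChartedSpace H' N]

/-- The inverse function theorem for maps from a manifold to a vector space. -/
lemma exists_local_inverse [FiniteDimensional ℝ E] [IsManifold I ∞ M] [I.Boundaryless]
    [FiniteDimensional ℝ E'] {f : M → E'} {x : M}
    (hf : ∀ᶠ y in 𝓝 x, ContMDiffAt I 𝓘(ℝ, E') ∞ f y) (hb : Function.Bijective (mfderiv I 𝓘(ℝ, E') f x)) :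
    ∃ g : E' → M, (∀ᶠ y in 𝓝 (f x), ContMDiffAt 𝓘(ℝ, E') I ∞ g y) ∧ g (f x) = x ∧
      (∀ᶠ y in 𝓝 x, g (f y) = y) ∧ ∀ᶠ y in 𝓝 (f x), f (g y) = y := by
  have : CompleteSpace E := FiniteDimensional.complete ℝ E
  set φ := extChartAt I x with hφ
  have hz : φ x ∈ φ.target := mem_extChartAt_target x
  have hzz : φ.symm (φ x) = x := extChartAt_to_inv x
  have h1 : ContMDiffAt 𝓘(ℝ, E) I ∞ φ.symm (φ x) :=
    (contMDiffOn_extChartAt_symm x).contMDiffAt ((isOpen_extChartAt_target x).mem_nhds hz)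
  have hFe : ∀ᶠ y in 𝓝 (φ x), ContDiffAt ℝ ∞ (f ∘ φ.symm) y := by
    have h2 : Tendsto φ.symm (𝓝 (φ x)) (𝓝 x) := by simpa [hzz] using h1.continuousAt.tendsto
    filter_upwards [h2.eventually hf, (isOpen_extChartAt_target x).mem_nhds hz] with y hy hy'
    exact (hy.comp y ((contMDiffOn_extChartAt_symm x).contMDiffAt
      ((isOpen_extChartAt_target x).mem_nhds hy'))).contDiffAt
  have hF := hFe.self_of_nhds
  replace hf := hf.self_of_nhds
  have hD : mfderiv I 𝓘(ℝ, E') f x = fderiv ℝ (f ∘ φ.symm) (φ x) := by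
    rw [(hf.mdifferentiableAt (by simp)).mfderiv, I.range_eq_univ, fderivWithin_univ]
    rfl
  rw [hD] at hb
  let L : E ≃L[ℝ] E' := (LinearEquiv.ofBijective
    (fderiv ℝ (f ∘ φ.symm) (φ x)).toLinearMap hb).toContinuousLinearEquiv
  have hL : HasFDerivAt (f ∘ φ.symm) (L : E →L[ℝ] E') (φ x) :=
    (hF.differentiableAt (by simp)).hasFDerivAt
  let Φ := hF.toOpenPartialHomeomorph (f ∘ φ.symm) hL (by simp)
  have hΦ : (Φ : E → E') = f ∘ φ.symm := rfl
  have hmem : φ x ∈ Φ.source := hF.mem_toOpenPartialHomeomorph_source hL (by simp)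
  have hfx : f x = Φ (φ x) := by rw [hΦ, Function.comp_apply, hzz]
  have hsm : ContDiffAt ℝ ∞ Φ.symm (f x) := by
    have := hF.to_localInverse hL (by simp)
    rw [Function.comp_apply, hzz] at this
    exact this
  have hinv : Φ.symm (f x) = φ x := by rw [hfx]; exact Φ.left_inv hmem
  have hft : f x ∈ Φ.target := by rw [hfx]; exact Φ.map_source hmem
  refine ⟨fun y ↦ φ.symm (Φ.symm y), ?_, by simp only; rw [hinv, hzz], ?_, ?_⟩
  -- Smoothness of the inverse is wanted on a neighbourhood and not only at `f x`; invertibility of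
  -- the derivative is an open condition.
  · have h2 : ∀ᶠ y in 𝓝 (f x), ContDiffAt ℝ ∞ Φ.symm y := by
      have h3 : ∀ᶠ y in 𝓝 (φ x), fderiv ℝ (f ∘ φ.symm) y ∈
          range (ContinuousLinearEquiv.toContinuousLinearMap
            (σ₁₂ := RingHom.id ℝ) (M₁ := E) (M₂ := E')) :=
        (hF.continuousAt_fderiv (by simp)).eventually
          (ContinuousLinearEquiv.isOpen.mem_nhds ⟨L, hL.fderiv.symm⟩)
      have h4 : Tendsto Φ.symm (𝓝 (f x)) (𝓝 (φ x)) := by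
        simpa [hinv] using hsm.continuousAt.tendsto
      filter_upwards [h4.eventually (h3.and hFe), Φ.open_target.mem_nhds hft]
        with y ⟨⟨C, hC⟩, hy⟩ hy'
      refine Φ.contDiffAt_symm hy' (f₀' := C) ?_ hy
      rw [hC]
      exact (hy.differentiableAt (by simp)).hasFDerivAt
    have h3 : ∀ᶠ y in 𝓝 (f x), Φ.symm y ∈ φ.target :=
      hsm.continuousAt.eventually (by rw [hinv]; exact (isOpen_extChartAt_target x).mem_nhds hz)
    filter_upwards [h2, h3] with y hy hy'
    exact ((contMDiffOn_extChartAt_symm x).contMDiffAt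
      ((isOpen_extChartAt_target x).mem_nhds hy')).comp y hy.contMDiffAt
  · have h2 : ∀ᶠ y in 𝓝 x, φ y ∈ Φ.source :=
      (continuousAt_extChartAt x).eventually (Φ.open_source.mem_nhds hmem)
    filter_upwards [h2, extChartAt_source_mem_nhds (I := I) x] with y hy hy'
    have h3 : f y = Φ (φ y) := by rw [hΦ, Function.comp_apply, φ.left_inv hy']
    rw [h3, Φ.left_inv hy, φ.left_inv hy']
  · filter_upwards [Φ.open_target.mem_nhds hft] with y hy
    exact Φ.right_inv hy

/-- An immersion has local smooth left inverses. -/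
lemma exists_local_left_inverse [FiniteDimensional ℝ E] [IsManifold I ∞ M] [I.Boundaryless]
    [FiniteDimensional ℝ E'] [IsManifold I' ∞ N] {j : M → N} (hj : ContMDiff I I' ∞ j) {x : M}
    (hi : Function.Injective (mfderiv I I' j x)) :
    ∃ r : N → M, (∀ᶠ y in 𝓝 (j x), ContMDiffAt I' I ∞ r y) ∧ r (j x) = x ∧
      ∀ᶠ y in 𝓝 x, r (j y) = y := by
  let D : E →L[ℝ] E' := mfderiv I I' j x
  -- A linear left inverse of the differential, applied in a chart of `N`, turns `j` into a local
  -- diffeomorphism at `x`, whose inverse completes the left inverse.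
  obtain ⟨l, hl⟩ := LinearMap.exists_leftInverse_of_injective D.toLinearMap
    (LinearMap.ker_eq_bot.2 hi)
  let ℓ : E' →L[ℝ] E := LinearMap.toContinuousLinearMap l
  set φ := extChartAt I' (j x) with hφ
  have hφs : ∀ᶠ y in 𝓝 (j x), ContMDiffAt I' 𝓘(ℝ, E') ∞ φ y := by
    filter_upwards [chart_source_mem_nhds H' (j x)] with y hy using contMDiffAt_extChartAt' hy
  have hℓ : ∀ᶠ y in 𝓝 (j x), ContMDiffAt I' 𝓘(ℝ, E) ∞ (fun y ↦ ℓ (φ y)) y := by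
    filter_upwards [hφs] with y hy using ℓ.contMDiff.contMDiffAt.comp y hy
  have hf : ∀ᶠ y in 𝓝 x, ContMDiffAt I 𝓘(ℝ, E) ∞ (fun y ↦ ℓ (φ (j y))) y := by
    filter_upwards [hj.continuous.continuousAt.eventually hℓ] with y hy
    exact hy.comp (I' := I') y hj.contMDiffAt
  have hD : mfderiv I 𝓘(ℝ, E) (fun y ↦ ℓ (φ (j y))) x = ContinuousLinearMap.id ℝ E := by
    have h1 : mfderiv I 𝓘(ℝ, E) (fun y ↦ ℓ (φ (j y))) x =
        (mfderiv I' 𝓘(ℝ, E) (fun y ↦ ℓ (φ y)) (j x)).comp (mfderiv I I' j x) :=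
      mfderiv_comp x (hℓ.self_of_nhds.mdifferentiableAt (by simp))
        (hj.mdifferentiableAt (by simp))
    have h2 : mfderiv I' 𝓘(ℝ, E) (fun y ↦ ℓ (φ y)) (j x) =
        (mfderiv 𝓘(ℝ, E') 𝓘(ℝ, E) ℓ (φ (j x))).comp (mfderiv I' 𝓘(ℝ, E') φ (j x)) :=
      mfderiv_comp (j x) (ℓ.contMDiff (n := ∞) |>.mdifferentiableAt (by simp))
        (hφs.self_of_nhds.mdifferentiableAt (by simp))
    have h3 : mfderiv I' 𝓘(ℝ, E') φ (j x) = ContinuousLinearMap.id ℝ E' := mfderiv_extChartAt_self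
    rw [h1, h2, h3, ℓ.mfderiv_eq]
    ext v
    exact congrArg (fun T : E →ₗ[ℝ] E ↦ T v) hl
  obtain ⟨τ, hτ, hτx, hτl, -⟩ := exists_local_inverse hf
    (by rw [hD]; exact Function.bijective_id)
  refine ⟨fun y ↦ τ (ℓ (φ y)), ?_, hτx, hτl⟩
  filter_upwards [hℓ, hℓ.self_of_nhds.continuousAt.eventually hτ] with y hy hy'
  exact hy'.comp y hy

/-- A smooth bijection with injective differentials between manifolds of the same dimension is a
diffeomorphism. -/
lemma exists_diffeomorph [FiniteDimensional ℝ E] [IsManifold I ∞ M] [I.Boundaryless]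
    [FiniteDimensional ℝ E'] [IsManifold I' ∞ N] {f : M → N} (hf : ContMDiff I I' ∞ f)
    (hb : Function.Bijective f) (hi : ∀ x, Function.Injective (mfderiv I I' f x))
    (hd : finrank ℝ E = finrank ℝ E') :
    ∃ Φ : Diffeomorph I I' M N ∞, ∀ x, Φ x = f x := by
  let e := Equiv.ofBijective f hb
  refine ⟨⟨e, hf, fun y ↦ ?_⟩, fun x ↦ rfl⟩
  obtain ⟨x, rfl⟩ := hb.2 y
  have hex : e.symm (f x) = x := e.symm_apply_apply x
  set φ := extChartAt I' (f x) with hφ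
  have hφs : ∀ᶠ y in 𝓝 (f x), ContMDiffAt I' 𝓘(ℝ, E') ∞ φ y := by
    filter_upwards [chart_source_mem_nhds H' (f x)] with y hy using contMDiffAt_extChartAt' hy
  have hF : ∀ᶠ y in 𝓝 x, ContMDiffAt I 𝓘(ℝ, E') ∞ (fun y ↦ φ (f y)) y := by
    filter_upwards [hf.continuous.continuousAt.eventually hφs] with y hy
    exact hy.comp (I' := I') y hf.contMDiffAt
  have hD : mfderiv I 𝓘(ℝ, E') (fun y ↦ φ (f y)) x = mfderiv I I' f x := by
    have h1 : mfderiv I 𝓘(ℝ, E') (fun y ↦ φ (f y)) x =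
        (mfderiv I' 𝓘(ℝ, E') φ (f x)).comp (mfderiv I I' f x) :=
      mfderiv_comp x (hφs.self_of_nhds.mdifferentiableAt (by simp))
        (hf.mdifferentiableAt (by simp))
    have h3 : mfderiv I' 𝓘(ℝ, E') φ (f x) = ContinuousLinearMap.id ℝ E' := mfderiv_extChartAt_self
    rw [h1, h3]
    rfl
  have hDb : Function.Bijective (mfderiv I 𝓘(ℝ, E') (fun y ↦ φ (f y)) x) := by
    rw [hD]
    let D : E →ₗ[ℝ] E' := (show E →L[ℝ] E' from mfderiv I I' f x).toLinearMap
    exact ⟨hi x, (LinearMap.injective_iff_surjective_of_finrank_eq_finrank hd (f := D)).1 (hi x)⟩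
  obtain ⟨g, hg, hgx, -, hgr⟩ := exists_local_inverse hF hDb
  have hgs : ContMDiffAt I' I ∞ (fun y ↦ g (φ y)) (f x) :=
    hg.self_of_nhds.comp (f x) hφs.self_of_nhds
  -- By injectivity of `f` the set-theoretic inverse agrees near `f x` with the smooth local
  -- inverse.
  refine hgs.congr_of_eventuallyEq ?_
  have hφc : ContinuousAt φ (f x) := hφs.self_of_nhds.continuousAt
  have h1 : Tendsto (fun y ↦ f (g (φ y))) (𝓝 (f x)) (𝓝 (f x)) := by
    have := hf.continuous.continuousAt.comp (x := f x) hgs.continuousAt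
    have h2 : Tendsto (fun y ↦ f (g (φ y))) (𝓝 (f x)) (𝓝 (f (g (φ (f x))))) := this
    rwa [hgx] at h2
  filter_upwards [hφc.eventually hgr, h1.eventually (extChartAt_source_mem_nhds (I := I') (f x)),
    extChartAt_source_mem_nhds (I := I') (f x)] with y hy hy' hy''
  refine e.injective ?_
  refine (e.apply_symm_apply y).trans ?_
  exact (φ.injOn hy' hy'' hy).symm
end Inverse

/-! ### Quotient bundles: annihilator sections and their fibrewise linear functions, for `E_X` and
`L_X` alike -/

section CokerBundle

variable {EX HX X : Type*} [NormedAddCommGroup EX] [NormedSpace ℝ EX] [TopologicalSpace HX]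
  [TopologicalSpace X] [ChartedSpace HX X]
  {EA HA A : Type*} [NormedAddCommGroup EA] [NormedSpace ℝ EA] [TopologicalSpace HA]
  [TopologicalSpace A] [ChartedSpace HA A]
  {EZ HZ Z : Type*} [NormedAddCommGroup EZ] [NormedSpace ℝ EZ] [TopologicalSpace HZ]
  [TopologicalSpace Z] [ChartedSpace HZ Z]
  {IX : ModelWithCorners ℝ EX HX} {IA : ModelWithCorners ℝ EA HA}
  {IZ : ModelWithCorners ℝ EZ HZ} [IsManifold IA ∞ A] [IsManifold IZ ∞ Z]
  {g : X → A} {f : X → Z} {φ : TangentMono IX IA IZ g f}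

/-- The smooth sections of the annihilator of the image of `φ` in `f^*(T^*Z)`. -/
@[ext]
structure AnnSection (φ : TangentMono IX IA IZ g f) where
  toFun : ∀ x, TangentSpace IZ (f x) →L[ℝ] ℝ
  map_eq_zero : ∀ x u, toFun x (φ.map x u) = 0
  smooth : ContMDiff IX (cotangentModel IZ) ∞ fun x ↦ (⟨f x, toFun x⟩ : CotangentBundle IZ Z)

namespace AnnSection

/-- The fibrewise linear function defined by a section of the annihilator. -/
def bar (σ : AnnSection φ) (t : φ.Total) : ℝ :=
  φ.desc (σ.toFun t.1).toLinearMap (σ.map_eq_zero t.1) t.2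

@[simp] lemma bar_cls (σ : AnnSection φ) (x : X) (v : TangentSpace IZ (f x)) :
    σ.bar ⟨x, φ.cls x v⟩ = σ.toFun x v := φ.desc_cls _ _ _

lemma bar_add_smul (σ : AnnSection φ) (x : X) (a b : φ.Coker x) (s : ℝ) :
    σ.bar ⟨x, a + s • b⟩ = σ.bar ⟨x, a⟩ + s * σ.bar ⟨x, b⟩ := by
  simp [bar]

lemma bar_smul (σ : AnnSection φ) (x : X) (b : φ.Coker x) (s : ℝ) :
    σ.bar ⟨x, s • b⟩ = s * σ.bar ⟨x, b⟩ := by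
  simp [bar]

lemma bar_zero (σ : AnnSection φ) (x : X) : σ.bar ⟨x, 0⟩ = 0 := by
  simp [bar]

lemma apply_field (σ : AnnSection φ) {V : ∀ z : Z, TangentSpace IZ z} (hV : IsSmoothField IZ V) :
    IsSmoothFun IX fun x ↦ σ.toFun x (V (f x)) := fun x ↦
  ContMDiffAt.covector_apply (σ.smooth x) ((hV (f x)).comp x (φ.contMDiff_cod x))

section mk

variable [FiniteDimensional ℝ EZ] [T2Space Z]

/-- Smoothness of a section of the annihilator may be tested on vector fields. -/
def ofApply (s : ∀ x, TangentSpace IZ (f x) →L[ℝ] ℝ) (h0 : ∀ x u, s x (φ.map x u) = 0)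
    (hs : ∀ V : ∀ z : Z, TangentSpace IZ z, IsSmoothField IZ V →
      IsSmoothFun IX fun x ↦ s x (V (f x))) : AnnSection φ where
  toFun := s
  map_eq_zero := h0
  smooth x := contMDiffAt_covector_of_apply (φ.contMDiff_cod x) fun V hV ↦ hs V hV x

/-- The combination `h σ + τ`. -/
def smulAdd {h : X → ℝ} (hh : IsSmoothFun IX h) (σ τ : AnnSection φ) : AnnSection φ :=
  ofApply (fun x ↦ h x • σ.toFun x + τ.toFun x)
    (fun x u ↦ by simp [σ.map_eq_zero, τ.map_eq_zero]) fun V hV ↦ by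
      exact (hh.mul (σ.apply_field hV)).add (τ.apply_field hV)

@[simp] lemma smulAdd_toFun {h : X → ℝ} (hh : IsSmoothFun IX h) (σ τ : AnnSection φ) (x : X) :
    (smulAdd hh σ τ).toFun x = h x • σ.toFun x + τ.toFun x := rfl

lemma smulAdd_bar {h : X → ℝ} (hh : IsSmoothFun IX h) (σ τ : AnnSection φ) (t : φ.Total) :
    (smulAdd hh σ τ).bar t = h t.1 * σ.bar t + τ.bar t := by
  obtain ⟨x, q⟩ := t
  obtain ⟨v, rfl⟩ := φ.cls_surjective x q
  simp

/-- The zero section of the annihilator. -/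
def zero : AnnSection φ :=
  ofApply (fun _ ↦ 0) (fun _ _ ↦ rfl) fun _ _ ↦ contMDiff_const

@[simp] lemma zero_toFun (x : X) : (zero : AnnSection φ).toFun x = 0 := rfl

lemma zero_bar (t : φ.Total) : (zero : AnnSection φ).bar t = 0 := by
  obtain ⟨x, q⟩ := t
  obtain ⟨v, rfl⟩ := φ.cls_surjective x q
  simp

end mk

end AnnSection

variable [FiniteDimensional ℝ EA] [FiniteDimensional ℝ EZ]

namespace TangentMono

lemma eventually_dom (x₀ : X) : ∀ᶠ x in 𝓝 x₀, x ∈ φ.dom x₀ :=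
  (φ.isOpen_dom x₀).mem_nhds (φ.mem_dom x₀)

lemma continuous_proj : Continuous (fun t : φ.Total ↦ t.1) :=
  FiberBundle.continuous_proj (CokerModel EA EZ) φ.Coker

lemma contMDiff_proj : ContMDiff (IX.prod 𝓘(ℝ, CokerModel EA EZ)) IX ∞ (fun t : φ.Total ↦ t.1) :=
  Bundle.contMDiff_proj φ.Coker

lemma _root_.IsSmoothFun.comp_proj {h : X → ℝ} (hh : IsSmoothFun IX h) :
    IsSmoothFun (IX.prod 𝓘(ℝ, CokerModel EA EZ)) (fun t : φ.Total ↦ h t.1) :=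
  hh.comp φ.contMDiff_proj

lemma contMDiffAt_fibTriv (t₀ : φ.Total) :
    ContMDiffAt (IX.prod 𝓘(ℝ, CokerModel EA EZ)) 𝓘(ℝ, CokerModel EA EZ) ∞
      (fun t : φ.Total ↦ φ.fibTriv t₀.1 t.1 t.2) t₀ :=
  (contMDiffAt_totalSpace (f := fun t : φ.Total ↦ t)).1 contMDiffAt_id |>.2

end TangentMono

namespace AnnSection

/-- A class is represented by a vector of the chosen complement. In the trivialization `σ̄` is thus
the pairing of a smooth covector with a smooth vector. -/
lemma bar_eq_fibTriv (σ : AnnSection φ) {x₀ : X} {t : φ.Total} (ht : t.1 ∈ φ.dom x₀) :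
    σ.bar t = σ.toFun t.1 ((φ.trivZ x₀).symmL ℝ (f t.1)
      (φ.sec x₀ (φ.fibTriv x₀ t.1 t.2))) := by
  obtain ⟨x, q⟩ := t
  have h : φ.fibSymm x₀ x (φ.fibTriv x₀ x q) = q := φ.fibSymm_fibTriv ht q
  conv_lhs => rw [← h]
  exact φ.desc_cls _ _ _

lemma smooth_bar (σ : AnnSection φ) : IsSmoothFun (IX.prod 𝓘(ℝ, CokerModel EA EZ)) σ.bar := by
  intro t₀
  have h1 := ((contMDiffAt_hom_bundle _).1 (σ.smooth t₀.1)).2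
  have h2 : ContMDiffAt (IX.prod 𝓘(ℝ, CokerModel EA EZ)) 𝓘(ℝ, EZ →L[ℝ] ℝ) ∞
      (fun t : φ.Total ↦ ContinuousLinearMap.inCoordinates EZ (TangentSpace IZ) ℝ
        (Bundle.Trivial Z ℝ) (f t₀.1) (f t.1) (f t₀.1) (f t.1) (σ.toFun t.1)) t₀ :=
    ContMDiffAt.comp (g := fun x ↦ ContinuousLinearMap.inCoordinates EZ (TangentSpace IZ) ℝ
        (Bundle.Trivial Z ℝ) (f t₀.1) (f x) (f t₀.1) (f x) (σ.toFun x)) t₀ h1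
      (φ.contMDiff_proj t₀)
  have h3 := h2.clm_apply ((φ.sec t₀.1).contMDiff.contMDiffAt.comp t₀ (φ.contMDiffAt_fibTriv t₀))
  refine h3.congr_of_eventuallyEq ?_
  filter_upwards [φ.continuous_proj.continuousAt.eventually (φ.eventually_dom t₀.1)] with t ht
  rw [σ.bar_eq_fibTriv ht]
  simp [ContinuousLinearMap.inCoordinates]

variable [IsManifold IX ∞ X]

/-- Local frames of the annihilator. -/
lemma exists_eq_fibTriv [FiniteDimensional ℝ EX] [T2Space X] [T2Space Z] (x₀ : X)
    (c : CokerModel EA EZ →L[ℝ] ℝ) :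
    ∃ σ : AnnSection φ, ∀ᶠ x in 𝓝 x₀, x ∈ φ.dom x₀ ∧
      ∀ v, σ.toFun x v = c (φ.fibTriv x₀ x (φ.cls x v)) := by
  -- The fibre coordinates are meaningful only on `dom x₀`; the cut-off removes them elsewhere.
  obtain ⟨χ, -, hχ⟩ := (SmoothBumpFunction.nhds_basis_tsupport (I := IX) x₀).mem_iff.1
    (φ.eventually_dom x₀)
  refine ⟨ofApply (fun x ↦ χ x • (c.comp (φ.cproj x₀ x)).comp
    ((φ.trivZ x₀).continuousLinearMapAt ℝ (f x))) ?_ ?_, ?_⟩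
  · intro x u
    by_cases hx : x ∈ φ.dom x₀
    · have h := φ.fibTriv_cls hx (φ.map x u)
      rw [φ.cls_eq_zero.2 ⟨u, rfl⟩, map_zero] at h
      exact (congrArg (fun w ↦ χ x • c w) h.symm).trans (by rw [map_zero, smul_zero])
    · have : χ x = 0 := image_eq_zero_of_notMem_tsupport fun h ↦ hx (hχ h)
      rw [this, zero_smul]; rfl
  · intro V hV
    have h0 : (fun x ↦ (χ x • (c.comp (φ.cproj x₀ x)).comp
        ((φ.trivZ x₀).continuousLinearMapAt ℝ (f x))) (V (f x))) = fun x ↦ χ x •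
        c (φ.cproj x₀ x ((φ.trivZ x₀).continuousLinearMapAt ℝ (f x) (V (f x)))) := rfl
    rw [h0]
    refine contMDiff_of_tsupport fun x hx ↦ ?_
    have hx' : x ∈ φ.dom x₀ := hχ (closure_mono (Function.support_smul_subset_left _ _) hx)
    have h1 : ContMDiffAt IZ 𝓘(ℝ, EZ) ∞ (fun z ↦ (φ.trivZ x₀ ⟨z, V z⟩).2) (f x) :=
      ((φ.trivZ x₀).contMDiffAt_section_iff hx'.1.2).1 (hV (f x))
    have h2 : ContMDiffAt IX 𝓘(ℝ, EZ) ∞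
        (fun x ↦ (φ.trivZ x₀).continuousLinearMapAt ℝ (f x) (V (f x))) x := by
      refine (h1.comp x (φ.contMDiff_cod x)).congr_of_eventuallyEq ?_
      filter_upwards [(φ.isOpen_dom x₀).mem_nhds hx'] with y hy
      exact (φ.trivZ x₀).continuousLinearMapAt_apply_of_mem ℝ hy.1.2 _
    have h3 := ((φ.contMDiffOn_cproj x₀).contMDiffAt ((φ.isOpen_dom x₀).mem_nhds hx')).clm_apply h2
    exact χ.contMDiffAt.smul (c.contMDiff.contMDiffAt.comp x h3)
  · filter_upwards [φ.eventually_dom x₀, χ.eventuallyEq_one] with x hx hx'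
    refine ⟨hx, fun v ↦ ?_⟩
    rw [φ.fibTriv_cls hx]
    change χ x • c _ = _
    rw [hx', Pi.one_apply, one_smul]
    rfl

/-- Every covector which kills the subbundle is the value of a section of the annihilator. -/
lemma exists_toFun_eq [FiniteDimensional ℝ EX] [T2Space X] [T2Space Z] (x₀ : X)
    (β : TangentSpace IZ (f x₀) →L[ℝ] ℝ) (hβ : ∀ u, β (φ.map x₀ u) = 0) :
    ∃ σ : AnnSection φ, σ.toFun x₀ = β := by
  obtain ⟨σ, hσ⟩ := exists_eq_fibTriv (φ := φ) x₀
    ((β.comp ((φ.trivZ x₀).symmL ℝ (f x₀))).comp (φ.sec x₀))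
  refine ⟨σ, ?_⟩
  obtain ⟨hx, hσ⟩ := hσ.self_of_nhds
  ext v
  rw [hσ]
  have h := φ.fibSymm_fibTriv hx (φ.cls x₀ v)
  change φ.cls x₀ ((φ.trivZ x₀).symmL ℝ (f x₀) (φ.sec x₀ _)) = φ.cls x₀ v at h
  rw [← sub_eq_zero, ← map_sub, φ.cls_eq_zero] at h
  obtain ⟨u, hu⟩ := h
  have h2 := hβ u
  rw [hu, map_sub, sub_eq_zero] at h2
  exact h2

end AnnSection

namespace TangentMono

variable [IsManifold IX ∞ X] [FiniteDimensional ℝ EX] [T2Space X] [T2Space Z]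

/-- The differentials of the functions `σ̄ + h ∘ π` exhaust the cotangent spaces of the quotient
bundle. -/
lemma exists_diff_eq_bar (t : φ.Total)
    (α : TangentSpace (IX.prod 𝓘(ℝ, CokerModel EA EZ)) t →L[ℝ] ℝ) :
    ∃ (σ : AnnSection φ) (h : X → ℝ), IsSmoothFun IX h ∧
      diff (IX.prod 𝓘(ℝ, CokerModel EA EZ)) (fun t ↦ σ.bar t + h t.1) t = α := by
  let a : EX × CokerModel EA EZ →L[ℝ] ℝ := α
  obtain ⟨q, hq, hqe⟩ := exists_contMDiff_eq_extChartAt (I := IX) t.1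
  obtain ⟨σ, hσ⟩ := AnnSection.exists_eq_fibTriv (φ := φ) t.1
    (a.comp (ContinuousLinearMap.inr ℝ EX (CokerModel EA EZ)))
  refine ⟨σ, fun x ↦ a (q x, 0), ?_, ?_⟩
  · exact (a.comp (ContinuousLinearMap.inl ℝ EX (CokerModel EA EZ))).contMDiff.comp hq
  -- A covector at `t`, read in the chart at `t`, splits into a fibre part, realized by `σ̄`, and a
  -- base part, realized by `h`.
  · have h1 : (fun s : φ.Total ↦ σ.bar s + a (q s.1, 0)) =ᶠ[𝓝 t]
        fun s ↦ a (extChartAt (IX.prod 𝓘(ℝ, CokerModel EA EZ)) t s) := by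
      filter_upwards [φ.continuous_proj.continuousAt.eventually hqe,
        φ.continuous_proj.continuousAt.eventually hσ] with s hs1 hs2
      obtain ⟨x, b⟩ := s
      obtain ⟨v, rfl⟩ := φ.cls_surjective x b
      have h2 : extChartAt (IX.prod 𝓘(ℝ, CokerModel EA EZ)) t ⟨x, φ.cls x v⟩ =
          (extChartAt IX t.1 x, φ.fibTriv t.1 x (φ.cls x v)) := by
        rw [FiberBundle.extChartAt]
        rfl
      rw [h2, σ.bar_cls, hs2.2 v]
      simp only at hs1
      rw [hs1]
      change a (0, _) + a (_, 0) = _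
      rw [← map_add]
      simp
    rw [diff_congr h1]
    ext v
    have h3 : MDifferentiableAt (IX.prod 𝓘(ℝ, CokerModel EA EZ)) 𝓘(ℝ, EX × CokerModel EA EZ)
        (extChartAt (IX.prod 𝓘(ℝ, CokerModel EA EZ)) t) t :=
      (contMDiffAt_extChartAt (n := ∞)).mdifferentiableAt (by simp)
    refine (diff_clm_comp a h3 v).trans ?_
    have h4 : mfderiv (IX.prod 𝓘(ℝ, CokerModel EA EZ)) 𝓘(ℝ, EX × CokerModel EA EZ)
      (extChartAt (IX.prod 𝓘(ℝ, CokerModel EA EZ)) t) t = ContinuousLinearMap.id ℝ _ :=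
        mfderiv_extChartAt_self
    rw [h4]
    rfl

/-- Maps into the quotient bundle are smooth if they are so after composition with the projection
and the fibrewise linear functions. -/
lemma contMDiffAt_of_bar {EN HN N : Type*} [NormedAddCommGroup EN] [NormedSpace ℝ EN]
    [TopologicalSpace HN] {IN : ModelWithCorners ℝ EN HN} [TopologicalSpace N] [ChartedSpace HN N]
    {Ψ : N → φ.Total} {m : N} (h1 : ContMDiffAt IN IX ∞ (fun m ↦ (Ψ m).1) m)
    (h2 : ∀ σ : AnnSection φ, ContMDiffAt IN 𝓘(ℝ, ℝ) ∞ (fun m ↦ σ.bar (Ψ m)) m) :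
    ContMDiffAt IN (IX.prod 𝓘(ℝ, CokerModel EA EZ)) ∞ Ψ m := by
  rw [contMDiffAt_totalSpace]
  refine ⟨h1, contMDiffAt_pi_space.2 fun i ↦ ?_⟩
  obtain ⟨σ, hσ⟩ := AnnSection.exists_eq_fibTriv (φ := φ) (Ψ m).1
    (ContinuousLinearMap.proj (R := ℝ) (φ := fun _ ↦ ℝ) i)
  refine (h2 σ).congr_of_eventuallyEq ?_
  filter_upwards [h1.continuousAt.eventually hσ] with m' hm'
  generalize Ψ m' = s at hm' ⊢
  obtain ⟨x, b⟩ := s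
  obtain ⟨v, rfl⟩ := φ.cls_surjective x b
  rw [σ.bar_cls, hm'.2 v]
  rfl

/-- The fibre coordinates over `x` are values of annihilator sections, so these separate the points
of the fibre. -/
lemma ext_bar {t t' : φ.Total} (h1 : t.1 = t'.1) (h2 : ∀ σ : AnnSection φ, σ.bar t = σ.bar t') :
    t = t' := by
  obtain ⟨x, b⟩ := t
  obtain ⟨x', b'⟩ := t'
  obtain rfl : x = x' := h1
  obtain ⟨v, rfl⟩ := φ.cls_surjective x b
  obtain ⟨v', rfl⟩ := φ.cls_surjective x b'
  congr 1
  have h3 : φ.fibTriv x x (φ.cls x v) = φ.fibTriv x x (φ.cls x v') := by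
    ext i
    obtain ⟨σ, hσ⟩ := AnnSection.exists_eq_fibTriv (φ := φ) x
      (ContinuousLinearMap.proj (R := ℝ) (φ := fun _ ↦ ℝ) i)
    have h4 := h2 σ
    rw [σ.bar_cls, σ.bar_cls, hσ.self_of_nhds.2, hσ.self_of_nhds.2] at h4
    exact h4
  have h5 := congrArg (φ.fibSymm x x) h3
  rwa [φ.fibSymm_fibTriv (φ.mem_dom x), φ.fibSymm_fibTriv (φ.mem_dom x)] at h5

/-- The base point and all the linear functions together map the total space injectively and
continuously to a Hausdorff space. -/
instance : T2Space φ.Total := by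
  refine T2Space.of_injective_continuous
    (f := fun t : φ.Total ↦ (t.1, fun σ : AnnSection φ ↦ σ.bar t)) ?_ ?_
  · intro t t' h
    exact ext_bar (congrArg Prod.fst h) fun σ ↦ congrFun (congrArg Prod.snd h) σ
  · exact φ.continuous_proj.prodMk (continuous_pi fun σ ↦ σ.smooth_bar.continuous)

/-- The differentials of `σ̄` and `h ∘ π` separate tangent vectors. -/
lemma vector_ext {t : φ.Total} {v w : TangentSpace (IX.prod 𝓘(ℝ, CokerModel EA EZ)) t}
    (h1 : ∀ σ : AnnSection φ, diff (IX.prod 𝓘(ℝ, CokerModel EA EZ)) σ.bar t v =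
      diff (IX.prod 𝓘(ℝ, CokerModel EA EZ)) σ.bar t w)
    (h2 : ∀ h : X → ℝ, IsSmoothFun IX h →
      diff (IX.prod 𝓘(ℝ, CokerModel EA EZ)) (fun t : φ.Total ↦ h t.1) t v =
      diff (IX.prod 𝓘(ℝ, CokerModel EA EZ)) (fun t : φ.Total ↦ h t.1) t w) : v = w := by
  by_contra hne
  obtain ⟨α, hα⟩ := SeparatingDual.exists_separating_of_ne (R := ℝ) (V := EX × CokerModel EA EZ) hne
  obtain ⟨σ, h, hh, hσ⟩ := φ.exists_diff_eq_bar t α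
  rw [diff_add (σ.smooth_bar.mdiff t) (hh.comp_proj.mdiff t)] at hσ
  apply hα
  have h3 := congrArg (fun T : EX × CokerModel EA EZ →L[ℝ] ℝ ↦ T v) hσ
  have h4 := congrArg (fun T : EX × CokerModel EA EZ →L[ℝ] ℝ ↦ T w) hσ
  refine h3.symm.trans (Eq.trans ?_ h4)
  exact congrArg₂ (· + ·) (h1 σ) (h2 h hh)

lemma contMDiff_line (x : X) (a b : φ.Coker x) :
    ContMDiff 𝓘(ℝ, ℝ) (IX.prod 𝓘(ℝ, CokerModel EA EZ)) ∞
      (fun s : ℝ ↦ (⟨x, a + s • b⟩ : φ.Total)) := by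
  refine fun s ↦ contMDiffAt_of_bar contMDiffAt_const fun σ ↦ ?_
  simp only [σ.bar_add_smul]
  exact (contMDiff_const.add (contMDiff_id.mul contMDiff_const)).contMDiffAt

end TangentMono

lemma diff_mfderiv_curve {E H M : Type*} [NormedAddCommGroup E] [NormedSpace ℝ E]
    [TopologicalSpace H] {I : ModelWithCorners ℝ E H} [TopologicalSpace M] [ChartedSpace H M]
    {u : M → ℝ} (hu : IsSmoothFun I u) {c : ℝ → M} (hc : ContMDiff 𝓘(ℝ, ℝ) I ∞ c) (s : ℝ) :
    diff I u (c s) (mfderiv 𝓘(ℝ, ℝ) I c s (1 : ℝ)) = deriv (fun s ↦ u (c s)) s := by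
  refine (diff_comp (hu.mdiff _) (hc.mdifferentiableAt (x := s) (by simp)) (1 : ℝ)).symm.trans ?_
  rw [diff, mfderiv_eq_fderiv]
  change fderiv ℝ (fun s ↦ u (c s)) s (1 : ℝ) = _
  exact fderiv_apply_one_eq_deriv

namespace TangentMono

variable [IsManifold IX ∞ X] [FiniteDimensional ℝ EX] [T2Space X] [T2Space Z]

/-- The vertical tangent vector at `t` given by an element of the fibre. -/
def vertAt (t : φ.Total) (b : φ.Coker t.1) : TangentSpace (IX.prod 𝓘(ℝ, CokerModel EA EZ)) t :=
  (mfderiv 𝓘(ℝ, ℝ) (IX.prod 𝓘(ℝ, CokerModel EA EZ))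
    (fun s : ℝ ↦ (⟨t.1, t.2 + s • b⟩ : φ.Total)) 0 (1 : ℝ) : EX × CokerModel EA EZ)

lemma diff_vertAt {u : φ.Total → ℝ} (hu : IsSmoothFun (IX.prod 𝓘(ℝ, CokerModel EA EZ)) u)
    (t : φ.Total) (b : φ.Coker t.1) : diff (IX.prod 𝓘(ℝ, CokerModel EA EZ)) u t (vertAt t b) =
      deriv (fun s : ℝ ↦ u ⟨t.1, t.2 + s • b⟩) 0 := by
  obtain ⟨x, a⟩ := t
  have h := diff_mfderiv_curve hu (φ.contMDiff_line x a b) 0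
  have h0 : (⟨x, a + (0 : ℝ) • b⟩ : φ.Total) = ⟨x, a⟩ := by rw [zero_smul, add_zero]
  exact (congrArg (fun p : φ.Total ↦ diff (IX.prod 𝓘(ℝ, CokerModel EA EZ)) u p
    (vertAt ⟨x, a⟩ b : EX × CokerModel EA EZ)) h0).symm.trans h

lemma diff_bar_vertAt (σ : AnnSection φ) (t : φ.Total) (b : φ.Coker t.1) :
    diff (IX.prod 𝓘(ℝ, CokerModel EA EZ)) σ.bar t (vertAt t b) = σ.bar ⟨t.1, b⟩ := by
  rw [diff_vertAt σ.smooth_bar]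
  simp only [σ.bar_add_smul]
  simp

lemma diff_proj_vertAt {h : X → ℝ} (hh : IsSmoothFun IX h) (t : φ.Total) (b : φ.Coker t.1) :
    diff (IX.prod 𝓘(ℝ, CokerModel EA EZ)) (fun t : φ.Total ↦ h t.1) t (vertAt t b) = 0 := by
  rw [diff_vertAt (u := fun t : φ.Total ↦ h t.1) (hh.comp_proj)]
  simp

lemma diff_bar_smulAdd {h : X → ℝ} (hh : IsSmoothFun IX h) (σ τ : AnnSection φ) (t : φ.Total) :
    diff (IX.prod 𝓘(ℝ, CokerModel EA EZ)) (AnnSection.smulAdd hh σ τ).bar t =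
      h t.1 • diff (IX.prod 𝓘(ℝ, CokerModel EA EZ)) σ.bar t + σ.bar t •
      diff (IX.prod 𝓘(ℝ, CokerModel EA EZ)) (fun t : φ.Total ↦ h t.1) t +
      diff (IX.prod 𝓘(ℝ, CokerModel EA EZ)) τ.bar t := by
  have h1 : IsSmoothFun (IX.prod 𝓘(ℝ, CokerModel EA EZ)) (fun t : φ.Total ↦ h t.1) := hh.comp_proj
  have h2 : IsSmoothFun (IX.prod 𝓘(ℝ, CokerModel EA EZ)) (fun t : φ.Total ↦ h t.1 * σ.bar t) :=
    h1.mul σ.smooth_bar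
  have h0 : (AnnSection.smulAdd hh σ τ).bar = fun t ↦ h t.1 * σ.bar t + τ.bar t :=
    funext fun t ↦ AnnSection.smulAdd_bar hh σ τ t
  rw [h0, diff_add (h2.mdiff t) (τ.smooth_bar.mdiff t),
    diff_mul (h1.mdiff t) (σ.smooth_bar.mdiff t)]

/-- The differential of a smooth function on the base. -/
lemma diff_proj {h : X → ℝ} (hh : IsSmoothFun IX h) (t : φ.Total)
    (v : TangentSpace (IX.prod 𝓘(ℝ, CokerModel EA EZ)) t) :
    diff (IX.prod 𝓘(ℝ, CokerModel EA EZ)) (fun t : φ.Total ↦ h t.1) t v =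
      diff IX h t.1 (mfderiv (IX.prod 𝓘(ℝ, CokerModel EA EZ)) IX (fun t : φ.Total ↦ t.1) t v) :=
  diff_comp (hh.mdiff _) (φ.contMDiff_proj.mdifferentiableAt (by simp)) v

/-- The differential of a fibrewise linear function at a point where the section vanishes. -/
lemma diff_section_comp {s : X → φ.Total} (hs : ContMDiff IX (IX.prod 𝓘(ℝ, CokerModel EA EZ)) ∞ s)
    {u : φ.Total → ℝ} (hu : IsSmoothFun (IX.prod 𝓘(ℝ, CokerModel EA EZ)) u) (x : X)
    (v : TangentSpace IX x) : diff (IX.prod 𝓘(ℝ, CokerModel EA EZ)) u (s x)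
      (mfderiv IX (IX.prod 𝓘(ℝ, CokerModel EA EZ)) s x v) = diff IX (fun y ↦ u (s y)) x v :=
  (diff_comp (hu.mdiff _) (hs.mdifferentiableAt (by simp)) v).symm

end TangentMono

end CokerBundle

/-! ### Poisson structures from generators; tests on generators -/

section PoissonBasics

variable {E H M : Type*} [NormedAddCommGroup E] [NormedSpace ℝ E] [TopologicalSpace H]
  {I : ModelWithCorners ℝ E H} [TopologicalSpace M] [ChartedSpace H M]
  {E' H' N : Type*} [NormedAddCommGroup E'] [NormedSpace ℝ E'] [TopologicalSpace H']
  {I' : ModelWithCorners ℝ E' H'} [TopologicalSpace N] [ChartedSpace H' N]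

lemma tangent_ext [FiniteDimensional ℝ E] {z : M} {v w : TangentSpace I z}
    (h : ∀ α : TangentSpace I z →L[ℝ] ℝ, α v = α w) : v = w := by
  by_contra hne
  obtain ⟨α, hα⟩ := SeparatingDual.exists_separating_of_ne (R := ℝ) (V := E) hne
  exact hα (h α)

section Generators

variable [FiniteDimensional ℝ E] [T2Space M] [IsManifold I ∞ M] [I.Boundaryless]

/-- The smoothness axiom speaks of brackets of functions only; as the differentials of smooth
functions fill the cotangent spaces, it controls the whole Hamiltonian field. -/
lemma isSmoothField_of_sharp
    {sharp : ∀ z : M, (TangentSpace I z →L[ℝ] ℝ) →ₗ[ℝ] TangentSpace I z}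
    (smooth : ∀ f g : M → ℝ, IsSmoothFun I f → IsSmoothFun I g →
      IsSmoothFun I fun z ↦ diff I f z (sharp z (diff I g z)))
    {f : M → ℝ} (hf : IsSmoothFun I f) : IsSmoothField I fun z ↦ sharp z (diff I f z) := fun z ↦
  contMDiffAt_field_of_diff (g := id) contMDiffAt_id {u | IsSmoothFun I u} (fun _ h ↦ h)
    (fun α ↦ by simpa using exists_diff_eq (I := I) z α) fun u hu ↦ smooth u f hu hf z

/-- The Jacobiator of a bivector field is a differential operator of order one in its last
argument. -/
lemma jacobiator_congr {sharp : ∀ z : M, (TangentSpace I z →L[ℝ] ℝ) →ₗ[ℝ] TangentSpace I z}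
    (skew : ∀ z (α β : TangentSpace I z →L[ℝ] ℝ), α (sharp z β) = -β (sharp z α))
    (smooth : ∀ f g : M → ℝ, IsSmoothFun I f → IsSmoothFun I g →
      IsSmoothFun I fun z ↦ diff I f z (sharp z (diff I g z)))
    {br : (M → ℝ) → (M → ℝ) → M → ℝ} (hbr : br = fun f g z ↦ diff I f z (sharp z (diff I g z)))
    {f g h h' : M → ℝ} (hf : IsSmoothFun I f) (hg : IsSmoothFun I g)
    (hh : IsSmoothFun I h) (hh' : IsSmoothFun I h') {z : M} (hd : diff I h z = diff I h' z) :
    br f (br g h) z + br g (br h f) z + br h (br f g) z =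
      br f (br g h') z + br g (br h' f) z + br h' (br f g) z := by
  -- By skewness the Jacobiator is `dh` applied to `[X_f, X_g] + X_{f, g}`, where the last field is
  -- that of the bracket; the second derivatives of `h` cancel in the commutator.
  have key : ∀ h, IsSmoothFun I h → br f (br g h) z + br g (br h f) z + br h (br f g) z =
      diff I h z (VectorField.mlieBracket I (fun z ↦ sharp z (diff I f z))
        (fun z ↦ sharp z (diff I g z)) z + sharp z (diff I (br f g) z)) := by
    intro h hh
    have hs := diff_mlieBracket (z := z) hh (isSmoothField_of_sharp smooth hf)
      (isSmoothField_of_sharp smooth hg)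
    have e1 : br f (br g h) z = diff I (br h g) z (sharp z (diff I f z)) := by
      have h1 : br g h = fun y ↦ - br h g y := by
        subst hbr; exact funext fun y ↦ skew _ _ _
      rw [h1, hbr]
      simp only
      rw [diff_neg, map_neg, map_neg, skew, neg_neg]
    have e2 : br g (br h f) z = - diff I (br h f) z (sharp z (diff I g z)) := by
      nth_rewrite 1 [hbr]
      exact skew _ _ _
    rw [map_add, hs, e1, e2, hbr]
    simp only
    ring
  rw [key h hh, key h' hh', hd]

/-- A Poisson structure is determined by brackets of functions whose differentials exhaust the
cotangent spaces, and exists if these brackets satisfy the axioms. -/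
theorem exists_poissonStructure_of_generators {W : Type*} (fn : W → M → ℝ)
    (hfn : ∀ a, IsSmoothFun I (fn a)) (hspan : ∀ z α, ∃ a, diff I (fn a) z = α) (br : W → W → W)
    (hV : ∀ z b, ∃ V : TangentSpace I z, ∀ a, diff I (fn a) z V = fn (br a b) z)
    (hskew : ∀ a b z, fn (br a b) z = -fn (br b a) z)
    (hjac : ∀ a b c z, fn (br a (br b c)) z + fn (br b (br c a)) z + fn (br c (br a b)) z = 0) :
    ∃ P : PoissonStructure I M, ∀ a b, P.bracket (fn a) (fn b) = fn (br a b) := by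
  choose V hV using hV
  choose b hb using hspan
  -- Skewness shows that the pairing with a generator is linear in `β`, and that the choice of a
  -- generator with differential `β` is immaterial.
  have key : ∀ z a β, diff I (fn a) z (V z (b z β)) = -β (V z a) := by
    intro z a β
    rw [hV, hskew, ← hV, hb]
  have hext : ∀ z (v w : TangentSpace I z), (∀ a, diff I (fn a) z v = diff I (fn a) z w) →
      v = w := by
    intro z v w h
    refine tangent_ext fun α ↦ ?_
    have := h (b z α)
    rwa [hb] at this
  let sharp : ∀ z : M, (TangentSpace I z →L[ℝ] ℝ) →ₗ[ℝ] TangentSpace I z := fun z ↦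
    { toFun := fun β ↦ V z (b z β)
      map_add' := fun β γ ↦ hext z _ _ fun a ↦ by
        rw [map_add, key, key, key, add_apply, neg_add]
      map_smul' := fun c β ↦ hext z _ _ fun a ↦ by
        rw [map_smul, key, key, RingHom.id_apply]
        simp }
  have hsharp : ∀ z a, sharp z (diff I (fn a) z) = V z a := fun z a ↦ hext z _ _ fun c ↦ by
    refine (key z c _).trans ?_
    rw [hV, ← hskew, hV]
  have hgen : ∀ a c z, diff I (fn a) z (sharp z (diff I (fn c) z)) = fn (br a c) z := by
    intro a c z
    rw [hsharp, hV]
  have skew : ∀ z (α β : TangentSpace I z →L[ℝ] ℝ), α (sharp z β) = -β (sharp z α) := by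
    intro z α β
    have h1 := key z (b z α) β
    rw [hb] at h1
    exact h1
  have hW : ∀ z : M, ∀ α, ∃ u ∈ range fn, diff I u (id z) = α :=
    fun z α ↦ ⟨fn (b z α), ⟨_, rfl⟩, hb z α⟩
  have hr : ∀ u ∈ range fn, IsSmoothFun I u := by rintro _ ⟨a, rfl⟩; exact hfn a
  have h1 : ∀ c, IsSmoothField I fun z ↦ sharp z (diff I (fn c) z) := fun c z ↦
    contMDiffAt_field_of_diff (g := id) contMDiffAt_id (range fn) hr (hW z) <| by
      rintro _ ⟨a, rfl⟩
      exact ((hfn (br a c)) z).congr_of_eventuallyEq (.of_forall fun y ↦ hgen a c y)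
  have h2 : ∀ f, IsSmoothFun I f → IsSmoothField I fun z ↦ sharp z (diff I f z) := fun f hf z ↦
    contMDiffAt_field_of_diff (g := id) contMDiffAt_id (range fn) hr (hW z) <| by
      rintro _ ⟨a, rfl⟩
      exact (((h1 a).diff_apply hf).neg z).congr_of_eventuallyEq (.of_forall fun y ↦ skew y _ _)
  have smooth : ∀ f g : M → ℝ, IsSmoothFun I f → IsSmoothFun I g →
      IsSmoothFun I fun z ↦ diff I f z (sharp z (diff I g z)) :=
    fun f g hf hg ↦ (h2 g hg).diff_apply hf
  refine ⟨⟨sharp, skew, smooth, ?_⟩, fun a c ↦ funext (hgen a c)⟩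
  intro B f g h hf hg hh z
  have t := fun {f g h h' : M → ℝ} (hf : IsSmoothFun I f) (hg : IsSmoothFun I g)
    (hh : IsSmoothFun I h) (hh' : IsSmoothFun I h') (hd : diff I h z = diff I h' z) ↦
    jacobiator_congr skew smooth (br := B) rfl hf hg hh hh' hd
  have hB : ∀ a c, B (fn a) (fn c) = fn (br a c) := fun a c ↦ funext (hgen a c)
  -- The Jacobiator at `z` sees only the differential at `z` of its last argument. By cyclic
  -- symmetry each argument in turn is replaced by a generator with the same differential.
  rw [t hf hg hh (hfn (b z (diff I h z))) (hb z _).symm]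
  generalize b z (diff I h z) = c
  have e1 := t hg (hfn c) hf (hfn (b z (diff I f z))) (hb z _).symm
  generalize b z (diff I f z) = a at e1
  have e2 := t (hfn c) (hfn a) hg (hfn (b z (diff I g z))) (hb z _).symm
  generalize b z (diff I g z) = d at e2
  have e3 := hjac c a d z
  rw [hB, hB, hB, hB, hB, hB, e3] at e2
  rw [hB] at e1
  linarith

end Generators

namespace PoissonStructure

variable (P Q : PoissonStructure I M)

lemma bracket_skew (f g : M → ℝ) (z : M) : P.bracket f g z = -P.bracket g f z := P.skew z _ _

lemma smooth_bracket {f g : M → ℝ} (hf : IsSmoothFun I f) (hg : IsSmoothFun I g) :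
    IsSmoothFun I (P.bracket f g) := P.smooth f g hf hg

lemma bracket_congr {f f' g g' : M → ℝ} {z : M} (hf : diff I f z = diff I f' z)
    (hg : diff I g z = diff I g' z) : P.bracket f g z = P.bracket f' g' z := by
  rw [bracket, bracket, hf, hg]

lemma eventuallyEq_bracket {f f' g g' : M → ℝ} {z : M} (hf : f =ᶠ[𝓝 z] f') (hg : g =ᶠ[𝓝 z] g') :
    P.bracket f g =ᶠ[𝓝 z] P.bracket f' g' := by
  filter_upwards [hf.eventuallyEq_nhds, hg.eventuallyEq_nhds] with y h1 h2
  exact P.bracket_congr (diff_congr h1) (diff_congr h2)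

lemma bracket_jacobi {f g h : M → ℝ} (hf : IsSmoothFun I f) (hg : IsSmoothFun I g)
    (hh : IsSmoothFun I h) (z : M) :
    P.bracket f (P.bracket g h) z + P.bracket g (P.bracket h f) z +
      P.bracket h (P.bracket f g) z = 0 := P.jacobi f g h hf hg hh z

lemma bracket_add_left {f f' : M → ℝ} (g : M → ℝ) {z : M} (hf : IsSmoothFun I f)
    (hf' : IsSmoothFun I f') :
    P.bracket (fun y ↦ f y + f' y) g z = P.bracket f g z + P.bracket f' g z := by
  simp only [bracket]
  rw [diff_add (hf.mdiff z) (hf'.mdiff z)]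
  rfl

lemma bracket_add_right {f f' : M → ℝ} (g : M → ℝ) {z : M} (hf : IsSmoothFun I f)
    (hf' : IsSmoothFun I f') :
    P.bracket g (fun y ↦ f y + f' y) z = P.bracket g f z + P.bracket g f' z := by
  simp only [bracket]
  rw [diff_add (hf.mdiff z) (hf'.mdiff z), map_add, map_add]

lemma bracket_neg_right (f g : M → ℝ) (z : M) :
    P.bracket g (fun y ↦ -f y) z = -P.bracket g f z := by
  simp only [bracket]
  rw [diff_neg, map_neg, map_neg]

variable {P Q} in
lemma ext_of_bracket [FiniteDimensional ℝ E] (G : Set (M → ℝ))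
    (hspan : ∀ z α, ∃ u ∈ G, diff I u z = α)
    (h : ∀ u ∈ G, ∀ v ∈ G, ∀ z, P.bracket u v z = Q.bracket u v z) : P = Q := by
  apply PoissonStructure.ext
  funext z
  refine LinearMap.ext fun β ↦ tangent_ext fun α ↦ ?_
  obtain ⟨u, hu, rfl⟩ := hspan z α
  obtain ⟨v, hv, rfl⟩ := hspan z β
  exact h u hu v hv z

/-- Both sides at `z` depend only on the differentials at `Ψ z`, so test functions that realize
every covector suffice. -/
lemma isPoissonMap_of_bracket {Q : PoissonStructure I' N} {Ψ : M → N} (hΨ : ContMDiff I I' ∞ Ψ)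
    (G : Set (N → ℝ)) (hG : ∀ u ∈ G, IsSmoothFun I' u) (hspan : ∀ z α, ∃ u ∈ G, diff I' u z = α)
    (h : ∀ u ∈ G, ∀ v ∈ G, ∀ z, P.bracket (u ∘ Ψ) (v ∘ Ψ) z = Q.bracket u v (Ψ z)) :
    P.IsPoissonMap Q Ψ := by
  refine ⟨hΨ, fun f g hf hg z ↦ ?_⟩
  obtain ⟨u, hu, hfu⟩ := hspan (Ψ z) (diff I' f (Ψ z))
  obtain ⟨v, hv, hgv⟩ := hspan (Ψ z) (diff I' g (Ψ z))
  have key : ∀ {f u : N → ℝ}, IsSmoothFun I' f → IsSmoothFun I' u →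
      diff I' u (Ψ z) = diff I' f (Ψ z) → diff I (f ∘ Ψ) z = diff I (u ∘ Ψ) z := by
    intro f u hf hu hfu
    ext w
    refine (diff_comp (hf.mdiff _) (hΨ.mdifferentiableAt (by simp)) w).trans ?_
    rw [← hfu]
    exact (diff_comp (hu.mdiff _) (hΨ.mdifferentiableAt (by simp)) w).symm
  rw [P.bracket_congr (key hf (hG u hu) hfu) (key hg (hG v hv) hgv), h u hu v hv,
    Q.bracket_congr hfu hgv]

variable [FiniteDimensional ℝ E] [T2Space M] [IsManifold I ∞ M] [I.Boundaryless]

lemma isSmoothField_sharp_diff {f : M → ℝ} (hf : IsSmoothFun I f) :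
    IsSmoothField I fun z ↦ P.sharp z (diff I f z) := isSmoothField_of_sharp P.smooth hf

/-- Skewness turns `du (w♯ β)` into `-β (w♯ du)`, and the Hamiltonian field of `u` is already known
to be smooth. -/
lemma isSmoothField_sharp {β : ∀ z : M, TangentSpace I z →L[ℝ] ℝ} (hβ : IsSmoothForm I β) :
    IsSmoothField I fun z ↦ P.sharp z (β z) := fun z ↦
  contMDiffAt_field_of_diff (g := id) contMDiffAt_id {u | IsSmoothFun I u} (fun _ h ↦ h)
    (fun α ↦ by simpa using exists_diff_eq (I := I) z α) fun u hu ↦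
    (ContMDiffAt.covector_apply (g := id) (hβ z)
      (P.isSmoothField_sharp_diff hu z)).neg.congr_of_eventuallyEq
      (.of_forall fun y ↦ P.skew y _ _)

end PoissonStructure

end PoissonBasics

/-! ### Local frames, extensions and potentials along an immersion -/

section Potentials

variable {EX HX X : Type*} [NormedAddCommGroup EX] [NormedSpace ℝ EX] [TopologicalSpace HX]
  [TopologicalSpace X] [ChartedSpace HX X]
  {ES HS S : Type*} [NormedAddCommGroup ES] [NormedSpace ℝ ES] [TopologicalSpace HS]
  [TopologicalSpace S] [ChartedSpace HS S]
  {EZ HZ Z : Type*} [NormedAddCommGroup EZ] [NormedSpace ℝ EZ] [TopologicalSpace HZ]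
  [TopologicalSpace Z] [ChartedSpace HZ Z]
  {IX : ModelWithCorners ℝ EX HX} {IS : ModelWithCorners ℝ ES HS}
  {IZ : ModelWithCorners ℝ EZ HZ}
  [IsManifold IX ∞ X] [IsManifold IS ∞ S] [IsManifold IZ ∞ Z]

/-- Local coframes of differentials with their dual frames. -/
lemma exists_local_frame [FiniteDimensional ℝ EZ] [T2Space Z] (z₀ : Z) :
    ∃ (V : Fin (finrank ℝ EZ) → ∀ z : Z, TangentSpace IZ z) (e : Fin (finrank ℝ EZ) → Z → ℝ),
      (∀ i, IsSmoothField IZ (V i)) ∧ (∀ i, IsSmoothFun IZ (e i)) ∧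
      ∀ᶠ z in 𝓝 z₀, ∀ v : TangentSpace IZ z, ∑ i, diff IZ (e i) z v • V i z = v := by
  let b := finBasis ℝ EZ
  choose V hV hVb using fun i ↦
    exists_contMDiff_section_eventuallyEq (I := IZ) (V := TangentSpace IZ) z₀ (b i)
  obtain ⟨q, hq, hqe⟩ := exists_contMDiff_eq_extChartAt (I := IZ) z₀
  let B : Fin (finrank ℝ EZ) → EZ →L[ℝ] ℝ := fun i ↦ LinearMap.toContinuousLinearMap (b.coord i)
  refine ⟨V, fun i z ↦ B i (q z), hV, fun i ↦ (B i).contMDiff.comp hq, ?_⟩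
  filter_upwards [eventually_all.2 hVb, hqe.eventuallyEq_nhds, chart_source_mem_nhds HZ z₀]
    with z h1 h2 h3 v
  -- Over the domain of the chart at `z₀` the trivialization of the tangent bundle is the
  -- differential of that chart.
  have h4 : ∀ i, diff IZ (fun z ↦ B i (q z)) z v =
      b.coord i ((trivializationAt EZ (TangentSpace IZ) z₀).continuousLinearMapAt ℝ z v) := by
    intro i
    refine (diff_clm_comp (B i) (hq.mdifferentiableAt (by simp)) v).trans ?_
    rw [h2.mfderiv_eq, TangentBundle.continuousLinearMapAt_trivializationAt h3]
    rfl
  have h5 := b.sum_repr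
    ((trivializationAt EZ (TangentSpace IZ) z₀).continuousLinearMapAt ℝ z v)
  have h6 := (trivializationAt EZ (TangentSpace IZ) z₀).symmL_continuousLinearMapAt (R := ℝ)
    (by simpa using h3) v
  rw [← h6]
  conv_rhs => rw [← h5]
  rw [map_sum]
  refine Finset.sum_congr rfl fun i _ ↦ ?_
  rw [map_smul, h1 i, h6, h4 i]
  rfl

lemma diff_sum {ι : Type} [Fintype ι] {u : ι → Z → ℝ} {z : Z}
    (hu : ∀ l, MDifferentiableAt IZ 𝓘(ℝ, ℝ) (u l) z) :
    diff IZ (fun y ↦ ∑ l, u l y) z = ∑ l, diff IZ (u l) z := by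
  have h0 : ∀ l ∈ Finset.univ, HasMFDerivAt IZ 𝓘(ℝ, ℝ) (u l) z (diff IZ (u l) z) :=
    fun l _ ↦ (hu l).hasMFDerivAt
  have h := HasMFDerivAt.sum (𝕜 := ℝ) (E' := ℝ) (I := IZ) (z := z) (f := u)
    (f' := fun l ↦ diff IZ (u l) z) h0
  have h1 : (∑ l, u l) = fun y ↦ ∑ l, u l y := by ext; simp
  rw [h1] at h
  exact h.mfderiv

lemma eventually_contMDiffAt_comp {EN HN N : Type*} [NormedAddCommGroup EN] [NormedSpace ℝ EN]
    [TopologicalSpace HN] {IN : ModelWithCorners ℝ EN HN} [TopologicalSpace N] [ChartedSpace HN N]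
    {r : Z → N} {z : Z} (hr : ∀ᶠ y in 𝓝 z, ContMDiffAt IZ IN ∞ r y) {u : N → ℝ}
    (hu : IsSmoothFun IN u) : ∀ᶠ y in 𝓝 z, ContMDiffAt IZ 𝓘(ℝ, ℝ) ∞ (fun y ↦ u (r y)) y := by
  filter_upwards [hr] with y hy
  exact (hu (r y)).comp y hy

/-- Smooth functions extend locally along an immersion. -/
lemma exists_extension [FiniteDimensional ℝ EZ] [FiniteDimensional ℝ EX] [T2Space Z]
    [IX.Boundaryless] (k : SmoothImmersion IX IZ X Z) (x₀ : X) {h : X → ℝ}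
    (hh : IsSmoothFun IX h) : ∃ f : Z → ℝ, IsSmoothFun IZ f ∧ ∀ᶠ x in 𝓝 x₀, f (k x) = h x := by
  obtain ⟨r, hr, -, hrk⟩ := exists_local_left_inverse k.contMDiff (k.injective_mfderiv x₀)
  obtain ⟨f, hf, hfe⟩ := exists_contMDiff_eventuallyEq (eventually_contMDiffAt_comp hr hh)
  refine ⟨f, hf, ?_⟩
  filter_upwards [k.contMDiff.continuous.continuousAt.eventually hfe, hrk] with x h1 h2
  rw [h1, h2]

/-- A section along `X ⊆ S` of the annihilator of `TS` is locally the restriction of the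
differential of a function which vanishes on `S`. -/
lemma exists_potential [FiniteDimensional ℝ EZ] [FiniteDimensional ℝ ES] [FiniteDimensional ℝ EX]
    [T2Space Z] [IX.Boundaryless] [IS.Boundaryless] (j : SmoothImmersion IS IZ S Z) {i : X → S}
    (hi : ContMDiff IX IS ∞ i) {k : SmoothImmersion IX IZ X Z} (hk : ∀ x, k x = j (i x))
    {σ : ∀ x, TangentSpace IZ (j (i x)) →L[ℝ] ℝ}
    (hσ : ∀ V : ∀ z : Z, TangentSpace IZ z, IsSmoothField IZ V →
      IsSmoothFun IX fun x ↦ σ x (V (j (i x))))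
    (h0 : ∀ x u, σ x (mfderiv IS IZ j (i x) u) = 0) (x₀ : X) :
    ∃ F : Z → ℝ, IsSmoothFun IZ F ∧ (∀ᶠ s in 𝓝 (i x₀), F (j s) = 0) ∧
      ∀ᶠ x in 𝓝 x₀, diff IZ F (j (i x)) = σ x := by
  obtain ⟨r, hr, -, hrk⟩ := exists_local_left_inverse k.contMDiff (k.injective_mfderiv x₀)
  obtain ⟨q, hq, -, hqj⟩ := exists_local_left_inverse j.contMDiff (j.injective_mfderiv (i x₀))
  rw [hk] at hr
  obtain ⟨V, e, hV, he, hVe⟩ := exists_local_frame (IZ := IZ) (j (i x₀))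
  -- Since `q` is a left inverse of `j`, the functions `u l` vanish on `S`. `F` combines them with
  -- the values of `σ` on the frame as coefficients, so along `X` only the differentials of the `u
  -- l` survive.
  let u : Fin (finrank ℝ EZ) → Z → ℝ := fun l z ↦ e l z - e l (j (q z))
  have huj : ∀ᶠ s in 𝓝 (i x₀), ∀ l, u l (j s) = 0 := by
    filter_upwards [hqj] with s hs l
    simp only [u, hs, sub_self]
  have hu : ∀ᶠ z in 𝓝 (j (i x₀)), ∀ l, ContMDiffAt IZ 𝓘(ℝ, ℝ) ∞ (u l) z :=
    eventually_all.2 fun l ↦ by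
      filter_upwards [eventually_contMDiffAt_comp hq ((he l).comp j.contMDiff)] with z hz
      exact (he l z).sub hz
  have ha : ∀ᶠ z in 𝓝 (j (i x₀)), ∀ l, ContMDiffAt IZ 𝓘(ℝ, ℝ) ∞
      (fun z ↦ σ (r z) (V l (j (i (r z))))) z :=
    eventually_all.2 fun l ↦ eventually_contMDiffAt_comp hr (hσ _ (hV l))
  obtain ⟨F, hF, hFe⟩ := exists_contMDiff_eventuallyEq (I := IZ) (G := ℝ) (z := j (i x₀))
    (f := fun z ↦ ∑ l, σ (r z) (V l (j (i (r z)))) * u l z) (by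
      filter_upwards [hu, ha] with z h1 h2
      exact ContMDiffAt.sum fun l _ ↦ (h2 l).mul (h1 l))
  refine ⟨F, hF, ?_, ?_⟩
  · filter_upwards [j.contMDiff.continuous.continuousAt.eventually hFe, huj] with s h1 h2
    rw [h1]
    exact Finset.sum_eq_zero fun l _ ↦ by rw [h2, mul_zero]
  · have hji : ContinuousAt (fun x ↦ j (i x)) x₀ :=
      (j.contMDiff.continuous.comp hi.continuous).continuousAt
    filter_upwards [hji.eventually hFe.eventuallyEq_nhds, hrk, hji.eventually hVe,
      hi.continuous.continuousAt.eventually huj, hji.eventually hu, hji.eventually ha,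
      hi.continuous.continuousAt.eventually hqj, hji.eventually hq]
      with x h1 h2 h3 h4 h5 h6 h7 h8
    rw [hk] at h2
    ext v
    rw [diff_congr h1]
    have d1 : ∀ l, MDifferentiableAt IZ 𝓘(ℝ, ℝ) (u l) (j (i x)) :=
      fun l ↦ (h5 l).mdifferentiableAt (by simp)
    have d2 : ∀ l, MDifferentiableAt IZ 𝓘(ℝ, ℝ) (fun z ↦ σ (r z) (V l (j (i (r z))))) (j (i x)) :=
      fun l ↦ (h6 l).mdifferentiableAt (by simp)
    have e1 : diff IZ (fun z ↦ ∑ l, σ (r z) (V l (j (i (r z)))) * u l z) (j (i x)) =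
        ∑ l, σ x (V l (j (i x))) • diff IZ (u l) (j (i x)) := by
      have d3 : ∀ l, MDifferentiableAt IZ 𝓘(ℝ, ℝ)
        (fun z ↦ σ (r z) (V l (j (i (r z)))) * u l z) (j (i x)) := fun l ↦ (d2 l).mul (d1 l)
      rw [diff_sum d3]
      refine Finset.sum_congr rfl fun l _ ↦ ?_
      rw [diff_mul (d2 l) (d1 l), h4 l, zero_smul, add_zero, h2]
    -- `w` is the image of `v` under `dq`: the correction in `u l` differentiates in a direction
    -- tangent to `S`, which `σ` kills.
    obtain ⟨w, e2⟩ : ∃ w : TangentSpace IS (i x), ∀ l, diff IZ (u l) (j (i x)) v =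
        diff IZ (e l) (j (i x)) v - diff IZ (e l) (j (i x)) (mfderiv IS IZ j (i x) w) := by
      refine ⟨(mfderiv IZ IS q (j (i x)) v : ES), fun l ↦ ?_⟩
      have d3 := h8.mdifferentiableAt (by simp)
      have d4 : IsSmoothFun IS (fun s ↦ e l (j s)) := (he l).comp j.contMDiff
      have d5 : MDifferentiableAt IZ 𝓘(ℝ, ℝ) (fun z ↦ e l (j (q z))) (j (i x)) :=
        (d4.mdiff _).comp _ d3
      rw [diff_sub ((he l).mdiff _) d5]
      have h10 := diff_comp (f := fun s ↦ e l (j s)) (d4.mdiff _) d3 v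
      rw [h7] at h10
      have h11 := diff_comp (g := j) (z := i x) ((he l).mdiff _)
        (j.contMDiff.mdifferentiableAt (by simp)) (mfderiv IZ IS q (j (i x)) v : ES)
      exact congrArg (diff IZ (e l) (j (i x)) v - ·) (h10.trans h11)
    have e3 : ∀ w : TangentSpace IZ (j (i x)),
        ∑ l, σ x (V l (j (i x))) * diff IZ (e l) (j (i x)) w = σ x w := by
      intro w
      conv_rhs => rw [← h3 w, map_sum]
      exact Finset.sum_congr rfl fun l _ ↦ by rw [map_smul, smul_eq_mul, mul_comm]
    rw [e1, _root_.sum_apply]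
    refine (Finset.sum_congr rfl fun l _ ↦ (congrArg (σ x (V l (j (i x))) * ·) (e2 l))).trans ?_
    simp only [mul_sub]
    rw [Finset.sum_sub_distrib, e3, e3, h0, sub_zero]

end Potentials

/-! ### Coisotropic immersions and the bracket of conormal sections -/

section Coisotropic

variable {EX HX X : Type*} [NormedAddCommGroup EX] [NormedSpace ℝ EX] [TopologicalSpace HX]
  [TopologicalSpace X] [ChartedSpace HX X]
  {EZ HZ Z : Type*} [NormedAddCommGroup EZ] [NormedSpace ℝ EZ] [TopologicalSpace HZ]
  [TopologicalSpace Z] [ChartedSpace HZ Z]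
  {IX : ModelWithCorners ℝ EX HX} {IZ : ModelWithCorners ℝ EZ HZ}
  [IsManifold IX ∞ X] [IsManifold IZ ∞ Z]
  {P : PoissonStructure IZ Z} {k : SmoothImmersion IX IZ X Z}

namespace PoissonStructure

/-- The immersion `k` is coisotropic: `w♯` maps the conormal spaces to the tangent spaces. -/
def IsCoisotropic (P : PoissonStructure IZ Z) (k : SmoothImmersion IX IZ X Z) : Prop :=
  ∀ (x : X) (α : TangentSpace IZ (k x) →L[ℝ] ℝ), (∀ u, α (mfderiv IX IZ k x u) = 0) →
    ∃ u, mfderiv IX IZ k x u = P.sharp (k x) α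

end PoissonStructure

namespace AnnSection

lemma apply_tangent (σ : AnnSection k.normal) (x : X) (u : TangentSpace IX x) :
    σ.toFun x (mfderiv IX IZ k x u) = 0 := σ.map_eq_zero x u

/-- The section `σ` is near `x` the restriction of the differential of `F`. -/
def HasPotential (σ : AnnSection k.normal) (F : Z → ℝ) (x : X) : Prop :=
  IsSmoothFun IZ F ∧ ∀ᶠ y in 𝓝 x, diff IZ F (k y) = σ.toFun y

namespace HasPotential

variable {σ : AnnSection k.normal} {F : Z → ℝ} {x : X}

lemma eq (h : σ.HasPotential F x) : diff IZ F (k x) = σ.toFun x := h.2.self_of_nhds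

lemma eventually (h : σ.HasPotential F x) : ∀ᶠ y in 𝓝 x, σ.HasPotential F y := by
  filter_upwards [eventually_eventually_nhds.2 h.2] with y hy using ⟨h.1, hy⟩

end HasPotential

lemma exists_hasPotential [FiniteDimensional ℝ EX] [FiniteDimensional ℝ EZ] [T2Space Z]
    [IX.Boundaryless] (σ : AnnSection k.normal) (x : X) : ∃ F, σ.HasPotential F x := by
  obtain ⟨F, hF, -, hFσ⟩ := exists_potential k (i := id) (k := k) contMDiff_id (fun _ ↦ rfl)
    (σ := σ.toFun) (fun V hV ↦ σ.apply_field hV) (fun x u ↦ σ.apply_tangent x u) x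
  exact ⟨F, hF, hFσ⟩

/-- The tangent vector field of `X` which is the image of `σ` under `w♯`. -/
def anchor (hP : P.IsCoisotropic k) (σ : AnnSection k.normal) (x : X) : TangentSpace IX x :=
  (hP x (σ.toFun x) (σ.apply_tangent x)).choose

lemma map_anchor (hP : P.IsCoisotropic k) (σ : AnnSection k.normal) (x : X) :
    mfderiv IX IZ k x (σ.anchor hP x) = P.sharp (k x) (σ.toFun x) :=
  (hP x (σ.toFun x) (σ.apply_tangent x)).choose_spec

lemma anchor_eq_iff (hP : P.IsCoisotropic k) (σ : AnnSection k.normal) (x : X)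
    (u : TangentSpace IX x) :
    σ.anchor hP x = u ↔ mfderiv IX IZ k x u = P.sharp (k x) (σ.toFun x) := by
  rw [← σ.map_anchor hP]
  exact ⟨fun h ↦ by rw [h], fun h ↦ (k.injective_mfderiv x h).symm⟩

/-- The derivative of a function on `X` along the anchor of a section. -/
def anchorDiff (hP : P.IsCoisotropic k) (σ : AnnSection k.normal) (h : X → ℝ) (x : X) : ℝ :=
  diff IX h x (σ.anchor hP x)

/-- The anchor is the Hamiltonian vector of a potential and is tangent to `X`, so `h` may be
replaced by an extension to `Z`. Derivations on `X` become brackets on `Z` in this way. -/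
lemma anchorDiff_eq (hP : P.IsCoisotropic k) {σ : AnnSection k.normal} {F : Z → ℝ} {x : X}
    (hF : diff IZ F (k x) = σ.toFun x) {h : X → ℝ} {f : Z → ℝ} (hf : IsSmoothFun IZ f)
    (hfh : ∀ᶠ y in 𝓝 x, f (k y) = h y) : σ.anchorDiff hP h x = P.bracket f F (k x) := by
  have h1 : h =ᶠ[𝓝 x] fun y ↦ f (k y) := by filter_upwards [hfh] with y hy using hy.symm
  rw [anchorDiff, diff_congr h1, PoissonStructure.bracket, hF, ← σ.map_anchor hP]
  exact diff_comp (hf.mdiff _) (k.contMDiff.mdifferentiableAt (by simp)) _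

variable [FiniteDimensional ℝ EX] [FiniteDimensional ℝ EZ] [T2Space Z] [IX.Boundaryless]

lemma smooth_anchorDiff (hP : P.IsCoisotropic k) (σ : AnnSection k.normal) {h : X → ℝ}
    (hh : IsSmoothFun IX h) : IsSmoothFun IX (σ.anchorDiff hP h) := by
  intro x
  obtain ⟨F, hF⟩ := σ.exists_hasPotential x
  obtain ⟨f, hf, hfh⟩ := exists_extension k x hh
  refine (((P.smooth_bracket hf hF.1).comp k.contMDiff) x).congr_of_eventuallyEq ?_
  filter_upwards [hF.eventually, eventually_eventually_nhds.2 hfh] with y h1 h2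
  exact anchorDiff_eq hP h1.eq hf h2

end AnnSection

section Independence

variable [FiniteDimensional ℝ EZ] [T2Space Z] [IZ.Boundaryless]

/-- If `dD` vanishes along `X` and `w♯ dG` is tangent to `X`, then `d {D, G}` vanishes. -/
lemma diff_bracket_eq_zero {D G : Z → ℝ} (hD : IsSmoothFun IZ D) (hG : IsSmoothFun IZ G) {x : X}
    (hDx : ∀ᶠ y in 𝓝 x, diff IZ D (k y) = 0) {u : TangentSpace IX x}
    (hu : mfderiv IX IZ k x u = P.sharp (k x) (diff IZ G (k x))) :
    diff IZ (P.bracket D G) (k x) = 0 := by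
  ext v
  obtain ⟨V, hV, rfl⟩ := exists_field_eq (I := IZ) (k x) v
  have hX := P.isSmoothField_sharp_diff hG
  -- `V{D, G} = X_G(V D) + [V, X_G] D`. The last term is zero because `dD = 0` at the point, the
  -- other because `V D` vanishes on `X` and `X_G` is tangent to `X` there.
  have h1 := diff_mlieBracket (z := k x) hD hV hX
  have h2 : diff IZ (fun y ↦ diff IZ D y (V y)) (k x) (P.sharp (k x) (diff IZ G (k x))) = 0 := by
    rw [← hu]
    refine (diff_comp ((hV.diff_apply hD).mdiff _) (k.contMDiff.mdifferentiableAt (by simp))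
      u).symm.trans ?_
    have h3 : (fun y ↦ diff IZ D (k y) (V (k y))) =ᶠ[𝓝 x] fun _ ↦ 0 := by
      filter_upwards [hDx] with y hy
      rw [hy]; rfl
    rw [diff_congr h3, diff_const]
    rfl
  rw [h2, hDx.self_of_nhds, sub_zero] at h1
  exact h1.symm

variable [FiniteDimensional ℝ EX] [IX.Boundaryless]

/-- One argument is changed at a time: the difference of two potentials of the same section has zero
differential along `X`, and by coisotropy the Hamiltonian vector of the other potential is tangent
to `X`. -/
lemma AnnSection.HasPotential.diff_bracket_congr (hP : P.IsCoisotropic k)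
    {σ τ : AnnSection k.normal} {F F' G G' : Z → ℝ} {x : X} (hF : σ.HasPotential F x)
    (hF' : σ.HasPotential F' x) (hG : τ.HasPotential G x) (hG' : τ.HasPotential G' x) :
    diff IZ (P.bracket F G) (k x) = diff IZ (P.bracket F' G') (k x) := by
  have key : ∀ {σ τ : AnnSection k.normal} {F F' G : Z → ℝ}, σ.HasPotential F x →
      σ.HasPotential F' x → τ.HasPotential G x →
      diff IZ (P.bracket F G) (k x) = diff IZ (P.bracket F' G) (k x) := by
    intro σ τ F F' G hF hF' hG
    have h1 : IsSmoothFun IZ fun y ↦ F y - F' y := hF.1.sub hF'.1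
    have h2 := diff_bracket_eq_zero (P := P) (k := k) h1 hG.1 (x := x) (by
      filter_upwards [hF.2, hF'.2] with y h2 h3
      rw [diff_sub (hF.1.mdiff _) (hF'.1.mdiff _), h2, h3, sub_self])
      (u := τ.anchor hP x) (by rw [τ.map_anchor, hG.eq])
    have h3 : P.bracket (fun y ↦ F y - F' y) G = fun y ↦ P.bracket F G y - P.bracket F' G y := by
      funext y
      simp only [PoissonStructure.bracket]
      rw [diff_sub (hF.1.mdiff _) (hF'.1.mdiff _)]
      rfl
    rw [h3, diff_sub ((P.smooth_bracket hF.1 hG.1).mdiff _)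
      ((P.smooth_bracket hF'.1 hG.1).mdiff _), sub_eq_zero] at h2
    exact h2
  have hs : ∀ F G : Z → ℝ, P.bracket F G = fun y ↦ -P.bracket G F y :=
    fun F G ↦ funext fun y ↦ P.bracket_skew F G y
  rw [key hF hF' hG, hs F' G, hs F' G', diff_neg, diff_neg, key hG hG' hF']

end Independence

namespace AnnSection

variable [FiniteDimensional ℝ EX] [FiniteDimensional ℝ EZ] [T2Space Z] [IX.Boundaryless]
  [IZ.Boundaryless] (hP : P.IsCoisotropic k)

/-- The bracket of sections of the conormal bundle of a coisotropic immersion. -/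
def bracket (σ τ : AnnSection k.normal) : AnnSection k.normal :=
  -- Potentials are chosen point by point; near `x` they may be traded for one fixed pair, which is
  -- what gives smoothness.
  have key : ∀ {x : X} {F G : Z → ℝ}, σ.HasPotential F x → τ.HasPotential G x →
      ∀ᶠ y in 𝓝 x, diff IZ (P.bracket (σ.exists_hasPotential y).choose
        (τ.exists_hasPotential y).choose) (k y) = diff IZ (P.bracket F G) (k y) := by
    intro x F G hF hG
    filter_upwards [hF.eventually, hG.eventually] with y h1 h2
    exact HasPotential.diff_bracket_congr hP (σ.exists_hasPotential y).choose_spec h1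
      (τ.exists_hasPotential y).choose_spec h2
  ofApply (fun x ↦ diff IZ (P.bracket (σ.exists_hasPotential x).choose
    (τ.exists_hasPotential x).choose) (k x))
    (fun x u ↦ by
      have hF := (σ.exists_hasPotential x).choose_spec
      have hG := (τ.exists_hasPotential x).choose_spec
      generalize (σ.exists_hasPotential x).choose = F at hF
      generalize (τ.exists_hasPotential x).choose = G at hG
      refine (diff_comp ((P.smooth_bracket hF.1 hG.1).mdiff _)
        (k.contMDiff.mdifferentiableAt (by simp)) u).symm.trans ?_
      -- `{F, G}` vanishes on `X` near `x`, since `dF` kills the tangent vector `w♯ dG`; hence `d{F,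
      -- G}` is conormal.
      have h1 : (fun y ↦ P.bracket F G (k y)) =ᶠ[𝓝 x] fun _ ↦ 0 := by
        filter_upwards [hF.2, hG.2] with y h2 h3
        rw [PoissonStructure.bracket, h2, h3, ← τ.map_anchor hP]
        exact σ.apply_tangent y _
      exact congrArg (fun T : TangentSpace IX x →L[ℝ] ℝ ↦ T u)
        ((diff_congr h1).trans (diff_const 0 x)))
    (fun V hV x ↦ by
      obtain ⟨F, hF⟩ := σ.exists_hasPotential x
      obtain ⟨G, hG⟩ := τ.exists_hasPotential x
      refine (((hV.diff_apply (P.smooth_bracket hF.1 hG.1)).comp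
        k.contMDiff) x).congr_of_eventuallyEq ?_
      filter_upwards [key hF hG] with y hy
      rw [hy]
      rfl)

/-- Brackets of potentials are potentials, so identities between iterated brackets of sections
reduce to identities between functions on `Z`. -/
lemma HasPotential.bracket {σ τ : AnnSection k.normal} {F G : Z → ℝ} {x : X}
    (hF : σ.HasPotential F x) (hG : τ.HasPotential G x) :
    (bracket hP σ τ).HasPotential (P.bracket F G) x := by
  refine ⟨P.smooth_bracket hF.1 hG.1, ?_⟩
  filter_upwards [hF.eventually, hG.eventually] with y h1 h2
  exact HasPotential.diff_bracket_congr hP h1 (σ.exists_hasPotential y).choose_spec h2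
    (τ.exists_hasPotential y).choose_spec

/-- The conormal section given by a section of the annihilator of `TX`. -/
def toConormal (σ : AnnSection k.normal) : ConormalSection k := ⟨σ.toFun, σ.map_eq_zero, σ.smooth⟩

/-- The section of the annihilator of `TX` given by a conormal section. -/
def ofConormal (σ : ConormalSection k) : AnnSection k.normal := ⟨σ.toFun, σ.map_tangent, σ.smooth⟩

end AnnSection

section FormBracket

variable [FiniteDimensional ℝ EZ] [T2Space Z] [IZ.Boundaryless]

lemma IsSmoothFun.isSmoothForm_diff {F : Z → ℝ} (hF : IsSmoothFun IZ F) :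
    IsSmoothForm IZ (diff IZ F) := fun z ↦
  contMDiffAt_covector_of_apply (g := id) contMDiffAt_id fun _ hV ↦ hV.diff_apply hF z

lemma IsSmoothForm.apply {α : ∀ z : Z, TangentSpace IZ z →L[ℝ] ℝ} (hα : IsSmoothForm IZ α)
    {V : ∀ z : Z, TangentSpace IZ z} (hV : IsSmoothField IZ V) :
    IsSmoothFun IZ fun z ↦ α z (V z) :=
  fun z ↦ ContMDiffAt.covector_apply (g := id) (hα z) (hV z)

lemma IsSmoothForm.sub {α β : ∀ z : Z, TangentSpace IZ z →L[ℝ] ℝ} (hα : IsSmoothForm IZ α)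
    (hβ : IsSmoothForm IZ β) : IsSmoothForm IZ fun z ↦ α z - β z := fun z ↦
  contMDiffAt_covector_of_apply (g := id) contMDiffAt_id fun _ hV ↦
    ((hα.apply hV).sub (hβ.apply hV)) z

/-- The bracket of exact forms is the differential of the Poisson bracket. -/
lemma PoissonStructure.isFormBracket_diff {F G : Z → ℝ} (hF : IsSmoothFun IZ F)
    (hG : IsSmoothFun IZ G) :
    P.IsFormBracket (diff IZ F) (diff IZ G) (diff IZ (P.bracket F G)) := by
  intro U hU z
  have hXF := P.isSmoothField_sharp_diff hF
  have hXG := P.isSmoothField_sharp_diff hG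
  have h1 := diff_mlieBracket (z := z) hF hXG hU
  have h2 := diff_mlieBracket (z := z) hG hXF hU
  have h3 : (fun y ↦ diff IZ G y (P.sharp y (diff IZ F y))) = fun y ↦ -P.bracket F G y :=
    funext fun y ↦ P.bracket_skew G F y
  rw [lieDerivForm, lieDerivForm, h1, h2, h3, diff_neg]
  change _ = _ - (_ - diff IZ (P.bracket F G) z (U z)) - _ - diff IZ (P.bracket F G) z (U z)
  rw [neg_apply]
  ring

/-- The derivative along `w♯ β`, tangent to `X`, of a 1-form which is exact along `X`. -/
lemma lieDerivForm_eq_of_potential {F : Z → ℝ} (hF : IsSmoothFun IZ F)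
    {α : ∀ z : Z, TangentSpace IZ z →L[ℝ] ℝ} (hα : IsSmoothForm IZ α)
    {V U : ∀ z : Z, TangentSpace IZ z} (hV : IsSmoothField IZ V) (hU : IsSmoothField IZ U) {x : X}
    (hFα : ∀ᶠ y in 𝓝 x, diff IZ F (k y) = α (k y)) {u : TangentSpace IX x}
    (hu : mfderiv IX IZ k x u = V (k x)) :
    lieDerivForm IZ V α U (k x) = diff IZ (fun y ↦ diff IZ F y (V y)) (k x) (U (k x)) := by
  have h1 := diff_mlieBracket (z := k x) hF hV hU
  rw [lieDerivForm, ← hFα.self_of_nhds, h1]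
  -- `α` and `dF` agree only along `X`, but the derivative is taken in a direction tangent to `X`.
  have h2 : diff IZ (fun y ↦ α y (U y)) (k x) (V (k x)) =
      diff IZ (fun y ↦ diff IZ F y (U y)) (k x) (V (k x)) := by
    rw [← hu]
    have d := k.contMDiff.mdifferentiableAt (x := x) (n := ∞) (by simp)
    refine (diff_comp ((hα.apply hU).mdiff _) d u).symm.trans
      (.trans ?_ (diff_comp ((hU.diff_apply hF).mdiff _) d u))
    have h3 : (fun y ↦ α (k y) (U (k y))) =ᶠ[𝓝 x] fun y ↦ diff IZ F (k y) (U (k y)) := by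
      filter_upwards [hFα] with y hy
      rw [hy]
    rw [diff_congr h3]
  rw [h2]
  ring

variable [FiniteDimensional ℝ EX] [IX.Boundaryless]

/-- For forms with the same restrictions as `dF` and `dG`, the form bracket at the point differs
from `d{F, G}` by the differential of `(α - dF)(w♯(β - dG))`, where both factors vanish. -/
lemma isConormalBracket_bracket (hP : P.IsCoisotropic k) (σ τ : AnnSection k.normal) :
    P.IsConormalBracket σ.toConormal τ.toConormal (AnnSection.bracket hP σ τ).toConormal := by
  intro x α β γ hα hβ hασ hβτ hγ
  obtain ⟨F, hF⟩ := σ.exists_hasPotential x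
  obtain ⟨G, hG⟩ := τ.exists_hasPotential x
  refine Eq.trans ?_ (hF.bracket hP hG).eq
  ext v
  obtain ⟨U, hU, rfl⟩ := exists_field_eq (I := IZ) (k x) v
  have hFα : ∀ᶠ y in 𝓝 x, diff IZ F (k y) = α (k y) := by
    filter_upwards [hF.2, hασ] with y h1 h2 using h1.trans h2.symm
  have hGβ : ∀ᶠ y in 𝓝 x, diff IZ G (k y) = β (k y) := by
    filter_upwards [hG.2, hβτ] with y h1 h2 using h1.trans h2.symm
  have hXα := P.isSmoothField_sharp hα
  have hXβ := P.isSmoothField_sharp hβ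
  have h1 := lieDerivForm_eq_of_potential hF.1 hα hXβ hU hFα (u := τ.anchor hP x)
    (by rw [τ.map_anchor, ← hGβ.self_of_nhds, hG.eq])
  have h2 := lieDerivForm_eq_of_potential hG.1 hβ hXα hU hGβ (u := σ.anchor hP x)
    (by rw [σ.map_anchor, ← hFα.self_of_nhds, hF.eq])
  rw [hγ U hU, h1, h2]
  have hdF := hF.1.isSmoothForm_diff
  have hdG := hG.1.isSmoothForm_diff
  have h3 := diff_covector_apply_eq_zero (z := k x) (hα.sub hdF)
    (P.isSmoothField_sharp (hβ.sub hdG)) (by rw [hFα.self_of_nhds, sub_self])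
    (by rw [hGβ.self_of_nhds, sub_self, map_zero])
  have s1 := hXβ.diff_apply hF.1
  have s2 := hXα.diff_apply hG.1
  have s3 := hα.apply hXβ
  have s4 := (hα.sub hdF).apply (P.isSmoothField_sharp (hβ.sub hdG))
  have h4 : P.bracket F G = fun y ↦ diff IZ F y (P.sharp y (β y)) -
      diff IZ G y (P.sharp y (α y)) - α y (P.sharp y (β y)) +
      (α y - diff IZ F y) (P.sharp y (β y - diff IZ G y)) := by
    funext y
    have h5 := P.skew y (diff IZ G y) (α y)
    rw [PoissonStructure.bracket, h5, map_sub]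
    simp only [sub_apply, map_sub]
    ring
  have s12 : IsSmoothFun IZ fun y ↦ diff IZ F y (P.sharp y (β y)) -
    diff IZ G y (P.sharp y (α y)) := s1.sub s2
  have s123 : IsSmoothFun IZ fun y ↦ diff IZ F y (P.sharp y (β y)) -
    diff IZ G y (P.sharp y (α y)) - α y (P.sharp y (β y)) := s12.sub s3
  rw [h4, diff_add (s123.mdiff _) (s4.mdiff _), h3, add_zero, diff_sub (s12.mdiff _) (s3.mdiff _),
    diff_sub (s1.mdiff _) (s2.mdiff _)]
  rfl

/-- Uniqueness comes from the exact forms `dF`, `dG` of two potentials: they are admissible test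
forms and possess a form bracket, so the defining condition is nowhere void. -/
lemma isConormalBracket_iff (hP : P.IsCoisotropic k) (σ τ κ : AnnSection k.normal) :
    P.IsConormalBracket σ.toConormal τ.toConormal κ.toConormal ↔
      κ = AnnSection.bracket hP σ τ := by
  refine ⟨fun h ↦ ?_, fun h ↦ h ▸ isConormalBracket_bracket hP σ τ⟩
  ext1
  funext x
  obtain ⟨F, hF⟩ := σ.exists_hasPotential x
  obtain ⟨G, hG⟩ := τ.exists_hasPotential x
  refine (h x _ _ _ hF.1.isSmoothForm_diff hG.1.isSmoothForm_diff hF.2 hG.2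
    (P.isFormBracket_diff hF.1 hG.1)).symm.trans ?_
  exact (hF.bracket hP hG).eq

lemma existsUnique_isConormalBracket (hP : P.IsCoisotropic k) (σ τ : ConormalSection k) :
    ∃! κ : ConormalSection k, P.IsConormalBracket σ τ κ :=
  ⟨(AnnSection.bracket hP (.ofConormal σ) (.ofConormal τ)).toConormal,
    isConormalBracket_bracket hP (.ofConormal σ) (.ofConormal τ), fun κ hκ ↦
    congrArg AnnSection.toConormal ((isConormalBracket_iff hP (.ofConormal σ) (.ofConormal τ)
      (.ofConormal κ)).1 hκ)⟩

end FormBracket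

end Coisotropic

/-! ### Existence of the linear Poisson structure on the normal bundle -/

section Linearization

variable {EX HX X : Type*} [NormedAddCommGroup EX] [NormedSpace ℝ EX] [TopologicalSpace HX]
  [TopologicalSpace X] [ChartedSpace HX X]
  {EZ HZ Z : Type*} [NormedAddCommGroup EZ] [NormedSpace ℝ EZ] [TopologicalSpace HZ]
  [TopologicalSpace Z] [ChartedSpace HZ Z]
  {IX : ModelWithCorners ℝ EX HX} {IZ : ModelWithCorners ℝ EZ HZ}
  [IsManifold IX ∞ X] [IsManifold IZ ∞ Z]
  {P : PoissonStructure IZ Z} {k : SmoothImmersion IX IZ X Z}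
  [FiniteDimensional ℝ EX] [FiniteDimensional ℝ EZ] [T2Space Z] [T2Space X] [IX.Boundaryless]
  [IZ.Boundaryless]

open SmoothImmersion AnnSection TangentMono

/-- The section of the normal bundle given by a vector field on the ambient manifold. -/
lemma contMDiff_cls_field {V : ∀ z : Z, TangentSpace IZ z} (hV : IsSmoothField IZ V) :
    ContMDiff IX (normalModel IX EX EZ) ∞
      (fun y ↦ (⟨y, k.normal.cls y (V (k y))⟩ : k.NormalBundle)) := fun y ↦
  contMDiffAt_of_bar contMDiffAt_id fun σ ↦ by
    simp only [σ.bar_cls]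
    exact σ.apply_field hV y

variable (hP : P.IsCoisotropic k)

namespace AnnSection

/-- The Hamiltonian vectors of the linearization. -/
lemma exists_hamiltonian (t : k.NormalBundle) (τ : AnnSection k.normal) {g : X → ℝ}
    (hg : IsSmoothFun IX g) :
    ∃ V : TangentSpace (normalModel IX EX EZ) t, ∀ (σ : AnnSection k.normal) (h : X → ℝ),
      IsSmoothFun IX h → diff (normalModel IX EX EZ) (fun t ↦ σ.bar t + h t.1) t V =
        (bracket hP σ τ).bar t + (τ.anchorDiff hP h t.1 - σ.anchorDiff hP g t.1) := by
  obtain ⟨x, b⟩ := t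
  obtain ⟨v, rfl⟩ := k.normal.cls_surjective x b
  obtain ⟨V, hV, rfl⟩ := exists_field_eq (I := IZ) (k x) v
  obtain ⟨G, hG⟩ := τ.exists_hasPotential x
  obtain ⟨g', hg', hgg⟩ := exists_extension k x hg
  set s : X → k.NormalBundle := fun y ↦ ⟨y, k.normal.cls y (V (k y))⟩ with hs
  have hss : ContMDiff IX (normalModel IX EX EZ) ∞ s := contMDiff_cls_field hV
  have hXG := P.isSmoothField_sharp_diff hG.1
  -- Lifting the anchor of `τ` along the section `[V]` yields `X_G(V F)` on `σ̄`, while `V{F, G}` is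
  -- wanted. The vertical vector of `[V, X_G]` makes up the difference and does not act on functions
  -- of the base; `w♯ dg'` contributes the term with `g`.
  let c : TangentSpace IZ (k x) :=
    VectorField.mlieBracket IZ V (fun z ↦ P.sharp z (diff IZ G z)) (k x) +
      P.sharp (k x) (diff IZ g' (k x))
  refine ⟨mfderiv IX (normalModel IX EX EZ) s x (τ.anchor hP x) +
    vertAt (s x) (k.normal.cls x c), fun σ h hh ↦ ?_⟩
  have d1 := (σ.smooth_bar).mdiff (s x)
  have d2 := (hh.comp_proj (φ := k.normal)).mdiff (s x)
  rw [diff_add d1 d2]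
  have e1 : diff (normalModel IX EX EZ) σ.bar (s x)
      (mfderiv IX (normalModel IX EX EZ) s x (τ.anchor hP x)) =
      diff IZ (fun y ↦ diff IZ (σ.exists_hasPotential x).choose y (V y)) (k x)
        (P.sharp (k x) (diff IZ G (k x))) := by
    have hF := (σ.exists_hasPotential x).choose_spec
    generalize (σ.exists_hasPotential x).choose = F at hF
    rw [diff_section_comp hss σ.smooth_bar, hG.eq, ← τ.map_anchor hP]
    refine Eq.trans ?_ (diff_comp ((hV.diff_apply hF.1).mdiff _)
      (k.contMDiff.mdifferentiableAt (by simp)) (τ.anchor hP x))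
    have h1 : (fun y ↦ σ.bar (s y)) =ᶠ[𝓝 x] fun y ↦ diff IZ F (k y) (V (k y)) := by
      filter_upwards [hF.2] with y hy
      rw [hy]
      exact σ.bar_cls y _
    rw [diff_congr h1]
  have e2 : diff (normalModel IX EX EZ) (fun t : k.NormalBundle ↦ h t.1) (s x)
      (mfderiv IX (normalModel IX EX EZ) s x (τ.anchor hP x)) = τ.anchorDiff hP h x :=
    diff_section_comp hss (hh.comp_proj (φ := k.normal)) x _
  have hF := (σ.exists_hasPotential x).choose_spec
  generalize (σ.exists_hasPotential x).choose = F at hF e1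
  have e3 : σ.toFun x c = diff IZ F (k x) c := by rw [hF.eq]
  have e4 := diff_mlieBracket (z := k x) hF.1 hV hXG
  have e5 : σ.anchorDiff hP g x = -diff IZ F (k x) (P.sharp (k x) (diff IZ g' (k x))) := by
    rw [anchorDiff_eq hP hF.eq hg' hgg, P.bracket_skew]
    rfl
  have e6 : (bracket hP σ τ).bar (s x) = diff IZ (P.bracket F G) (k x) (V (k x)) := by
    rw [(hF.bracket hP hG).eq]
    exact (bracket hP σ τ).bar_cls x _
  have e7 : diff (normalModel IX EX EZ) σ.bar (s x) (vertAt (s x) (k.normal.cls x c)) =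
      σ.toFun x c := (diff_bar_vertAt σ (s x) _).trans (σ.bar_cls x c)
  have e8 : diff (normalModel IX EX EZ) (fun t : k.NormalBundle ↦ h t.1) (s x)
      (vertAt (s x) (k.normal.cls x c)) = 0 := diff_proj_vertAt hh (s x) _
  refine (congrArg₂ (· + ·) ((map_add _ _ _).trans (congrArg₂ (· + ·) e1 (e7.trans e3)))
    ((map_add _ _ _).trans (congrArg₂ (· + ·) e2 e8))).trans ?_
  have e9 : diff IZ F (k x) c = diff IZ (P.bracket F G) (k x) (V (k x)) -
      diff IZ (fun y ↦ diff IZ F y (V y)) (k x) (P.sharp (k x) (diff IZ G (k x))) -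
      σ.anchorDiff hP g x := by
    rw [e5, map_add, e4]
    change diff IZ (P.bracket F G) (k x) (V (k x)) - _ + _ = _
    ring
  refine Eq.trans ?_ (congrArg₂ (· + ·) e6.symm rfl)
  rw [e9]
  ring

end AnnSection

namespace PoissonStructure

/-- The defining property of the linearization on the generating functions. -/
def IsLinearization (hP : P.IsCoisotropic k)
    (P' : PoissonStructure (normalModel IX EX EZ) k.NormalBundle) : Prop :=
  ∀ (σ τ : AnnSection k.normal) (h g : X → ℝ), IsSmoothFun IX h → IsSmoothFun IX g → ∀ t,
    P'.bracket (fun t ↦ σ.bar t + h t.1) (fun t ↦ τ.bar t + g t.1) t =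
      (AnnSection.bracket hP σ τ).bar t + (τ.anchorDiff hP h t.1 - σ.anchorDiff hP g t.1)

/-- A generator is locally a pair `(F, f)`, with value `dF(v) + f` at the class of `v`, and pairs
are bracketed like `F + ε f` modulo `ε²`. The axioms on generators are thus those of `P`, separated
into orders in `ε`. -/
theorem exists_isLinearization (hP : P.IsCoisotropic k) :
    ∃ P' : PoissonStructure (normalModel IX EX EZ) k.NormalBundle, IsLinearization hP P' := by
  let W := AnnSection k.normal × {h : X → ℝ // IsSmoothFun IX h}
  let fn : W → k.NormalBundle → ℝ := fun a t ↦ a.1.bar t + a.2.1 t.1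
  let br : W → W → W := fun a b ↦ (AnnSection.bracket hP a.1 b.1,
    ⟨fun x ↦ b.1.anchorDiff hP a.2.1 x - a.1.anchorDiff hP b.2.1 x,
      (b.1.smooth_anchorDiff hP a.2.2).sub (a.1.smooth_anchorDiff hP b.2.2)⟩)
  let Pot : W → (Z → ℝ) → (Z → ℝ) → X → Prop := fun a F f x ↦
    a.1.HasPotential F x ∧ IsSmoothFun IZ f ∧ ∀ᶠ y in 𝓝 x, f (k y) = a.2.1 y
  have hex : ∀ (a : W) (x : X), ∃ F f, Pot a F f x := fun a x ↦ by
    obtain ⟨F, hF⟩ := a.1.exists_hasPotential x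
    obtain ⟨f, hf, hfa⟩ := exists_extension k x a.2.2
    exact ⟨F, f, hF, hf, hfa⟩
  have hfn : ∀ {a : W} {F f : Z → ℝ} {x : X}, Pot a F f x → ∀ v,
      fn a ⟨x, k.normal.cls x v⟩ = diff IZ F (k x) v + f (k x) := by
    intro a F f x ⟨hF, hf, hfa⟩ v
    rw [hF.eq, hfa.self_of_nhds]
    exact congrArg (· + a.2.1 x) (a.1.bar_cls x v)
  have hbr : ∀ {a b : W} {F f G g : Z → ℝ} {x : X}, Pot a F f x → Pot b G g x →
      Pot (br a b) (P.bracket F G) (fun z ↦ P.bracket f G z - P.bracket g F z) x := by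
    intro a b F f G g x ⟨hF, hf, hfa⟩ ⟨hG, hg, hgb⟩
    refine ⟨hF.bracket hP hG, (P.smooth_bracket hf hG.1).sub (P.smooth_bracket hg hF.1), ?_⟩
    filter_upwards [hF.eventually, hG.eventually, eventually_eventually_nhds.2 hfa,
      eventually_eventually_nhds.2 hgb] with y h1 h2 h3 h4
    exact (congrArg₂ (· - ·) (anchorDiff_eq hP h2.eq hf h3) (anchorDiff_eq hP h1.eq hg h4)).symm
  obtain ⟨P', hP'⟩ := exists_poissonStructure_of_generators (I := normalModel IX EX EZ) fn
    (fun a ↦ (a.1.smooth_bar).add a.2.2.comp_proj) (fun z α ↦ by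
      obtain ⟨σ, h, hh, e⟩ := k.normal.exists_diff_eq_bar z α
      exact ⟨(σ, ⟨h, hh⟩), e⟩) br (fun t b ↦ by
      obtain ⟨V, hV⟩ := AnnSection.exists_hamiltonian hP t b.1 b.2.2
      exact ⟨V, fun a ↦ hV a.1 a.2.1 a.2.2⟩) (by
      intro a b ⟨x, q⟩
      obtain ⟨v, rfl⟩ := k.normal.cls_surjective x q
      obtain ⟨F, f, hF⟩ := hex a x
      obtain ⟨G, g, hG⟩ := hex b x
      rw [hfn (hbr hF hG), hfn (hbr hG hF)]
      have h1 : P.bracket F G = fun y ↦ -P.bracket G F y := funext fun y ↦ P.bracket_skew F G y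
      rw [h1, diff_neg, neg_apply]
      ring) (by
      intro a b c ⟨x, q⟩
      obtain ⟨v, rfl⟩ := k.normal.cls_surjective x q
      obtain ⟨F, f, hF⟩ := hex a x
      obtain ⟨G, g, hG⟩ := hex b x
      obtain ⟨H, h, hH⟩ := hex c x
      rw [hfn (hbr hF (hbr hG hH)), hfn (hbr hG (hbr hH hF)), hfn (hbr hH (hbr hF hG))]
      have s := fun {F G : Z → ℝ} (hF : IsSmoothFun IZ F) (hG : IsSmoothFun IZ G) ↦
        P.smooth_bracket hF hG
      have hsub : ∀ {F G A : Z → ℝ} (z : Z), IsSmoothFun IZ F → IsSmoothFun IZ G →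
          P.bracket (fun y ↦ F y - G y) A z = P.bracket F A z - P.bracket G A z := by
        intro F G A z hF hG
        simp only [PoissonStructure.bracket]
        rw [diff_sub (hF.mdiff z) (hG.mdiff z)]
        rfl
      have hneg : ∀ (F G A : Z → ℝ) (z : Z),
          P.bracket (P.bracket F G) A z = P.bracket A (P.bracket G F) z := by
        intro F G A z
        have h1 : P.bracket F G = fun y ↦ -P.bracket G F y := funext fun y ↦ P.bracket_skew F G y
        rw [P.bracket_skew, h1, P.bracket_neg_right, neg_neg]
      have hJ : ∀ z, P.bracket F (P.bracket G H) z + P.bracket G (P.bracket H F) z +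
          P.bracket H (P.bracket F G) z = 0 := P.bracket_jacobi hF.1.1 hG.1.1 hH.1.1
      -- The fibrewise linear part of the Jacobi identity: the differential of the Jacobi identity
      -- of the potentials.
      have hd : diff IZ (P.bracket F (P.bracket G H)) (k x) v +
          diff IZ (P.bracket G (P.bracket H F)) (k x) v +
          diff IZ (P.bracket H (P.bracket F G)) (k x) v = 0 := by
        have h1 : (fun z ↦ P.bracket F (P.bracket G H) z + P.bracket G (P.bracket H F) z +
          P.bracket H (P.bracket F G) z) = fun _ ↦ 0 := funext hJ
        have h2 := diff_const (I := IZ) 0 (k x)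
        have s1 := s hF.1.1 (s hG.1.1 hH.1.1)
        have s2 := s hG.1.1 (s hH.1.1 hF.1.1)
        have s12 : IsSmoothFun IZ fun z ↦ P.bracket F (P.bracket G H) z +
          P.bracket G (P.bracket H F) z := s1.add s2
        rw [← h1, diff_add (s12.mdiff _) ((s hH.1.1 (s hF.1.1 hG.1.1)).mdiff _),
          diff_add (s1.mdiff _) (s2.mdiff _)] at h2
        exact congrArg (fun T : TangentSpace IZ (k x) →L[ℝ] ℝ ↦ T v) h2
      rw [hsub _ (s hG.2.1 hH.1.1) (s hH.2.1 hG.1.1), hsub _ (s hH.2.1 hF.1.1) (s hF.2.1 hH.1.1),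
        hsub _ (s hF.2.1 hG.1.1) (s hG.2.1 hF.1.1), hneg g H F, hneg h G F, hneg h F G, hneg f H G,
        hneg f G H, hneg g F H]
      -- The part on the base: three Jacobi identities on `Z`, one for each potential replaced by
      -- its function of order `ε`.
      have j1 := P.bracket_jacobi hF.2.1 hG.1.1 hH.1.1 (k x)
      have j2 := P.bracket_jacobi hG.2.1 hH.1.1 hF.1.1 (k x)
      have j3 := P.bracket_jacobi hH.2.1 hF.1.1 hG.1.1 (k x)
      have n : ∀ A F G : Z → ℝ, P.bracket A (P.bracket F G) (k x) =
          -P.bracket A (P.bracket G F) (k x) := by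
        intro A F G
        have h1 : P.bracket F G = fun y ↦ -P.bracket G F y := funext fun y ↦ P.bracket_skew F G y
        rw [h1, P.bracket_neg_right]
      rw [n H f G, n G H f] at j1
      rw [n F g H, n H F g] at j2
      rw [n G h F, n F G h] at j3
      rw [n G H f, n H F g, n F G h]
      linarith)
  exact ⟨P', fun σ τ h g hh hg t ↦ congrFun (hP' (σ, ⟨h, hh⟩) (τ, ⟨g, hg⟩)) t⟩

end PoissonStructure
end Linearization

/-! ### Exactness may be tested on generators -/

section Exactness

variable {E H M : Type*} [NormedAddCommGroup E] [NormedSpace ℝ E] [TopologicalSpace H]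
  {I : ModelWithCorners ℝ E H} [TopologicalSpace M] [ChartedSpace H M]
  [FiniteDimensional ℝ E] [T2Space M] [IsManifold I ∞ M] [I.Boundaryless]

namespace PoissonStructure

variable (P : PoissonStructure I M)

lemma lieDeriv_skew (T : ∀ z : M, TangentSpace I z) (f g : M → ℝ) (z : M) :
    P.lieDeriv T f g z = -P.lieDeriv T g f z := by
  have h1 : P.bracket f g = fun y ↦ -P.bracket g f y := funext fun y ↦ P.bracket_skew f g y
  rw [lieDeriv, lieDeriv, P.bracket_skew (fun y ↦ diff I f y (T y)) g,
    P.bracket_skew f (fun y ↦ diff I g y (T y)), h1, diff_neg, neg_apply]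
  ring

/-- `L_T w` is a tensor: its value is `df` applied to `[T, X_g] - X_{T g}`, the second derivatives
of `f` cancelling in the commutator. -/
lemma lieDeriv_congr {T : ∀ z : M, TangentSpace I z} (hT : IsSmoothField I T) {f f' g : M → ℝ}
    (hf : IsSmoothFun I f) (hf' : IsSmoothFun I f') (hg : IsSmoothFun I g) {z : M}
    (h : diff I f z = diff I f' z) : P.lieDeriv T f g z = P.lieDeriv T f' g z := by
  have key : ∀ f, IsSmoothFun I f → P.lieDeriv T f g z = diff I f z
      (VectorField.mlieBracket I T (fun y ↦ P.sharp y (diff I g y)) z -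
        P.sharp z (diff I (fun y ↦ diff I g y (T y)) z)) := by
    intro f hf
    rw [map_sub, diff_mlieBracket hf hT (P.isSmoothField_sharp_diff hg)]
    rfl
  rw [key f hf, key f' hf', h]

lemma isExactVia_of_generators {T : ∀ z : M, TangentSpace I z} (hT : IsSmoothField I T)
    (G : Set (M → ℝ)) (hG : ∀ u ∈ G, IsSmoothFun I u) (hspan : ∀ z α, ∃ u ∈ G, diff I u z = α)
    (h : ∀ u ∈ G, ∀ v ∈ G, ∀ z, P.bracket u v z = -P.lieDeriv T u v z) : P.IsExactVia T := by
  refine ⟨hT, fun f g hf hg z ↦ ?_⟩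
  obtain ⟨u, hu, hfu⟩ := hspan z (diff I f z)
  obtain ⟨v, hv, hgv⟩ := hspan z (diff I g z)
  rw [P.bracket_congr hfu.symm hgv.symm, P.lieDeriv_congr hT hf (hG u hu) hg hfu.symm,
    P.lieDeriv_skew T u g, P.lieDeriv_congr hT hg (hG v hv) (hG u hu) hgv.symm,
    ← P.lieDeriv_skew T u v]
  exact h u hu v hv z

end PoissonStructure

end Exactness

/-! ### Brackets, exactness and uniqueness of the linear structure -/

section Linearization

variable {EX HX X : Type*} [NormedAddCommGroup EX] [NormedSpace ℝ EX] [TopologicalSpace HX]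
  [TopologicalSpace X] [ChartedSpace HX X]
  {EZ HZ Z : Type*} [NormedAddCommGroup EZ] [NormedSpace ℝ EZ] [TopologicalSpace HZ]
  [TopologicalSpace Z] [ChartedSpace HZ Z]
  {IX : ModelWithCorners ℝ EX HX} {IZ : ModelWithCorners ℝ EZ HZ}
  [IsManifold IX ∞ X] [IsManifold IZ ∞ Z]
  {P : PoissonStructure IZ Z} {k : SmoothImmersion IX IZ X Z}
  [FiniteDimensional ℝ EX] [FiniteDimensional ℝ EZ] [T2Space Z] [T2Space X] [IX.Boundaryless]
  [IZ.Boundaryless]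

open SmoothImmersion AnnSection TangentMono

namespace PoissonStructure.IsLinearization

variable {hP : P.IsCoisotropic k} {P' : PoissonStructure (normalModel IX EX EZ) k.NormalBundle}
  (h' : IsLinearization hP P')

include h'

lemma bracket_bar_bar (σ τ : AnnSection k.normal) (t : k.NormalBundle) :
    P'.bracket σ.bar τ.bar t = (AnnSection.bracket hP σ τ).bar t := by
  have h := h' σ τ (fun _ ↦ 0) (fun _ ↦ 0) contMDiff_const contMDiff_const t
  simp only [add_zero, anchorDiff, diff_const] at h
  refine h.trans ?_
  change _ + ((0 : ℝ) - 0) = _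
  simp

lemma bracket_bar_proj (σ : AnnSection k.normal) {g : X → ℝ} (hg : IsSmoothFun IX g)
    (t : k.NormalBundle) :
    P'.bracket σ.bar (fun t ↦ g t.1) t = -σ.anchorDiff hP g t.1 := by
  have h := h' σ σ (fun _ ↦ 0) g contMDiff_const hg t
  simp only [add_zero, anchorDiff, diff_const] at h
  rw [P'.bracket_add_right _ σ.smooth_bar hg.comp_proj, h'.bracket_bar_bar] at h
  have h2 := add_left_cancel h
  rw [h2, anchorDiff]
  change (0 : ℝ) - _ = _
  simp

lemma bracket_proj_bar (σ : AnnSection k.normal) {g : X → ℝ} (hg : IsSmoothFun IX g)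
    (t : k.NormalBundle) :
    P'.bracket (fun t ↦ g t.1) σ.bar t = σ.anchorDiff hP g t.1 := by
  rw [P'.bracket_skew, h'.bracket_bar_proj σ hg, neg_neg]

lemma bracket_proj_proj {h g : X → ℝ} (hh : IsSmoothFun IX h) (hg : IsSmoothFun IX g)
    (t : k.NormalBundle) :
    P'.bracket (fun t ↦ h t.1) (fun t ↦ g t.1) t = 0 := by
  have h1 := h' AnnSection.zero AnnSection.zero h g hh hg t
  have s0 := (AnnSection.zero : AnnSection k.normal).smooth_bar
  rw [P'.bracket_add_right _ s0 hg.comp_proj, P'.bracket_add_left _ s0 hh.comp_proj,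
    P'.bracket_add_left _ s0 hh.comp_proj, h'.bracket_bar_bar, h'.bracket_bar_proj _ hg,
    h'.bracket_proj_bar _ hh] at h1
  linarith

lemma extends_linearization : P.Extends k P' := fun σ τ ↦
  ⟨(AnnSection.bracket hP (.ofConormal σ) (.ofConormal τ)).toConormal,
    isConormalBracket_bracket hP (.ofConormal σ) (.ofConormal τ),
    fun t ↦ h'.bracket_bar_bar (.ofConormal σ) (.ofConormal τ) t⟩

/-- The Euler field multiplies a function homogeneous of degree `d` on the fibres by `d`, and the
bracket lowers the total degree by one. It is enough to look at `σ̄` and `h ∘ π`, of degrees one and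
zero. -/
lemma isExactVia_euler : P'.IsExactVia k.euler := by
  have hline : ∀ t : k.NormalBundle, ContMDiff 𝓘(ℝ, ℝ) (normalModel IX EX EZ) ∞
      (fun s : ℝ ↦ (⟨t.1, s • t.2⟩ : k.NormalBundle)) := by
    intro t
    have := k.normal.contMDiff_line t.1 0 t.2
    simpa only [zero_add] using this
  have hdiff : ∀ {u : k.NormalBundle → ℝ}, IsSmoothFun (normalModel IX EX EZ) u → ∀ t,
      diff (normalModel IX EX EZ) u t (k.euler t) =
        deriv (fun s : ℝ ↦ u ⟨t.1, s • t.2⟩) 1 := by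
    intro u hu t
    obtain ⟨x, a⟩ := t
    have h := diff_mfderiv_curve hu (hline ⟨x, a⟩) 1
    have h0 : (⟨x, (1 : ℝ) • a⟩ : k.NormalBundle) = ⟨x, a⟩ := by rw [one_smul]
    exact (congrArg (fun p : k.NormalBundle ↦ diff (normalModel IX EX EZ) u p
      (k.euler ⟨x, a⟩ : EX × CokerModel EX EZ)) h0).symm.trans h
  have hbar : ∀ (σ : AnnSection k.normal) t,
      diff (normalModel IX EX EZ) σ.bar t (k.euler t) = σ.bar t := by
    intro σ t
    rw [hdiff σ.smooth_bar]
    simp only [σ.bar_smul]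
    simp
  have hproj : ∀ {h : X → ℝ}, IsSmoothFun IX h → ∀ t : k.NormalBundle,
      diff (normalModel IX EX EZ) (fun t : k.NormalBundle ↦ h t.1) t (k.euler t) = 0 := by
    intro h hh t
    rw [hdiff (u := fun t : k.NormalBundle ↦ h t.1) hh.comp_proj]
    simp
  have hgen : ∀ (σ : AnnSection k.normal) {h : X → ℝ}, IsSmoothFun IX h →
      (fun t ↦ diff (normalModel IX EX EZ) (fun t : k.NormalBundle ↦ σ.bar t + h t.1) t
        (k.euler t)) = σ.bar := by
    intro σ h hh
    funext t
    rw [diff_add (σ.smooth_bar.mdiff t) (hh.comp_proj.mdiff t), add_apply, hbar, hproj hh,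
      add_zero]
  let G : Set (k.NormalBundle → ℝ) :=
    {u | ∃ (σ : AnnSection k.normal) (h : X → ℝ), IsSmoothFun IX h ∧ u = fun t ↦ σ.bar t + h t.1}
  have hG : ∀ u ∈ G, IsSmoothFun (normalModel IX EX EZ) u := by
    rintro _ ⟨σ, h, hh, rfl⟩
    exact σ.smooth_bar.add hh.comp_proj
  have hspan : ∀ z α, ∃ u ∈ G, diff (normalModel IX EX EZ) u z = α := by
    intro z α
    obtain ⟨σ, h, hh, e⟩ := k.normal.exists_diff_eq_bar z α
    exact ⟨_, ⟨σ, h, hh, rfl⟩, e⟩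
  refine P'.isExactVia_of_generators (fun t ↦ contMDiffAt_field_of_diff (g := id) contMDiffAt_id G
    hG (hspan t) ?_) G hG hspan ?_
  · rintro _ ⟨σ, h, hh, rfl⟩
    exact (σ.smooth_bar t).congr_of_eventuallyEq (.of_forall fun t ↦ congrFun (hgen σ hh) t)
  · rintro _ ⟨σ, h, hh, rfl⟩ _ ⟨τ, g, hg, rfl⟩ t
    rw [lieDeriv, hgen σ hh, hgen τ hg]
    have e1 : P'.bracket (fun t ↦ σ.bar t + h t.1) (fun t ↦ τ.bar t + g t.1) =
        fun t ↦ (AnnSection.bracket hP σ τ).bar t +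
          (fun x ↦ τ.anchorDiff hP h x - σ.anchorDiff hP g x) t.1 := funext fun t ↦
      h' σ τ h g hh hg t
    have e2 : IsSmoothFun IX fun x ↦ τ.anchorDiff hP h x - σ.anchorDiff hP g x :=
      (τ.smooth_anchorDiff hP hh).sub (σ.smooth_anchorDiff hP hg)
    rw [e1, congrFun (hgen _ e2) t, P'.bracket_add_right _ τ.smooth_bar hg.comp_proj,
      P'.bracket_add_left _ σ.smooth_bar hh.comp_proj, h'.bracket_bar_bar, h'.bracket_bar_proj _ hg,
      h'.bracket_proj_bar _ hh]
    ring

omit h' in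
/-- Away from the zero section, the differentials of the fibrewise linear functions exhaust the
cotangent spaces. -/
lemma exists_diff_bar_eq {t : k.NormalBundle} (ht : t.2 ≠ 0)
    (α : TangentSpace (normalModel IX EX EZ) t →L[ℝ] ℝ) :
    ∃ σ : AnnSection k.normal, diff (normalModel IX EX EZ) σ.bar t = α := by
  obtain ⟨τ, h, hh, rfl⟩ := k.normal.exists_diff_eq_bar t α
  -- With `σ̄₀ = 1` at `t`, the fibrewise linear function `(h - h(π t)) σ̄₀` has at `t` the same
  -- differential as `h ∘ π`.
  obtain ⟨σ₀, hσ₀⟩ : ∃ σ₀ : AnnSection k.normal, σ₀.bar t = 1 := by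
    by_contra hne
    push Not at hne
    have h0 : ∀ σ : AnnSection k.normal, σ.bar t = 0 := by
      intro σ
      by_contra hσ
      apply hne (smulAdd (contMDiff_const (c := (σ.bar t)⁻¹)) σ AnnSection.zero)
      rw [smulAdd_bar, AnnSection.zero_bar, add_zero, inv_mul_cancel₀ hσ]
    have h1 : t = ⟨t.1, 0⟩ := ext_bar rfl fun σ ↦ (h0 σ).trans (σ.bar_zero t.1).symm
    apply ht
    rw [h1]
  have hc : IsSmoothFun IX fun x ↦ h x - h t.1 := hh.sub contMDiff_const
  refine ⟨smulAdd hc σ₀ τ, ?_⟩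
  have h2 : diff (normalModel IX EX EZ) (fun s : k.NormalBundle ↦ h s.1 - h t.1) t =
      diff (normalModel IX EX EZ) (fun s : k.NormalBundle ↦ h s.1) t := by
    have h3 := diff_sub (I := normalModel IX EX EZ) (z := t) (hh.comp_proj.mdiff t)
      (mdifferentiableAt_const (c := h t.1))
    rw [diff_const, sub_zero] at h3
    exact h3
  rw [diff_bar_smulAdd, hσ₀, h2, diff_add (τ.smooth_bar.mdiff t) (hh.comp_proj.mdiff t)]
  simp [add_comm]

/-- Only brackets of fibrewise linear functions are prescribed. They determine the structure off the
zero section, whose complement is dense if the fibres have positive dimension. In the other case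
admitted by `hd` the total space has dimension zero and nothing is left to compare. -/
lemma eq_of_extends (hd : finrank ℝ EX < finrank ℝ EZ ∨ finrank ℝ EX = 0)
    {Q : PoissonStructure (normalModel IX EX EZ) k.NormalBundle} (hQ : P.Extends k Q) : Q = P' := by
  have h0 : ∀ (σ τ : AnnSection k.normal) t, Q.bracket σ.bar τ.bar t =
      P'.bracket σ.bar τ.bar t := by
    intro σ τ t
    obtain ⟨κ, hκ, hκQ⟩ := hQ σ.toConormal τ.toConormal
    rw [h'.bracket_bar_bar, ← (isConormalBracket_iff hP σ τ (.ofConormal κ)).1 hκ]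
    exact hκQ t
  have h1 : ∀ {t : k.NormalBundle}, t.2 ≠ 0 → ∀ f g, Q.bracket f g t = P'.bracket f g t := by
    intro t ht f g
    obtain ⟨σ, hσ⟩ := exists_diff_bar_eq ht (diff (normalModel IX EX EZ) f t)
    obtain ⟨τ, hτ⟩ := exists_diff_bar_eq ht (diff (normalModel IX EX EZ) g t)
    rw [Q.bracket_congr hσ.symm hτ.symm, P'.bracket_congr hσ.symm hτ.symm, h0]
  by_cases hlt : finrank ℝ EX < finrank ℝ EZ
  · refine ext_of_bracket {u | IsSmoothFun (normalModel IX EX EZ) u} (fun z α ↦ ?_)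
      fun f hf g hg t ↦ ?_
    · exact exists_diff_eq z α
    by_cases ht : t.2 = 0
    · obtain ⟨x, a⟩ := t
      obtain rfl : a = 0 := ht
      obtain ⟨b, hb⟩ : ∃ b : k.normal.Coker x, b ≠ 0 := by
        refine ⟨k.normal.fibSymm x x fun _ ↦ 1, fun hb ↦ ?_⟩
        have h2 := k.normal.fibTriv_fibSymm (k.normal.mem_dom x) (fun _ ↦ 1)
        rw [hb, map_zero] at h2
        have h3 := congrFun h2 ⟨0, by omega⟩
        simp at h3
      have hc := (k.normal.contMDiff_line x 0 b).continuous
      have c1 : Continuous fun s : ℝ ↦ Q.bracket f g ⟨x, 0 + s • b⟩ :=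
        (Q.smooth_bracket hf hg).continuous.comp hc
      have c2 : Continuous fun s : ℝ ↦ P'.bracket f g ⟨x, 0 + s • b⟩ :=
        (P'.smooth_bracket hf hg).continuous.comp hc
      have h4 := Continuous.ext_on (dense_compl_singleton (0 : ℝ)) c1 c2 fun s hs ↦
        h1 (t := ⟨x, 0 + s • b⟩) (by simpa using ⟨hs, hb⟩) f g
      have h5 := congrFun h4 0
      simpa using h5
    · exact h1 ht f g
  · have hX : finrank ℝ EX = 0 := hd.resolve_left hlt
    have : Subsingleton EX := finrank_zero_iff.1 hX
    have : IsEmpty (Fin (finrank ℝ EZ - finrank ℝ EX)) := by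
      have : finrank ℝ EZ - finrank ℝ EX = 0 := by omega
      rw [this]; infer_instance
    have hs : Subsingleton (EX × CokerModel EX EZ) := inferInstance
    apply PoissonStructure.ext
    funext z
    refine LinearMap.ext fun β ↦ ?_
    exact hs.elim _ _

end PoissonStructure.IsLinearization
end Linearization

/-! ### Symplectic form of an integral manifold; Lagrangian implies coisotropic -/

section LeafForm

variable {EX HX X : Type*} [NormedAddCommGroup EX] [NormedSpace ℝ EX] [TopologicalSpace HX]
  [TopologicalSpace X] [ChartedSpace HX X]
  {ES HS S : Type*} [NormedAddCommGroup ES] [NormedSpace ℝ ES] [TopologicalSpace HS]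
  [TopologicalSpace S] [ChartedSpace HS S]
  {EZ HZ Z : Type*} [NormedAddCommGroup EZ] [NormedSpace ℝ EZ] [TopologicalSpace HZ]
  [TopologicalSpace Z] [ChartedSpace HZ Z]
  {IX : ModelWithCorners ℝ EX HX} {IS : ModelWithCorners ℝ ES HS}
  {IZ : ModelWithCorners ℝ EZ HZ}
  {P : PoissonStructure IZ Z} {j : SmoothImmersion IS IZ S Z} {i : SmoothImmersion IX IS X S}

namespace PoissonStructure

lemma IsIntegral.exists_sharp_eq (hj : P.IsIntegral j) (s : S) (u : TangentSpace IS s) :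
    ∃ α, P.sharp (j s) α = mfderiv IS IZ j s u := by
  have h : mfderiv IS IZ j s u ∈ range (mfderiv IS IZ j s) := ⟨u, rfl⟩
  rwa [hj.range_eq] at h

lemma IsIntegral.exists_mfderiv_eq (hj : P.IsIntegral j) (s : S)
    (α : TangentSpace IZ (j s) →L[ℝ] ℝ) : ∃ u, mfderiv IS IZ j s u = P.sharp (j s) α := by
  have h : P.sharp (j s) α ∈ range (P.sharp (j s)) := ⟨α, rfl⟩
  rwa [← hj.range_eq] at h

/-- The choice of `α` is immaterial: `dj v` is itself some `w♯ γ`, and skewness expresses the value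
through `w♯ α`. -/
lemma IsIntegral.leafForm_eq (hj : P.IsIntegral j) {s : S} {u : TangentSpace IS s}
    {α : TangentSpace IZ (j s) →L[ℝ] ℝ} (hα : P.sharp (j s) α = mfderiv IS IZ j s u)
    (v : TangentSpace IS s) : P.leafForm j s u v = α (mfderiv IS IZ j s v) := by
  have h : ∃ α, P.sharp (j s) α = mfderiv IS IZ j s u := ⟨α, hα⟩
  rw [leafForm, dif_pos h]
  obtain ⟨γ, hγ⟩ := hj.exists_sharp_eq s v
  rw [← hγ, P.skew _ h.choose, P.skew _ α, h.choose_spec, hα]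

/-- The symplectic form as a bilinear form. -/
def IsIntegral.bilinForm (hj : P.IsIntegral j) (s : S) : LinearMap.BilinForm ℝ (TangentSpace IS s) :=
  LinearMap.mk₂ ℝ (P.leafForm j s)
    (fun u u' v ↦ by
      obtain ⟨α, hα⟩ := hj.exists_sharp_eq s u
      obtain ⟨α', hα'⟩ := hj.exists_sharp_eq s u'
      rw [hj.leafForm_eq hα, hj.leafForm_eq hα',
        hj.leafForm_eq (α := α + α') (by rw [map_add, map_add, hα, hα'])]
      rfl)
    (fun c u v ↦ by
      obtain ⟨α, hα⟩ := hj.exists_sharp_eq s u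
      rw [hj.leafForm_eq hα, hj.leafForm_eq (α := c • α) (by rw [map_smul, map_smul, hα])]
      rfl)
    (fun u v v' ↦ by
      obtain ⟨α, hα⟩ := hj.exists_sharp_eq s u
      rw [hj.leafForm_eq hα, hj.leafForm_eq hα, hj.leafForm_eq hα, map_add, map_add])
    (fun c u v ↦ by
      obtain ⟨α, hα⟩ := hj.exists_sharp_eq s u
      rw [hj.leafForm_eq hα, hj.leafForm_eq hα, map_smul, map_smul])

lemma IsIntegral.leafForm_skew (hj : P.IsIntegral j) (s : S) (u v : TangentSpace IS s) :
    P.leafForm j s u v = -P.leafForm j s v u := by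
  obtain ⟨α, hα⟩ := hj.exists_sharp_eq s u
  obtain ⟨β, hβ⟩ := hj.exists_sharp_eq s v
  rw [hj.leafForm_eq hα, hj.leafForm_eq hβ, ← hα, ← hβ, P.skew]

/-- Nondegeneracy: `γ (w♯ α) = -α (w♯ γ)`, and `w♯ γ` is tangent to the integral manifold for every
`γ`. -/
lemma IsIntegral.eq_zero_of_leafForm [FiniteDimensional ℝ EZ] (hj : P.IsIntegral j) {s : S}
    {u : TangentSpace IS s} (h : ∀ v, P.leafForm j s u v = 0) : u = 0 := by
  obtain ⟨α, hα⟩ := hj.exists_sharp_eq s u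
  apply j.injective_mfderiv s
  rw [map_zero, ← hα]
  refine tangent_ext fun γ ↦ ?_
  obtain ⟨v, hv⟩ := hj.exists_mfderiv_eq s γ
  rw [P.skew, ← hv, ← hj.leafForm_eq hα, h, neg_zero, map_zero]

variable [FiniteDimensional ℝ EX] [FiniteDimensional ℝ ES] [FiniteDimensional ℝ EZ]

/-- A vector which is symplectically orthogonal to a Lagrangian submanifold is tangent to it. -/
lemma IsLagrangian.exists_tangent_eq (hi : P.IsLagrangian j i) (hj : P.IsIntegral j) {x : X}
    {s : TangentSpace IS (i x)} (h : ∀ u, P.leafForm j (i x) s (mfderiv IX IS i x u) = 0) :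
    ∃ u, mfderiv IX IS i x u = s := by
  have f1 : FiniteDimensional ℝ (TangentSpace IS (i x)) := inferInstanceAs (FiniteDimensional ℝ ES)
  have f2 : FiniteDimensional ℝ (TangentSpace IX x) := inferInstanceAs (FiniteDimensional ℝ EX)
  let B := hj.bilinForm (i x)
  have hB : ∀ u v, B u v = P.leafForm j (i x) u v := fun _ _ ↦ rfl
  let L := LinearMap.range (mfderiv IX IS i x).toLinearMap
  have hr : B.IsRefl := fun u v huv ↦ by
    rw [hB] at huv ⊢
    rw [hj.leafForm_skew, huv, neg_zero]
  have hn : B.Nondegenerate :=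
    ⟨fun u hu ↦ hj.eq_zero_of_leafForm hu, fun v hv ↦ hj.eq_zero_of_leafForm fun u ↦ by
      rw [hj.leafForm_skew]
      exact neg_eq_zero.2 (hv u)⟩
  have h1 : finrank ℝ (B.orthogonal L) = finrank ℝ (TangentSpace IS (i x)) - finrank ℝ L :=
    LinearMap.BilinForm.finrank_orthogonal hn L
  have h2 : finrank ℝ L = finrank ℝ EX :=
    LinearMap.finrank_range_of_inj (i.injective_mfderiv x)
  have h3 : finrank ℝ (TangentSpace IS (i x)) = 2 * finrank ℝ EX := hi.finrank_eq
  have h4 : L ≤ B.orthogonal L := by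
    rintro _ ⟨u, rfl⟩
    rw [LinearMap.BilinForm.mem_orthogonal_iff]
    rintro _ ⟨v, rfl⟩
    exact hi.isotropic x v u
  -- Being isotropic of half the dimension, the tangent space equals its symplectic orthogonal.
  have h5 : L = B.orthogonal L := Submodule.eq_of_le_of_finrank_eq h4 (by omega)
  have h6 : s ∈ B.orthogonal L := by
    rw [LinearMap.BilinForm.mem_orthogonal_iff]
    rintro _ ⟨v, rfl⟩
    exact hr _ _ (h v)
  rw [← h5] at h6
  exact h6

variable [IsManifold IX ∞ X] [IsManifold IS ∞ S] [IsManifold IZ ∞ Z]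

/-- A Lagrangian submanifold of a leaf is coisotropic. -/
lemma IsLagrangian.isCoisotropic (hi : P.IsLagrangian j i) (hj : P.IsIntegral j) :
    P.IsCoisotropic (j.comp i) := by
  intro x α hα
  obtain ⟨s, hs⟩ := hj.exists_mfderiv_eq (i x) α
  obtain ⟨u, rfl⟩ := hi.exists_tangent_eq hj (x := x) (s := s) fun u ↦ by
    rw [hj.leafForm_eq hs.symm]
    exact (congrArg α (SmoothImmersion.mfderiv_comp_apply j i x u)).symm.trans (hα u)
  exact ⟨u, (SmoothImmersion.mfderiv_comp_apply j i x u).trans hs⟩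

/-- Every tangent vector of a Lagrangian submanifold is the image of a conormal section. -/
lemma IsLagrangian.exists_anchor_eq [T2Space X] [T2Space Z] (hi : P.IsLagrangian j i)
    (hj : P.IsIntegral j) (x : X) (u : TangentSpace IX x) :
    ∃ σ : AnnSection (j.comp i).normal, σ.anchor (hi.isCoisotropic hj) x = u := by
  obtain ⟨α, hα⟩ := hj.exists_sharp_eq (i x) (mfderiv IX IS i x u)
  obtain ⟨σ, hσ⟩ := AnnSection.exists_toFun_eq (φ := (j.comp i).normal) x α fun v ↦ by
    refine (congrArg α (SmoothImmersion.mfderiv_comp_apply j i x v)).trans ?_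
    rw [← hj.leafForm_eq hα]
    exact hi.isotropic x u v
  refine ⟨σ, (AnnSection.anchor_eq_iff _ σ x u).2 ?_⟩
  rw [hσ]
  exact (SmoothImmersion.mfderiv_comp_apply j i x u).trans hα.symm

end PoissonStructure

end LeafForm

/-! ### Conormal sections from functions that vanish on `X` -/

section Sections

variable {EX HX X : Type*} [NormedAddCommGroup EX] [NormedSpace ℝ EX] [TopologicalSpace HX]
  [TopologicalSpace X] [ChartedSpace HX X]
  {EZ HZ Z : Type*} [NormedAddCommGroup EZ] [NormedSpace ℝ EZ] [TopologicalSpace HZ]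
  [TopologicalSpace Z] [ChartedSpace HZ Z]
  {IX : ModelWithCorners ℝ EX HX} {IZ : ModelWithCorners ℝ EZ HZ}
  [IsManifold IX ∞ X] [IsManifold IZ ∞ Z] {k : SmoothImmersion IX IZ X Z}
  [FiniteDimensional ℝ EX] [FiniteDimensional ℝ EZ] [T2Space Z] [T2Space X]

/-- A function which is locally constant along `X` near a point is the potential of a section. -/
lemma AnnSection.exists_of_potential {F : Z → ℝ} (hF : IsSmoothFun IZ F) {x : X}
    (h : ∀ᶠ y in 𝓝 x, F (k y) = 0) : ∃ σ : AnnSection k.normal, σ.HasPotential F x := by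
  have h0 : ∀ᶠ y in 𝓝 x, ∀ u, diff IZ F (k y) (mfderiv IX IZ k y u) = 0 := by
    filter_upwards [eventually_eventually_nhds.2 h] with y hy u
    refine (diff_comp (hF.mdiff _) (k.contMDiff.mdifferentiableAt (by simp)) u).symm.trans ?_
    have h1 : (fun y ↦ F (k y)) =ᶠ[𝓝 y] fun _ ↦ 0 := hy
    exact congrArg (fun T : TangentSpace IX y →L[ℝ] ℝ ↦ T u)
      ((diff_congr h1).trans (diff_const 0 y))
  obtain ⟨χ, -, hχ⟩ := (SmoothBumpFunction.nhds_basis_tsupport (I := IX) x).mem_iff.1 h0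
  refine ⟨AnnSection.ofApply (fun y ↦ χ y • diff IZ F (k y)) ?_ ?_, hF, ?_⟩
  · intro y u
    by_cases hy : y ∈ tsupport χ
    · change χ y • diff IZ F (k y) (mfderiv IX IZ k y u) = 0
      rw [hχ hy u, smul_zero]
    · rw [image_eq_zero_of_notMem_tsupport hy, zero_smul]
      rfl
  · intro V hV
    exact χ.contMDiff.mul ((hV.diff_apply hF).comp k.contMDiff)
  · filter_upwards [χ.eventuallyEq_one] with y hy
    change _ = χ y • diff IZ F (k y)
    rw [hy, Pi.one_apply, one_smul]

end Sections

/-! ### Charts from injective local diffeomorphisms -/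

section OpenEmbedding

variable {E H M : Type*} [NormedAddCommGroup E] [NormedSpace ℝ E] [TopologicalSpace H]
  {I : ModelWithCorners ℝ E H} [TopologicalSpace M] [ChartedSpace H M]
  {E' : Type*} [NormedAddCommGroup E'] [NormedSpace ℝ E']

/-- An injective local diffeomorphism to a vector space is a chart. -/
lemma exists_openPartialHomeomorph [FiniteDimensional ℝ E] [FiniteDimensional ℝ E']
    [IsManifold I ∞ M] [I.Boundaryless] [Nonempty M] {f : M → E'} {s : Set M} (hs : IsOpen s)
    (hf : ContMDiffOn I 𝓘(ℝ, E') ∞ f s) (hinj : InjOn f s)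
    (hb : ∀ x ∈ s, Function.Bijective (mfderiv I 𝓘(ℝ, E') f x)) :
    ∃ e : OpenPartialHomeomorph M E', e.source = s ∧ (∀ x, e x = f x) ∧
      ContMDiffOn 𝓘(ℝ, E') I ∞ e.symm e.target := by
  -- Near `f x` the local inverse takes values in `s`, so injectivity on `s` makes it coincide with
  -- the global inverse.
  have key : ∀ x ∈ s, f '' s ∈ 𝓝 (f x) ∧
      ContMDiffAt 𝓘(ℝ, E') I ∞ (Function.invFunOn f s) (f x) := by
    intro x hx
    obtain ⟨g, hg, hgx, -, hfg⟩ := exists_local_inverse (I := I) (f := f) (x := x) (by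
      filter_upwards [hs.mem_nhds hx] with y hy using hf.contMDiffAt (hs.mem_nhds hy)) (hb x hx)
    have h1 : ∀ᶠ y in 𝓝 (f x), g y ∈ s :=
      hg.self_of_nhds.continuousAt.eventually (by rw [hgx]; exact hs.mem_nhds hx)
    refine ⟨?_, hg.self_of_nhds.congr_of_eventuallyEq ?_⟩
    · filter_upwards [h1, hfg] with y h2 h3 using ⟨g y, h2, h3⟩
    · filter_upwards [h1, hfg] with y h2 h3
      have h4 : ∃ a ∈ s, f a = y := ⟨g y, h2, h3⟩
      exact hinj (Function.invFunOn_mem h4) h2 ((Function.invFunOn_eq h4).trans h3.symm)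
  let e : PartialEquiv M E' := hinj.bijOn_image.toPartialEquiv
  refine ⟨⟨⟨e, hf.continuousOn, ?_⟩, hs, isOpen_iff_mem_nhds.2 ?_⟩, rfl, fun _ ↦ rfl, ?_⟩
  · rintro _ ⟨x, hx, rfl⟩
    exact (key x hx).2.continuousAt.continuousWithinAt
  · rintro _ ⟨x, hx, rfl⟩
    exact (key x hx).1
  · rintro _ ⟨x, hx, rfl⟩
    exact (key x hx).2.contMDiffWithinAt

end OpenEmbedding

/-! ### Darboux coordinates of the linear structure -/

section Darboux

variable {EX HX X : Type*} [NormedAddCommGroup EX] [NormedSpace ℝ EX] [TopologicalSpace HX]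
  [TopologicalSpace X] [ChartedSpace HX X]
  {EZ HZ Z : Type*} [NormedAddCommGroup EZ] [NormedSpace ℝ EZ] [TopologicalSpace HZ]
  [TopologicalSpace Z] [ChartedSpace HZ Z]
  {IX : ModelWithCorners ℝ EX HX} {IZ : ModelWithCorners ℝ EZ HZ}
  [IsManifold IX ∞ X] [IsManifold IZ ∞ Z]
  {P : PoissonStructure IZ Z} {k : SmoothImmersion IX IZ X Z}
  [FiniteDimensional ℝ EX] [FiniteDimensional ℝ EZ] [T2Space Z] [T2Space X] [IX.Boundaryless]
  [IZ.Boundaryless]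

open SmoothImmersion AnnSection TangentMono

/-- Functions vanishing on an open subset of `X` define sections of the conormal bundle. -/
lemma exists_section_of_vanishing {q : Z → ℝ} {W : Set Z} (hW : IsOpen W)
    (hq : ContMDiffOn IZ 𝓘(ℝ, ℝ) ∞ q W) {V : Set X} (hV : IsOpen V)
    (hVW : ∀ y ∈ V, k y ∈ W ∧ q (k y) = 0) {x : X} (hx : x ∈ V) :
    ∃ (F : Z → ℝ) (σ : AnnSection k.normal), σ.HasPotential F x ∧ F =ᶠ[𝓝 (k x)] q ∧
      ∀ t : k.NormalBundle, t.1 = x → ∀ᶠ t' in 𝓝 t, ∀ v, k.normal.cls t'.1 v = t'.2 →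
        diff IZ q (k t'.1) v = σ.bar t' := by
  obtain ⟨F, hF, hFq⟩ := exists_contMDiff_eventuallyEq (I := IZ) (f := q) (z := k x) (by
    filter_upwards [hW.mem_nhds (hVW x hx).1] with y hy using hq.contMDiffAt (hW.mem_nhds hy))
  obtain ⟨σ, hσ⟩ := AnnSection.exists_of_potential (k := k) hF (x := x) (by
    filter_upwards [k.contMDiff.continuous.continuousAt.eventually hFq, hV.mem_nhds hx] with y h1 h2
    rw [h1, (hVW y h2).2])
  refine ⟨F, σ, hσ, hFq, ?_⟩
  rintro ⟨x, a⟩ rfl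
  have h1 : ∀ᶠ y in 𝓝 x, diff IZ q (k y) = σ.toFun y := by
    filter_upwards [k.contMDiff.continuous.continuousAt.eventually hFq.eventuallyEq_nhds, hσ.2]
      with y h1 h2
    rw [← h2, diff_congr h1]
  filter_upwards [k.normal.continuous_proj.continuousAt.eventually h1] with t' h2
  obtain ⟨y, b⟩ := t'
  change ∀ v : TangentSpace IZ (k y), k.normal.cls y v = b → diff IZ q (k y) v = σ.bar ⟨y, b⟩
  rintro v rfl
  rw [σ.bar_cls]
  exact congrArg (fun T : TangentSpace IZ (k y) →L[ℝ] ℝ ↦ T v) h2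

namespace PoissonStructure

namespace DarbouxChart

variable {z₀ : Z} {m n : ℕ} (D : P.DarbouxChart z₀ m n)

lemma mdifferentiableAt_chart {z : Z} (hz : z ∈ D.chart.source) :
    MDifferentiableAt IZ 𝓘(ℝ, (Fin m → ℝ) × (Fin m → ℝ) × (Fin n → ℝ)) D.chart z :=
  (D.contMDiffOn_chart.contMDiffAt (D.chart.open_source.mem_nhds hz)).mdifferentiableAt (by simp)

lemma bijective_mfderiv {z : Z} (hz : z ∈ D.chart.source) :
    Function.Bijective (mfderiv IZ 𝓘(ℝ, (Fin m → ℝ) × (Fin m → ℝ) × (Fin n → ℝ)) D.chart z) :=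
  OpenPartialHomeomorph.MDifferentiable.mfderiv_bijective
    ⟨D.contMDiffOn_chart.mdifferentiableOn (by simp),
      D.contMDiffOn_symm.mdifferentiableOn (by simp)⟩ hz

/-- The coordinate functionals. -/
def cx (m n : ℕ) (μ : Fin m) : (Fin m → ℝ) × (Fin m → ℝ) × (Fin n → ℝ) →L[ℝ] ℝ :=
  (ContinuousLinearMap.proj μ).comp (ContinuousLinearMap.fst ℝ _ _)

/-- The coordinate functionals. -/
def cp (m n : ℕ) (μ : Fin m) : (Fin m → ℝ) × (Fin m → ℝ) × (Fin n → ℝ) →L[ℝ] ℝ :=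
  (ContinuousLinearMap.proj μ).comp ((ContinuousLinearMap.fst ℝ _ _).comp
    (ContinuousLinearMap.snd ℝ _ _))

/-- The coordinate functionals. -/
def cr (m n : ℕ) (a : Fin n) : (Fin m → ℝ) × (Fin m → ℝ) × (Fin n → ℝ) →L[ℝ] ℝ :=
  (ContinuousLinearMap.proj a).comp ((ContinuousLinearMap.snd ℝ _ _).comp
    (ContinuousLinearMap.snd ℝ _ _))

lemma contMDiffOn_comp (L : (Fin m → ℝ) × (Fin m → ℝ) × (Fin n → ℝ) →L[ℝ] ℝ) :
    ContMDiffOn IZ 𝓘(ℝ, ℝ) ∞ (fun z ↦ L (D.chart z)) D.chart.source :=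
  L.contMDiff.comp_contMDiffOn D.contMDiffOn_chart

lemma diff_comp_apply (L : (Fin m → ℝ) × (Fin m → ℝ) × (Fin n → ℝ) →L[ℝ] ℝ) {z : Z}
    (hz : z ∈ D.chart.source) (v : TangentSpace IZ z) : diff IZ (fun z ↦ L (D.chart z)) z v =
      L (mfderiv IZ 𝓘(ℝ, (Fin m → ℝ) × (Fin m → ℝ) × (Fin n → ℝ)) D.chart z v) :=
  diff_clm_comp L (D.mdifferentiableAt_chart hz) v

lemma eq_zero_of_diff {z : Z} (hz : z ∈ D.chart.source) {v : TangentSpace IZ z}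
    (h1 : ∀ μ, diff IZ (D.x μ) z v = 0) (h2 : ∀ μ, diff IZ (D.p μ) z v = 0)
    (h3 : ∀ a, diff IZ (D.r a) z v = 0) : v = 0 := by
  apply (D.bijective_mfderiv hz).1
  rw [map_zero]
  refine Prod.ext (funext fun μ ↦ ?_) (Prod.ext (funext fun μ ↦ ?_) (funext fun a ↦ ?_))
  · exact (D.diff_comp_apply (cx m n μ) hz v).symm.trans (h1 μ)
  · exact (D.diff_comp_apply (cp m n μ) hz v).symm.trans (h2 μ)
  · exact (D.diff_comp_apply (cr m n a) hz v).symm.trans (h3 a)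

lemma exists_diff_eq {z : Z} (hz : z ∈ D.chart.source) (p : Fin m → ℝ) (r : Fin n → ℝ) :
    ∃ v, (∀ μ, diff IZ (D.p μ) z v = p μ) ∧ ∀ a, diff IZ (D.r a) z v = r a := by
  obtain ⟨v, hv⟩ := (D.bijective_mfderiv hz).2 (0, p, r)
  refine ⟨v, fun μ ↦ ?_, fun a ↦ ?_⟩
  · exact (D.diff_comp_apply (cp m n μ) hz v).trans (congrArg (cp m n μ) hv)
  · exact (D.diff_comp_apply (cr m n a) hz v).trans (congrArg (cr m n a) hv)

variable (k) in
/-- The coordinates induced on the normal bundle. -/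
def linearized (t : k.NormalBundle) : (Fin m → ℝ) × (Fin m → ℝ) × (Fin n → ℝ) :=
  (fun μ ↦ D.x μ (k t.1),
    fun μ ↦ diff IZ (D.p μ) (k t.1) (k.normal.cls_surjective t.1 t.2).choose,
    fun a ↦ diff IZ (D.r a) (k t.1) (k.normal.cls_surjective t.1 t.2).choose)

section Adapted

variable {V : Set X} (hV : IsOpen V)
  (hD : ∀ x ∈ V, k x ∈ D.chart.source ∧ (∀ μ, D.p μ (k x) = 0) ∧ ∀ a, D.r a (k x) = 0)

include hV hD

lemma exists_section_p {x : X} (hx : x ∈ V) (μ : Fin m) :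
    ∃ (F : Z → ℝ) (σ : AnnSection k.normal), σ.HasPotential F x ∧ F =ᶠ[𝓝 (k x)] D.p μ ∧
      (∀ t : k.NormalBundle, t.1 = x → (fun t ↦ (D.linearized k t).2.1 μ) =ᶠ[𝓝 t] σ.bar) := by
  obtain ⟨F, σ, h1, h2, h3⟩ := exists_section_of_vanishing (k := k) D.chart.open_source
    (D.contMDiffOn_comp (cp m n μ)) hV (fun y hy ↦ ⟨(hD y hy).1, (hD y hy).2.1 μ⟩) hx
  refine ⟨F, σ, h1, h2, fun t ht ↦ ?_⟩
  filter_upwards [h3 t ht] with t' ht'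
  exact ht' _ (k.normal.cls_surjective t'.1 t'.2).choose_spec

lemma exists_section_r {x : X} (hx : x ∈ V) (a : Fin n) :
    ∃ (F : Z → ℝ) (σ : AnnSection k.normal), σ.HasPotential F x ∧ F =ᶠ[𝓝 (k x)] D.r a ∧
      (∀ t : k.NormalBundle, t.1 = x → (fun t ↦ (D.linearized k t).2.2 a) =ᶠ[𝓝 t] σ.bar) := by
  obtain ⟨F, σ, h1, h2, h3⟩ := exists_section_of_vanishing (k := k) D.chart.open_source
    (D.contMDiffOn_comp (cr m n a)) hV (fun y hy ↦ ⟨(hD y hy).1, (hD y hy).2.2 a⟩) hx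
  refine ⟨F, σ, h1, h2, fun t ht ↦ ?_⟩
  filter_upwards [h3 t ht] with t' ht'
  exact ht' _ (k.normal.cls_surjective t'.1 t'.2).choose_spec

lemma exists_fun_x {x : X} (hx : x ∈ V) (μ : Fin m) :
    ∃ F : Z → ℝ, IsSmoothFun IZ F ∧ F =ᶠ[𝓝 (k x)] D.x μ ∧
      (∀ t : k.NormalBundle, t.1 = x →
        (fun t ↦ (D.linearized k t).1 μ) =ᶠ[𝓝 t] fun t ↦ F (k t.1)) := by
  obtain ⟨F, hF, hFq⟩ := exists_contMDiff_eventuallyEq (I := IZ) (f := D.x μ) (z := k x) (by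
    filter_upwards [D.chart.open_source.mem_nhds (hD x hx).1] with y hy
    exact (D.contMDiffOn_comp (cx m n μ)).contMDiffAt (D.chart.open_source.mem_nhds hy))
  refine ⟨F, hF, hFq, ?_⟩
  rintro t rfl
  have h1 : ContinuousAt (fun t : k.NormalBundle ↦ k t.1) t :=
    (k.contMDiff.continuous.comp k.normal.continuous_proj).continuousAt
  filter_upwards [h1.eventually hFq] with t' ht'
  exact ht'.symm

/-- Over `V` the functions `p` and `r` vanish on `X`, so their differentials descend to the normal
spaces and the chosen representative does not matter. -/
lemma linearized_cls {x : X} (hx : x ∈ V) (v : TangentSpace IZ (k x)) :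
    D.linearized k ⟨x, k.normal.cls x v⟩ = (fun μ ↦ D.x μ (k x),
      fun μ ↦ diff IZ (D.p μ) (k x) v, fun a ↦ diff IZ (D.r a) (k x) v) := by
  refine Prod.ext rfl (Prod.ext (funext fun μ ↦ ?_) (funext fun a ↦ ?_))
  · obtain ⟨F, σ, h1, h2, h3⟩ := D.exists_section_p hV hD hx μ
    refine (h3 ⟨x, k.normal.cls x v⟩ rfl).self_of_nhds.trans ?_
    rw [σ.bar_cls, ← h1.eq, diff_congr h2]
  · obtain ⟨F, σ, h1, h2, h3⟩ := D.exists_section_r hV hD hx a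
    refine (h3 ⟨x, k.normal.cls x v⟩ rfl).self_of_nhds.trans ?_
    rw [σ.bar_cls, ← h1.eq, diff_congr h2]

lemma contMDiffAt_linearized {t : k.NormalBundle} (ht : t.1 ∈ V) :
    ContMDiffAt (normalModel IX EX EZ) 𝓘(ℝ, (Fin m → ℝ) × (Fin m → ℝ) × (Fin n → ℝ)) ∞
      (D.linearized k) t := by
  refine ContMDiffAt.prodMk_space (contMDiffAt_pi_space.2 fun μ ↦ ?_)
    (ContMDiffAt.prodMk_space (contMDiffAt_pi_space.2 fun μ ↦ ?_)
      (contMDiffAt_pi_space.2 fun a ↦ ?_))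
  · obtain ⟨F, hF, -, h⟩ := D.exists_fun_x hV hD ht μ
    have h1 : IsSmoothFun IX fun x ↦ F (k x) := hF.comp k.contMDiff
    exact (h1.comp_proj t).congr_of_eventuallyEq (h t rfl)
  · obtain ⟨F, σ, -, -, h⟩ := D.exists_section_p hV hD ht μ
    exact (σ.smooth_bar t).congr_of_eventuallyEq (h t rfl)
  · obtain ⟨F, σ, -, -, h⟩ := D.exists_section_r hV hD ht a
    exact (σ.smooth_bar t).congr_of_eventuallyEq (h t rfl)

/-- `w♯ (∑ q_ν dp_ν)` is tangent to `X` by coisotropy, and `{x^μ, p_ν} = δ` gives its components.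
Thus the `x^μ` have independent differentials on `X`. -/
lemma exists_tangent {x : X} (hP : P.IsCoisotropic k) (hx : x ∈ V) (q : Fin m → ℝ) :
    ∃ u, ∀ μ, diff IZ (D.x μ) (k x) (mfderiv IX IZ k x u) = q μ := by
  obtain ⟨u, hu⟩ := hP x (∑ ν, q ν • diff IZ (D.p ν) (k x)) fun u ↦ by
    rw [_root_.sum_apply]
    refine Finset.sum_eq_zero fun ν _ ↦ ?_
    obtain ⟨F, σ, h1, h2, -⟩ := D.exists_section_p hV hD hx ν
    rw [← diff_congr h2, h1.eq]
    exact (congrArg (q ν * ·) (σ.apply_tangent x u)).trans (mul_zero _)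
  refine ⟨u, fun μ ↦ ?_⟩
  rw [hu, map_sum, map_sum]
  have h1 : ∀ ν, diff IZ (D.x μ) (k x) (P.sharp (k x) (q ν • diff IZ (D.p ν) (k x))) =
      q ν * if μ = ν then 1 else 0 := fun ν ↦ by
    rw [map_smul, map_smul, ← D.bracket_x_p _ (hD x hx).1]
    rfl
  simp only [h1]
  simp

/-- Over `V` a point of `X` is recovered from its `x`-coordinates. Two representatives with equal
`p`- and `r`-components differ by a tangent vector of `X`: subtract one with the right
`x`-components and every coordinate vanishes. -/
lemma injOn_linearized (hP : P.IsCoisotropic k) (hk : Function.Injective k) :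
    InjOn (D.linearized k) {t | t.1 ∈ V} := by
  rintro ⟨x, a⟩ hx ⟨x', a'⟩ hx' h
  obtain ⟨v, rfl⟩ := k.normal.cls_surjective x a
  obtain ⟨v', rfl⟩ := k.normal.cls_surjective x' a'
  rw [D.linearized_cls hV hD hx, D.linearized_cls hV hD hx'] at h
  have hc : ∀ y ∈ V, D.chart (k y) = (fun μ ↦ D.x μ (k y), 0, 0) := fun y hy ↦
    Prod.ext rfl (Prod.ext (funext (hD y hy).2.1) (funext (hD y hy).2.2))
  obtain rfl : x = x' := by
    apply hk
    apply D.chart.injOn (hD x hx).1 (hD x' hx').1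
    rw [hc x hx, hc x' hx']
    exact Prod.ext (funext fun μ ↦ congrFun (congrArg (fun c ↦ c.1) h) μ) rfl
  obtain ⟨u, hu⟩ := D.exists_tangent hV hD hP hx (fun μ ↦ diff IZ (D.x μ) (k x) (v - v'))
  have hσp : ∀ μ, diff IZ (D.p μ) (k x) (mfderiv IX IZ k x u) = 0 := fun μ ↦ by
    obtain ⟨F, σ, h1, h2, -⟩ := D.exists_section_p hV hD hx μ
    rw [← diff_congr h2, h1.eq]
    exact σ.apply_tangent x u
  have hσr : ∀ a, diff IZ (D.r a) (k x) (mfderiv IX IZ k x u) = 0 := fun a ↦ by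
    obtain ⟨F, σ, h1, h2, -⟩ := D.exists_section_r hV hD hx a
    rw [← diff_congr h2, h1.eq]
    exact σ.apply_tangent x u
  have h0 : v - v' - mfderiv IX IZ k x u = 0 := by
    refine D.eq_zero_of_diff (hD x hx).1 (fun μ ↦ ?_) (fun μ ↦ ?_) fun a ↦ ?_
    · rw [map_sub, hu, sub_self]
    · rw [map_sub, hσp, map_sub, sub_zero, sub_eq_zero]
      exact congrFun (congrArg (fun c ↦ c.2.1) h) μ
    · rw [map_sub, hσr, map_sub, sub_zero, sub_eq_zero]
      exact congrFun (congrArg (fun c ↦ c.2.2) h) a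
  congr 1
  rw [← sub_eq_zero, ← map_sub, k.normal.cls_eq_zero]
  exact ⟨u, (sub_eq_zero.1 h0).symm⟩

/-- The dimensions agree, so surjectivity suffices. Vertical vectors realize all `(p, r)`-components
without `x`-component, and lifts of tangent vectors of `X` along a section through `t` realize all
`x`-components. -/
lemma bijective_mfderiv_linearized (hP : P.IsCoisotropic k) {t : k.NormalBundle} (ht : t.1 ∈ V) :
    Function.Bijective (mfderiv (normalModel IX EX EZ)
      𝓘(ℝ, (Fin m → ℝ) × (Fin m → ℝ) × (Fin n → ℝ)) (D.linearized k) t) := by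
  let T : EX × CokerModel EX EZ →ₗ[ℝ] (Fin m → ℝ) × (Fin m → ℝ) × (Fin n → ℝ) :=
    (show EX × CokerModel EX EZ →L[ℝ] (Fin m → ℝ) × (Fin m → ℝ) × (Fin n → ℝ) from
      mfderiv (normalModel IX EX EZ) 𝓘(ℝ, (Fin m → ℝ) × (Fin m → ℝ) × (Fin n → ℝ))
        (D.linearized k) t).toLinearMap
  have hT : ∀ L : (Fin m → ℝ) × (Fin m → ℝ) × (Fin n → ℝ) →L[ℝ] ℝ,
      ∀ v : TangentSpace (normalModel IX EX EZ) t,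
      diff (normalModel IX EX EZ) (fun t ↦ L (D.linearized k t)) t v = L (T v) := fun L v ↦
    diff_clm_comp L ((D.contMDiffAt_linearized hV hD ht).mdifferentiableAt (by simp)) v
  have hZ : finrank ℝ EZ = finrank ℝ ((Fin m → ℝ) × (Fin m → ℝ) × (Fin n → ℝ)) := by
    let C : EZ →ₗ[ℝ] (Fin m → ℝ) × (Fin m → ℝ) × (Fin n → ℝ) :=
      (show EZ →L[ℝ] (Fin m → ℝ) × (Fin m → ℝ) × (Fin n → ℝ) from
        mfderiv IZ 𝓘(ℝ, (Fin m → ℝ) × (Fin m → ℝ) × (Fin n → ℝ)) D.chart (k t.1)).toLinearMap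
    exact (LinearEquiv.ofBijective C (D.bijective_mfderiv (hD _ ht).1)).finrank_eq
  have hle : finrank ℝ EX ≤ finrank ℝ EZ := LinearMap.finrank_le_finrank_of_injective
    (f := (show EX →L[ℝ] EZ from mfderiv IX IZ k t.1).toLinearMap) (k.injective_mfderiv t.1)
  have hfin : finrank ℝ (EX × CokerModel EX EZ) =
      finrank ℝ ((Fin m → ℝ) × (Fin m → ℝ) × (Fin n → ℝ)) := by
    rw [← hZ, Module.finrank_prod, Module.finrank_fin_fun]
    omega
  suffices hs : Function.Surjective T from
    ⟨(LinearMap.injective_iff_surjective_of_finrank_eq_finrank hfin).2 hs, hs⟩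
  have hvert : ∀ p r, ∃ v, T v = (0, p, r) := by
    intro p r
    obtain ⟨w, hwp, hwr⟩ := D.exists_diff_eq (hD _ ht).1 p r
    refine ⟨vertAt t (k.normal.cls t.1 w), Prod.ext (funext fun μ ↦ ?_)
      (Prod.ext (funext fun μ ↦ ?_) (funext fun a ↦ ?_))⟩
    · refine (hT (cx m n μ) _).symm.trans ?_
      obtain ⟨F, hF, -, h⟩ := D.exists_fun_x hV hD ht μ
      have h1 : IsSmoothFun IX fun x ↦ F (k x) := hF.comp k.contMDiff
      exact (congrArg (fun A : EX × CokerModel EX EZ →L[ℝ] ℝ ↦ A _) (diff_congr (h t rfl))).trans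
        (diff_proj_vertAt h1 t _)
    · refine (hT (cp m n μ) _).symm.trans ?_
      obtain ⟨F, σ, h1, h2, h⟩ := D.exists_section_p hV hD ht μ
      refine (congrArg (fun A : EX × CokerModel EX EZ →L[ℝ] ℝ ↦ A _)
        (diff_congr (h t rfl))).trans ((diff_bar_vertAt σ t _).trans ?_)
      rw [σ.bar_cls, ← h1.eq, diff_congr h2, hwp]
    · refine (hT (cr m n a) _).symm.trans ?_
      obtain ⟨F, σ, h1, h2, h⟩ := D.exists_section_r hV hD ht a
      refine (congrArg (fun A : EX × CokerModel EX EZ →L[ℝ] ℝ ↦ A _)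
        (diff_congr (h t rfl))).trans ((diff_bar_vertAt σ t _).trans ?_)
      rw [σ.bar_cls, ← h1.eq, diff_congr h2, hwr]
  have hhor : ∀ q, ∃ v, (T v).1 = q := by
    intro q
    obtain ⟨u, hu⟩ := D.exists_tangent hV hD hP ht q
    obtain ⟨v, hv⟩ := k.normal.cls_surjective t.1 t.2
    obtain ⟨U, hU, hUv⟩ := exists_field_eq (I := IZ) (k t.1) v
    have hs := contMDiff_cls_field (k := k) hU
    have hst : (⟨t.1, k.normal.cls t.1 (U (k t.1))⟩ : k.NormalBundle) = t := by rw [hUv, hv]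
    refine ⟨(mfderiv IX (normalModel IX EX EZ)
      (fun y ↦ (⟨y, k.normal.cls y (U (k y))⟩ : k.NormalBundle)) t.1 u : EX × CokerModel EX EZ),
      funext fun μ ↦ ?_⟩
    refine (hT (cx m n μ) _).symm.trans ?_
    obtain ⟨F, hF, hFx, h⟩ := D.exists_fun_x hV hD ht μ
    have h1 : IsSmoothFun IX fun x ↦ F (k x) := hF.comp k.contMDiff
    refine (congrArg (fun A : EX × CokerModel EX EZ →L[ℝ] ℝ ↦ A _) (diff_congr (h t rfl))).trans ?_
    have h2 := diff_section_comp (φ := k.normal) hs (h1.comp_proj (φ := k.normal)) t.1 u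
    rw [hst] at h2
    refine h2.trans ?_
    rw [← hu μ, ← diff_congr hFx]
    exact diff_comp (hF.mdiff _) (k.contMDiff.mdifferentiableAt (by simp)) u
  rintro ⟨q, p, r⟩
  obtain ⟨v, hv⟩ := hhor q
  obtain ⟨w, hw⟩ := hvert (p - (T v).2.1) (r - (T v).2.2)
  refine ⟨v + w, ?_⟩
  rw [map_add, hw]
  refine Prod.ext ?_ (Prod.ext ?_ ?_)
  · simp [hv]
  · simp
  · simp

end Adapted

end DarbouxChart

/-- Darboux coordinates adapted to a coisotropic immersion induce Darboux coordinates of its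
linearization. -/
theorem IsLinearization.exists_darbouxChart {hP : P.IsCoisotropic k}
    {P' : PoissonStructure (normalModel IX EX EZ) k.NormalBundle} (h' : IsLinearization hP P')
    (hk : Function.Injective k) {m n : ℕ} {x₀ : X} (D : P.DarbouxChart (k x₀) m n) {V : Set X}
    (hV : IsOpen V) (hx₀ : x₀ ∈ V) (hD : ∀ x ∈ V, k x ∈ D.chart.source ∧
      (∀ μ, D.p μ (k x) = 0) ∧ ∀ a, D.r a (k x) = 0) :
    ∃ D' : P'.DarbouxChart (k.zero x₀) m n, D'.chart.source = {t | t.proj ∈ V} ∧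
      (∀ x ∈ V, ∀ v : TangentSpace IZ (k x),
        (∀ μ, D'.x μ ⟨x, k.normal.cls x v⟩ = D.x μ (k x)) ∧
        (∀ μ, D'.p μ ⟨x, k.normal.cls x v⟩ = diff IZ (D.p μ) (k x) v) ∧
        (∀ a, D'.r a ⟨x, k.normal.cls x v⟩ = diff IZ (D.r a) (k x) v)) ∧
      ∀ c a b r, D'.w c a b r = D.w c a b 0 := by
  have : Nonempty k.NormalBundle := ⟨k.zero x₀⟩
  have hsm : ContMDiffOn (normalModel IX EX EZ) 𝓘(ℝ, (Fin m → ℝ) × (Fin m → ℝ) × (Fin n → ℝ)) ∞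
      (D.linearized k) {t | t.1 ∈ V} :=
    fun t ht ↦ (D.contMDiffAt_linearized hV hD ht).contMDiffWithinAt
  obtain ⟨e, he, heD, hes⟩ := exists_openPartialHomeomorph (I := normalModel IX EX EZ)
    (hV.preimage k.normal.continuous_proj) hsm (D.injOn_linearized hV hD hP hk)
    fun t ht ↦ D.bijective_mfderiv_linearized hV hD hP ht
  have heD' : (e : k.NormalBundle → _) = D.linearized k := funext heD
  -- Brackets of the new coordinates reduce to `Z`: that of two linear ones is the differential of a
  -- bracket, that of a base and a linear one is the value of a bracket.
  have hbar : ∀ {t : k.NormalBundle} {u v : k.NormalBundle → ℝ} {σ τ : AnnSection k.normal}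
      {F G q q' : Z → ℝ}, u =ᶠ[𝓝 t] σ.bar → v =ᶠ[𝓝 t] τ.bar → σ.HasPotential F t.1 →
      τ.HasPotential G t.1 → F =ᶠ[𝓝 (k t.1)] q → G =ᶠ[𝓝 (k t.1)] q' →
      ∃ w, k.normal.cls t.1 w = t.2 ∧
        P'.bracket u v t = diff IZ (P.bracket q q') (k t.1) w := by
    intro t u v σ τ F G q q' hu hv hF hG hFq hGq
    obtain ⟨x, a⟩ := t
    obtain ⟨w, rfl⟩ := k.normal.cls_surjective x a
    refine ⟨w, rfl, ?_⟩
    rw [P'.bracket_congr (diff_congr hu) (diff_congr hv), h'.bracket_bar_bar,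
      ← diff_congr (P.eventuallyEq_bracket hFq hGq)]
    refine ((AnnSection.bracket hP σ τ).bar_cls x w).trans ?_
    rw [← (hF.bracket hP hG).eq]
  have hmix : ∀ {t : k.NormalBundle} {u v : k.NormalBundle → ℝ} {τ : AnnSection k.normal}
      {F G q q' : Z → ℝ}, u =ᶠ[𝓝 t] (fun t ↦ F (k t.1)) → v =ᶠ[𝓝 t] τ.bar → IsSmoothFun IZ F →
      τ.HasPotential G t.1 → F =ᶠ[𝓝 (k t.1)] q → G =ᶠ[𝓝 (k t.1)] q' →
        P'.bracket u v t = P.bracket q q' (k t.1) := by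
    intro t u v τ F G q q' hu hv hF hG hFq hGq
    have hFk : IsSmoothFun IX fun x ↦ F (k x) := hF.comp k.contMDiff
    rw [P'.bracket_congr (diff_congr hu) (diff_congr hv), h'.bracket_proj_bar τ hFk,
      anchorDiff_eq hP hG.eq hF (.of_forall fun _ ↦ rfl),
      P.bracket_congr (diff_congr hFq) (diff_congr hGq)]
  have hzero : ∀ {x : X} {q q' : Z → ℝ}, x ∈ V →
      (∀ z ∈ D.chart.source, P.bracket q q' z = 0) → diff IZ (P.bracket q q') (k x) = 0 := by
    intro x q q' hx h
    have h1 : P.bracket q q' =ᶠ[𝓝 (k x)] fun _ ↦ 0 := by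
      filter_upwards [D.chart.open_source.mem_nhds (hD x hx).1] with z hz using h z hz
    rw [diff_congr h1, diff_const]
  have hlin : ∀ {t : k.NormalBundle} {w}, t.1 ∈ V → k.normal.cls t.1 w = t.2 → ∀ c,
      (D.linearized k t).2.2 c = diff IZ (D.r c) (k t.1) w := by
    rintro ⟨x, q⟩
    change ∀ {w : TangentSpace IZ (k x)}, x ∈ V → k.normal.cls x w = q → ∀ c,
      (D.linearized k ⟨x, q⟩).2.2 c = diff IZ (D.r c) (k x) w
    rintro w hx rfl c
    rw [D.linearized_cls hV hD hx]
  have hmem : ∀ {t : k.NormalBundle}, t ∈ e.source → t.1 ∈ V := fun ht ↦ by rwa [he] at ht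
  refine ⟨{
    chart := e
    contMDiffOn_chart := by rw [heD', he]; exact hsm
    contMDiffOn_symm := hes
    mem_source := by rw [he]; exact hx₀
    centered := ?_
    w := fun c a b _ ↦ D.w c a b 0
    contDiffOn_w := fun _ _ _ ↦ contDiffOn_const
    bracket_x_x := ?_
    bracket_p_p := ?_
    bracket_x_p := ?_
    bracket_x_r := ?_
    bracket_p_r := ?_
    bracket_r_r := ?_ }, he, ?_, fun _ _ _ _ ↦ rfl⟩
  · rw [heD]
    have h0 : k.zero x₀ = ⟨x₀, k.normal.cls x₀ 0⟩ := by rw [map_zero]; rfl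
    have h1 : ∀ μ, D.x μ (k x₀) = 0 := fun μ ↦
      congrFun (congrArg (fun c ↦ c.1) D.centered) μ
    rw [h0, D.linearized_cls hV hD hx₀]
    refine Prod.ext (funext h1) (Prod.ext (funext fun μ ↦ map_zero _) (funext fun a ↦ map_zero _))
  · intro t ht μ ν
    simp only [heD]
    obtain ⟨F, hF, hFq, h1⟩ := D.exists_fun_x hV hD (hmem ht) μ
    obtain ⟨G, hG, hGq, h2⟩ := D.exists_fun_x hV hD (hmem ht) ν
    rw [P'.bracket_congr (diff_congr (h1 t rfl)) (diff_congr (h2 t rfl))]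
    exact h'.bracket_proj_proj (hF.comp k.contMDiff) (hG.comp k.contMDiff) t
  · intro t ht μ ν
    simp only [heD]
    obtain ⟨F, σ, hF, hFq, h1⟩ := D.exists_section_p hV hD (hmem ht) μ
    obtain ⟨G, τ, hG, hGq, h2⟩ := D.exists_section_p hV hD (hmem ht) ν
    obtain ⟨w, -, hw⟩ := hbar (h1 t rfl) (h2 t rfl) hF hG hFq hGq
    rw [hw, hzero (q := D.p μ) (q' := D.p ν) (hmem ht) fun z hz ↦ D.bracket_p_p z hz μ ν]
    rfl
  · intro t ht μ ν
    simp only [heD]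
    obtain ⟨F, hF, hFq, h1⟩ := D.exists_fun_x hV hD (hmem ht) μ
    obtain ⟨G, τ, hG, hGq, h2⟩ := D.exists_section_p hV hD (hmem ht) ν
    rw [hmix (h1 t rfl) (h2 t rfl) hF hG hFq hGq]
    exact D.bracket_x_p _ (hD _ (hmem ht)).1 μ ν
  · intro t ht μ a
    simp only [heD]
    obtain ⟨F, hF, hFq, h1⟩ := D.exists_fun_x hV hD (hmem ht) μ
    obtain ⟨G, τ, hG, hGq, h2⟩ := D.exists_section_r hV hD (hmem ht) a
    rw [hmix (h1 t rfl) (h2 t rfl) hF hG hFq hGq]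
    exact D.bracket_x_r _ (hD _ (hmem ht)).1 μ a
  · intro t ht μ a
    simp only [heD]
    obtain ⟨F, σ, hF, hFq, h1⟩ := D.exists_section_p hV hD (hmem ht) μ
    obtain ⟨G, τ, hG, hGq, h2⟩ := D.exists_section_r hV hD (hmem ht) a
    obtain ⟨w, -, hw⟩ := hbar (h1 t rfl) (h2 t rfl) hF hG hFq hGq
    rw [hw, hzero (q := D.p μ) (q' := D.r a) (hmem ht) fun z hz ↦ D.bracket_p_r z hz μ a]
    rfl
  · intro t ht a b
    have htV := hmem ht
    obtain ⟨hs, -, hr⟩ := hD _ htV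
    simp only [heD]
    obtain ⟨F, σ, hF, hFq, h1⟩ := D.exists_section_r hV hD (hmem ht) a
    obtain ⟨G, τ, hG, hGq, h2⟩ := D.exists_section_r hV hD (hmem ht) b
    obtain ⟨w, hwt, hw⟩ := hbar (h1 t rfl) (h2 t rfl) hF hG hFq hGq
    have h3 : P.bracket (D.r a) (D.r b) =ᶠ[𝓝 (k t.1)]
        fun z ↦ ∑ c, D.w c a b (D.chart z).2.2 * D.r c z := by
      filter_upwards [D.chart.open_source.mem_nhds hs] with z hz using D.bracket_r_r z hz a b
    have hr0 : (D.chart (k t.1)).2.2 = 0 := funext hr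
    have ho : IsOpen ((fun z ↦ (D.chart z).2.2) '' D.chart.source) := by
      have h4 : (fun z ↦ (D.chart z).2.2) '' D.chart.source =
          (fun c : (Fin m → ℝ) × (Fin m → ℝ) × (Fin n → ℝ) ↦ c.2.2) '' D.chart.target := by
        rw [← D.chart.image_source_eq_target, image_image]
      rw [h4]
      exact (isOpenMap_snd.comp isOpenMap_snd) _ D.chart.open_target
    have hwd : ∀ c, MDifferentiableAt IZ 𝓘(ℝ, ℝ) (fun z ↦ D.w c a b (D.chart z).2.2) (k t.1) := by
      intro c
      have h5 : ContDiffAt ℝ ∞ (D.w c a b) (D.chart (k t.1)).2.2 :=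
        (D.contDiffOn_w c a b).contDiffAt (ho.mem_nhds ⟨_, hs, rfl⟩)
      have h6 : MDifferentiableAt IZ 𝓘(ℝ, Fin n → ℝ) (fun z ↦ (D.chart z).2.2) (k t.1) :=
        (((ContinuousLinearMap.snd ℝ _ _).comp (ContinuousLinearMap.snd ℝ (Fin m → ℝ)
          ((Fin m → ℝ) × (Fin n → ℝ)))).contMDiff (n := ∞) |>.mdifferentiableAt (by simp)).comp
          (k t.1) (D.mdifferentiableAt_chart hs)
      exact (h5.contMDiffAt.mdifferentiableAt (by simp)).comp (k t.1) h6
    have hrd : ∀ c, MDifferentiableAt IZ 𝓘(ℝ, ℝ) (D.r c) (k t.1) := fun c ↦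
      ((D.contMDiffOn_comp (DarbouxChart.cr m n c)).contMDiffAt
        (D.chart.open_source.mem_nhds hs)).mdifferentiableAt (by simp)
    have hmul : ∀ c, MDifferentiableAt IZ 𝓘(ℝ, ℝ)
        (fun z ↦ D.w c a b (D.chart z).2.2 * D.r c z) (k t.1) := fun c ↦ (hwd c).mul (hrd c)
    -- Differentiating `∑ w^c_{ab}(r) r_c` where `r = 0` leaves only the terms `w^c_{ab}(0) dr_c`.
    rw [hw, diff_congr h3, diff_sum hmul, _root_.sum_apply]
    refine Finset.sum_congr rfl fun c _ ↦ ?_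
    rw [diff_mul (hwd c) (hrd c), hr0, hr c, zero_smul, add_zero]
    refine congrArg (D.w c a b 0 * ·) ?_
    exact (hlin htV hwt c).symm
  · intro x hx v
    have h1 : e ⟨x, k.normal.cls x v⟩ = _ := (heD _).trans (D.linearized_cls hV hD hx v)
    exact ⟨fun μ ↦ congrFun (congrArg (fun c ↦ c.1) h1) μ,
      fun μ ↦ congrFun (congrArg (fun c ↦ c.2.1) h1) μ,
      fun a ↦ congrFun (congrArg (fun c ↦ c.2.2) h1) a⟩

end PoissonStructure
end Darboux

/-! ### The zero section and the linearization of the linearization -/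

section ZeroSection

variable {EX HX X : Type*} [NormedAddCommGroup EX] [NormedSpace ℝ EX] [TopologicalSpace HX]
  [TopologicalSpace X] [ChartedSpace HX X]
  {EZ HZ Z : Type*} [NormedAddCommGroup EZ] [NormedSpace ℝ EZ] [TopologicalSpace HZ]
  [TopologicalSpace Z] [ChartedSpace HZ Z]
  {IX : ModelWithCorners ℝ EX HX} {IZ : ModelWithCorners ℝ EZ HZ}
  [IsManifold IX ∞ X] [IsManifold IZ ∞ Z]
  {P : PoissonStructure IZ Z} {k : SmoothImmersion IX IZ X Z}
  [FiniteDimensional ℝ EX] [FiniteDimensional ℝ EZ] [T2Space Z] [T2Space X] [IX.Boundaryless]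
  [IZ.Boundaryless]

open SmoothImmersion AnnSection TangentMono

section General

variable {EA HA A : Type*} [NormedAddCommGroup EA] [NormedSpace ℝ EA] [TopologicalSpace HA]
  [TopologicalSpace A] [ChartedSpace HA A] {IA : ModelWithCorners ℝ EA HA} [IsManifold IA ∞ A]
  {g : X → A} {f : X → Z} {φ : TangentMono IX IA IZ g f} [FiniteDimensional ℝ EA]

/-- The fibres of the quotient bundle are isomorphic to the typical fibre. -/
def TangentMono.fibEquiv (φ : TangentMono IX IA IZ g f) (x : X) :
    φ.Coker x ≃ₗ[ℝ] CokerModel EA EZ :=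
  LinearEquiv.ofLinearMap (φ.fibTriv x x) (φ.fibSymm x x)
    (LinearMap.ext fun v ↦ φ.fibTriv_fibSymm (φ.mem_dom x) v)
    (LinearMap.ext fun v ↦ φ.fibSymm_fibTriv (φ.mem_dom x) v)

lemma diff_clm_apply_eq_zero {E H M F : Type*} [NormedAddCommGroup E] [NormedSpace ℝ E]
    [TopologicalSpace H] {I : ModelWithCorners ℝ E H} [TopologicalSpace M] [ChartedSpace H M]
    [NormedAddCommGroup F] [NormedSpace ℝ F] {A : M → F →L[ℝ] ℝ} {B : M → F} {z : M}
    (hA : MDifferentiableAt I 𝓘(ℝ, F →L[ℝ] ℝ) A z) (hB : MDifferentiableAt I 𝓘(ℝ, F) B z)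
    (hA0 : A z = 0) (hB0 : B z = 0) : diff I (fun y ↦ A y (B y)) z = 0 := by
  have h4 : HasFDerivAt (fun p : (F →L[ℝ] ℝ) × F ↦ p.1 p.2)
      (0 : (F →L[ℝ] ℝ) × F →L[ℝ] ℝ) (A z, B z) := by
    refine ((hasFDerivAt_fst (𝕜 := ℝ)).clm_apply (hasFDerivAt_snd (𝕜 := ℝ))).congr_fderiv ?_
    ext <;> simp [hA0, hB0]
  ext v
  refine (diff_comp (I' := 𝓘(ℝ, (F →L[ℝ] ℝ) × F)) (f := fun p : (F →L[ℝ] ℝ) × F ↦ p.1 p.2)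
    (g := fun y ↦ (A y, B y)) (z := z) h4.differentiableAt.mdifferentiableAt
    (hA.prodMk_space hB) v).trans ?_
  have h7 : diff 𝓘(ℝ, (F →L[ℝ] ℝ) × F) (fun p : (F →L[ℝ] ℝ) × F ↦ p.1 p.2) (A z, B z) = 0 :=
    (mfderiv_eq_fderiv).trans h4.fderiv
  rw [h7]
  rfl

/-- At the zero vector over `x` both factors of the pairing vanish, the covector by assumption and
the fibre coordinate. -/
lemma AnnSection.diff_bar_eq_zero {σ : AnnSection φ} {x : X} (hσ : σ.toFun x = 0) :
    diff (IX.prod 𝓘(ℝ, CokerModel EA EZ)) σ.bar (⟨x, 0⟩ : φ.Total) = 0 := by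
  let t₀ : φ.Total := ⟨x, 0⟩
  have h1 := ((contMDiffAt_hom_bundle _).1 (σ.smooth x)).2
  have h2 : ContMDiffAt (IX.prod 𝓘(ℝ, CokerModel EA EZ)) 𝓘(ℝ, EZ →L[ℝ] ℝ) ∞
      (fun t : φ.Total ↦ ContinuousLinearMap.inCoordinates EZ (TangentSpace IZ) ℝ
        (Bundle.Trivial Z ℝ) (f x) (f t.1) (f x) (f t.1) (σ.toFun t.1)) t₀ :=
    ContMDiffAt.comp (g := fun y ↦ ContinuousLinearMap.inCoordinates EZ (TangentSpace IZ) ℝ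
        (Bundle.Trivial Z ℝ) (f x) (f y) (f x) (f y) (σ.toFun y)) t₀ h1
      (φ.contMDiff_proj t₀)
  have h3 : ContMDiffAt (IX.prod 𝓘(ℝ, CokerModel EA EZ)) 𝓘(ℝ, EZ) ∞
      (fun t : φ.Total ↦ φ.sec x (φ.fibTriv x t.1 t.2)) t₀ :=
    (φ.sec x).contMDiff.contMDiffAt.comp t₀ (φ.contMDiffAt_fibTriv t₀)
  refine (diff_congr ?_).trans (diff_clm_apply_eq_zero (h2.mdifferentiableAt (by simp))
    (h3.mdifferentiableAt (by simp)) ?_ ?_)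
  · filter_upwards [φ.continuous_proj.continuousAt.eventually (φ.eventually_dom x)] with t ht
    rw [σ.bar_eq_fibTriv ht]
    simp [ContinuousLinearMap.inCoordinates]
  · ext v
    refine Eq.trans ?_ (congrArg (fun T : TangentSpace IZ (f x) →L[ℝ] ℝ ↦ T
      ((trivializationAt EZ (TangentSpace IZ) (f x)).symmL ℝ (f x) v)) hσ)
    simp [ContinuousLinearMap.inCoordinates]
  · change φ.sec x (φ.fibTriv x x 0) = 0
    rw [map_zero, map_zero]

/-- On the zero section the differential of `σ̄` depends on the value of `σ` alone, since the
difference of two such sections vanishes there. This identifies the conormal spaces of `X` and of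
the zero section. -/
lemma AnnSection.diff_bar_congr {σ τ : AnnSection φ} {x : X} (h : σ.toFun x = τ.toFun x) :
    diff (IX.prod 𝓘(ℝ, CokerModel EA EZ)) σ.bar (⟨x, 0⟩ : φ.Total) =
      diff (IX.prod 𝓘(ℝ, CokerModel EA EZ)) τ.bar (⟨x, 0⟩ : φ.Total) := by
  have h1 := AnnSection.diff_bar_eq_zero (φ := φ) (x := x)
    (σ := smulAdd (contMDiff_const (c := (-1 : ℝ))) σ τ) (by
      ext v
      change (-1 : ℝ) * σ.toFun x v + τ.toFun x v = 0
      rw [h]; ring)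
  have h2 := diff_bar_smulAdd (φ := φ) (contMDiff_const (c := (-1 : ℝ))) σ τ ⟨x, 0⟩
  have h3 : diff (IX.prod 𝓘(ℝ, CokerModel EA EZ)) (fun _ : φ.Total ↦ (-1 : ℝ)) ⟨x, 0⟩ = 0 :=
    diff_const _ _
  rw [h1, h3] at h2
  ext v
  have h4 : (0 : ℝ) = -1 * diff (IX.prod 𝓘(ℝ, CokerModel EA EZ)) σ.bar (⟨x, 0⟩ : φ.Total) v +
      σ.bar (⟨x, 0⟩ : φ.Total) * 0 +
      diff (IX.prod 𝓘(ℝ, CokerModel EA EZ)) τ.bar (⟨x, 0⟩ : φ.Total) v := congrArg (fun T : TangentSpace (IX.prod 𝓘(ℝ, CokerModel EA EZ))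
    (⟨x, 0⟩ : φ.Total) →L[ℝ] ℝ ↦ T v) h2
  linarith

end General

namespace SmoothImmersion

lemma diff_bar_vert (σ : AnnSection k.normal) (x : X) (b : k.normal.Coker x) :
    diff (normalModel IX EX EZ) σ.bar (k.zero x) (k.vert x b) = σ.bar ⟨x, b⟩ := by
  have h1 : ContMDiff 𝓘(ℝ, ℝ) (normalModel IX EX EZ) ∞
      (fun s : ℝ ↦ (⟨x, s • b⟩ : k.NormalBundle)) := by
    simpa only [zero_add] using k.normal.contMDiff_line x 0 b
  have h := diff_mfderiv_curve σ.smooth_bar h1 0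
  have h0 : (⟨x, (0 : ℝ) • b⟩ : k.NormalBundle) = k.zero x := by rw [zero_smul]; rfl
  refine (congrArg (fun p : k.NormalBundle ↦ diff (normalModel IX EX EZ) σ.bar p
      (k.vert x b : EX × CokerModel EX EZ)) h0).symm.trans (h.trans ?_)
  simp only [σ.bar_smul]
  simp

lemma diff_proj_vert {h : X → ℝ} (hh : IsSmoothFun IX h) (x : X) (b : k.normal.Coker x) :
    diff (normalModel IX EX EZ) (fun t : k.NormalBundle ↦ h t.1) (k.zero x) (k.vert x b) = 0 := by
  have h1 : ContMDiff 𝓘(ℝ, ℝ) (normalModel IX EX EZ) ∞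
      (fun s : ℝ ↦ (⟨x, s • b⟩ : k.NormalBundle)) := by
    simpa only [zero_add] using k.normal.contMDiff_line x 0 b
  have h2 := diff_mfderiv_curve (u := fun t : k.NormalBundle ↦ h t.1) hh.comp_proj h1 0
  have h0 : (⟨x, (0 : ℝ) • b⟩ : k.NormalBundle) = k.zero x := by rw [zero_smul]; rfl
  refine (congrArg (fun p : k.NormalBundle ↦ diff (normalModel IX EX EZ)
      (fun t : k.NormalBundle ↦ h t.1) p
      (k.vert x b : EX × CokerModel EX EZ)) h0).symm.trans (h2.trans ?_)
  simp

/-- The linear isomorphism of a fibre onto the vertical vectors at the zero section. -/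
lemma vert_add_smul (x : X) (c : ℝ) (a b : k.normal.Coker x) :
    k.vert x (c • a + b) = c • k.vert x a + k.vert x b := by
  refine vector_ext (φ := k.normal) (t := k.zero x) (fun σ ↦ ?_) fun h hh ↦ ?_
  · refine (diff_bar_vert σ x _).trans (Eq.trans ?_ ((map_add _ _ _).trans (congrArg₂ (· + ·)
      ((map_smul _ c _).trans (congrArg (c • ·) (diff_bar_vert σ x a)))
      (diff_bar_vert σ x b))).symm)
    simp [bar]
  · refine (diff_proj_vert hh x _).trans (Eq.trans ?_ ((map_add _ _ _).trans (congrArg₂ (· + ·)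
      ((map_smul _ c _).trans (congrArg (c • ·) (diff_proj_vert hh x a)))
      (diff_proj_vert hh x b))).symm)
    simp

lemma diff_bar_zero (σ : AnnSection k.normal) (x : X) (u : TangentSpace IX x) :
    diff (normalModel IX EX EZ) σ.bar (k.zero x)
      (mfderiv IX (normalModel IX EX EZ) k.zero x u) = 0 := by
  refine (diff_section_comp (φ := k.normal) k.zero.contMDiff σ.smooth_bar x u).trans ?_
  have h1 : (fun y ↦ σ.bar (k.zero y)) = fun _ ↦ 0 := funext fun y ↦ σ.bar_zero y
  rw [h1, diff_const]
  rfl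

lemma diff_proj_zero {h : X → ℝ} (hh : IsSmoothFun IX h) (x : X) (u : TangentSpace IX x) :
    diff (normalModel IX EX EZ) (fun t : k.NormalBundle ↦ h t.1) (k.zero x)
      (mfderiv IX (normalModel IX EX EZ) k.zero x u) = diff IX h x u :=
  diff_section_comp (φ := k.normal) k.zero.contMDiff hh.comp_proj x u

/-- The conormal covectors of the zero section are the differentials of fibrewise linear
functions. -/
lemma exists_diff_bar_eq_of_zero (x : X)
    (α : TangentSpace (normalModel IX EX EZ) (k.zero x) →L[ℝ] ℝ)
    (hα : ∀ u, α (mfderiv IX (normalModel IX EX EZ) k.zero x u) = 0) :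
    ∃ σ : AnnSection k.normal, diff (normalModel IX EX EZ) σ.bar (k.zero x) = α := by
  obtain ⟨σ, h, hh, e⟩ := k.normal.exists_diff_eq_bar (k.zero x) α
  refine ⟨σ, ?_⟩
  rw [diff_add (σ.smooth_bar.mdiff _) (hh.comp_proj.mdiff _)] at e
  -- Functions `σ̄` vanish on the zero section, so on its tangent vectors `α` reduces to `dh`.
  have h1 : diff IX h x = 0 := by
    ext u
    have h2 := hα u
    rw [← e] at h2
    have h3 : diff (normalModel IX EX EZ) σ.bar (k.zero x)
        (mfderiv IX (normalModel IX EX EZ) k.zero x u) + diff (normalModel IX EX EZ)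
        (fun t : k.NormalBundle ↦ h t.1) (k.zero x)
        (mfderiv IX (normalModel IX EX EZ) k.zero x u) = 0 := h2
    rw [diff_bar_zero, diff_proj_zero hh, zero_add] at h3
    exact h3
  have h2 : diff (normalModel IX EX EZ) (fun t : k.NormalBundle ↦ h t.1) (k.zero x) = 0 := by
    ext v
    refine (diff_proj hh _ v).trans ?_
    exact congrArg (fun T : TangentSpace IX x →L[ℝ] ℝ ↦ T _) h1
  rw [h2, add_zero] at e
  exact e

end SmoothImmersion

namespace AnnSection

/-- The conormal section of the zero section given by the differential of the fibrewise linear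
function of a conormal section. -/
def lift (σ : AnnSection k.normal) : AnnSection k.zero.normal :=
  ofApply (fun x ↦ diff (normalModel IX EX EZ) σ.bar (k.zero x)) (fun x u ↦ k.diff_bar_zero σ x u)
    fun _ hV ↦ (hV.diff_apply σ.smooth_bar).comp k.zero.contMDiff

lemma lift_hasPotential (σ : AnnSection k.normal) (x : X) : σ.lift.HasPotential σ.bar x :=
  ⟨σ.smooth_bar, .of_forall fun _ ↦ rfl⟩

/-- Every conormal section of the zero section is of this form. -/
lemma lift_surjective : Function.Surjective (lift : AnnSection k.normal → AnnSection k.zero.normal) := by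
  intro σ
  let vf : ∀ x, TangentSpace IZ (k x) →ₗ[ℝ] TangentSpace (normalModel IX EX EZ) (k.zero x) :=
    fun x ↦
    { toFun := fun v ↦ k.vert x (k.normal.cls x v)
      map_add' := fun v w ↦ by
        have := k.vert_add_smul x 1 (k.normal.cls x v) (k.normal.cls x w)
        rw [one_smul, one_smul] at this
        rw [map_add, this]
      map_smul' := fun c v ↦ by
        have h0 : k.vert x 0 = 0 := by
          have := k.vert_add_smul x 1 0 0
          rw [one_smul, one_smul, add_zero] at this
          exact left_eq_add.1 this
        have := k.vert_add_smul x c (k.normal.cls x v) 0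
        rw [h0, add_zero, add_zero] at this
        rw [map_smul, this]
        rfl }
  have f1 : ∀ x, FiniteDimensional ℝ (TangentSpace IZ (k x)) :=
    fun x ↦ inferInstanceAs (FiniteDimensional ℝ EZ)
  have f2 : ∀ x, T2Space (TangentSpace IZ (k x)) := fun x ↦ inferInstanceAs (T2Space EZ)
  -- The inverse of the lift: restrict a covector at the zero section to vertical vectors, that is,
  -- to normal vectors of `X`.
  let τ : AnnSection k.normal := ofApply
    (fun x ↦ (LinearMap.toContinuousLinearMap
      ((σ.toFun x).toLinearMap ∘ₗ vf x) : TangentSpace IZ (k x) →L[ℝ] ℝ)) (fun x u ↦ by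
      change σ.toFun x (vf x (k.normal.map x u)) = 0
      have h1 : vf x (k.normal.map x u) = 0 := by
        have h2 : k.normal.cls x (k.normal.map x u) = 0 := k.normal.cls_eq_zero.2 ⟨u, rfl⟩
        have h3 : vf x 0 = 0 := map_zero _
        change k.vert x _ = 0
        rw [h2, ← map_zero (k.normal.cls x)]
        exact h3
      rw [h1, map_zero]) fun V hV x ↦ by
      change ContMDiffAt IX 𝓘(ℝ, ℝ) ∞
        (fun x ↦ σ.toFun x (k.vert x (k.normal.cls x (V (k x))))) x
      refine ContMDiffAt.covector_apply (g := k.zero)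
        (V := fun x ↦ k.vert x (k.normal.cls x (V (k x)))) (σ.smooth x) ?_
      let G : Set (k.NormalBundle → ℝ) := {u | ∃ (σ : AnnSection k.normal) (h : X → ℝ),
        IsSmoothFun IX h ∧ u = fun t ↦ σ.bar t + h t.1}
      refine contMDiffAt_field_of_diff (k.zero.contMDiff x) G ?_ ?_ ?_
      · rintro _ ⟨σ, h, hh, rfl⟩
        exact σ.smooth_bar.add hh.comp_proj
      · intro α
        obtain ⟨σ, h, hh, e⟩ := k.normal.exists_diff_eq_bar (k.zero x) α
        exact ⟨_, ⟨σ, h, hh, rfl⟩, e⟩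
      · rintro _ ⟨τ, h, hh, rfl⟩
        refine (τ.apply_field hV x).congr_of_eventuallyEq (.of_forall fun y ↦ ?_)
        change diff (normalModel IX EX EZ) _ (k.zero y) (k.vert y (k.normal.cls y (V (k y)))) = _
        rw [diff_add (τ.smooth_bar.mdiff _) (hh.comp_proj.mdiff _), add_apply,
          k.diff_bar_vert, k.diff_proj_vert hh, add_zero, τ.bar_cls]
  refine ⟨τ, AnnSection.ext (funext fun x ↦ ?_)⟩
  obtain ⟨ρ, hρ⟩ := k.exists_diff_bar_eq_of_zero x (σ.toFun x) (σ.apply_tangent x)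
  rw [← hρ]
  refine AnnSection.diff_bar_congr (φ := k.normal) ?_
  ext v
  change σ.toFun x (k.vert x (k.normal.cls x v)) = _
  rw [← hρ, k.diff_bar_vert, ρ.bar_cls]

lemma lift_bar_toZeroNormal (σ : AnnSection k.normal) (t : k.NormalBundle) :
    σ.lift.bar (k.toZeroNormal t) = σ.bar t :=
  (σ.lift.bar_cls t.1 _).trans (k.diff_bar_vert σ t.1 t.2)

end AnnSection

namespace SmoothImmersion

/-- The normal bundle is isomorphic to the normal bundle of its zero section. -/
lemma exists_diffeomorph_toZeroNormal (k : SmoothImmersion IX IZ X Z) :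
    ∃ Φ : Diffeomorph (normalModel IX EX EZ) (normalModel IX EX (EX × CokerModel EX EZ))
      k.NormalBundle k.zero.NormalBundle ∞, ∀ t, Φ t = k.toZeroNormal t := by
  -- The zero section has the codimension of `X`; stated for truncated subtraction, this needs no
  -- inequality of dimensions.
  have hle : (finrank ℝ EX) + (finrank ℝ EZ - finrank ℝ EX) - finrank ℝ EX =
      finrank ℝ EZ - finrank ℝ EX := by omega
  have hs : ContMDiff (normalModel IX EX EZ) (normalModel IX EX (EX × CokerModel EX EZ)) ∞
      k.toZeroNormal := fun t ↦ by
    refine contMDiffAt_of_bar (k.normal.contMDiff_proj t) fun σ ↦ ?_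
    obtain ⟨σ, rfl⟩ := lift_surjective σ
    exact (σ.smooth_bar t).congr_of_eventuallyEq
      (.of_forall fun t ↦ σ.lift_bar_toZeroNormal t)
  have hinj : Function.Injective k.toZeroNormal := fun t t' h ↦
    ext_bar (congrArg (fun t : k.zero.NormalBundle ↦ t.1) h) fun σ ↦ by
      rw [← σ.lift_bar_toZeroNormal, h, σ.lift_bar_toZeroNormal]
  have hsurj : Function.Surjective k.toZeroNormal := by
    rintro ⟨x, b⟩
    let A : k.normal.Coker x →ₗ[ℝ] k.zero.normal.Coker x :=
      { toFun := fun a ↦ k.zero.normal.cls x (k.vert x a)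
        map_add' := fun a b ↦ by
          have := k.vert_add_smul x 1 a b
          rw [one_smul, one_smul] at this
          rw [this, map_add]
        map_smul' := fun c a ↦ by
          have h0 : k.vert x 0 = 0 := by
            have := k.vert_add_smul x 1 0 0
            rw [one_smul, one_smul, add_zero] at this
            exact left_eq_add.1 this
          have := k.vert_add_smul x c a 0
          rw [h0, add_zero, add_zero] at this
          rw [this, map_smul]
          rfl }
    have hA : Function.Injective A := fun a a' h ↦ by
      have h1 : k.toZeroNormal ⟨x, a⟩ = k.toZeroNormal ⟨x, a'⟩ := congrArg (TotalSpace.mk x) h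
      have h2 := hinj h1
      simpa using h2
    have f1 := LinearEquiv.finiteDimensional (k.normal.fibEquiv x).symm
    have f2 := LinearEquiv.finiteDimensional (k.zero.normal.fibEquiv x).symm
    have hfin : finrank ℝ (k.normal.Coker x) = finrank ℝ (k.zero.normal.Coker x) := by
      rw [(k.normal.fibEquiv x).finrank_eq, (k.zero.normal.fibEquiv x).finrank_eq]
      simp only [Module.finrank_fin_fun, Module.finrank_prod]
      exact hle.symm
    obtain ⟨a, ha⟩ := (LinearMap.injective_iff_surjective_of_finrank_eq_finrank hfin).1 hA b
    exact ⟨⟨x, a⟩, congrArg (TotalSpace.mk x) ha⟩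
  refine exists_diffeomorph hs ⟨hinj, hsurj⟩ (fun t ↦ ?_) ?_
  · refine (injective_iff_map_eq_zero _).2 fun v hv ↦ ?_
    refine vector_ext (φ := k.normal) (fun σ ↦ ?_) fun h hh ↦ ?_
    · have h1 : σ.bar = fun t ↦ σ.lift.bar (k.toZeroNormal t) :=
        funext fun t ↦ (σ.lift_bar_toZeroNormal t).symm
      rw [map_zero, h1]
      refine (diff_comp (σ.lift.smooth_bar.mdiff _) (hs.mdifferentiableAt (by simp)) v).trans ?_
      rw [hv, map_zero]
    · rw [map_zero]
      refine (diff_comp (f := fun t : k.zero.NormalBundle ↦ h t.1) (g := k.toZeroNormal)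
        (hh.comp_proj.mdiff _) (hs.mdifferentiableAt (by simp)) v).trans ?_
      rw [hv, map_zero]
  · simp only [Module.finrank_fin_fun, Module.finrank_prod]
    rw [hle]

end SmoothImmersion

namespace PoissonStructure.IsLinearization

variable {hP : P.IsCoisotropic k} {P' : PoissonStructure (normalModel IX EX EZ) k.NormalBundle}
  (h' : IsLinearization hP P')

include h'

/-- All functions `[τ, σ]‾` vanish on the zero section, so there the Hamiltonian vector of `σ̄` is
determined by its action on functions of the base, which is the anchor. -/
lemma sharp_diff_bar_zero (σ : AnnSection k.normal) (x : X) :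
    P'.sharp (k.zero x) (diff (normalModel IX EX EZ) σ.bar (k.zero x)) =
      mfderiv IX (normalModel IX EX EZ) k.zero x (σ.anchor hP x) := by
  refine vector_ext (φ := k.normal) (fun τ ↦ ?_) fun h hh ↦ ?_
  · refine (h'.bracket_bar_bar τ σ _).trans (Eq.trans ?_ (k.diff_bar_zero τ x _).symm)
    exact AnnSection.bar_zero _ x
  · exact (h'.bracket_proj_bar σ hh _).trans (k.diff_proj_zero hh x _).symm

/-- The zero section of the linearization is coisotropic. -/
lemma isCoisotropic_zero : P'.IsCoisotropic k.zero := by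
  intro x α hα
  obtain ⟨σ, rfl⟩ := k.exists_diff_bar_eq_of_zero x α hα
  exact ⟨σ.anchor hP x, (h'.sharp_diff_bar_zero σ x).symm⟩

lemma anchor_lift (σ : AnnSection k.normal) (x : X) :
    σ.lift.anchor h'.isCoisotropic_zero x = σ.anchor hP x :=
  (anchor_eq_iff _ _ _ _).2 (h'.sharp_diff_bar_zero σ x).symm

/-- `σ̄` is a global potential of the lift of `σ`, so the bracket of two lifts is the differential
of `{σ̄, τ̄}' = [σ, τ]‾`. -/
lemma bracket_lift (σ τ : AnnSection k.normal) :
    AnnSection.bracket h'.isCoisotropic_zero σ.lift τ.lift = (AnnSection.bracket hP σ τ).lift := by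
  ext1
  funext x
  refine ((σ.lift_hasPotential x).bracket h'.isCoisotropic_zero (τ.lift_hasPotential x)).eq.symm.trans
    ?_
  have h1 : P'.bracket σ.bar τ.bar = (AnnSection.bracket hP σ τ).bar :=
    funext (h'.bracket_bar_bar σ τ)
  rw [h1]
  rfl

/-- A linearization is its own linearization at the zero section. -/
theorem isPoissonMap_toZeroNormal
    {P'' : PoissonStructure (normalModel IX EX (EX × CokerModel EX EZ)) k.zero.NormalBundle}
    (h'' : IsLinearization h'.isCoisotropic_zero P'')
    (hΦ : ContMDiff (normalModel IX EX EZ) (normalModel IX EX (EX × CokerModel EX EZ)) ∞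
      k.toZeroNormal) : P'.IsPoissonMap P'' k.toZeroNormal := by
  refine P'.isPoissonMap_of_bracket hΦ {u | ∃ (σ : AnnSection k.normal) (h : X → ℝ),
    IsSmoothFun IX h ∧ u = fun t ↦ σ.lift.bar t + h t.1} ?_ ?_ ?_
  · rintro _ ⟨σ, h, hh, rfl⟩
    exact σ.lift.smooth_bar.add hh.comp_proj
  · intro t α
    obtain ⟨σ, h, hh, e⟩ := k.zero.normal.exists_diff_eq_bar t α
    obtain ⟨σ, rfl⟩ := lift_surjective σ
    exact ⟨_, ⟨σ, h, hh, rfl⟩, e⟩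
  · rintro _ ⟨σ, h, hh, rfl⟩ _ ⟨τ, g, hg, rfl⟩ t
    have key : ∀ (σ : AnnSection k.normal) (h : X → ℝ),
        (fun t : k.zero.NormalBundle ↦ σ.lift.bar t + h t.1) ∘ k.toZeroNormal =
        fun t ↦ σ.bar t + h t.1 := fun σ h ↦ funext fun t ↦
      congrArg (· + h t.1) (σ.lift_bar_toZeroNormal t)
    rw [key, key, h' σ τ h g hh hg, h'' σ.lift τ.lift h g hh hg, h'.bracket_lift,
      lift_bar_toZeroNormal]
    simp only [anchorDiff, h'.anchor_lift]
    rfl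

end PoissonStructure.IsLinearization

end ZeroSection

/-! ### The ideal of sections of `L_X` and the Poisson structure of `L_X^*` -/

section Transverse

variable {EX HX X : Type*} [NormedAddCommGroup EX] [NormedSpace ℝ EX] [TopologicalSpace HX]
  [TopologicalSpace X] [ChartedSpace HX X]
  {ES HS S : Type*} [NormedAddCommGroup ES] [NormedSpace ℝ ES] [TopologicalSpace HS]
  [TopologicalSpace S] [ChartedSpace HS S]
  {EZ HZ Z : Type*} [NormedAddCommGroup EZ] [NormedSpace ℝ EZ] [TopologicalSpace HZ]
  [TopologicalSpace Z] [ChartedSpace HZ Z]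
  {IX : ModelWithCorners ℝ EX HX} {IS : ModelWithCorners ℝ ES HS}
  {IZ : ModelWithCorners ℝ EZ HZ}
  [IsManifold IX ∞ X] [IsManifold IS ∞ S] [IsManifold IZ ∞ Z]
  {P : PoissonStructure IZ Z} {j : SmoothImmersion IS IZ S Z} {i : SmoothImmersion IX IS X S}

open SmoothImmersion AnnSection TangentMono

namespace AnnSection

/-- A section which annihilates `TS` annihilates `TX`. -/
def ofAlong (l : AnnSection (j.along i)) : AnnSection (j.comp i).normal where
  toFun := l.toFun
  map_eq_zero x u :=
    (congrArg (l.toFun x) (mfderiv_comp_apply j i x u)).trans (l.map_eq_zero x _)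
  smooth := l.smooth

/-- A conormal section which annihilates `TS`. -/
def toAlong (σ : AnnSection (j.comp i).normal)
    (h : ∀ x u, σ.toFun x (mfderiv IS IZ j (i x) u) = 0) : AnnSection (j.along i) where
  toFun := σ.toFun
  map_eq_zero := h
  smooth := σ.smooth

lemma ofAlong_bar (l : AnnSection (j.along i)) (t : (j.comp i).NormalBundle) :
    l.ofAlong.bar t = l.bar (projAlong j i t) := by
  obtain ⟨x, b⟩ := t
  obtain ⟨v, rfl⟩ := (j.comp i).normal.cls_surjective x b
  have h : projAlong j i ⟨x, (j.comp i).normal.cls x v⟩ = ⟨x, (j.along i).cls x v⟩ :=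
    congrArg (TotalSpace.mk x) ((j.comp i).normal.desc_cls _ _ v)
  rw [h, bar_cls, bar_cls]
  rfl

end AnnSection

lemma SmoothImmersion.projAlong_cls (x : X) (v : TangentSpace IZ (j (i x))) :
    projAlong j i ⟨x, (j.comp i).normal.cls x v⟩ = ⟨x, (j.along i).cls x v⟩ :=
  congrArg (TotalSpace.mk x) ((j.comp i).normal.desc_cls _ _ v)

lemma SmoothImmersion.projAlong_surjective : Function.Surjective (projAlong j i) := by
  rintro ⟨x, b⟩
  obtain ⟨v, rfl⟩ := (j.along i).cls_surjective x b
  exact ⟨_, projAlong_cls x v⟩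

variable [FiniteDimensional ℝ EX] [FiniteDimensional ℝ ES] [FiniteDimensional ℝ EZ]

lemma SmoothImmersion.contMDiff_projAlong [T2Space X] [T2Space Z] :
    ContMDiff (normalModel IX EX EZ) (normalModel IX ES EZ) ∞ (projAlong j i) := fun t ↦
  contMDiffAt_of_bar ((j.comp i).normal.contMDiff_proj t) fun l ↦
    (l.ofAlong.smooth_bar t).congr_of_eventuallyEq (.of_forall fun t ↦ (l.ofAlong_bar t).symm)

variable [T2Space Z] [T2Space X] [IX.Boundaryless] [IS.Boundaryless] [IZ.Boundaryless]

namespace AnnSection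

/-- A section which annihilates `TS` has potentials which vanish on `S`. -/
lemma exists_potential_of_along (l : AnnSection (j.along i)) (x : X) :
    ∃ F, l.ofAlong.HasPotential F x ∧ ∀ᶠ s in 𝓝 (i x), F (j s) = 0 := by
  obtain ⟨F, hF, hF0, hFl⟩ := exists_potential j i.contMDiff (k := j.comp i) (fun _ ↦ rfl)
    (σ := l.toFun) (fun V hV ↦ l.apply_field hV) (fun x u ↦ l.map_eq_zero x u) x
  exact ⟨F, ⟨hF, hFl⟩, hF0⟩

/-- `w♯` has image `TS`, so by skewness a covector that kills `TS` lies in its kernel. -/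
lemma sharp_ofAlong (hj : P.IsIntegral j) (l : AnnSection (j.along i)) (x : X) :
    P.sharp (j (i x)) (l.toFun x) = 0 := by
  refine tangent_ext fun α ↦ ?_
  obtain ⟨u, hu⟩ := hj.exists_mfderiv_eq (i x) α
  have h1 : α (P.sharp (j (i x)) (l.toFun x)) = -l.toFun x (P.sharp (j (i x)) α) := P.skew _ _ _
  rw [h1, ← hu]
  exact (congrArg Neg.neg (l.map_eq_zero x u)).trans (by simp)

lemma anchor_ofAlong (hP : P.IsCoisotropic (j.comp i)) (hj : P.IsIntegral j)
    (l : AnnSection (j.along i)) (x : X) : l.ofAlong.anchor hP x = 0 :=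
  (anchor_eq_iff hP _ x 0).2 ((map_zero _).trans (l.sharp_ofAlong hj x).symm)

/-- The sections which annihilate `TS` form an ideal. -/
lemma bracket_ofAlong_apply (hP : P.IsCoisotropic (j.comp i)) (hj : P.IsIntegral j)
    (σ : AnnSection (j.comp i).normal) (l : AnnSection (j.along i)) (x : X)
    (u : TangentSpace IS (i x)) :
    (bracket hP σ l.ofAlong).toFun x (mfderiv IS IZ j (i x) u) = 0 := by
  obtain ⟨G, hG⟩ := σ.exists_hasPotential x
  obtain ⟨F, hF, hF0⟩ := l.exists_potential_of_along x
  rw [← (hG.bracket hP hF).eq]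
  refine (diff_comp ((P.smooth_bracket hG.1 hF.1).mdiff _)
    (j.contMDiff.mdifferentiableAt (by simp)) u).symm.trans ?_
  -- `F` vanishes on `S` and the Hamiltonian field of `G` is tangent to `S`, so `{G, F}` vanishes on
  -- `S` near the point.
  have h1 : (fun s ↦ P.bracket G F (j s)) =ᶠ[𝓝 (i x)] fun _ ↦ 0 := by
    filter_upwards [eventually_eventually_nhds.2 hF0] with s hs
    obtain ⟨w, hw⟩ := hj.exists_mfderiv_eq s (diff IZ G (j s))
    rw [P.bracket_skew, PoissonStructure.bracket, ← hw, neg_eq_zero]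
    refine (diff_comp (hF.1.mdiff _) (j.contMDiff.mdifferentiableAt (by simp)) w).symm.trans ?_
    have h2 : (fun s ↦ F (j s)) =ᶠ[𝓝 s] fun _ ↦ 0 := hs
    rw [diff_congr h2, diff_const]
    rfl
  rw [diff_congr h1, diff_const]
  rfl

/-- The bracket of sections which annihilate `TS`. -/
def bracketAlong (hP : P.IsCoisotropic (j.comp i)) (hj : P.IsIntegral j)
    (l m : AnnSection (j.along i)) : AnnSection (j.along i) :=
  (bracket hP l.ofAlong m.ofAlong).toAlong (bracket_ofAlong_apply hP hj _ m)

end AnnSection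

namespace PoissonStructure

/-- The differential of a bracket of functions whose Hamiltonian vectors vanish at a point depends
only on the differentials at this point. -/
lemma diff_bracket_congr {z : Z} {F F' G G' : Z → ℝ} (hF : IsSmoothFun IZ F)
    (hF' : IsSmoothFun IZ F') (hG : IsSmoothFun IZ G) (hG' : IsSmoothFun IZ G')
    (hFF : diff IZ F z = diff IZ F' z) (hGG : diff IZ G z = diff IZ G' z)
    (hF0 : P.sharp z (diff IZ F z) = 0) (hG0 : P.sharp z (diff IZ G z) = 0) :
    diff IZ (P.bracket F G) z = diff IZ (P.bracket F' G') z := by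
  have key : ∀ {F F' G : Z → ℝ}, IsSmoothFun IZ F → IsSmoothFun IZ F' → IsSmoothFun IZ G →
      diff IZ F z = diff IZ F' z → P.sharp z (diff IZ G z) = 0 →
      diff IZ (P.bracket F G) z = diff IZ (P.bracket F' G) z := by
    intro F F' G hF hF' hG h h0
    -- `{F - F', G}` pairs `dF - dF'` with the Hamiltonian field of `G`, and both vanish at `z`.
    have h1 := diff_covector_apply_eq_zero (z := z)
      (hF.isSmoothForm_diff.sub hF'.isSmoothForm_diff) (P.isSmoothField_sharp_diff hG)
      (by rw [h, sub_self]) h0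
    have h2 := diff_sub ((P.smooth_bracket hF hG).mdiff z) ((P.smooth_bracket hF' hG).mdiff z)
    exact sub_eq_zero.1 (h2.symm.trans h1)
  have hs : ∀ F G : Z → ℝ, P.bracket F G = fun y ↦ -P.bracket G F y :=
    fun F G ↦ funext fun y ↦ P.bracket_skew F G y
  rw [key hF hF' hG hFF hG0, hs F' G, hs F' G', diff_neg, diff_neg,
    key hG hG' hF' hGG (by rw [← hFF, hF0])]

variable {hP : P.IsCoisotropic (j.comp i)}
  {P' : PoissonStructure (normalModel IX EX EZ) (j.comp i).NormalBundle}

/-- The linearization projects to a Poisson structure on `TZ|_X / TS|_X`. -/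
lemma IsLinearization.exists_along (h' : IsLinearization hP P') (hj : P.IsIntegral j) :
    ∃ PL : PoissonStructure (normalModel IX ES EZ) (j.along i).Total,
      ∀ (l m : AnnSection (j.along i)) (h g : X → ℝ), IsSmoothFun IX h → IsSmoothFun IX g →
        ∀ t, PL.bracket (fun t ↦ l.bar t + h t.1) (fun t ↦ m.bar t + g t.1) t =
          (bracketAlong hP hj l m).bar t := by
  let W := AnnSection (j.along i) × {h : X → ℝ // IsSmoothFun IX h}
  let fn : W → (j.along i).Total → ℝ := fun a t ↦ a.1.bar t + a.2.1 t.1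
  let br : W → W → W := fun a b ↦ (bracketAlong hP hj a.1 b.1, ⟨fun _ ↦ 0, contMDiff_const⟩)
  have hsm : ∀ a : W, IsSmoothFun (normalModel IX ES EZ) (fn a) :=
    fun a ↦ a.1.smooth_bar.add a.2.2.comp_proj
  have hbr : ∀ (l m : AnnSection (j.along i)) t, (bracketAlong hP hj l m).bar (projAlong j i t) =
      P'.bracket l.ofAlong.bar m.ofAlong.bar t := by
    intro l m t
    rw [h'.bracket_bar_bar, ← ofAlong_bar]
    rfl
  have hbr' : ∀ l m : AnnSection (j.along i), (bracketAlong hP hj l m).ofAlong.bar =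
      P'.bracket l.ofAlong.bar m.ofAlong.bar := fun l m ↦ funext fun t ↦ by
    rw [ofAlong_bar, hbr]
  have hfn : ∀ a b t, fn (br a b) (projAlong j i t) =
      P'.bracket a.1.ofAlong.bar b.1.ofAlong.bar t := fun a b t ↦ by
    rw [← hbr]
    exact add_zero _
  obtain ⟨PL, hPL⟩ := exists_poissonStructure_of_generators (I := normalModel IX ES EZ) fn hsm
    (fun t α ↦ by
      obtain ⟨l, h, hh, e⟩ := (j.along i).exists_diff_eq_bar t α
      exact ⟨(l, ⟨h, hh⟩), e⟩) br (fun n b ↦ by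
      -- The Hamiltonian vector upstairs at any preimage projects to the required one. Sections of
      -- `L_X` have zero anchor, so functions of the base bracket to zero with every generator.
      obtain ⟨t, rfl⟩ := projAlong_surjective n
      obtain ⟨V, hV⟩ := AnnSection.exists_hamiltonian hP t b.1.ofAlong (g := fun _ ↦ 0)
        contMDiff_const
      refine ⟨mfderiv (normalModel IX EX EZ) (normalModel IX ES EZ) (projAlong j i) t V,
        fun a ↦ ?_⟩
      refine (diff_comp ((hsm a).mdiff _) (contMDiff_projAlong.mdifferentiableAt (by simp))
        V).symm.trans ?_
      have h1 : (fun t ↦ fn a (projAlong j i t)) = fun t ↦ a.1.ofAlong.bar t + a.2.1 t.1 :=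
        funext fun t ↦ congrArg (· + a.2.1 t.1) (a.1.ofAlong_bar t).symm
      rw [h1, hV a.1.ofAlong a.2.1 a.2.2, hfn, h'.bracket_bar_bar, anchorDiff, anchorDiff,
        anchor_ofAlong hP hj, anchor_ofAlong hP hj, map_zero, map_zero, sub_zero, add_zero]) (by
      intro a b n
      obtain ⟨t, rfl⟩ := projAlong_surjective n
      rw [hfn, hfn]
      exact P'.bracket_skew _ _ _) (by
      intro a b c n
      obtain ⟨t, rfl⟩ := projAlong_surjective n
      rw [hfn, hfn, hfn]
      simp only [br]
      rw [hbr', hbr', hbr']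
      exact P'.bracket_jacobi a.1.ofAlong.smooth_bar b.1.ofAlong.smooth_bar
        c.1.ofAlong.smooth_bar t)
  exact ⟨PL, fun l m h g hh hg t ↦
    (congrFun (hPL (l, ⟨h, hh⟩) (m, ⟨g, hg⟩)) t).trans (add_zero _)⟩

/-- The quotient of the linearization is given by the Lie-Poisson structures of the duals of the
transverse Lie algebras, and the projection is a Poisson map. -/
theorem IsLinearization.exists_isFibrewiseLiePoisson (h' : IsLinearization hP P')
    (hj : P.IsIntegral j) :
    ∃ PL : PoissonStructure (normalModel IX ES EZ) (j.along i).Total,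
      P.IsFibrewiseLiePoisson j i PL ∧ P'.IsPoissonMap PL (projAlong j i) := by
  obtain ⟨PL, hPL⟩ := h'.exists_along hj
  refine ⟨PL, ?_, ?_⟩
  · intro f g hf hg x v F G hF hG hFf hGg
    -- The fibre derivative of `f` is the value of a section `l` of `L_X`; the base part of `df`
    -- does not influence the bracket.
    have key : ∀ {f : (j.along i).Total → ℝ} {F : Z → ℝ},
        IsSmoothFun (normalModel IX ES EZ) f →
        (∀ u, diff IZ F (j (i x)) u = deriv (fun s : ℝ ↦
          f ⟨x, (j.along i).cls x v + s • (j.along i).cls x u⟩) 0) →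
        ∃ (l : AnnSection (j.along i)) (h : X → ℝ), IsSmoothFun IX h ∧
          diff (normalModel IX ES EZ) (fun t ↦ l.bar t + h t.1) ⟨x, (j.along i).cls x v⟩ =
            diff (normalModel IX ES EZ) f ⟨x, (j.along i).cls x v⟩ ∧
          diff IZ F (j (i x)) = l.toFun x := by
      intro f F hf hFf
      obtain ⟨l, h, hh, e⟩ := (j.along i).exists_diff_eq_bar ⟨x, (j.along i).cls x v⟩
        (diff (normalModel IX ES EZ) f ⟨x, (j.along i).cls x v⟩)
      refine ⟨l, h, hh, e, ?_⟩
      ext u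
      rw [hFf u]
      refine (diff_vertAt hf ⟨x, (j.along i).cls x v⟩ ((j.along i).cls x u)).symm.trans ?_
      rw [← e, diff_add (l.smooth_bar.mdiff _) (hh.comp_proj.mdiff _)]
      refine (congrArg₂ (· + ·) (diff_bar_vertAt l ⟨x, (j.along i).cls x v⟩ _)
        (diff_proj_vertAt hh ⟨x, (j.along i).cls x v⟩ _)).trans ?_
      rw [add_zero]
      exact l.bar_cls x u
    obtain ⟨l, h, hh, e, hFl⟩ := key hf hFf
    obtain ⟨m, h₂, hh₂, e₂, hGm⟩ := key hg hGg
    obtain ⟨F', hF'⟩ := l.ofAlong.exists_hasPotential x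
    obtain ⟨G', hG'⟩ := m.ofAlong.exists_hasPotential x
    rw [← PL.bracket_congr e e₂, hPL l m h h₂ hh hh₂]
    refine ((bracketAlong hP hj l m).bar_cls x v).trans ?_
    refine (congrArg (fun T : TangentSpace IZ (j (i x)) →L[ℝ] ℝ ↦ T v)
      (hF'.bracket hP hG').eq).symm.trans ?_
    -- `F` and the potential `F'` share their differential at a single point only. This suffices
    -- because these covectors are in the kernel of `w♯`.
    refine (congrArg (fun T : TangentSpace IZ (j (i x)) →L[ℝ] ℝ ↦ T v)
      (P.diff_bracket_congr hF hF'.1 hG hG'.1 (hFl.trans hF'.eq.symm) (hGm.trans hG'.eq.symm)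
      ?_ ?_)).symm
    · rw [hFl, l.sharp_ofAlong hj]
    · rw [hGm, m.sharp_ofAlong hj]
  · refine P'.isPoissonMap_of_bracket contMDiff_projAlong
      {u | ∃ (l : AnnSection (j.along i)) (h : X → ℝ), IsSmoothFun IX h ∧
        u = fun t ↦ l.bar t + h t.1} ?_ ?_ ?_
    · rintro _ ⟨l, h, hh, rfl⟩
      exact l.smooth_bar.add hh.comp_proj
    · intro t α
      obtain ⟨l, h, hh, e⟩ := (j.along i).exists_diff_eq_bar t α
      exact ⟨_, ⟨l, h, hh, rfl⟩, e⟩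
    · rintro _ ⟨l, h, hh, rfl⟩ _ ⟨m, g, hg, rfl⟩ t
      have key : ∀ (l : AnnSection (j.along i)) (h : X → ℝ),
          (fun t : (j.along i).Total ↦ l.bar t + h t.1) ∘ projAlong j i =
          fun t ↦ l.ofAlong.bar t + h t.1 := fun l h ↦ funext fun t ↦
        congrArg (· + h t.1) (l.ofAlong_bar t).symm
      rw [key, key, h' _ _ h g hh hg, hPL l m h g hh hg, ← ofAlong_bar, anchorDiff, anchorDiff,
        anchor_ofAlong hP hj, anchor_ofAlong hP hj, map_zero, map_zero, sub_zero, add_zero]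
      rfl

/-- The sections which annihilate `TS` form an ideal. -/
lemma IsLinearization.exists_ideal (h' : IsLinearization hP P') (hj : P.IsIntegral j)
    (σ l : ConormalSection (j.comp i))
    (hl : ∀ x (u : TangentSpace IS (i x)), l.toFun x (mfderiv IS IZ j (i x) u) = 0) :
    ∃ κ : ConormalSection (j.comp i),
      (∀ x (u : TangentSpace IS (i x)), κ.toFun x (mfderiv IS IZ j (i x) u) = 0) ∧
      P.IsConormalBracket σ l κ ∧ ∀ t, P'.bracket σ.bar l.bar t = κ.bar t :=
  ⟨(AnnSection.bracket hP (.ofConormal σ) (.ofConormal l)).toConormal,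
    fun x u ↦ bracket_ofAlong_apply hP hj _ ((ofConormal l).toAlong hl) x u,
    isConormalBracket_bracket hP (.ofConormal σ) (.ofConormal l),
    fun t ↦ h'.bracket_bar_bar (.ofConormal σ) (.ofConormal l) t⟩

end PoissonStructure

end Transverse

/-! ### `S'` as an integral manifold -/

section InclNormal

variable {EX HX X : Type*} [NormedAddCommGroup EX] [NormedSpace ℝ EX] [TopologicalSpace HX]
  [TopologicalSpace X] [ChartedSpace HX X]
  {ES HS S : Type*} [NormedAddCommGroup ES] [NormedSpace ℝ ES] [TopologicalSpace HS]
  [TopologicalSpace S] [ChartedSpace HS S]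
  {EZ HZ Z : Type*} [NormedAddCommGroup EZ] [NormedSpace ℝ EZ] [TopologicalSpace HZ]
  [TopologicalSpace Z] [ChartedSpace HZ Z]
  {IX : ModelWithCorners ℝ EX HX} {IS : ModelWithCorners ℝ ES HS}
  {IZ : ModelWithCorners ℝ EZ HZ}
  [IsManifold IX ∞ X] [IsManifold IS ∞ S] [IsManifold IZ ∞ Z]
  {P : PoissonStructure IZ Z} {j : SmoothImmersion IS IZ S Z} {i : SmoothImmersion IX IS X S}
  [FiniteDimensional ℝ EX] [FiniteDimensional ℝ ES] [FiniteDimensional ℝ EZ]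
  [T2Space Z] [T2Space S] [T2Space X] [IX.Boundaryless] [IS.Boundaryless] [IZ.Boundaryless]

open SmoothImmersion AnnSection TangentMono

section General

variable {EA HA A : Type*} [NormedAddCommGroup EA] [NormedSpace ℝ EA] [TopologicalSpace HA]
  [TopologicalSpace A] [ChartedSpace HA A] {IA : ModelWithCorners ℝ EA HA} [IsManifold IA ∞ A]
  {g : X → A} {f : X → Z} {φ : TangentMono IX IA IZ g f} [FiniteDimensional ℝ EA]

/-- If a section vanishes at a point, the differential of its fibrewise linear function on the
fibre over this point is the differential of a function on the base. -/
lemma AnnSection.exists_diff_bar_eq_diff_proj {σ : AnnSection φ} (t : φ.Total)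
    (hσ : σ.toFun t.1 = 0) : ∃ h : X → ℝ, IsSmoothFun IX h ∧
      diff (IX.prod 𝓘(ℝ, CokerModel EA EZ)) σ.bar t =
        diff (IX.prod 𝓘(ℝ, CokerModel EA EZ)) (fun t : φ.Total ↦ h t.1) t := by
  obtain ⟨x, b⟩ := t
  obtain ⟨v, rfl⟩ := φ.cls_surjective x b
  obtain ⟨V, hV, rfl⟩ := exists_field_eq (I := IZ) (f x) v
  -- Translation by the section `[V]` moves `t` to the zero vector, where `dσ̄ = 0`, and changes
  -- `σ̄` by a function of the base only.
  let T : φ.Total → φ.Total := fun t ↦ ⟨t.1, t.2 - φ.cls t.1 (V (f t.1))⟩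
  have hT : ∀ (τ : AnnSection φ) t, τ.bar (T t) = τ.bar t - τ.toFun t.1 (V (f t.1)) := by
    intro τ t
    obtain ⟨y, b⟩ := t
    obtain ⟨w, rfl⟩ := φ.cls_surjective y b
    change τ.bar ⟨y, φ.cls y w - φ.cls y (V (f y))⟩ = τ.bar ⟨y, φ.cls y w⟩ - _
    rw [← map_sub, bar_cls, bar_cls, map_sub]
  have hh : ∀ τ : AnnSection φ, IsSmoothFun IX fun y ↦ τ.toFun y (V (f y)) :=
    fun τ ↦ τ.apply_field hV
  have hTs : ContMDiff (IX.prod 𝓘(ℝ, CokerModel EA EZ)) (IX.prod 𝓘(ℝ, CokerModel EA EZ)) ∞ T :=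
    fun t ↦ contMDiffAt_of_bar (φ.contMDiff_proj t) fun τ ↦ by
      simp only [hT]
      exact (τ.smooth_bar.sub (hh τ).comp_proj) t
  refine ⟨_, hh σ, ?_⟩
  have h1 : diff (IX.prod 𝓘(ℝ, CokerModel EA EZ)) (fun t ↦ σ.bar (T t))
      (⟨x, φ.cls x (V (f x))⟩ : φ.Total) = 0 := by
    ext w
    refine (diff_comp (σ.smooth_bar.mdiff _) (hTs.mdifferentiableAt (by simp)) w).trans ?_
    have h2 : T ⟨x, φ.cls x (V (f x))⟩ = ⟨x, 0⟩ := congrArg (TotalSpace.mk x) (sub_self _)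
    have h3 := AnnSection.diff_bar_eq_zero hσ
    rw [← h2] at h3
    rw [h3]
    rfl
  have h4 : (fun t ↦ σ.bar (T t)) = fun t ↦ σ.bar t - σ.toFun t.1 (V (f t.1)) := funext (hT σ)
  rw [h4, diff_sub (σ.smooth_bar.mdiff _) ((hh σ).comp_proj.mdiff _)] at h1
  exact sub_eq_zero.1 h1

/-- The total space of a quotient bundle over a connected base is connected. -/
lemma TangentMono.connectedSpace_total (φ : TangentMono IX IA IZ g f) [ConnectedSpace X] :
    ConnectedSpace φ.Total := by
  obtain ⟨x₀⟩ := (inferInstance : Nonempty X)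
  have hz : Continuous (zeroSection (CokerModel EA EZ) φ.Coker) :=
    (contMDiff_zeroSection (IB := IX) (n := ∞) ℝ φ.Coker).continuous
  have : PreconnectedSpace φ.Total := by
    refine ⟨isPreconnected_of_forall (zeroSection (CokerModel EA EZ) φ.Coker x₀) fun t _ ↦ ?_⟩
    refine ⟨range (zeroSection (CokerModel EA EZ) φ.Coker) ∪
      range (fun s : ℝ ↦ (⟨t.1, 0 + s • t.2⟩ : φ.Total)), subset_univ _, .inl ⟨x₀, rfl⟩,
      .inr ⟨1, by simp⟩, ?_⟩
    exact (isPreconnected_range hz).union (zeroSection (CokerModel EA EZ) φ.Coker t.1) ⟨t.1, rfl⟩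
      ⟨0, by simp [zeroSection]⟩ (isPreconnected_range (φ.contMDiff_line t.1 0 t.2).continuous)
  exact ⟨⟨zeroSection (CokerModel EA EZ) φ.Coker x₀⟩⟩

end General

namespace SmoothImmersion

lemma inclNormal_cls (x : X) (v : TangentSpace IS (i x)) :
    inclNormal j i ⟨x, i.normal.cls x v⟩ =
      ⟨x, (j.comp i).normal.cls x (mfderiv IS IZ j (i x) v)⟩ :=
  congrArg (TotalSpace.mk x) (i.normal.desc_cls _ _ v)

lemma inclNormal_injective : Function.Injective (inclNormal j i) := by
  intro t t' h
  obtain ⟨x, b⟩ := t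
  obtain ⟨x', b'⟩ := t'
  obtain rfl : x = x' := congrArg (fun t : (j.comp i).NormalBundle ↦ t.1) h
  obtain ⟨v, rfl⟩ := i.normal.cls_surjective x b
  obtain ⟨v', rfl⟩ := i.normal.cls_surjective x b'
  rw [inclNormal_cls, inclNormal_cls] at h
  have h1 : (j.comp i).normal.cls x (mfderiv IS IZ j (i x) (v - v')) = 0 :=
    (congrArg ((j.comp i).normal.cls x) (map_sub (mfderiv IS IZ j (i x)) v v')).trans
      ((map_sub ((j.comp i).normal.cls x) _ _).trans (sub_eq_zero.2 (TotalSpace.mk_injective x h)))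
  obtain ⟨u, hu⟩ := (cls_eq_zero _).1 h1
  have h2 : mfderiv IS IZ j (i x) (mfderiv IX IS i x u) = mfderiv IS IZ j (i x) (v - v') :=
    (mfderiv_comp_apply j i x u).symm.trans hu
  refine congrArg (TotalSpace.mk x) (sub_eq_zero.1 ?_)
  rw [← map_sub, cls_eq_zero]
  exact ⟨u, j.injective_mfderiv _ h2⟩

end SmoothImmersion

namespace AnnSection

/-- The restriction of a conormal section to the tangent spaces of `S`. -/
def pullback (σ : AnnSection (j.comp i).normal) : AnnSection i.normal :=
  ofApply (fun x ↦ (σ.toFun x).comp (mfderiv IS IZ j (i x)))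
    (fun x u ↦ (congrArg (σ.toFun x) (mfderiv_comp_apply j i x u)).symm.trans
      (σ.apply_tangent x u)) fun V hV x ↦ by
    obtain ⟨F, hF⟩ := σ.exists_hasPotential x
    have h1 : IsSmoothFun IS fun s ↦ F (j s) := hF.1.comp j.contMDiff
    refine (((hV.diff_apply h1).comp i.contMDiff) x).congr_of_eventuallyEq ?_
    filter_upwards [hF.2] with y hy
    change σ.toFun y (mfderiv IS IZ j (i y) (V (i y))) = _
    rw [← hy]
    exact (diff_comp (hF.1.mdiff _) (j.contMDiff.mdifferentiableAt (by simp)) _).symm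

lemma pullback_toFun (σ : AnnSection (j.comp i).normal) (x : X) (v : TangentSpace IS (i x)) :
    σ.pullback.toFun x v = σ.toFun x (mfderiv IS IZ j (i x) v) := rfl

lemma bar_inclNormal (σ : AnnSection (j.comp i).normal) (t : i.NormalBundle) :
    σ.bar (inclNormal j i t) = σ.pullback.bar t := by
  obtain ⟨x, b⟩ := t
  obtain ⟨v, rfl⟩ := i.normal.cls_surjective x b
  exact (congrArg σ.bar (inclNormal_cls x v)).trans
    ((σ.bar_cls x _).trans (σ.pullback.bar_cls x v).symm)

/-- Every section of the conormal bundle of `X` in `S` is locally a restriction. -/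
lemma exists_pullback_eq (τ : AnnSection i.normal) (x : X) :
    ∃ σ : AnnSection (j.comp i).normal, ∀ᶠ y in 𝓝 x, σ.pullback.toFun y = τ.toFun y := by
  obtain ⟨f, hf, hf0, hfτ⟩ := exists_potential i (i := id) (k := i) contMDiff_id (fun _ ↦ rfl)
    (σ := τ.toFun) (fun V hV ↦ τ.apply_field hV) (fun x u ↦ τ.apply_tangent x u) x
  obtain ⟨F, hF, hFf⟩ := exists_extension j (i x) hf
  have hi : Tendsto i (𝓝 x) (𝓝 (i x)) := i.contMDiff.continuous.continuousAt
  obtain ⟨σ, hσ⟩ := AnnSection.exists_of_potential (k := j.comp i) hF (x := x) (by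
    filter_upwards [hi.eventually hFf, hf0] with y h1 h2
    exact h1.trans h2)
  refine ⟨σ, ?_⟩
  filter_upwards [hσ.2, hfτ, hi.eventually (eventually_eventually_nhds.2 hFf)] with y h1 h2 h3
  have h4 : (fun s ↦ F (j s)) =ᶠ[𝓝 (i y)] f := h3
  ext v
  rw [pullback_toFun, ← h1, ← h2]
  refine (diff_comp (hF.mdiff _) (j.contMDiff.mdifferentiableAt (by simp)) v).symm.trans ?_
  rw [diff_congr h4]
  rfl

lemma diff_bar_congr_of_eventuallyEq {φ : TangentMono IX IX IS id i} {σ τ : AnnSection φ}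
    {t : φ.Total} (h : ∀ᶠ y in 𝓝 t.1, σ.toFun y = τ.toFun y) :
    diff (normalModel IX EX ES) σ.bar t = diff (normalModel IX EX ES) τ.bar t := by
  refine diff_congr ?_
  filter_upwards [φ.continuous_proj.continuousAt.eventually h] with t' ht
  obtain ⟨y, b⟩ := t'
  obtain ⟨v, rfl⟩ := φ.cls_surjective y b
  rw [bar_cls, bar_cls, ht]

end AnnSection

namespace SmoothImmersion

lemma contMDiff_inclNormal :
    ContMDiff (normalModel IX EX ES) (normalModel IX EX EZ) ∞ (inclNormal j i) := fun t ↦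
  contMDiffAt_of_bar (i.normal.contMDiff_proj t) fun σ ↦
    (σ.pullback.smooth_bar t).congr_of_eventuallyEq (.of_forall fun t ↦ σ.bar_inclNormal t)

/-- Tangent vectors of `TS|_X / TX` are determined by restrictions of fibrewise linear functions on
`TZ|_X / TX`. -/
lemma eq_zero_of_diff_pullback {t : i.NormalBundle}
    {v : TangentSpace (normalModel IX EX ES) t}
    (h1 : ∀ σ : AnnSection (j.comp i).normal, diff (normalModel IX EX ES) σ.pullback.bar t v = 0)
    (h2 : ∀ h : X → ℝ, IsSmoothFun IX h →
      diff (normalModel IX EX ES) (fun t : i.NormalBundle ↦ h t.1) t v = 0) : v = 0 := by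
  refine vector_ext (φ := i.normal) (fun τ ↦ ?_) fun h hh ↦ ?_
  · obtain ⟨σ, hσ⟩ := τ.exists_pullback_eq (j := j) t.1
    rw [map_zero, ← diff_bar_congr_of_eventuallyEq hσ, h1]
  · rw [map_zero, h2 h hh]

/-- The inclusion of `TS|_X / TX` in `TZ|_X / TX`. -/
def inclNormalImmersion (j : SmoothImmersion IS IZ S Z) (i : SmoothImmersion IX IS X S) :
    SmoothImmersion (normalModel IX EX ES) (normalModel IX EX EZ) i.NormalBundle
      (j.comp i).NormalBundle where
  toFun := inclNormal j i
  contMDiff := contMDiff_inclNormal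
  injective_mfderiv t := by
    refine (injective_iff_map_eq_zero _).2 fun v hv ↦ ?_
    have d := (contMDiff_inclNormal (j := j) (i := i)).mdifferentiableAt (x := t) (by simp)
    refine eq_zero_of_diff_pullback (j := j) (fun σ ↦ ?_) fun h hh ↦ ?_
    · have h1 : σ.pullback.bar = fun t ↦ σ.bar (inclNormal j i t) :=
        funext fun t ↦ (σ.bar_inclNormal t).symm
      rw [h1]
      refine (diff_comp (σ.smooth_bar.mdiff _) d v).trans ?_
      rw [hv, map_zero]
    · refine (diff_comp (f := fun t : (j.comp i).NormalBundle ↦ h t.1) (g := inclNormal j i)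
        (hh.comp_proj.mdiff _) d v).trans ?_
      rw [hv, map_zero]

lemma diff_bar_mfderiv_incl (σ : AnnSection (j.comp i).normal) (t : i.NormalBundle)
    (v : TangentSpace (normalModel IX EX ES) t) :
    diff (normalModel IX EX EZ) σ.bar (inclNormal j i t)
      (mfderiv (normalModel IX EX ES) (normalModel IX EX EZ) (inclNormal j i) t v) =
      diff (normalModel IX EX ES) σ.pullback.bar t v := by
  have h1 : σ.pullback.bar = fun t ↦ σ.bar (inclNormal j i t) :=
    funext fun t ↦ (σ.bar_inclNormal t).symm
  rw [h1]
  exact (diff_comp (σ.smooth_bar.mdiff _) (contMDiff_inclNormal.mdifferentiableAt (by simp)) v).symm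

lemma diff_proj_mfderiv_incl {h : X → ℝ} (hh : IsSmoothFun IX h) (t : i.NormalBundle)
    (v : TangentSpace (normalModel IX EX ES) t) :
    diff (normalModel IX EX EZ) (fun t : (j.comp i).NormalBundle ↦ h t.1) (inclNormal j i t)
      (mfderiv (normalModel IX EX ES) (normalModel IX EX EZ) (inclNormal j i) t v) =
      diff (normalModel IX EX ES) (fun t : i.NormalBundle ↦ h t.1) t v :=
  (diff_comp (f := fun t : (j.comp i).NormalBundle ↦ h t.1) (hh.comp_proj.mdiff _)
    (contMDiff_inclNormal.mdifferentiableAt (by simp)) v).symm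

end SmoothImmersion

lemma AnnSection.pullback_ofAlong_bar (l : AnnSection (j.along i)) (t : i.NormalBundle) :
    l.ofAlong.pullback.bar t = 0 := by
  obtain ⟨x, b⟩ := t
  obtain ⟨v, rfl⟩ := i.normal.cls_surjective x b
  rw [bar_cls, pullback_toFun]
  exact l.map_eq_zero x v

/-- If a conormal section annihilates `TS` at a point, the differential of its fibrewise linear
function is given by a section which annihilates `TS` and a function on the base. -/
lemma AnnSection.exists_diff_bar_eq_along (σ : AnnSection (j.comp i).normal)
    (t : (j.comp i).NormalBundle)
    (hσ : ∀ v, σ.toFun t.1 (mfderiv IS IZ j (i t.1) v) = 0) :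
    ∃ (l : AnnSection (j.along i)) (h : X → ℝ), IsSmoothFun IX h ∧
      diff (normalModel IX EX EZ) σ.bar t = diff (normalModel IX EX EZ) l.ofAlong.bar t +
        diff (normalModel IX EX EZ) (fun t : (j.comp i).NormalBundle ↦ h t.1) t := by
  -- Subtracting a section of `L_X` with the same value leaves a section that vanishes at the point,
  -- whose linear function has its differential from the base.
  obtain ⟨l, hl⟩ := exists_toFun_eq (φ := j.along i) t.1 (σ.toFun t.1) hσ
  have hm : IsSmoothFun IX fun _ : X ↦ (-1 : ℝ) := contMDiff_const
  have h0 : (smulAdd hm l.ofAlong σ).toFun t.1 = 0 := by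
    ext v
    change (-1 : ℝ) * l.toFun t.1 v + σ.toFun t.1 v = 0
    rw [hl]; ring
  obtain ⟨h, hh, e⟩ := exists_diff_bar_eq_diff_proj t h0
  refine ⟨l, h, hh, ?_⟩
  have h2 := diff_bar_smulAdd hm l.ofAlong σ t
  have h3 : diff (normalModel IX EX EZ) (fun _ : (j.comp i).NormalBundle ↦ (-1 : ℝ)) t = 0 :=
    diff_const _ _
  have h4 := e.symm.trans h2
  rw [h3] at h4
  rw [h4]
  ext v
  change diff (normalModel IX EX EZ) σ.bar t v = diff (normalModel IX EX EZ) l.ofAlong.bar t v +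
    ((-1 : ℝ) * diff (normalModel IX EX EZ) l.ofAlong.bar t v + l.ofAlong.bar t * (0 : ℝ) +
      diff (normalModel IX EX EZ) σ.bar t v)
  ring

namespace PoissonStructure

variable {hP : P.IsCoisotropic (j.comp i)}
  {P' : PoissonStructure (normalModel IX EX EZ) (j.comp i).NormalBundle}

/-- By skewness the kernel of `w♯` annihilates its image, and the image is the tangent space. -/
lemma IsIntegral.apply_mfderiv_eq_zero (hj : P.IsIntegral j) {s : S}
    {α : TangentSpace IZ (j s) →L[ℝ] ℝ} (hα : P.sharp (j s) α = 0) (v : TangentSpace IS s) :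
    α (mfderiv IS IZ j s v) = 0 := by
  obtain ⟨γ, hγ⟩ := hj.exists_sharp_eq s v
  rw [← hγ, P.skew, hα, map_zero, neg_zero]

namespace IsLinearization

variable (h' : IsLinearization hP P')

include h'

/-- The functions given by sections which annihilate `TS` are Casimirs on `TS|_X / TX`. -/
lemma sharp_diff_ofAlong_bar (hj : P.IsIntegral j) (l : AnnSection (j.along i))
    (t : i.NormalBundle) : P'.sharp (inclNormal j i t)
      (diff (normalModel IX EX EZ) l.ofAlong.bar (inclNormal j i t)) = 0 := by
  refine vector_ext (φ := (j.comp i).normal) (fun σ ↦ ?_) fun h hh ↦ ?_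
  · rw [map_zero]
    refine (h'.bracket_bar_bar σ l.ofAlong _).trans ?_
    rw [bar_inclNormal]
    exact pullback_ofAlong_bar
      ((AnnSection.bracket hP σ l.ofAlong).toAlong (bracket_ofAlong_apply hP hj σ l)) t
  · rw [map_zero]
    refine (h'.bracket_proj_bar l.ofAlong hh _).trans ?_
    rw [anchorDiff, anchor_ofAlong hP hj, map_zero]

/-- The kernel of `w♯` at points of `TS|_X / TX` is the annihilator of its tangent space. -/
lemma sharp_eq_zero_iff (hj : P.IsIntegral j) (hi : P.IsLagrangian j i) (t : i.NormalBundle)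
    (β : TangentSpace (normalModel IX EX EZ) (inclNormal j i t) →L[ℝ] ℝ) :
    P'.sharp (inclNormal j i t) β = 0 ↔
      ∀ v, β (mfderiv (normalModel IX EX ES) (normalModel IX EX EZ) (inclNormal j i) t v) = 0 := by
  obtain ⟨σ, h, hh, rfl⟩ := (j.comp i).normal.exists_diff_eq_bar (inclNormal j i t) β
  -- Once `σ` kills `TS` at the base point, the covector splits into `dl̄`, which is in the kernel
  -- and kills `TS'`, and a covector from the base.
  have key : (∀ v, σ.toFun t.1 (mfderiv IS IZ j (i t.1) v) = 0) →
      ∃ (l : AnnSection (j.along i)) (g : X → ℝ), IsSmoothFun IX g ∧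
        diff (normalModel IX EX EZ) (fun t : (j.comp i).NormalBundle ↦ σ.bar t + h t.1)
          (inclNormal j i t) = diff (normalModel IX EX EZ) l.ofAlong.bar (inclNormal j i t) +
          diff (normalModel IX EX EZ) (fun t : (j.comp i).NormalBundle ↦ g t.1)
            (inclNormal j i t) := by
    intro hσ
    obtain ⟨l, g, hg, e⟩ := σ.exists_diff_bar_eq_along (inclNormal j i t) hσ
    refine ⟨l, fun x ↦ g x + h x, hg.add hh, ?_⟩
    have hgp : IsSmoothFun (normalModel IX EX EZ) fun t : (j.comp i).NormalBundle ↦ g t.1 :=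
      hg.comp_proj
    have hhp : IsSmoothFun (normalModel IX EX EZ) fun t : (j.comp i).NormalBundle ↦ h t.1 :=
      hh.comp_proj
    rw [diff_add (σ.smooth_bar.mdiff _) (hhp.mdiff _), e,
      diff_add (f := fun t : (j.comp i).NormalBundle ↦ g t.1)
        (g := fun t : (j.comp i).NormalBundle ↦ h t.1) (hgp.mdiff _) (hhp.mdiff _), add_assoc]
  have hl : ∀ (l : AnnSection (j.along i)) v, diff (normalModel IX EX EZ) l.ofAlong.bar
      (inclNormal j i t) (mfderiv (normalModel IX EX ES) (normalModel IX EX EZ) (inclNormal j i) t v)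
      = 0 := by
    intro l v
    have h1 : l.ofAlong.pullback.bar = fun _ ↦ 0 := funext l.pullback_ofAlong_bar
    rw [diff_bar_mfderiv_incl, h1, diff_const]
    rfl
  constructor
  · intro h0
    -- Bracketing with functions of the base detects the anchor of `σ`.
    have h1 : σ.anchor hP t.1 = 0 := by
      refine tangent_ext fun α ↦ ?_
      obtain ⟨g, hg, rfl⟩ := exists_diff_eq (I := IX) t.1 α
      have h2 := h' AnnSection.zero σ g h hg hh (inclNormal j i t)
      have h3 : P'.bracket (fun t ↦ g t.1) (fun t ↦ σ.bar t + h t.1) (inclNormal j i t) = 0 := by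
        rw [PoissonStructure.bracket, h0, map_zero]
      rw [P'.bracket_add_right _ σ.smooth_bar hh.comp_proj, h'.bracket_proj_bar σ hg,
        h'.bracket_proj_proj hg hh, add_zero] at h3
      rw [map_zero]
      exact h3
    have h2 : P.sharp (j (i t.1)) (σ.toFun t.1) = 0 := by
      have := σ.map_anchor hP t.1
      rw [h1, map_zero] at this
      exact this.symm
    obtain ⟨l, g, hg, e⟩ := key fun v ↦ hj.apply_mfderiv_eq_zero h2 v
    rw [e] at h0 ⊢
    rw [map_add, h'.sharp_diff_ofAlong_bar hj, zero_add] at h0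
    -- Bracketing the base part with `τ̄` gives its derivative along the anchor of `τ`, and anchors
    -- exhaust `TX` because `X` is Lagrangian.
    have h3 : diff IX g t.1 = 0 := by
      ext u
      obtain ⟨τ, hτ⟩ := hi.exists_anchor_eq hj t.1 u
      have h4 : P'.bracket τ.bar (fun t ↦ g t.1) (inclNormal j i t) = 0 := by
        rw [PoissonStructure.bracket, h0, map_zero]
      rw [h'.bracket_bar_proj τ hg, neg_eq_zero] at h4
      rw [← hτ]
      exact h4
    intro v
    have h5 := hl l v
    refine (congrArg₂ (· + ·) h5 ((diff_proj_mfderiv_incl hg t v).trans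
      (diff_proj hg t v))).trans ?_
    rw [h3, zero_add]
    rfl
  · intro h0
    have hsum : ∀ v, diff (normalModel IX EX ES) σ.pullback.bar t v +
        diff (normalModel IX EX ES) (fun t : i.NormalBundle ↦ h t.1) t v = 0 := by
      intro v
      have := h0 v
      rw [diff_add (σ.smooth_bar.mdiff _) (hh.comp_proj.mdiff _)] at this
      rw [← diff_bar_mfderiv_incl, ← diff_proj_mfderiv_incl (j := j) hh]
      exact this
    -- Vertical vectors of `S'` show that `σ` kills `TS`.
    obtain ⟨l, g, hg, e⟩ := key fun v ↦ by
      have h1 := hsum (vertAt t (i.normal.cls t.1 v))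
      have h2 : diff (normalModel IX EX ES) σ.pullback.bar t (vertAt t (i.normal.cls t.1 v)) = _ :=
        diff_bar_vertAt σ.pullback t _
      have h3 : diff (normalModel IX EX ES) (fun t : i.NormalBundle ↦ h t.1) t
        (vertAt t (i.normal.cls t.1 v)) = 0 := diff_proj_vertAt hh t _
      rw [h2, h3, add_zero, bar_cls] at h1
      exact h1
    rw [e] at h0 ⊢
    have h1 : ∀ v, diff (normalModel IX EX ES) (fun t : i.NormalBundle ↦ g t.1) t v = 0 := by
      intro v
      rw [← diff_proj_mfderiv_incl (j := j) hg]
      have h2 := h0 v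
      refine Eq.trans ?_ h2
      refine Eq.trans ?_ (congrArg (· + _) (hl l v).symm)
      exact (zero_add _).symm
    have h2 : diff IX g t.1 = 0 := by
      obtain ⟨x, b⟩ := t
      obtain ⟨v, rfl⟩ := i.normal.cls_surjective x b
      obtain ⟨V, hV, rfl⟩ := exists_field_eq (I := IS) (i x) v
      ext u
      have hs := contMDiff_cls_field (k := i) hV
      refine Eq.trans ?_ (h1 (mfderiv IX (normalModel IX EX ES)
        (fun y ↦ (⟨y, i.normal.cls y (V (i y))⟩ : i.NormalBundle)) x u))
      exact (diff_section_comp (φ := i.normal) hs (u := fun t : i.NormalBundle ↦ g t.1)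
        hg.comp_proj x u).symm
    have h3 : diff (normalModel IX EX EZ) (fun t : (j.comp i).NormalBundle ↦ g t.1)
        (inclNormal j i t) = 0 := by
      ext v
      refine (diff_proj hg _ v).trans ?_
      exact congrArg (fun T : TangentSpace IX t.1 →L[ℝ] ℝ ↦ T _) h2
    rw [h3, add_zero, h'.sharp_diff_ofAlong_bar hj]

/-- `TS|_X / TX` is an integral manifold of the linearization. -/
lemma isIntegral_incl (hj : P.IsIntegral j) (hi : P.IsLagrangian j i) :
    P'.IsIntegral (inclNormalImmersion j i) where
  injective := inclNormal_injective
  range_eq t := by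
    have f1 : FiniteDimensional ℝ (TangentSpace (normalModel IX EX EZ) (inclNormal j i t)) :=
      inferInstanceAs (FiniteDimensional ℝ (EX × CokerModel EX EZ))
    have f2 : T2Space (TangentSpace (normalModel IX EX EZ) (inclNormal j i t)) :=
      inferInstanceAs (T2Space (EX × CokerModel EX EZ))
    -- A subspace is determined by its annihilator; both `TS'` and the image of `w'♯` have `ker w'♯`
    -- as annihilator.
    have sep : ∀ (R : Submodule ℝ (TangentSpace (normalModel IX EX EZ) (inclNormal j i t))) v,
        (∀ β : TangentSpace (normalModel IX EX EZ) (inclNormal j i t) →L[ℝ] ℝ,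
          (∀ w ∈ R, β w = 0) → β v = 0) → v ∈ R := by
      intro R v h
      by_contra hv
      obtain ⟨f, hf, hR⟩ := Submodule.exists_le_ker_of_notMem hv
      exact hf (h (LinearMap.toContinuousLinearMap f) fun w hw ↦ hR hw)
    have h0 := h'.sharp_eq_zero_iff hj hi t
    refine Subset.antisymm ?_ ?_
    · rintro _ ⟨w, rfl⟩
      refine sep (LinearMap.range (P'.sharp (inclNormal j i t))) _ fun β hβ ↦ ?_
      refine (h0 β).1 (tangent_ext fun γ ↦ ?_) w
      rw [P'.skew, hβ _ ⟨γ, rfl⟩, neg_zero, map_zero]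
    · rintro _ ⟨γ, rfl⟩
      refine sep (LinearMap.range (mfderiv (normalModel IX EX ES) (normalModel IX EX EZ)
        (inclNormal j i) t).toLinearMap) _ fun β hβ ↦ ?_
      refine (P'.skew (inclNormal j i t) β γ).trans ?_
      rw [(h0 β).2 fun v ↦ hβ _ ⟨v, rfl⟩]
      exact (congrArg Neg.neg (map_zero γ)).trans neg_zero

/-- The functions which vanish on `TS|_X / TX` form a Poisson ideal. -/
lemma bracket_eq_zero_of_incl (hj : P.IsIntegral j) (hi : P.IsLagrangian j i)
    {f g : (j.comp i).NormalBundle → ℝ} (hf : IsSmoothFun (normalModel IX EX EZ) f)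
    (h0 : ∀ t, f (inclNormal j i t) = 0) (t : i.NormalBundle) :
    P'.bracket f g (inclNormal j i t) = 0 := by
  obtain ⟨v, hv⟩ := (h'.isIntegral_incl hj hi).exists_mfderiv_eq t
    (diff (normalModel IX EX EZ) g (inclNormal j i t))
  have h1 : (fun t ↦ f (inclNormal j i t)) = fun _ ↦ 0 := funext h0
  have h2 := diff_comp (hf.mdiff (inclNormal j i t))
    (contMDiff_inclNormal.mdifferentiableAt (x := t) (by simp)) v
  rw [h1, diff_const] at h2
  refine (congrArg (diff (normalModel IX EX EZ) f (inclNormal j i t)) hv).symm.trans ?_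
  exact h2.symm

/-- The zero section is a Lagrangian submanifold of `TS|_X / TX`. -/
lemma isLagrangian_zero (hj : P.IsIntegral j) (hi : P.IsLagrangian j i) :
    P'.IsLagrangian (inclNormalImmersion j i) i.zero where
  isEmbedding := Topology.IsEmbedding.of_leftInverse (f := fun t : i.NormalBundle ↦ t.1)
    (fun _ ↦ rfl) i.normal.continuous_proj i.zero.contMDiff.continuous
  finrank_eq := by
    have := hi.finrank_eq
    rw [Module.finrank_prod, Module.finrank_fin_fun]
    omega
  isotropic x u v := by
    have hI := h'.isIntegral_incl hj hi
    -- With `u` the anchor of `σ`, its image is the Hamiltonian vector of `σ̄`, and `σ̄` is constant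
    -- on the zero section.
    obtain ⟨σ, hσ⟩ := hi.exists_anchor_eq hj x u
    have hz : ∀ (τ : AnnSection (j.comp i).normal) (w : TangentSpace IX x),
        diff (normalModel IX EX EZ) τ.bar (inclNormal j i (i.zero x))
          (mfderiv (normalModel IX EX ES) (normalModel IX EX EZ) (inclNormal j i) (i.zero x)
            (mfderiv IX (normalModel IX EX ES) i.zero x w)) = 0 := fun τ w ↦ by
      rw [diff_bar_mfderiv_incl, diff_bar_zero]
    have h1 : P'.sharp (inclNormal j i (i.zero x))
        (diff (normalModel IX EX EZ) σ.bar (inclNormal j i (i.zero x))) =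
        mfderiv (normalModel IX EX ES) (normalModel IX EX EZ) (inclNormal j i) (i.zero x)
          (mfderiv IX (normalModel IX EX ES) i.zero x u) := by
      refine vector_ext (φ := (j.comp i).normal) (fun τ ↦ ?_) fun h hh ↦ ?_
      · refine (h'.bracket_bar_bar τ σ _).trans (Eq.trans ?_ (hz τ u).symm)
        rw [bar_inclNormal]
        exact bar_zero _ x
      · refine (h'.bracket_proj_bar σ hh _).trans (Eq.trans ?_
          (diff_proj_mfderiv_incl hh _ _).symm)
        rw [diff_proj_zero hh, ← hσ]
        rfl
    exact (hI.leafForm_eq h1 _).trans (hz σ v)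

end IsLinearization
end PoissonStructure

end InclNormal

/-! ### A Gronwall argument in local frames -/

section Gronwall

/-- A function which vanishes at the centre of a ball and whose derivative is bounded by a multiple
of the function vanishes on the ball. -/
lemma eq_zero_of_norm_fderiv_le {E F : Type*} [NormedAddCommGroup E] [NormedSpace ℝ E]
    [NormedAddCommGroup F] [NormedSpace ℝ F] {g : E → F} {c : E} {r K : ℝ}
    (hg : ∀ y ∈ Metric.ball c r, DifferentiableAt ℝ g y)
    (hK : ∀ y ∈ Metric.ball c r, ‖fderiv ℝ g y‖ ≤ K * ‖g y‖) (h0 : g c = 0) {y : E}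
    (hy : y ∈ Metric.ball c r) : g y = 0 := by
  have hmem : ∀ s ∈ Icc (0 : ℝ) 1, c + s • (y - c) ∈ Metric.ball c r := by
    intro s hs
    rw [Metric.mem_ball, dist_eq_norm] at hy ⊢
    rw [add_sub_cancel_left, norm_smul, Real.norm_of_nonneg hs.1]
    exact (mul_le_of_le_one_left (norm_nonneg _) hs.2).trans_lt hy
  have hd : ∀ s ∈ Icc (0 : ℝ) 1, HasDerivAt (fun s : ℝ ↦ g (c + s • (y - c)))
      (fderiv ℝ g (c + s • (y - c)) (y - c)) s := by
    intro s hs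
    have h1 : HasDerivAt (fun s : ℝ ↦ c + s • (y - c)) (y - c) s := by
      simpa using ((hasDerivAt_id s).smul_const (y - c)).const_add c
    exact (hg _ (hmem s hs)).hasFDerivAt.comp_hasDerivAt s h1
  -- Gronwall's inequality on the segment from `c` to `y`.
  have h := eq_zero_of_abs_deriv_le_mul_abs_self_of_eq_zero_right (K := K * ‖y - c‖)
    (fun s hs ↦ (hd s hs).continuousAt.continuousWithinAt)
    (fun s hs ↦ (hd s (Ico_subset_Icc_self hs)).hasDerivWithinAt) (by simpa using h0)
    (fun s hs ↦ by
      refine (ContinuousLinearMap.le_opNorm _ _).trans ?_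
      have := mul_le_mul_of_nonneg_right (hK _ (hmem s (Ico_subset_Icc_self hs)))
        (norm_nonneg (y - c))
      linarith) 1 (by simp)
  simpa using h

/-- A linear map is bounded by its values on a small perturbation of a basis. -/
lemma exists_norm_le_of_basis {E : Type*} [NormedAddCommGroup E] [NormedSpace ℝ E]
    [FiniteDimensional ℝ E] {n : ℕ} (b : Basis (Fin n) ℝ E) :
    ∃ C : ℝ, 0 < C ∧ ∀ {F : Type} [NormedAddCommGroup F] [NormedSpace ℝ F] (T : E →L[ℝ] F)
      (y : Fin n → E) (K : ℝ), 0 ≤ K → (∀ a, ‖y a - b a‖ ≤ 1 / (2 * C)) → (∀ a, ‖T (y a)‖ ≤ K) →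
      ‖T‖ ≤ 2 * C * K := by
  let B : Fin n → E →L[ℝ] ℝ := fun a ↦ LinearMap.toContinuousLinearMap (b.coord a)
  have hS : 0 ≤ ∑ a, ‖B a‖ := Finset.sum_nonneg fun _ _ ↦ norm_nonneg _
  -- The sum bounds the coordinate functionals and the `+ 1` makes the constant positive. A
  -- perturbation by `1 / (2 * C)` costs at most half of `‖T‖`, which the left side absorbs; hence
  -- the factor 2.
  refine ⟨∑ a, ‖B a‖ + 1, by positivity, fun T y K hK0 hy hT ↦ ?_⟩
  set C := ∑ a, ‖B a‖ + 1 with hC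
  have hCpos : 0 < C := by positivity
  have h1 : ∀ a, ‖T (b a)‖ ≤ K + ‖T‖ * (1 / (2 * C)) := by
    intro a
    have h2 : T (b a) = T (y a) - T (y a - b a) := by rw [map_sub]; abel
    rw [h2]
    refine (norm_sub_le _ _).trans (add_le_add (hT a) ((T.le_opNorm _).trans ?_))
    exact mul_le_mul_of_nonneg_left (hy a) (norm_nonneg _)
  have h0 : 0 ≤ K + ‖T‖ * (1 / (2 * C)) := by positivity
  have h3 : ‖T‖ ≤ C * (K + ‖T‖ * (1 / (2 * C))) := by
    refine T.opNorm_le_bound (by positivity) fun w ↦ ?_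
    have h4 : T w = ∑ a, B a w • T (b a) := by
      conv_lhs => rw [← b.sum_repr w]
      rw [map_sum]
      simp only [map_smul]
      rfl
    rw [h4]
    refine (norm_sum_le _ _).trans ?_
    have h5 : ∀ a ∈ Finset.univ, ‖B a w • T (b a)‖ ≤
        ‖B a‖ * (‖w‖ * (K + ‖T‖ * (1 / (2 * C)))) := by
      intro a _
      rw [norm_smul, ← mul_assoc]
      exact mul_le_mul ((B a).le_opNorm w) (h1 a) (norm_nonneg _) (by positivity)
    refine (Finset.sum_le_sum h5).trans ?_
    rw [← Finset.sum_mul]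
    have h6 : 0 ≤ ‖w‖ * (K + ‖T‖ * (1 / (2 * C))) := by positivity
    have h7 : (∑ a, ‖B a‖) * (‖w‖ * (K + ‖T‖ * (1 / (2 * C)))) ≤
        C * (‖w‖ * (K + ‖T‖ * (1 / (2 * C)))) :=
      mul_le_mul_of_nonneg_right (by rw [hC]; linarith) h6
    linarith
  have h8 : C * (K + ‖T‖ * (1 / (2 * C))) = C * K + ‖T‖ / 2 := by field_simp
  rw [h8] at h3
  linarith

variable {E H M : Type*} [NormedAddCommGroup E] [NormedSpace ℝ E] [TopologicalSpace H]
  {I : ModelWithCorners ℝ E H} [TopologicalSpace M] [ChartedSpace H M]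
  [FiniteDimensional ℝ E] [T2Space M] [IsManifold I ∞ M] [I.Boundaryless]

/-- A smooth function which vanishes at a point, and whose derivatives along a local frame are
bounded by a multiple of the function, vanishes near this point. -/
lemma eventually_eq_zero_of_frame {m : ℕ} {f : M → Fin m → ℝ} (hf : ContMDiff I 𝓘(ℝ, Fin m → ℝ) ∞ f)
    {s₀ : M} (h0 : f s₀ = 0) (Y : Fin (finrank ℝ E) → ∀ s : M, TangentSpace I s)
    (hYb : ∀ a, Y a s₀ = (finBasis ℝ E a : E))
    (hY : ∀ a (u : M → ℝ), IsSmoothFun I u → ContinuousAt (fun s ↦ diff I u s (Y a s)) s₀) (K : ℝ)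
    (hK0 : 0 ≤ K)
    (hK : ∀ᶠ s in 𝓝 s₀, ∀ a c, |diff I (fun s ↦ f s c) s (Y a s)| ≤ K * ‖f s‖) :
    ∀ᶠ s in 𝓝 s₀, f s = 0 := by
  obtain ⟨G, hG, hGe⟩ := exists_contMDiff_eq_extChartAt (I := I) s₀
  set φ := extChartAt I s₀ with hφ
  have hz : φ s₀ ∈ φ.target := mem_extChartAt_target s₀
  have hzz : φ.symm (φ s₀) = s₀ := extChartAt_to_inv s₀
  -- The frame read in a chart. At `s₀` it is the standard basis and it is continuous there, so near
  -- `s₀` bounds along the frame bound the full derivative.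
  let y : Fin (finrank ℝ E) → M → E := fun a s ↦ mfderiv I 𝓘(ℝ, E) G s (Y a s)
  have hy0 : ∀ a, y a s₀ = finBasis ℝ E a := by
    intro a
    have h1 : mfderiv I 𝓘(ℝ, E) G s₀ = ContinuousLinearMap.id ℝ E := by
      rw [hGe.mfderiv_eq]; exact mfderiv_extChartAt_self
    change mfderiv I 𝓘(ℝ, E) G s₀ (Y a s₀) = _
    rw [h1, hYb]
    rfl
  have hyc : ∀ a, ContinuousAt (y a) s₀ := by
    intro a
    let B : Fin (finrank ℝ E) → E →L[ℝ] ℝ :=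
      fun a ↦ LinearMap.toContinuousLinearMap ((finBasis ℝ E).coord a)
    have h1 : y a = fun s ↦ ∑ c, diff I (fun s ↦ B c (G s)) s (Y a s) • finBasis ℝ E c := by
      funext s
      rw [← (finBasis ℝ E).sum_repr (y a s)]
      refine Finset.sum_congr rfl fun c _ ↦ ?_
      rw [diff_clm_comp (B c) (hG.mdifferentiableAt (by simp))]
      rfl
    rw [h1]
    refine tendsto_finsetSum _ fun c _ ↦ ?_
    exact ContinuousAt.smul (hY a _ ((B c).contMDiff.comp hG)) continuousAt_const
  obtain ⟨C, hC, hCb⟩ := exists_norm_le_of_basis (finBasis ℝ E)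
  have hsymm : ∀ᶠ θ in 𝓝 (φ s₀), ContMDiffAt 𝓘(ℝ, E) I ∞ φ.symm θ := by
    filter_upwards [(isOpen_extChartAt_target (I := I) s₀).mem_nhds hz] with θ hθ
    exact (contMDiffOn_extChartAt_symm s₀).contMDiffAt
      ((isOpen_extChartAt_target s₀).mem_nhds hθ)
  let g : E → Fin m → ℝ := fun θ ↦ f (φ.symm θ)
  have hgd : ∀ᶠ θ in 𝓝 (φ s₀), DifferentiableAt ℝ g θ := by
    filter_upwards [hsymm] with θ hθ
    have h1 : ContMDiffAt 𝓘(ℝ, E) 𝓘(ℝ, Fin m → ℝ) ∞ g θ := (hf _).comp θ hθ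
    exact h1.contDiffAt.differentiableAt (by simp)
  have ht : Tendsto φ.symm (𝓝 (φ s₀)) (𝓝 s₀) := by
    have := hsymm.self_of_nhds.continuousAt.tendsto
    rwa [hzz] at this
  have hGφ : ∀ᶠ s in 𝓝 s₀, f =ᶠ[𝓝 s] fun s ↦ g (G s) := by
    filter_upwards [eventually_eventually_nhds.2 hGe,
      eventually_eventually_nhds.2 (extChartAt_source_mem_nhds (I := I) s₀)] with s h1 h2
    filter_upwards [h1, h2] with s' h3 h4
    change f s' = f (φ.symm (G s'))
    rw [h3, φ.left_inv h4]
  have hGs : ∀ᶠ s in 𝓝 s₀, DifferentiableAt ℝ g (G s) := by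
    have : Tendsto G (𝓝 s₀) (𝓝 (φ s₀)) := by
      have := hG.continuous.continuousAt (x := s₀)
      rwa [ContinuousAt, hGe.self_of_nhds] at this
    exact this.eventually hgd
  have hbound : ∀ᶠ s in 𝓝 s₀, ‖fderiv ℝ g (G s)‖ ≤ 2 * C * (K * ‖f s‖) := by
    have hyn : ∀ᶠ s in 𝓝 s₀, ∀ a, ‖y a s - finBasis ℝ E a‖ ≤ 1 / (2 * C) := by
      refine eventually_all.2 fun a ↦ ?_
      have h1 : Tendsto (fun s ↦ ‖y a s - finBasis ℝ E a‖) (𝓝 s₀)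
          (𝓝 ‖y a s₀ - finBasis ℝ E a‖) := ((hyc a).sub continuousAt_const).norm
      rw [hy0, sub_self, norm_zero] at h1
      have hpos : 0 < 1 / (2 * C) := by positivity
      filter_upwards [h1.eventually (gt_mem_nhds hpos)] with s hs
        using hs.le
    filter_upwards [hK, hGφ, hGs, hyn] with s h1 h2 h3 h4
    refine hCb _ (fun a ↦ y a s) _ (by positivity) h4 fun a ↦ ?_
    refine (pi_norm_le_iff_of_nonneg (by positivity)).2 fun c ↦ ?_
    refine le_trans (le_of_eq ?_) (h1 a c)
    rw [Real.norm_eq_abs]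
    congr 1
    have h5 : (fun s ↦ f s c) =ᶠ[𝓝 s] fun s ↦ g (G s) c := by
      filter_upwards [h2] with s' hs'
      rw [hs']
    rw [diff_congr h5]
    have h6 : HasFDerivAt (fun θ ↦ g θ c)
        ((ContinuousLinearMap.proj (R := ℝ) (φ := fun _ : Fin m ↦ ℝ) c).comp (fderiv ℝ g (G s)))
        (G s) := hasFDerivAt_pi'.1 h3.hasFDerivAt c
    refine Eq.trans ?_ (diff_comp (I' := 𝓘(ℝ, E)) (f := fun θ ↦ g θ c) (g := G) (z := s)
      h6.differentiableAt.mdifferentiableAt (hG.mdifferentiableAt (by simp)) (Y a s)).symm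
    have h7 : diff 𝓘(ℝ, E) (fun θ ↦ g θ c) (G s) = _ := (mfderiv_eq_fderiv).trans h6.fderiv
    rw [h7]
    rfl
  have hb2 : ∀ᶠ θ in 𝓝 (φ s₀), ‖fderiv ℝ g θ‖ ≤ (2 * C * K) * ‖g θ‖ := by
    filter_upwards [ht.eventually hbound, ht.eventually hGe,
      (isOpen_extChartAt_target (I := I) s₀).mem_nhds hz] with θ h1 h2 h3
    rw [h2, φ.right_inv h3] at h1
    rw [mul_assoc]
    exact h1
  obtain ⟨r, hr, hball⟩ := Metric.eventually_nhds_iff_ball.1 (hgd.and hb2)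
  have hg0 : ∀ᶠ θ in 𝓝 (φ s₀), g θ = 0 := by
    filter_upwards [Metric.ball_mem_nhds (φ s₀) hr] with θ hθ
    refine eq_zero_of_norm_fderiv_le (fun y hy ↦ (hball y hy).1) (fun y hy ↦ (hball y hy).2) ?_ hθ
    change f (φ.symm (φ s₀)) = 0
    rw [hzz, h0]
  have hφc : Tendsto φ (𝓝 s₀) (𝓝 (φ s₀)) := continuousAt_extChartAt s₀
  filter_upwards [hφc.eventually hg0, extChartAt_source_mem_nhds (I := I) s₀] with s h1 h2
  have h3 : f (φ.symm (φ s)) = 0 := h1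
  rwa [φ.left_inv h2] at h3

end Gronwall

/-! ### Maximality of `S'` -/

section Maximal

variable {EX HX X : Type*} [NormedAddCommGroup EX] [NormedSpace ℝ EX] [TopologicalSpace HX]
  [TopologicalSpace X] [ChartedSpace HX X]
  {ES HS S : Type*} [NormedAddCommGroup ES] [NormedSpace ℝ ES] [TopologicalSpace HS]
  [TopologicalSpace S] [ChartedSpace HS S]
  {EZ HZ Z : Type*} [NormedAddCommGroup EZ] [NormedSpace ℝ EZ] [TopologicalSpace HZ]
  [TopologicalSpace Z] [ChartedSpace HZ Z]
  {IX : ModelWithCorners ℝ EX HX} {IS : ModelWithCorners ℝ ES HS}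
  {IZ : ModelWithCorners ℝ EZ HZ}
  [IsManifold IX ∞ X] [IsManifold IS ∞ S] [IsManifold IZ ∞ Z]
  {P : PoissonStructure IZ Z} {j : SmoothImmersion IS IZ S Z} {i : SmoothImmersion IX IS X S}
  [FiniteDimensional ℝ EX] [FiniteDimensional ℝ ES] [FiniteDimensional ℝ EZ]
  [T2Space Z] [T2Space S] [T2Space X] [IX.Boundaryless] [IS.Boundaryless] [IZ.Boundaryless]

open SmoothImmersion AnnSection TangentMono

/-- In a trivialization `κ̄` is a covector of locally bounded norm applied to the fibre coordinate.
-/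
lemma AnnSection.exists_bar_le {EA HA A : Type*} [NormedAddCommGroup EA] [NormedSpace ℝ EA]
    [TopologicalSpace HA] [TopologicalSpace A] [ChartedSpace HA A] {IA : ModelWithCorners ℝ EA HA}
    [IsManifold IA ∞ A] {g : X → A} {f : X → Z} {φ : TangentMono IX IA IZ g f}
    [FiniteDimensional ℝ EA] (κ : AnnSection φ) (x₀ : X) :
    ∃ K : ℝ, 0 ≤ K ∧ ∀ᶠ x in 𝓝 x₀, ∀ b : φ.Coker x,
      |κ.bar ⟨x, b⟩| ≤ K * ‖φ.fibTriv x₀ x b‖ := by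
  let A : X → EZ →L[ℝ] ℝ := fun x ↦ ContinuousLinearMap.inCoordinates EZ (TangentSpace IZ) ℝ
        (Bundle.Trivial Z ℝ) (f x₀) (f x) (f x₀) (f x) (κ.toFun x)
  have hA : ContinuousAt A x₀ := ((contMDiffAt_hom_bundle _).1 (κ.smooth x₀)).2.continuousAt
  refine ⟨(‖A x₀‖ + 1) * ‖φ.sec x₀‖, by positivity, ?_⟩
  filter_upwards [hA.norm.eventually (gt_mem_nhds (lt_add_one ‖A x₀‖)), φ.eventually_dom x₀]
    with x h1 h2 b
  rw [κ.bar_eq_fibTriv (t := ⟨x, b⟩) h2]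
  have h3 : κ.toFun x ((φ.trivZ x₀).symmL ℝ (f x) (φ.sec x₀ (φ.fibTriv x₀ x b))) =
      A x (φ.sec x₀ (φ.fibTriv x₀ x b)) := by
    simp [A, ContinuousLinearMap.inCoordinates]
  rw [h3, ← Real.norm_eq_abs]
  refine ((A x).le_opNorm _).trans ?_
  rw [mul_assoc]
  exact mul_le_mul h1.le ((φ.sec x₀).le_opNorm _) (norm_nonneg _) (by positivity)

/-- `S'` is the kernel of the projection to `TZ|_X / TS|_X`, on which the linear functions of
sections of `L_X` separate points. -/
lemma SmoothImmersion.mem_range_inclNormal_iff {t : (j.comp i).NormalBundle} :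
    t ∈ range (inclNormal j i) ↔ ∀ l : AnnSection (j.along i), l.ofAlong.bar t = 0 := by
  constructor
  · rintro ⟨t, rfl⟩ l
    rw [bar_inclNormal, pullback_ofAlong_bar]
  · intro h
    obtain ⟨x, b⟩ := t
    obtain ⟨v, rfl⟩ := (j.comp i).normal.cls_surjective x b
    have h1 : projAlong j i ⟨x, (j.comp i).normal.cls x v⟩ = ⟨x, 0⟩ :=
      ext_bar rfl fun l ↦ by rw [← ofAlong_bar, h, bar_zero]
    obtain ⟨s, rfl⟩ := ((j.along i).cls_eq_zero).1
      (TotalSpace.mk_injective x ((projAlong_cls x v).symm.trans h1))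
    exact ⟨⟨x, i.normal.cls x s⟩, inclNormal_cls x s⟩

namespace PoissonStructure.IsLinearization

variable {hP : P.IsCoisotropic (j.comp i)}
  {P' : PoissonStructure (normalModel IX EX EZ) (j.comp i).NormalBundle}
  (h' : IsLinearization hP P')

include h'

/-- The ideal property and the vanishing anchor: derivatives of the `l̄` in Hamiltonian directions
are again functions of this type. The differential inequality for Gronwall rests on this. -/
lemma bracket_ofAlong_bar (hj : P.IsIntegral j) (l : AnnSection (j.along i))
    (σ : AnnSection (j.comp i).normal) {h : X → ℝ} (hh : IsSmoothFun IX h)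
    (t : (j.comp i).NormalBundle) :
    P'.bracket l.ofAlong.bar (fun t ↦ σ.bar t + h t.1) t =
      -((AnnSection.bracket hP σ l.ofAlong).toAlong (bracket_ofAlong_apply hP hj σ l)).bar
        (projAlong j i t) := by
  rw [P'.bracket_skew, P'.bracket_add_left _ σ.smooth_bar hh.comp_proj, h'.bracket_bar_bar,
    h'.bracket_proj_bar _ hh, anchorDiff, anchor_ofAlong hP hj, map_zero, add_zero, ← ofAlong_bar]
  rfl

/-- The fibre coordinates of the projection to `TZ|_X / TS|_X`, followed along the integral
manifold, vanish at `s₀` and have derivatives bounded by a multiple of themselves. -/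
lemma eventually_mem_range_inclNormal (hj : P.IsIntegral j)
    {S₁ : Type*} [TopologicalSpace S₁] [ChartedSpace (ModelProd HX (CokerModel EX ES)) S₁]
    [IsManifold (normalModel IX EX ES) ∞ S₁]
    (j₁ : SmoothImmersion (normalModel IX EX ES) (normalModel IX EX EZ) S₁ (j.comp i).NormalBundle)
    (hj₁ : P'.IsIntegral j₁) {s₀ : S₁} (h0 : j₁ s₀ ∈ range (inclNormal j i)) :
    ∀ᶠ s in 𝓝 s₀, j₁ s ∈ range (inclNormal j i) := by
  have : T2Space S₁ := T2Space.of_injective_continuous hj₁.injective j₁.contMDiff.continuous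
  let x₀ : X := (j₁ s₀).1
  have hpr : Tendsto (fun s ↦ (j₁ s).1) (𝓝 s₀) (𝓝 x₀) :=
    ((j.comp i).normal.continuous_proj.comp j₁.contMDiff.continuous).continuousAt
  choose l hl using fun c ↦ exists_eq_fibTriv (φ := j.along i) x₀
    (ContinuousLinearMap.proj (R := ℝ) (φ := fun _ ↦ ℝ) c)
  let f : S₁ → CokerModel ES EZ := fun s c ↦ (l c).ofAlong.bar (j₁ s)
  have hf : ContMDiff (normalModel IX EX ES) 𝓘(ℝ, CokerModel ES EZ) ∞ f :=
    contMDiff_pi_space.2 fun c ↦ (l c).ofAlong.smooth_bar.comp j₁.contMDiff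
  have hfe : ∀ᶠ s in 𝓝 s₀, f s = (j.along i).fibTriv x₀ (j₁ s).1 (projAlong j i (j₁ s)).2 := by
    filter_upwards [hpr.eventually (eventually_all.2 hl)] with s hs
    funext c
    change (l c).ofAlong.bar (j₁ s) = _
    rw [ofAlong_bar]
    have h1 := (hs c).2
    change (l c).bar ⟨(j₁ s).1, (projAlong j i (j₁ s)).2⟩ = _
    obtain ⟨v, hv⟩ := (j.along i).cls_surjective _ (projAlong j i (j₁ s)).2
    rw [← hv]
    exact (bar_cls _ _ _).trans (h1 v)
  have hdom : ∀ᶠ s in 𝓝 s₀, (j₁ s).1 ∈ (j.along i).dom x₀ :=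
    hpr.eventually ((j.along i).eventually_dom x₀)
  -- Each basis vector at `s₀` is the Hamiltonian vector of a generator; the same generators furnish
  -- the frame `Y` at the other points.
  have hb : ∀ a, ∃ (σ : AnnSection (j.comp i).normal) (h : X → ℝ), IsSmoothFun IX h ∧
      P'.sharp (j₁ s₀) (diff (normalModel IX EX EZ) (fun t ↦ σ.bar t + h t.1) (j₁ s₀)) =
      mfderiv (normalModel IX EX ES) (normalModel IX EX EZ) j₁ s₀
        (finBasis ℝ (EX × CokerModel EX ES) a : EX × CokerModel EX ES) := by
    intro a
    obtain ⟨β, hβ⟩ := hj₁.exists_sharp_eq s₀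
      (finBasis ℝ (EX × CokerModel EX ES) a : EX × CokerModel EX ES)
    obtain ⟨σ, h, hh, e⟩ := (j.comp i).normal.exists_diff_eq_bar (j₁ s₀) β
    exact ⟨σ, h, hh, by rw [e, hβ]⟩
  choose σ h hh hσ using hb
  have hu : ∀ a, IsSmoothFun (normalModel IX EX EZ)
      fun t : (j.comp i).NormalBundle ↦ (σ a).bar t + h a t.1 :=
    fun a ↦ (σ a).smooth_bar.add (hh a).comp_proj
  choose Y hY using fun a s ↦ hj₁.exists_mfderiv_eq s
    (diff (normalModel IX EX EZ) (fun t ↦ (σ a).bar t + h a t.1) (j₁ s))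
  have hYd : ∀ a s {U : (j.comp i).NormalBundle → ℝ}, IsSmoothFun (normalModel IX EX EZ) U →
      diff (normalModel IX EX ES) (fun s ↦ U (j₁ s)) s (Y a s) =
        P'.bracket U (fun t ↦ (σ a).bar t + h a t.1) (j₁ s) := by
    intro a s U hU
    refine (diff_comp (hU.mdiff _) (j₁.contMDiff.mdifferentiableAt (by simp)) _).trans ?_
    rw [hY]
    rfl
  choose K hK0 hK using fun (c : Fin (finrank ℝ EZ - finrank ℝ ES))
      (a : Fin (finrank ℝ (EX × CokerModel EX ES))) ↦
    ((AnnSection.bracket hP (σ a) (l c).ofAlong).toAlong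
      (bracket_ofAlong_apply hP hj (σ a) (l c))).exists_bar_le x₀
  have hz : ∀ᶠ s in 𝓝 s₀, f s = 0 := by
    refine eventually_eq_zero_of_frame hf ?_ Y ?_ ?_ (∑ c, ∑ a, K c a)
      (Finset.sum_nonneg fun c _ ↦ Finset.sum_nonneg fun a _ ↦ hK0 c a) ?_
    · funext c
      exact mem_range_inclNormal_iff.1 h0 (l c)
    · intro a
      exact j₁.injective_mfderiv s₀ ((hY a s₀).trans (hσ a))
    · intro a u hus
      obtain ⟨U, hU, hUu⟩ := exists_extension j₁ s₀ hus
      refine (((P'.smooth_bracket hU (hu a)).continuous.comp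
        j₁.contMDiff.continuous).continuousAt).congr ?_
      filter_upwards [eventually_eventually_nhds.2 hUu] with s hs
      have h1 : (fun s ↦ U (j₁ s)) =ᶠ[𝓝 s] u := hs
      rw [← diff_congr h1, hYd a s hU]
      rfl
    · filter_upwards [hfe, hpr.eventually (eventually_all.2 fun c ↦ eventually_all.2 (hK c))]
        with s h1 h2 a c
      have h3 : diff (normalModel IX EX ES) (fun s ↦ f s c) s (Y a s) = _ :=
        hYd a s (l c).ofAlong.smooth_bar
      rw [h3, h'.bracket_ofAlong_bar hj (l c) (σ a) (hh a), abs_neg]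
      refine (h2 c a (projAlong j i (j₁ s)).2).trans ?_
      rw [h1]
      refine mul_le_mul_of_nonneg_right ?_ (norm_nonneg _)
      refine (Finset.single_le_sum (fun a _ ↦ hK0 c a) (Finset.mem_univ a)).trans ?_
      exact Finset.single_le_sum (f := fun c ↦ ∑ a, K c a)
        (fun c _ ↦ Finset.sum_nonneg fun a _ ↦ hK0 c a) (Finset.mem_univ c)
  filter_upwards [hz, hfe, hdom] with s h1 h2 h3
  rw [mem_range_inclNormal_iff]
  intro m
  rw [ofAlong_bar]
  refine (m.bar_eq_fibTriv (t := projAlong j i (j₁ s)) h3).trans ?_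
  have h4 : (j.along i).fibTriv x₀ (projAlong j i (j₁ s)).1 (projAlong j i (j₁ s)).2 = 0 :=
    h2.symm.trans h1
  rw [h4, map_zero, map_zero, map_zero]

/-- `TS|_X / TX` contains the connected integral manifolds that it meets. -/
lemma isMaximalIntegral_incl (hj : P.IsIntegral j) (hi : P.IsLagrangian j i) :
    P'.IsMaximalIntegral (inclNormalImmersion j i) where
  toIsIntegral := h'.isIntegral_incl hj hi
  maximal S₁ _ _ _ _ j₁ hj₁ hne := by
    have hcl : IsClosed {s | j₁ s ∈ range (inclNormal j i)} := by
      have h1 : {s | j₁ s ∈ range (inclNormal j i)} =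
          ⋂ l : AnnSection (j.along i), {s | l.ofAlong.bar (j₁ s) = 0} := by
        ext s
        rw [mem_iInter]
        exact mem_range_inclNormal_iff
      rw [h1]
      exact isClosed_iInter fun l ↦ isClosed_eq
        (l.ofAlong.smooth_bar.continuous.comp j₁.contMDiff.continuous) continuous_const
    have hop : IsOpen {s | j₁ s ∈ range (inclNormal j i)} :=
      isOpen_iff_mem_nhds.2 fun s hs ↦ h'.eventually_mem_range_inclNormal hj j₁ hj₁ hs
    obtain ⟨_, ⟨s, rfl⟩, hs⟩ := hne
    have huniv := IsClopen.eq_univ ⟨hcl, hop⟩ ⟨s, hs⟩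
    rintro _ ⟨s', rfl⟩
    have : s' ∈ {s | j₁ s ∈ range (inclNormal j i)} := by rw [huniv]; trivial
    exact this

lemma isSymplecticLeaf_incl (hj : P.IsIntegral j) (hi : P.IsLagrangian j i) [ConnectedSpace X] :
    P'.IsSymplecticLeaf (inclNormalImmersion j i) where
  toIsMaximalIntegral := h'.isMaximalIntegral_incl hj hi
  connected := i.normal.connectedSpace_total

end PoissonStructure.IsLinearization

end Maximal

/-! ### Covector fields tested on a spanning family of vector fields -/

section CovectorSpan

variable {E H M : Type*} [NormedAddCommGroup E] [NormedSpace ℝ E] [TopologicalSpace H]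
  {I : ModelWithCorners ℝ E H} [TopologicalSpace M] [ChartedSpace H M]
  {E' H' N : Type*} [NormedAddCommGroup E'] [NormedSpace ℝ E'] [TopologicalSpace H']
  {I' : ModelWithCorners ℝ E' H'} [TopologicalSpace N] [ChartedSpace H' N]

/-- A covector field along a map is smooth if it is so when tested on smooth vector fields which
span the tangent space. -/
lemma contMDiffAt_covector_of_span [FiniteDimensional ℝ E] [IsManifold I ∞ M]
    {g : N → M} {α : ∀ t, TangentSpace I (g t) →L[ℝ] ℝ} {t₀ : N} (hg : ContMDiffAt I' I ∞ g t₀)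
    (𝒱 : Set (∀ z : M, TangentSpace I z)) (h𝒱 : ∀ V ∈ 𝒱, IsSmoothField I V)
    (hspan : ∀ v, ∃ V ∈ 𝒱, V (g t₀) = v)
    (hα : ∀ V ∈ 𝒱, ContMDiffAt I' 𝓘(ℝ, ℝ) ∞ (fun t ↦ α t (V (g t))) t₀) :
    ContMDiffAt I' (cotangentModel I) ∞ (fun t ↦ (⟨g t, α t⟩ : CotangentBundle I M)) t₀ := by
  have : CompleteSpace E := FiniteDimensional.complete ℝ E
  set e := trivializationAt E (TangentSpace I) (g t₀) with he
  have hmem : g t₀ ∈ e.baseSet := mem_baseSet_trivializationAt E (TangentSpace I) (g t₀)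
  let b := finBasis ℝ E
  let B : Fin (finrank ℝ E) → E →L[ℝ] ℝ := fun i ↦ LinearMap.toContinuousLinearMap (b.coord i)
  choose V hV hVb using fun i ↦ hspan (e.symmL ℝ (g t₀) (b i))
  -- `A` compares the chosen fields with the coordinate frame. It is the identity at `g t₀`, hence
  -- invertible nearby, and its inverse recovers `α` from its values on these fields.
  let A : M → E →L[ℝ] E := fun z ↦ ∑ i, (B i).smulRight (e.continuousLinearMapAt ℝ z (V i z))
  have hA : ContMDiffAt I 𝓘(ℝ, E →L[ℝ] E) ∞ A (g t₀) := by
    refine ContMDiffAt.sum fun i _ ↦ ?_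
    have h1 : ContMDiffAt I 𝓘(ℝ, E) ∞ (fun z ↦ e.continuousLinearMapAt ℝ z (V i z)) (g t₀) := by
      refine ((contMDiffAt_totalSpace.1 (h𝒱 _ (hV i) (g t₀))).2).congr_of_eventuallyEq ?_
      filter_upwards [e.open_baseSet.mem_nhds hmem] with z hz
      exact e.continuousLinearMapAt_apply_of_mem ℝ hz _
    exact ((ContinuousLinearMap.smulRightL ℝ E E (B i)).contMDiff.contMDiffAt).comp (g t₀) h1
  have hA0 : A (g t₀) = ContinuousLinearEquiv.refl ℝ E := by
    refine ContinuousLinearMap.coe_injective (b.ext fun k ↦ ?_)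
    change (∑ i, (B i).smulRight (e.continuousLinearMapAt ℝ (g t₀) (V i (g t₀)))) (b k) = b k
    rw [_root_.sum_apply, Finset.sum_eq_single k]
    · simp [B, hVb, e.continuousLinearMapAt_symmL hmem]
    · intro i _ hi
      simp [B, hi.symm]
    · simp
  have hAg := hA.comp t₀ hg
  have hinv : ContMDiffAt I' 𝓘(ℝ, E →L[ℝ] E) ∞ (fun t ↦ (A (g t)).inverse) t₀ := by
    have h1 : ContDiffAt ℝ ∞ ContinuousLinearMap.inverse (A (g t₀)) := by
      rw [hA0]; exact contDiffAt_map_inverse _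
    exact h1.contMDiffAt.comp t₀ hAg
  rw [contMDiffAt_hom_bundle]
  have h1 : ContMDiffAt I' 𝓘(ℝ, E →L[ℝ] ℝ) ∞ (fun t ↦ ∑ i, α t (V i (g t)) • B i) t₀ :=
    ContMDiffAt.sum fun i _ ↦ (hα _ (hV i)).smul contMDiffAt_const
  refine ⟨hg, (h1.clm_comp hinv).congr_of_eventuallyEq ?_⟩
  have h2 : ∀ᶠ t in 𝓝 t₀, g t ∈ e.baseSet :=
    hg.continuousAt.eventually (e.open_baseSet.mem_nhds hmem)
  have h3 : ∀ᶠ t in 𝓝 t₀, A (g t) ∈ range (ContinuousLinearEquiv.toContinuousLinearMap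
      (σ₁₂ := RingHom.id ℝ) (M₁ := E) (M₂ := E)) :=
    hAg.continuousAt.eventually (ContinuousLinearEquiv.isOpen.mem_nhds ⟨_, hA0.symm⟩)
  filter_upwards [h2, h3] with t ht ⟨C, hC⟩
  have h4 : (∑ i, α t (V i (g t)) • B i) = ((α t).comp (e.symmL ℝ (g t))).comp (A (g t)) := by
    ext w
    change (∑ i, α t (V i (g t)) • B i) w = α t (e.symmL ℝ (g t)
      ((∑ i, (B i).smulRight (e.continuousLinearMapAt ℝ (g t) (V i (g t)))) w))
    rw [_root_.sum_apply, _root_.sum_apply, map_sum, map_sum]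
    refine Finset.sum_congr rfl fun i _ ↦ ?_
    change α t (V i (g t)) * B i w = α t (e.symmL ℝ (g t)
      (B i w • e.continuousLinearMapAt ℝ (g t) (V i (g t))))
    rw [map_smul, e.symmL_continuousLinearMapAt ht, map_smul, smul_eq_mul, mul_comm]
  rw [h4, ← hC, ContinuousLinearMap.inverse_equiv]
  ext w
  change _ = α t (e.symmL ℝ (g t) (C (C.symm w)))
  rw [C.apply_symm_apply]
  simp [ContinuousLinearMap.inCoordinates, he]

lemma diff_apply_eq_zero {f : M → ℝ} {z : M} {v : TangentSpace I z} (hv : v = 0) :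
    diff I f z v = 0 := by
  rw [hv, map_zero]

end CovectorSpan

/-! ### The diffeomorphism from `S'` to the cotangent bundle -/

section ToCotangent

variable {EX HX X : Type*} [NormedAddCommGroup EX] [NormedSpace ℝ EX] [TopologicalSpace HX]
  [TopologicalSpace X] [ChartedSpace HX X]
  {ES HS S : Type*} [NormedAddCommGroup ES] [NormedSpace ℝ ES] [TopologicalSpace HS]
  [TopologicalSpace S] [ChartedSpace HS S]
  {EZ HZ Z : Type*} [NormedAddCommGroup EZ] [NormedSpace ℝ EZ] [TopologicalSpace HZ]
  [TopologicalSpace Z] [ChartedSpace HZ Z]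
  {IX : ModelWithCorners ℝ EX HX} {IS : ModelWithCorners ℝ ES HS}
  {IZ : ModelWithCorners ℝ EZ HZ}
  [IsManifold IX ∞ X] [IsManifold IS ∞ S] [IsManifold IZ ∞ Z]
  {P : PoissonStructure IZ Z} {j : SmoothImmersion IS IZ S Z} {i : SmoothImmersion IX IS X S}
  [FiniteDimensional ℝ EX] [FiniteDimensional ℝ ES] [FiniteDimensional ℝ EZ]
  [T2Space Z] [T2Space S] [T2Space X] [IX.Boundaryless] [IS.Boundaryless] [IZ.Boundaryless]

open SmoothImmersion AnnSection TangentMono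

/-- The fibrewise linear function on the cotangent bundle given by a vector field. -/
def cotangentPairing (V : ∀ x : X, TangentSpace IX x) (ξ : CotangentBundle IX X) : ℝ := ξ.2 (V ξ.1)

lemma smooth_cotangentPairing {V : ∀ x : X, TangentSpace IX x} (hV : IsSmoothField IX V) :
    IsSmoothFun (cotangentModel IX) (cotangentPairing V) := fun ξ ↦
  ContMDiffAt.covector_apply (g := fun ξ : CotangentBundle IX X ↦ ξ.1)
    (α := fun ξ ↦ ξ.2) (V := fun ξ ↦ V ξ.1) contMDiffAt_id
    ((hV.comp (Bundle.contMDiff_proj _)) ξ)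

lemma AnnSection.isSmoothField_anchor (hP : P.IsCoisotropic (j.comp i))
    (σ : AnnSection (j.comp i).normal) : IsSmoothField IX (σ.anchor hP) := fun x ↦
  contMDiffAt_field_of_diff (g := id) contMDiffAt_id {u | IsSmoothFun IX u} (fun _ h ↦ h)
    (fun α ↦ exists_diff_eq (I := IX) x α) fun _ hu ↦ σ.smooth_anchorDiff hP hu x

namespace PoissonStructure

/-- The symplectic form as a nondegenerate bilinear form. -/
lemma IsIntegral.nondegenerate (hj : P.IsIntegral j) (s : S) : (hj.bilinForm s).Nondegenerate :=
  ⟨fun _ hu ↦ hj.eq_zero_of_leafForm hu, fun v hv ↦ hj.eq_zero_of_leafForm fun u ↦ by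
      rw [hj.leafForm_skew]
      exact neg_eq_zero.2 (hv u)⟩

/-- Isotropy makes the functional independent of the representative of the class. With `w♯ β = dj
v₀` it is `β ∘ dj ∘ di`, which is visibly linear and continuous. -/
lemma IsLagrangian.exists_covector (hi : P.IsLagrangian j i) (hj : P.IsIntegral j)
    (t : i.NormalBundle) : ∃ ξ : TangentSpace IX t.1 →L[ℝ] ℝ,
      ∀ v, i.normal.cls t.1 v = t.2 →
        ∀ u, ξ u = -P.leafForm j (i t.1) (mfderiv IX IS i t.1 u) v := by
  obtain ⟨v₀, hv₀⟩ := i.normal.cls_surjective t.1 t.2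
  obtain ⟨β, hβ⟩ := hj.exists_sharp_eq (i t.1) v₀
  refine ⟨β.comp ((mfderiv IS IZ j (i t.1)).comp (mfderiv IX IS i t.1)), fun v hv u ↦ ?_⟩
  have h1 : i.normal.cls t.1 (v - v₀) = 0 := by rw [map_sub, hv, hv₀, sub_self]
  obtain ⟨w, hw⟩ := i.normal.cls_eq_zero.1 h1
  have hw' : v = v₀ + mfderiv IX IS i t.1 w := by
    have h2 : mfderiv IX IS i t.1 w = v - v₀ := hw
    rw [h2]; abel
  have h3 : P.leafForm j (i t.1) (mfderiv IX IS i t.1 u) v =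
      P.leafForm j (i t.1) (mfderiv IX IS i t.1 u) v₀ +
      P.leafForm j (i t.1) (mfderiv IX IS i t.1 u) (mfderiv IX IS i t.1 w) := by
    rw [hw']
    exact map_add (hj.bilinForm (i t.1) (mfderiv IX IS i t.1 u)) _ _
  rw [h3, hi.isotropic, add_zero, ← hj.leafForm_skew, hj.leafForm_eq hβ]
  rfl

/-- The map `TS|_X / TX → T^*X` given by the symplectic form. -/
def IsLagrangian.toCotangent (hi : P.IsLagrangian j i) (hj : P.IsIntegral j)
    (t : i.NormalBundle) : CotangentBundle IX X := ⟨t.1, (hi.exists_covector hj t).choose⟩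

namespace IsLagrangian

variable (hi : P.IsLagrangian j i) (hj : P.IsIntegral j)

lemma toCotangent_apply (x : X) (v : TangentSpace IS (i x)) (u : TangentSpace IX x) :
    (hi.toCotangent hj ⟨x, i.normal.cls x v⟩).2 u =
      -P.leafForm j (i x) (mfderiv IX IS i x u) v :=
  (hi.exists_covector hj ⟨x, i.normal.cls x v⟩).choose_spec v rfl u

/-- By the definition of the form, `ω(ρ(σ), v) = σ(v)`. As anchors span `TX`, this one identity
controls the whole comparison of `S'` with `T^*X`. -/
lemma cotangentPairing_toCotangent (σ : AnnSection (j.comp i).normal) (t : i.NormalBundle) :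
    cotangentPairing (σ.anchor (hi.isCoisotropic hj)) (hi.toCotangent hj t) =
      -σ.pullback.bar t := by
  obtain ⟨x, b⟩ := t
  obtain ⟨v, rfl⟩ := i.normal.cls_surjective x b
  refine (hi.toCotangent_apply hj x v _).trans ?_
  rw [bar_cls, pullback_toFun, hj.leafForm_eq (α := σ.toFun x)]
  · rfl
  exact (σ.map_anchor (hi.isCoisotropic hj) x).symm.trans (mfderiv_comp_apply j i x _)

lemma toCotangent_injective : Function.Injective (hi.toCotangent hj) := fun t t' h ↦ by
  refine inclNormal_injective (j := j) (ext_bar (congrArg (fun ξ : CotangentBundle IX X ↦ ξ.1) h)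
    fun σ ↦ ?_)
  rw [bar_inclNormal, bar_inclNormal, ← neg_inj, ← hi.cotangentPairing_toCotangent hj, h,
    hi.cotangentPairing_toCotangent]

/-- A covector is extended from `T_x X` to `T_x S` by a linear retraction and represented by a
vector through the nondegenerate form. -/
lemma toCotangent_surjective : Function.Surjective (hi.toCotangent hj) := by
  rintro ⟨x, ξ⟩
  have f1 : FiniteDimensional ℝ (TangentSpace IS (i x)) := inferInstanceAs (FiniteDimensional ℝ ES)
  obtain ⟨l, hl⟩ := LinearMap.exists_leftInverse_of_injective (mfderiv IX IS i x).toLinearMap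
    (LinearMap.ker_eq_bot.2 (i.injective_mfderiv x))
  let Ξ : Module.Dual ℝ (TangentSpace IS (i x)) := ξ.toLinearMap ∘ₗ l
  let v := ((hj.bilinForm (i x)).toDual (hj.nondegenerate (i x))).symm Ξ
  refine ⟨⟨x, i.normal.cls x v⟩, congrArg (TotalSpace.mk x) ?_⟩
  ext u
  refine (hi.toCotangent_apply hj x v u).trans ?_
  rw [← hj.leafForm_skew]
  refine (LinearMap.BilinForm.apply_toDual_symm_apply (hB := hj.nondegenerate (i x)) Ξ _).trans ?_
  exact congrArg ξ (congrArg (fun T : TangentSpace IX x →ₗ[ℝ] TangentSpace IX x ↦ T u) hl)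

/-- It suffices to test on anchors, which span `TX`, and there the pairing is the smooth function
`-σ̄`. -/
lemma contMDiff_toCotangent :
    ContMDiff (normalModel IX EX ES) (cotangentModel IX) ∞ (hi.toCotangent hj) := fun t ↦
  contMDiffAt_covector_of_span (g := fun t : i.NormalBundle ↦ t.1)
    (α := fun t ↦ (hi.toCotangent hj t).2) (i.normal.contMDiff_proj t)
    (range fun σ : AnnSection (j.comp i).normal ↦ σ.anchor (hi.isCoisotropic hj))
    (by rintro _ ⟨σ, rfl⟩; exact σ.isSmoothField_anchor _)
    (fun v ↦ by
      obtain ⟨σ, hσ⟩ := hi.exists_anchor_eq hj t.1 v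
      exact ⟨_, ⟨σ, rfl⟩, hσ⟩) (by
      rintro _ ⟨σ, rfl⟩
      exact (σ.pullback.smooth_bar.neg t).congr_of_eventuallyEq
        (.of_forall fun t ↦ hi.cotangentPairing_toCotangent hj σ t))

lemma exists_diffeomorph_toCotangent :
    ∃ Ψ : Diffeomorph (normalModel IX EX ES) (cotangentModel IX) i.NormalBundle
      (CotangentBundle IX X) ∞, ∀ t, Ψ t = hi.toCotangent hj t := by
  refine exists_diffeomorph (hi.contMDiff_toCotangent hj)
    ⟨hi.toCotangent_injective hj, hi.toCotangent_surjective hj⟩ (fun t ↦ ?_) ?_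
  · let T : EX × CokerModel EX ES →L[ℝ] EX × (EX →L[ℝ] ℝ) :=
      mfderiv (normalModel IX EX ES) (cotangentModel IX) (hi.toCotangent hj) t
    refine (injective_iff_map_eq_zero T).2 fun v hv ↦ ?_
    have hv : mfderiv (normalModel IX EX ES) (cotangentModel IX) (hi.toCotangent hj) t v = 0 := hv
    have d := (hi.contMDiff_toCotangent hj).mdifferentiableAt (x := t) (by simp)
    refine eq_zero_of_diff_pullback (j := j) (i := i) (t := t) (v := v) (fun σ ↦ ?_) fun h hh ↦ ?_
    · have h1 : σ.pullback.bar = fun t ↦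
          -cotangentPairing (σ.anchor (hi.isCoisotropic hj)) (hi.toCotangent hj t) :=
        funext fun t ↦ by rw [hi.cotangentPairing_toCotangent hj, neg_neg]
      rw [h1, diff_neg]
      exact neg_eq_zero.2 ((diff_comp
        ((smooth_cotangentPairing (σ.isSmoothField_anchor _)).mdiff _) d v).trans
        (diff_apply_eq_zero hv))
    · have h2 : IsSmoothFun (cotangentModel IX) fun ξ : CotangentBundle IX X ↦ h ξ.1 :=
        hh.comp (Bundle.contMDiff_proj _)
      exact (diff_comp (f := fun ξ : CotangentBundle IX X ↦ h ξ.1) (g := hi.toCotangent hj)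
        (h2.mdiff _) d v).trans (diff_apply_eq_zero hv)
  · have h1 : finrank ℝ (EX →L[ℝ] ℝ) = finrank ℝ EX :=
      ((LinearMap.toContinuousLinearMap (𝕜 := ℝ) (E := EX) (F' := ℝ)).finrank_eq).symm.trans
        Subspace.dual_finrank_eq
    have := hi.finrank_eq
    rw [Module.finrank_prod, Module.finrank_prod, Module.finrank_fin_fun, h1]
    omega

end IsLagrangian
end PoissonStructure

end ToCotangent

/-! ### Differential of a sum of products -/

section SumMul

variable {E H M : Type*} [NormedAddCommGroup E] [NormedSpace ℝ E] [TopologicalSpace H]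
  [TopologicalSpace M] [ChartedSpace H M] {I : ModelWithCorners ℝ E H}
  [IsManifold I ∞ M]

lemma diff_sum_mul {ι : Type} [Fintype ι] {p q : ι → M → ℝ} {x : M}
    (hp : ∀ l, MDifferentiableAt I 𝓘(ℝ, ℝ) (p l) x)
    (hq : ∀ l, MDifferentiableAt I 𝓘(ℝ, ℝ) (q l) x) (u : TangentSpace I x) :
    diff I (fun y ↦ ∑ l, p l y * q l y) x u =
      ∑ l, (p l x * diff I (q l) x u + q l x * diff I (p l) x u) := by
  have h : ∀ l, MDifferentiableAt I 𝓘(ℝ, ℝ) (fun y ↦ p l y * q l y) x :=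
    fun l ↦ (hp l).mul (hq l)
  rw [diff_sum h]
  refine (_root_.sum_apply _ _ _).trans (Finset.sum_congr rfl fun l _ ↦ ?_)
  rw [diff_mul (hp l) (hq l)]
  rfl

end SumMul

/-! ### The canonical symplectic form in a local frame -/

section CanonicalForm

variable {EX HX X : Type*} [NormedAddCommGroup EX] [NormedSpace ℝ EX] [TopologicalSpace HX]
  [TopologicalSpace X] [ChartedSpace HX X] {IX : ModelWithCorners ℝ EX HX} [IsManifold IX ∞ X]
  [FiniteDimensional ℝ EX] [IX.Boundaryless] [T2Space X]

lemma apply_sum_smul {F : Type*} [AddCommGroup F] [Module ℝ F] [TopologicalSpace F] {ι : Type}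
    [Fintype ι] (ξ : F →L[ℝ] ℝ) {c : ι → ℝ} {V : ι → F} {v : F} (h : ∑ l, c l • V l = v) :
    ξ v = ∑ l, ξ (V l) * c l := by
  rw [← h, map_sum]
  exact Finset.sum_congr rfl fun l _ ↦ by rw [map_smul, smul_eq_mul, mul_comm]

/-- This is `θ = ∑ p_l dq_l`, where `p_l` pairs with the frame field `V l` and `q_l` is the pullback
of `e l`. -/
lemma tautologicalForm_apply {ι : Type} [Fintype ι] {V : ι → ∀ x : X, TangentSpace IX x}
    {e : ι → X → ℝ} (he : ∀ l, IsSmoothFun IX (e l)) {ξ : CotangentBundle IX X}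
    (h : ∀ v, ∑ l, diff IX (e l) ξ.1 v • V l ξ.1 = v) (w : TangentSpace (cotangentModel IX) ξ) :
    tautologicalForm IX ξ w = ∑ l, cotangentPairing (V l) ξ *
      diff (cotangentModel IX) (fun ξ : CotangentBundle IX X ↦ e l ξ.1) ξ w := by
  have hπ : MDifferentiableAt (cotangentModel IX) IX
      (fun ξ : CotangentBundle IX X ↦ ξ.1) ξ :=
    (Bundle.contMDiff_proj _ (n := ∞)).mdifferentiableAt (by simp)
  refine (apply_sum_smul ξ.2 (h _)).trans (Finset.sum_congr rfl fun l _ ↦ ?_)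
  exact congrArg (ξ.2 (V l ξ.1) * ·) (diff_comp ((he l).mdiff _) hπ w).symm

/-- The canonical symplectic form in terms of a local frame. -/
lemma extDerivForm_tautologicalForm {ι : Type} [Fintype ι] {V : ι → ∀ x : X, TangentSpace IX x}
    {e : ι → X → ℝ} (hV : ∀ l, IsSmoothField IX (V l)) (he : ∀ l, IsSmoothFun IX (e l))
    {ξ : CotangentBundle IX X}
    (h : ∀ᶠ x in 𝓝 ξ.1, ∀ v, ∑ l, diff IX (e l) x v • V l x = v)
    {U W : ∀ ξ : CotangentBundle IX X, TangentSpace (cotangentModel IX) ξ}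
    (hU : IsSmoothField (cotangentModel IX) U) (hW : IsSmoothField (cotangentModel IX) W) :
    extDerivForm (cotangentModel IX) (tautologicalForm IX) U W ξ =
      ∑ l, diff (cotangentModel IX) (cotangentPairing (V l)) ξ (U ξ) *
        diff (cotangentModel IX) (fun ξ : CotangentBundle IX X ↦ e l ξ.1) ξ (W ξ) -
      ∑ l, diff (cotangentModel IX) (cotangentPairing (V l)) ξ (W ξ) *
        diff (cotangentModel IX) (fun ξ : CotangentBundle IX X ↦ e l ξ.1) ξ (U ξ) := by
  have hQ : ∀ l, IsSmoothFun (cotangentModel IX) fun ξ : CotangentBundle IX X ↦ e l ξ.1 :=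
    fun l ↦ (he l).comp (Bundle.contMDiff_proj _)
  have hπ : Continuous fun ξ : CotangentBundle IX X ↦ ξ.1 :=
    (Bundle.contMDiff_proj (n := ∞) (IB := IX) (F := EX →L[ℝ] ℝ)
      (fun x : X ↦ TangentSpace IX x →L[ℝ] ℝ)).continuous
  have key : ∀ {U W : ∀ ξ : CotangentBundle IX X, TangentSpace (cotangentModel IX) ξ},
      IsSmoothField (cotangentModel IX) W →
      diff (cotangentModel IX) (fun ζ ↦ tautologicalForm IX ζ (W ζ)) ξ (U ξ) =
        ∑ l, (cotangentPairing (V l) ξ * diff (cotangentModel IX) (fun ζ ↦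
          diff (cotangentModel IX) (fun ξ : CotangentBundle IX X ↦ e l ξ.1) ζ (W ζ)) ξ (U ξ) +
        diff (cotangentModel IX) (fun ξ : CotangentBundle IX X ↦ e l ξ.1) ξ (W ξ) *
          diff (cotangentModel IX) (cotangentPairing (V l)) ξ (U ξ)) := by
    intro U W hW
    have h1 : (fun ζ ↦ tautologicalForm IX ζ (W ζ)) =ᶠ[𝓝 ξ] fun ζ ↦
        ∑ l, cotangentPairing (V l) ζ *
          diff (cotangentModel IX) (fun ξ : CotangentBundle IX X ↦ e l ξ.1) ζ (W ζ) := by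
      filter_upwards [hπ.continuousAt.eventually h] with ζ hζ
      exact tautologicalForm_apply he hζ _
    have hd : ∀ l, MDifferentiableAt (cotangentModel IX) 𝓘(ℝ, ℝ) (fun ζ ↦
        diff (cotangentModel IX) (fun ξ : CotangentBundle IX X ↦ e l ξ.1) ζ (W ζ)) ξ :=
      fun l ↦ (hW.diff_apply (hQ l)).mdiff _
    have hp : ∀ l, MDifferentiableAt (cotangentModel IX) 𝓘(ℝ, ℝ) (cotangentPairing (V l)) ξ :=
      fun l ↦ (smooth_cotangentPairing (hV l)).mdiff _
    rw [diff_congr h1]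
    exact diff_sum_mul hp hd _
  rw [extDerivForm, key hW, key hU, tautologicalForm_apply he h.self_of_nhds]
  -- The Lie bracket acts on `q_l` as a commutator, so the second derivatives of the `q_l` cancel
  -- and only `∑ dp_l ∧ dq_l` remains.
  simp_rw [diff_mlieBracket (hQ _) hU hW]
  rw [← Finset.sum_sub_distrib, ← Finset.sum_sub_distrib, ← Finset.sum_sub_distrib]
  exact Finset.sum_congr rfl fun l _ ↦ by ring

end CanonicalForm

/-! ### Equality of the symplectic forms -/

section Symplectomorphism

variable {EX HX X : Type*} [NormedAddCommGroup EX] [NormedSpace ℝ EX] [TopologicalSpace HX]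
  [TopologicalSpace X] [ChartedSpace HX X]
  {ES HS S : Type*} [NormedAddCommGroup ES] [NormedSpace ℝ ES] [TopologicalSpace HS]
  [TopologicalSpace S] [ChartedSpace HS S]
  {EZ HZ Z : Type*} [NormedAddCommGroup EZ] [NormedSpace ℝ EZ] [TopologicalSpace HZ]
  [TopologicalSpace Z] [ChartedSpace HZ Z]
  {IX : ModelWithCorners ℝ EX HX} {IS : ModelWithCorners ℝ ES HS}
  {IZ : ModelWithCorners ℝ EZ HZ}
  [IsManifold IX ∞ X] [IsManifold IS ∞ S] [IsManifold IZ ∞ Z]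
  {P : PoissonStructure IZ Z} {j : SmoothImmersion IS IZ S Z} {i : SmoothImmersion IX IS X S}
  [FiniteDimensional ℝ EX] [FiniteDimensional ℝ ES] [FiniteDimensional ℝ EZ]
  [T2Space Z] [T2Space S] [T2Space X] [IX.Boundaryless] [IS.Boundaryless] [IZ.Boundaryless]

open SmoothImmersion AnnSection TangentMono

namespace PoissonStructure

variable {hP : P.IsCoisotropic (j.comp i)}
  {P' : PoissonStructure (normalModel IX EX EZ) (j.comp i).NormalBundle}

/-- The anchor is a homomorphism of Lie algebras. -/
lemma IsLinearization.anchorDiff_bracket (h' : IsLinearization hP P')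
    (σ τ : AnnSection (j.comp i).normal) {h : X → ℝ} (hh : IsSmoothFun IX h) (x : X) :
    (AnnSection.bracket hP τ σ).anchorDiff hP h x =
      σ.anchorDiff hP (τ.anchorDiff hP h) x - τ.anchorDiff hP (σ.anchorDiff hP h) x := by
  let t : (j.comp i).NormalBundle := ⟨x, 0⟩
  -- The Jacobi identity for one function of the base and two fibrewise linear functions.
  have h1 := P'.bracket_jacobi (hh.comp_proj (φ := (j.comp i).normal)) τ.smooth_bar
    σ.smooth_bar t
  have e1 : P'.bracket τ.bar σ.bar = (AnnSection.bracket hP τ σ).bar :=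
    funext (h'.bracket_bar_bar τ σ)
  have e2 : P'.bracket σ.bar (fun t : (j.comp i).NormalBundle ↦ h t.1) =
      fun t ↦ -(σ.anchorDiff hP h) t.1 := funext (h'.bracket_bar_proj σ hh)
  have e3 : P'.bracket (fun t : (j.comp i).NormalBundle ↦ h t.1) τ.bar =
      fun t ↦ (τ.anchorDiff hP h) t.1 := funext (h'.bracket_proj_bar τ hh)
  rw [e1, e2, e3, P'.bracket_neg_right, h'.bracket_proj_bar _ hh,
    h'.bracket_bar_proj _ (σ.smooth_anchorDiff hP hh),
    h'.bracket_bar_proj _ (τ.smooth_anchorDiff hP hh)] at h1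
  change (AnnSection.bracket hP τ σ).anchorDiff hP h x +
    - -τ.anchorDiff hP (σ.anchorDiff hP h) x + -σ.anchorDiff hP (τ.anchorDiff hP h) x = 0 at h1
  linarith

namespace IsLagrangian

variable (hi : P.IsLagrangian j i) (hj : P.IsIntegral j)

section Frame

variable {ι : Type} [Fintype ι] {V : ι → ∀ x : X, TangentSpace IX x} {e : ι → X → ℝ}

/-- The anchor of `σ` is expanded in the frame, in the identity that pairs it with the covector to
give `-σ̄`. -/
lemma pullback_bar_eq_sum (σ : AnnSection (j.comp i).normal) {t : i.NormalBundle}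
    (h : ∀ v, ∑ l, diff IX (e l) t.1 v • V l t.1 = v) :
    σ.pullback.bar t = -∑ l, cotangentPairing (V l) (hi.toCotangent hj t) *
      σ.anchorDiff (hi.isCoisotropic hj) (e l) t.1 := by
  rw [← neg_eq_iff_eq_neg, ← hi.cotangentPairing_toCotangent hj]
  exact apply_sum_smul (hi.toCotangent hj t).2 (h _)

lemma diff_pullback_bar_eq_sum (hV : ∀ l, IsSmoothField IX (V l)) (he : ∀ l, IsSmoothFun IX (e l))
    (σ : AnnSection (j.comp i).normal) {t : i.NormalBundle}
    (h : ∀ᶠ x in 𝓝 t.1, ∀ v, ∑ l, diff IX (e l) x v • V l x = v)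
    (w : TangentSpace (normalModel IX EX ES) t) :
    diff (normalModel IX EX ES) σ.pullback.bar t w =
      -∑ l, (cotangentPairing (V l) (hi.toCotangent hj t) * diff (normalModel IX EX ES)
        (fun t : i.NormalBundle ↦ σ.anchorDiff (hi.isCoisotropic hj) (e l) t.1) t w +
      σ.anchorDiff (hi.isCoisotropic hj) (e l) t.1 * diff (normalModel IX EX ES)
        (fun t ↦ cotangentPairing (V l) (hi.toCotangent hj t)) t w) := by
  have h1 : σ.pullback.bar =ᶠ[𝓝 t] fun t ↦ -∑ l, cotangentPairing (V l) (hi.toCotangent hj t) *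
      σ.anchorDiff (hi.isCoisotropic hj) (e l) t.1 := by
    filter_upwards [i.normal.contMDiff_proj.continuous.continuousAt.eventually h] with t ht
    exact hi.pullback_bar_eq_sum hj σ ht
  have hp : ∀ l, MDifferentiableAt (normalModel IX EX ES) 𝓘(ℝ, ℝ)
      (fun t ↦ cotangentPairing (V l) (hi.toCotangent hj t)) t :=
    fun l ↦ IsSmoothFun.mdiff ((smooth_cotangentPairing (hV l)).comp
      (hi.contMDiff_toCotangent hj)) t
  have hd : ∀ l, MDifferentiableAt (normalModel IX EX ES) 𝓘(ℝ, ℝ)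
      (fun t : i.NormalBundle ↦ σ.anchorDiff (hi.isCoisotropic hj) (e l) t.1) t :=
    fun l ↦ (IsSmoothFun.comp_proj (φ := i.normal)
      (σ.smooth_anchorDiff (hi.isCoisotropic hj) (he l))).mdiff t
  rw [diff_congr h1, diff_neg]
  exact congrArg Neg.neg (diff_sum_mul hp hd w)

/-- The symplectic form of `TS|_X / TX` in terms of a local frame of `X`. -/
lemma leafForm_eq_sum (h' : IsLinearization (hi.isCoisotropic hj) P')
    (hV : ∀ l, IsSmoothField IX (V l)) (he : ∀ l, IsSmoothFun IX (e l)) {t : i.NormalBundle}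
    (h : ∀ᶠ x in 𝓝 t.1, ∀ v, ∑ l, diff IX (e l) x v • V l x = v)
    (u v : TangentSpace (normalModel IX EX ES) t) :
    P'.leafForm (inclNormalImmersion j i) t u v =
      ∑ l, diff (normalModel IX EX ES)
          (fun t ↦ cotangentPairing (V l) (hi.toCotangent hj t)) t u *
        diff (normalModel IX EX ES) (fun t : i.NormalBundle ↦ e l t.1) t v -
      ∑ l, diff (normalModel IX EX ES)
          (fun t ↦ cotangentPairing (V l) (hi.toCotangent hj t)) t v *
        diff (normalModel IX EX ES) (fun t : i.NormalBundle ↦ e l t.1) t u := by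
  have hI := h'.isIntegral_incl hj hi
  obtain ⟨β, hβ⟩ := hI.exists_sharp_eq t u
  rw [hI.leafForm_eq hβ]
  -- The image of `u` is now the Hamiltonian vector of `σ̄ + g`, so the form is the derivative of
  -- this function along `v`.
  obtain ⟨σ, g, hg, rfl⟩ := (j.comp i).normal.exists_diff_eq_bar (inclNormal j i t) β
  have hβu : ∀ f : (j.comp i).NormalBundle → ℝ,
      diff (normalModel IX EX EZ) f (inclNormal j i t)
        (mfderiv (normalModel IX EX ES) (normalModel IX EX EZ) (inclNormal j i) t u) =
      P'.bracket f (fun t ↦ σ.bar t + g t.1) (inclNormal j i t) := fun f ↦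
    congrArg (fun w : TangentSpace (normalModel IX EX EZ) (inclNormal j i t) ↦
      diff (normalModel IX EX EZ) f (inclNormal j i t) w) hβ.symm
  have hu : ∀ {f : X → ℝ}, IsSmoothFun IX f →
      diff (normalModel IX EX ES) (fun t : i.NormalBundle ↦ f t.1) t u =
        σ.anchorDiff (hi.isCoisotropic hj) f t.1 := by
    intro f hf
    rw [← diff_proj_mfderiv_incl (j := j) hf, hβu,
      P'.bracket_add_right _ σ.smooth_bar hg.comp_proj, h'.bracket_proj_bar σ hf,
      h'.bracket_proj_proj hf hg, add_zero]
    rfl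
  -- The anchor of `τ` is only the base component of `v`; it is needed to evaluate derivatives of
  -- functions of the base along `v`.
  obtain ⟨τ, hτ⟩ := hi.exists_anchor_eq hj t.1
    (mfderiv (normalModel IX EX ES) IX (fun t : i.NormalBundle ↦ t.1) t v)
  have hv : ∀ {f : X → ℝ}, IsSmoothFun IX f →
      diff (normalModel IX EX ES) (fun t : i.NormalBundle ↦ f t.1) t v =
        τ.anchorDiff (hi.isCoisotropic hj) f t.1 := by
    intro f hf
    rw [AnnSection.anchorDiff, hτ]
    exact diff_proj (φ := i.normal) hf t v
  have hτu : diff (normalModel IX EX ES) τ.pullback.bar t u =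
      (AnnSection.bracket (hi.isCoisotropic hj) τ σ).pullback.bar t -
        τ.anchorDiff (hi.isCoisotropic hj) g t.1 := by
    rw [← diff_bar_mfderiv_incl, hβu, P'.bracket_add_right _ σ.smooth_bar hg.comp_proj,
      h'.bracket_bar_bar, h'.bracket_bar_proj τ hg, bar_inclNormal]
    rfl
  -- The derivative of `τ̄` along `u` is known both as a bracket and in the frame. The homomorphism
  -- property of the anchor then cancels all second-order terms against those in the derivative of
  -- `σ̄` along `v`.
  have e1 := hi.diff_pullback_bar_eq_sum hj hV he τ h u
  have e2 := hi.diff_pullback_bar_eq_sum hj hV he σ h v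
  rw [hτu, hi.pullback_bar_eq_sum hj _ h.self_of_nhds] at e1
  simp only [h'.anchorDiff_bracket σ τ (he _), hu ((τ.smooth_anchorDiff _ (he _))),
    hv (σ.smooth_anchorDiff _ (he _)), Finset.sum_add_distrib, mul_sub,
    Finset.sum_sub_distrib] at e1 e2
  have e3 : diff (normalModel IX EX EZ) (fun t : (j.comp i).NormalBundle ↦ σ.bar t + g t.1)
      (inclNormal j i t)
      (mfderiv (normalModel IX EX ES) (normalModel IX EX EZ) (inclNormal j i) t v) =
      diff (normalModel IX EX ES) σ.pullback.bar t v + τ.anchorDiff (hi.isCoisotropic hj) g t.1 := by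
    rw [diff_add (σ.smooth_bar.mdiff _) (hg.comp_proj.mdiff _), ← hv hg,
      ← diff_proj_mfderiv_incl (j := j) hg, ← diff_bar_mfderiv_incl]
    rfl
  refine e3.trans ?_
  simp only [hu (he _), hv (he _)]
  simp only [mul_comm (diff (normalModel IX EX ES) _ t _)]
  linarith

end Frame

/-- The identification of `TS|_X / TX` with `T^*X` is a symplectomorphism. -/
theorem exists_symplectomorphism (h' : IsLinearization (hi.isCoisotropic hj) P') :
    ∃ (Ψ : Diffeomorph (normalModel IX EX ES) (cotangentModel IX) i.NormalBundle
        (CotangentBundle IX X) ∞)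
      (η : ∀ ξ : CotangentBundle IX X, TangentSpace (cotangentModel IX) ξ →
        TangentSpace (cotangentModel IX) ξ → ℝ),
      (∀ x (v : TangentSpace IS (i x)), ∃ ξ : TangentSpace IX x →L[ℝ] ℝ,
        (∀ u, ξ u = -P.leafForm j (i x) (mfderiv IX IS i x u) v) ∧
        Ψ ⟨x, i.normal.cls x v⟩ = ⟨x, ξ⟩) ∧
      IsExtDeriv (cotangentModel IX) (tautologicalForm IX) η ∧
      ∀ t (u v : TangentSpace (normalModel IX EX ES) t),
        η (Ψ t) (mfderiv (normalModel IX EX ES) (cotangentModel IX) Ψ t u)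
          (mfderiv (normalModel IX EX ES) (cotangentModel IX) Ψ t v) =
          P'.leafForm (inclNormalImmersion j i) t u v := by
  obtain ⟨Ψ, hΨ⟩ := hi.exists_diffeomorph_toCotangent hj
  have hΨ' : ⇑Ψ = hi.toCotangent hj := funext hΨ
  choose V e hV he hVe using fun x : X ↦ exists_local_frame (IZ := IX) x
  -- At each point the form is written in the frame chosen at its base point; the local formula for
  -- `dθ` identifies it with the exterior derivative.
  let η : ∀ ξ : CotangentBundle IX X, TangentSpace (cotangentModel IX) ξ →
      TangentSpace (cotangentModel IX) ξ → ℝ := fun ξ a b ↦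
    ∑ l, diff (cotangentModel IX) (cotangentPairing (V ξ.1 l)) ξ a *
        diff (cotangentModel IX) (fun ζ : CotangentBundle IX X ↦ e ξ.1 l ζ.1) ξ b -
      ∑ l, diff (cotangentModel IX) (cotangentPairing (V ξ.1 l)) ξ b *
        diff (cotangentModel IX) (fun ζ : CotangentBundle IX X ↦ e ξ.1 l ζ.1) ξ a
  refine ⟨Ψ, η, fun x v ↦ ⟨(hi.toCotangent hj ⟨x, i.normal.cls x v⟩).2,
    hi.toCotangent_apply hj x v, hΨ _⟩, fun U W hU hW ξ ↦ ?_, fun t u v ↦ ?_⟩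
  · exact (extDerivForm_tautologicalForm (hV ξ.1) (he ξ.1) (hVe ξ.1) hU hW).symm
  · have d : MDifferentiableAt (normalModel IX EX ES) (cotangentModel IX) (hi.toCotangent hj) t :=
      (hi.contMDiff_toCotangent hj).mdifferentiableAt (by simp)
    rw [hΨ', hi.leafForm_eq_sum hj h' (hV t.1) (he t.1) (hVe t.1)]
    have e1 : ∀ l w, diff (normalModel IX EX ES)
        (fun s ↦ cotangentPairing (V t.1 l) (hi.toCotangent hj s)) t w =
        diff (cotangentModel IX) (cotangentPairing (V t.1 l)) (hi.toCotangent hj t)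
          (mfderiv (normalModel IX EX ES) (cotangentModel IX) (hi.toCotangent hj) t w) :=
      fun l w ↦ diff_comp ((smooth_cotangentPairing (hV t.1 l)).mdiff _) d w
    have e2 : ∀ l w, diff (normalModel IX EX ES) (fun s : i.NormalBundle ↦ e t.1 l s.1) t w =
        diff (cotangentModel IX) (fun ζ : CotangentBundle IX X ↦ e t.1 l ζ.1)
          (hi.toCotangent hj t)
          (mfderiv (normalModel IX EX ES) (cotangentModel IX) (hi.toCotangent hj) t w) :=
      fun l w ↦ diff_comp (f := fun ζ : CotangentBundle IX X ↦ e t.1 l ζ.1)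
        (IsSmoothFun.mdiff ((he t.1 l).comp (Bundle.contMDiff_proj _)) _) d w
    simp only [e1, e2]
    rfl

end IsLagrangian
end PoissonStructure

end Symplectomorphism

end

/-! ### The main theorem -/

theorem mainTheorem3
    {EX HX X : Type*} [NormedAddCommGroup EX] [NormedSpace ℝ EX] [FiniteDimensional ℝ EX]
    [TopologicalSpace HX] [TopologicalSpace X] [ChartedSpace HX X]
    {ES HS S : Type*} [NormedAddCommGroup ES] [NormedSpace ℝ ES] [FiniteDimensional ℝ ES]
    [TopologicalSpace HS] [TopologicalSpace S] [ChartedSpace HS S]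
    {EZ HZ Z : Type*} [NormedAddCommGroup EZ] [NormedSpace ℝ EZ] [FiniteDimensional ℝ EZ]
    [TopologicalSpace HZ] [TopologicalSpace Z] [ChartedSpace HZ Z]
    {IX : ModelWithCorners ℝ EX HX} {IS : ModelWithCorners ℝ ES HS}
    {IZ : ModelWithCorners ℝ EZ HZ}
    [IX.Boundaryless] [IS.Boundaryless] [IZ.Boundaryless]
    [IsManifold IX ∞ X] [IsManifold IS ∞ S] [IsManifold IZ ∞ Z]
    [T2Space Z] [SecondCountableTopology Z]
    (P : PoissonStructure IZ Z)
    (j : SmoothImmersion IS IZ S Z) (_hj : P.IsSymplecticLeaf j)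
    (i : SmoothImmersion IX IS X S) (_hi : P.IsLagrangian j i) :
    -- the bracket of sections of `E_X` is well defined
    (∀ σ τ : ConormalSection (j.comp i), ∃! κ : ConormalSection (j.comp i),
      P.IsConormalBracket σ τ κ) ∧
    -- it extends uniquely to a Poisson structure on `Z' = TZ|_X / TX`
    ∃ P' : PoissonStructure (SmoothImmersion.normalModel IX EX EZ) (j.comp i).NormalBundle,
      P.Extends (j.comp i) P' ∧
      (∀ Q : PoissonStructure (SmoothImmersion.normalModel IX EX EZ) (j.comp i).NormalBundle,
        P.Extends (j.comp i) Q → Q = P') ∧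
      -- which is exact
      P'.IsExactVia (j.comp i).euler ∧
      -- Darboux coordinates adapted to `X` induce Darboux coordinates of `Z'`
      (∀ (m n : ℕ) (x₀ : X) (D : P.DarbouxChart (j (i x₀)) m n) (V : Set X), IsOpen V → x₀ ∈ V →
        (∀ x ∈ V, j (i x) ∈ D.chart.source ∧ (∀ μ, D.p μ (j (i x)) = 0) ∧
          ∀ a, D.r a (j (i x)) = 0) →
        ∃ D' : P'.DarbouxChart ((j.comp i).zero x₀) m n,
          D'.chart.source = {t | t.proj ∈ V} ∧
          (∀ x ∈ V, ∀ v : TangentSpace IZ (j (i x)),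
            (∀ μ, D'.x μ ⟨x, (j.comp i).normal.cls x v⟩ = D.x μ (j (i x))) ∧
            (∀ μ, D'.p μ ⟨x, (j.comp i).normal.cls x v⟩ = diff IZ (D.p μ) (j (i x)) v) ∧
            (∀ a, D'.r a ⟨x, (j.comp i).normal.cls x v⟩ = diff IZ (D.r a) (j (i x)) v)) ∧
          ∀ c a b r, D'.w c a b r = D.w c a b 0) ∧
      -- `S' = TS|_X / TX` is a symplectic leaf, symplectomorphic to `T^*X`
      (∃ ι : SmoothImmersion (SmoothImmersion.normalModel IX EX ES)
          (SmoothImmersion.normalModel IX EX EZ) i.NormalBundle (j.comp i).NormalBundle,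
        (∀ t, ι t = SmoothImmersion.inclNormal j i t) ∧
        P'.IsMaximalIntegral ι ∧
        (ConnectedSpace X → P'.IsSymplecticLeaf ι) ∧
        P'.IsLagrangian ι i.zero ∧
        ∃ (Ψ : Diffeomorph (SmoothImmersion.normalModel IX EX ES) (cotangentModel IX)
            i.NormalBundle (CotangentBundle IX X) ∞)
          (η : ∀ ξ : CotangentBundle IX X, TangentSpace (cotangentModel IX) ξ →
            TangentSpace (cotangentModel IX) ξ → ℝ),
          (∀ x (v : TangentSpace IS (i x)), ∃ ξ : TangentSpace IX x →L[ℝ] ℝ,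
            (∀ u, ξ u = -P.leafForm j (i x) (mfderiv IX IS i x u) v) ∧
            Ψ ⟨x, i.normal.cls x v⟩ = ⟨x, ξ⟩) ∧
          IsExtDeriv (cotangentModel IX) (tautologicalForm IX) η ∧
          ∀ t (u v : TangentSpace (SmoothImmersion.normalModel IX EX ES) t),
            η (Ψ t) (mfderiv (SmoothImmersion.normalModel IX EX ES) (cotangentModel IX) Ψ t u)
              (mfderiv (SmoothImmersion.normalModel IX EX ES) (cotangentModel IX) Ψ t v) =
              P'.leafForm ι t u v) ∧
      -- the functions vanishing on `S'` form an ideal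
      (∀ f g : (j.comp i).NormalBundle → ℝ,
        IsSmoothFun (SmoothImmersion.normalModel IX EX EZ) f →
        IsSmoothFun (SmoothImmersion.normalModel IX EX EZ) g →
        (∀ t, f (SmoothImmersion.inclNormal j i t) = 0) →
        ∀ t, P'.bracket f g (SmoothImmersion.inclNormal j i t) = 0) ∧
      -- the sections of `L_X` form an ideal of the sections of `E_X`
      (∀ σ l : ConormalSection (j.comp i),
        (∀ x (u : TangentSpace IS (i x)), l.toFun x (mfderiv IS IZ j (i x) u) = 0) →
        ∃ κ : ConormalSection (j.comp i),
          (∀ x (u : TangentSpace IS (i x)), κ.toFun x (mfderiv IS IZ j (i x) u) = 0) ∧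
          P.IsConormalBracket σ l κ ∧ ∀ t, P'.bracket σ.bar l.bar t = κ.bar t) ∧
      -- the projection to `L_X^* = TZ|_X / TS|_X` is a Poisson map
      (∃ PL : PoissonStructure (SmoothImmersion.normalModel IX ES EZ) (j.along i).Total,
        P.IsFibrewiseLiePoisson j i PL ∧
        P'.IsPoissonMap PL (SmoothImmersion.projAlong j i)) ∧
      -- the approximation of `Z'` at the zero section is `Z'`
      (∃ P'' : PoissonStructure
          (SmoothImmersion.normalModel IX EX (EX × CokerModel EX EZ)) (j.comp i).zero.NormalBundle,
        P'.Extends (j.comp i).zero P'' ∧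
        (∀ Q : PoissonStructure (SmoothImmersion.normalModel IX EX (EX × CokerModel EX EZ))
          (j.comp i).zero.NormalBundle, P'.Extends (j.comp i).zero Q → Q = P'') ∧
        ∃ Φ : Diffeomorph (SmoothImmersion.normalModel IX EX EZ)
            (SmoothImmersion.normalModel IX EX (EX × CokerModel EX EZ))
            (j.comp i).NormalBundle (j.comp i).zero.NormalBundle ∞,
          (∀ t, Φ t = (j.comp i).toZeroNormal t) ∧ P'.IsPoissonMap P'' Φ) := by
  have hj := _hj.toIsMaximalIntegral.toIsIntegral
  -- `S` and `X` inherit the Hausdorff property from `Z` through injective continuous maps.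
  have hS : T2Space S := .of_injective_continuous hj.injective j.contMDiff.continuous
  have hX : T2Space X := _hi.isEmbedding.t2Space
  have hP := _hi.isCoisotropic hj
  have hk : Function.Injective (j.comp i) := hj.injective.comp _hi.isEmbedding.injective
  obtain ⟨P', h'⟩ := PoissonStructure.exists_isLinearization hP
  obtain ⟨P'', h''⟩ := PoissonStructure.exists_isLinearization h'.isCoisotropic_zero
  -- `2 dim X = dim S ≤ dim Z` gives the alternative needed for uniqueness. The inequality comes
  -- from a tangent space at a point, so an empty `X` is treated apart.
  have hd : IsEmpty X ∨ finrank ℝ EX < finrank ℝ EZ ∨ finrank ℝ EX = 0 := by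
    rcases isEmpty_or_nonempty X with hE | ⟨⟨x⟩⟩
    · exact .inl hE
    · have h1 : finrank ℝ ES ≤ finrank ℝ EZ :=
        LinearMap.finrank_le_finrank_of_injective
          (f := (mfderiv IS IZ j (i x) : ES →L[ℝ] EZ).toLinearMap) (j.injective_mfderiv (i x))
      have := _hi.finrank_eq
      omega
  have hd' : finrank ℝ (EX × CokerModel EX EZ) =
      finrank ℝ EX + (finrank ℝ EZ - finrank ℝ EX) := by
    rw [Module.finrank_prod, Module.finrank_fin_fun]
  obtain ⟨Ψ, η, hΨ, hη, hΨη⟩ := _hi.exists_symplectomorphism hj h'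
  obtain ⟨Φ, hΦ⟩ := (j.comp i).exists_diffeomorph_toZeroNormal
  have hΦ' : ⇑Φ = (j.comp i).toZeroNormal := funext hΦ
  refine ⟨existsUnique_isConormalBracket hP, P', h'.extends_linearization,
    fun Q hQ ↦ ?_, h'.isExactVia_euler, fun m n x₀ D V hV hx₀ hD ↦
      h'.exists_darbouxChart hk D hV hx₀ hD,
    ⟨SmoothImmersion.inclNormalImmersion j i, fun _ ↦ rfl, h'.isMaximalIntegral_incl hj _hi,
      fun _ ↦ h'.isSymplecticLeaf_incl hj _hi, h'.isLagrangian_zero hj _hi, Ψ, η, hΨ, hη, hΨη⟩,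
    fun f g hf _ h0 ↦ h'.bracket_eq_zero_of_incl hj _hi hf h0, h'.exists_ideal hj,
    h'.exists_isFibrewiseLiePoisson hj, P'', h''.extends_linearization, fun Q hQ ↦ ?_, Φ, hΦ, ?_⟩
  · rcases hd with hE | hd
    · exact PoissonStructure.ext (funext fun t ↦ isEmptyElim t.1)
    · exact h'.eq_of_extends hd hQ
  · rcases hd with hE | hd
    · exact PoissonStructure.ext (funext fun t ↦ isEmptyElim t.1)
    · exact h''.eq_of_extends (by omega) hQ
  · rw [hΦ']
    exact h'.isPoissonMap_toZeroNormal h'' (hΦ' ▸ Φ.contMDiff)
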